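/- Let $a,b,c,d,e,\xi\in\mathbb R$ with $b<0$, $c>0$, $d>0$, $e>0$, $\xi>0$ and $a^2+bc=-\xi^2$. Let $Z_0$ be the planar piecewise linear vector field $$Z_0(x,y)=\begin{pmatrix}a&b\\c&-a\end{pmatrix}\begin{pmatrix}x\\y\end{pmatrix}+\begin{pmatrix}0\\d\end{pmatrix}\ (x\ge 0),\qquad Z_0(x,y)=\begin{pmatrix}0&-1\\1&0\end{pmatrix}\begin{pmatrix}x\\y\end{pmatrix}+\begin{pmatrix}0\\e\end{pmatrix}\ (x\le 0).$$ (This is the canonical form of a piecewise linear field with a real center in $x<0$, a virtual center for the zone $x\ge0$, and such that the real center is a global center.) Consider families $$Z_\varepsilon=Z_0+\varepsilon Z_1+\varepsilon^2Z_2+O(\varepsilon^3)\qquad(\varepsilon\to0^+)$$ of piecewise linear fields with the same two zones, where $Z_1(p)=B^\pm p+v^\pm$ for $\pm x\ge0$, $B^\pm=(b^\pm_{ij})$, $v^\pm=(v_1^\pm,v_2^\pm)^T$, where $Z_2$ is a piecewise linear field of the same kind, and $O(\varepsilon^3)$ refers to all coefficients. Put $$K_0=\frac{2d\big(\xi^2(2v_1^-b-be(b_{11}^-+b_{22}^-)+2v_1^+)+bd(b_{11}^++b_{22}^+)\big)}{e\xi},\quad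 K_1=be\xi^2(b_{11}^-+b_{22}^-),\quad K_2=-\frac{bd^2(b_{11}^++b_{22}^+)}{e\xi}.$$ A point of $\Sigma=\{x=0\}$ is a crossing point if the first components of the two fields there have a positive product. A crossing periodic orbit is a periodic orbit that meets $\Sigma$, and only at crossing points; a crossing limit cycle is an isolated crossing periodic orbit. Its amplitude is the largest ordinate of its points on $\Sigma$. Its multiplicity is the order of the amplitude as a zero of $P(y)-y$, where $P$ is the first return map on $\Sigma$ near the amplitude (one passage through each zone), and it is hyperbolic if $P'\ne1$ at the amplitude. Stable means asymptotically orbitally stable, and unstable means repelling, that is, stable for the time-reversed field. Infinity is a periodic orbit if, in the polar Bendixson coordinates $(x,y)=(\cos\theta,\sin\theta)/r$, the angular velocity at $r=0$ does not vanish for any $\theta$ and has the same sign in both zones; it is stable if $r=0$ is asymptotically stable, and unstable if this holds for the time-reversed field. "For small $\varepsilon$" means for all $\varepsilon\in(0,\varepsilon_0)$ with some $\varepsilon_0>0$, which may depend on the family $(Z_\varepsilon)$. (a) Let $(m_1,\dots,m_k)$, $k\ge1$, be positive integers with $m_1+\dots+m_k\le 2$, or with $m_1+\dots+m_k=3$ if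 $d>\xi e$. There are values of $K_0,K_1,K_2$, attained by some $Z_1$, such that for every $Z_1$ with these values there is a family $Z_\varepsilon=Z_0+\varepsilon Z_1+\varepsilon^2Z_2+O(\varepsilon^3)$ which, for small $\varepsilon$, has exactly $k$ crossing limit cycles, with multiplicities $m_1,\dots,m_k$ in the order of increasing amplitude. If $m_1=\dots=m_k=1$, then for small $\varepsilon$ every family with such a $Z_1$ has this configuration. For every family $Z_\varepsilon$ as above the following hold. (b) For small $\varepsilon$, infinity is a periodic orbit of $Z_\varepsilon$, and if a crossing limit cycle of highest amplitude exists and is hyperbolic, then it and infinity have opposite stability. If $\xi(b_{11}^-+b_{22}^-)+b_{11}^++b_{22}^+<0$ (resp. $>0$), then for small $\varepsilon$ infinity is unstable (resp. stable), and the crossing limit cycle of highest amplitude, when it exists and is hyperbolic, is stable (resp. unstable). (c) If $b_{11}^-+b_{22}^->0$ (resp. $<0$), then for small $\varepsilon$ the crossing limit cycle of lowest amplitude, when it exists and is hyperbolic, is stable (resp. unstable). If $b_{11}^-+b_{22}^-=0$ and $bv_1^-+v_1^+>0$ (resp. $<0$), the same holds for the crossing limit cycles whose amplitude stays away from $0$: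 there is $r_0>0$ such that for each $r\in(0,r_0)$ and for small $\varepsilon$ (depending on $r$) the one of lowest amplitude among the crossing limit cycles of amplitude at least $r$, when it exists and is hyperbolic, is stable (resp. unstable). If moreover the matrix of $Z_\varepsilon$ in $x\le0$ has trace $0$ for all small $\varepsilon$ (for instance if $Z_\varepsilon=Z_0+\varepsilon Z_1$), then this holds, for small $\varepsilon$, for the crossing limit cycle of lowest amplitude among all. -/

import Mathlib

open Filter Topology Asymptotics
open scoped Matrix

noncomputable section

/-- A piecewise linear (affine in each zone) planar vector field with the two zones `x ≥ 0` and
`x ≤ 0`: it is `p ↦ rightMat p + rightVec` for `x ≥ 0` and `p ↦ leftMat p + leftVec` for `x ≤ 0`. -/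
structure PWL where
  rightMat : Matrix (Fin 2) (Fin 2) ℝ
  rightVec : Fin 2 → ℝ
  leftMat : Matrix (Fin 2) (Fin 2) ℝ
  leftVec : Fin 2 → ℝ

namespace PWL

/-- The linear field `Z⁺` of the zone `x ≥ 0`. -/
def right (Z : PWL) (p : Fin 2 → ℝ) : Fin 2 → ℝ := Z.rightMat *ᵥ p + Z.rightVec

/-- The linear field `Z⁻` of the zone `x ≤ 0`. -/
def left (Z : PWL) (p : Fin 2 → ℝ) : Fin 2 → ℝ := Z.leftMat *ᵥ p + Z.leftVec

/-- The time-reversed field `-Z`. -/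
def reverse (Z : PWL) : PWL := ⟨-Z.rightMat, -Z.rightVec, -Z.leftMat, -Z.leftVec⟩

/-- The crossing region `Σᶜ` of `Σ = {x = 0}` (Filippov's convention, `h(x,y) = x`). -/
def crossingRegion (Z : PWL) : Set (Fin 2 → ℝ) :=
  {p | p 0 = 0 ∧ 0 < Z.right p 0 * Z.left p 0}

open Classical in
/-- The velocity with which an orbit leaves the point `p`. At a point of the crossing region this is
`Z⁺` if both fields point to the right and `Z⁻` if both point to the left. (At the other points of
`Σ` the value is irrelevant: they are never used.) -/
def field (Z : PWL) (p : Fin 2 → ℝ) : Fin 2 → ℝ :=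
  if 0 < p 0 ∨ (p 0 = 0 ∧ 0 < Z.right p 0) then Z.right p else Z.left p

/-- `γ` is a crossing trajectory of `Z` on the interval `I`: a solution that meets `Σ` only in the
crossing region. It is continuous and at every time its forward derivative is the velocity
prescribed by `Z` (which is equivalent to `γ' = Z^±(γ)` in each open zone together with
concatenation at the crossing points). -/
def IsCrossingTrajectory (Z : PWL) (γ : ℝ → Fin 2 → ℝ) (I : Set ℝ) : Prop :=
  ContinuousOn γ I ∧ ∀ t ∈ I, (γ t 0 = 0 → γ t ∈ Z.crossingRegion) ∧
    HasDerivWithinAt γ (Z.field (γ t)) (I ∩ Set.Ici t) t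

/-- `Γ` is a crossing periodic orbit: the image of a periodic crossing trajectory that meets `Σ`. -/
def IsCrossingPeriodicOrbit (Z : PWL) (Γ : Set (Fin 2 → ℝ)) : Prop :=
  ∃ (γ : ℝ → Fin 2 → ℝ) (T : ℝ), 0 < T ∧ Z.IsCrossingTrajectory γ Set.univ ∧
    (∀ t, γ (t + T) = γ t) ∧ (∃ t, γ t 0 = 0) ∧ Γ = Set.range γ

/-- A crossing limit cycle: an isolated crossing periodic orbit. -/
def IsCrossingLimitCycle (Z : PWL) (Γ : Set (Fin 2 → ℝ)) : Prop :=
  Z.IsCrossingPeriodicOrbit Γ ∧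
    ∃ U : Set (Fin 2 → ℝ), IsOpen U ∧ Γ ⊆ U ∧
      ∀ Γ', Z.IsCrossingPeriodicOrbit Γ' → Γ' ⊆ U → Γ' = Γ

/-- The amplitude of a closed orbit: the ordinate of its highest point on `Σ`. -/
def HasAmplitude (Γ : Set (Fin 2 → ℝ)) (y : ℝ) : Prop :=
  IsGreatest {s : ℝ | ![0, s] ∈ Γ} y

/-- The crossing trajectory through `(0, y)` traverses one zone, crosses `Σ`, traverses the other
zone, and comes back to `Σ` at `(0, y')`; i.e. `y'` is the image of `y` under the first return map
(the composition of the two half-return maps). -/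
def Returns (Z : PWL) (y y' : ℝ) : Prop :=
  ∃ (γ : ℝ → Fin 2 → ℝ) (s T : ℝ), 0 < s ∧ s < T ∧
    Z.IsCrossingTrajectory γ (Set.Icc 0 T) ∧
    γ 0 = ![0, y] ∧ γ s 0 = 0 ∧ γ T = ![0, y'] ∧
    ∀ t ∈ Set.Ioo 0 T, t ≠ s → γ t 0 ≠ 0

/-- `P` is the first return map in a neighbourhood of `y`. -/
def IsReturnMapNear (Z : PWL) (P : ℝ → ℝ) (y : ℝ) : Prop :=
  ∀ᶠ s in 𝓝 y, Z.Returns s (P s)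

/-- A hyperbolic closed orbit: the derivative of the return map at its amplitude is not `1`. -/
def IsHyperbolic (Z : PWL) (Γ : Set (Fin 2 → ℝ)) : Prop :=
  ∃ (y : ℝ) (P : ℝ → ℝ) (κ : ℝ), HasAmplitude Γ y ∧ Z.IsReturnMapNear P y ∧
    HasDerivAt P κ y ∧ κ ≠ 1

/-- The multiplicity of a closed orbit: the order of its amplitude as a zero of the displacement
function `s ↦ P s - s`, where `P` is the return map. -/
def HasMultiplicity (Z : PWL) (Γ : Set (Fin 2 → ℝ)) (m : ℕ) : Prop :=
  ∃ (y : ℝ) (P : ℝ → ℝ), HasAmplitude Γ y ∧ Z.IsReturnMapNear P y ∧ ContDiffAt ℝ m P y ∧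
    (∀ k < m, iteratedDeriv k (fun s => P s - s) y = 0) ∧
    iteratedDeriv m (fun s => P s - s) y ≠ 0

/-- A stable closed orbit: asymptotically orbitally stable. (Crossing trajectories are determined
by their initial point.) -/
def IsStable (Z : PWL) (Γ : Set (Fin 2 → ℝ)) : Prop :=
  ∀ U : Set (Fin 2 → ℝ), IsOpen U → Γ ⊆ U →
    ∃ V : Set (Fin 2 → ℝ), IsOpen V ∧ Γ ⊆ V ∧ ∀ p ∈ V,
      ∃ γ : ℝ → Fin 2 → ℝ, γ 0 = p ∧ Z.IsCrossingTrajectory γ (Set.Ici 0) ∧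
        (∀ t, 0 ≤ t → γ t ∈ U) ∧ Tendsto (fun t => Metric.infDist (γ t) Γ) atTop (𝓝 0)

/-- An unstable (repelling) closed orbit: stable for the time-reversed field. -/
def IsUnstable (Z : PWL) (Γ : Set (Fin 2 → ℝ)) : Prop := Z.reverse.IsStable Γ

/-- The angular component `θ'` of `p' = A p + v` in the polar Bendixson coordinates
`p = (cos θ, sin θ) / r`, extended to `r = 0`. (The radial component always vanishes at `r = 0`.) -/
def bendixsonAngular (A : Matrix (Fin 2) (Fin 2) ℝ) (v : Fin 2 → ℝ) (r θ : ℝ) : ℝ :=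
  let w := A *ᵥ ![Real.cos θ, Real.sin θ] + r • v
  Real.cos θ * w 1 - Real.sin θ * w 0

/-- The infinity `r = 0` is a periodic orbit in the Bendixson compactification: the angular velocity
there never vanishes, and it has the same sign in both zones. -/
def InfinityPeriodic (Z : PWL) : Prop :=
  ∃ σ : ℝ, ∀ θ : ℝ,
    (0 ≤ Real.cos θ → 0 < σ * bendixsonAngular Z.rightMat Z.rightVec 0 θ) ∧
    (Real.cos θ ≤ 0 → 0 < σ * bendixsonAngular Z.leftMat Z.leftVec 0 θ)

/-- The infinity is asymptotically stable (attracting): trajectories starting far enough out stay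
as far out as prescribed and tend to infinity. Since `r = 1 / |p|` this is asymptotic stability of
`r = 0` in the Bendixson coordinates. -/
def InfinityStable (Z : PWL) : Prop :=
  ∀ R : ℝ, ∃ R' : ℝ, ∀ p : Fin 2 → ℝ, R' ≤ ‖p‖ →
    ∃ γ : ℝ → Fin 2 → ℝ, γ 0 = p ∧ Z.IsCrossingTrajectory γ (Set.Ici 0) ∧
      (∀ t, 0 ≤ t → R ≤ ‖γ t‖) ∧ Tendsto (fun t => ‖γ t‖) atTop atTop

/-- The infinity is unstable (repelling): stable for the time-reversed field. -/
def InfinityUnstable (Z : PWL) : Prop := Z.reverse.InfinityStable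

/-- `Γ` is the crossing limit cycle of highest amplitude. -/
def IsHighest (Z : PWL) (Γ : Set (Fin 2 → ℝ)) : Prop :=
  Z.IsCrossingLimitCycle Γ ∧ ∃ y, HasAmplitude Γ y ∧
    ∀ Γ' y', Z.IsCrossingLimitCycle Γ' → HasAmplitude Γ' y' → y' ≤ y

/-- `Γ` is the crossing limit cycle of lowest amplitude. -/
def IsLowest (Z : PWL) (Γ : Set (Fin 2 → ℝ)) : Prop :=
  Z.IsCrossingLimitCycle Γ ∧ ∃ y, HasAmplitude Γ y ∧
    ∀ Γ' y', Z.IsCrossingLimitCycle Γ' → HasAmplitude Γ' y' → y ≤ y'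

/-- `Γ` is the one of lowest amplitude among the crossing limit cycles of amplitude at least `r`. -/
def IsLowestAbove (Z : PWL) (r : ℝ) (Γ : Set (Fin 2 → ℝ)) : Prop :=
  Z.IsCrossingLimitCycle Γ ∧ ∃ y, HasAmplitude Γ y ∧ r ≤ y ∧
    ∀ Γ' y', Z.IsCrossingLimitCycle Γ' → HasAmplitude Γ' y' → r ≤ y' → y ≤ y'

/-- `Z` has exactly `m.length` crossing limit cycles, and, ordered by increasing amplitude, their
multiplicities are the entries of `m`. -/
def HasConfiguration (Z : PWL) (m : List ℕ) : Prop :=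
  ∃ (Γ : Fin m.length → Set (Fin 2 → ℝ)) (y : Fin m.length → ℝ), StrictMono y ∧
    (∀ i, Z.IsCrossingLimitCycle (Γ i) ∧ HasAmplitude (Γ i) (y i) ∧
      Z.HasMultiplicity (Γ i) (m.get i)) ∧
    ∀ Γ', Z.IsCrossingLimitCycle Γ' → ∃ i, Γ' = Γ i

/-- The canonical form of the unperturbed field. -/
def canonical (a b c d e : ℝ) : PWL :=
  ⟨!![a, b; c, -a], ![0, d], !![0, -1; 1, 0], ![0, e]⟩

/-- `Z_ε = Z₀ + ε Z₁ + ε² Z₂ + O(ε³)` as `ε → 0⁺`, coefficientwise. -/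
def IsPerturbation (Z₀ Z₁ Z₂ : PWL) (Z : ℝ → PWL) : Prop :=
  (∀ i j, (fun ε : ℝ => (Z ε).rightMat i j - (Z₀.rightMat i j + ε * Z₁.rightMat i j
      + ε ^ 2 * Z₂.rightMat i j)) =O[𝓝[≥] 0] (fun ε : ℝ => ε ^ 3)) ∧
  (∀ i, (fun ε : ℝ => (Z ε).rightVec i - (Z₀.rightVec i + ε * Z₁.rightVec i
      + ε ^ 2 * Z₂.rightVec i)) =O[𝓝[≥] 0] (fun ε : ℝ => ε ^ 3)) ∧
  (∀ i j, (fun ε : ℝ => (Z ε).leftMat i j - (Z₀.leftMat i j + ε * Z₁.leftMat i j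
      + ε ^ 2 * Z₂.leftMat i j)) =O[𝓝[≥] 0] (fun ε : ℝ => ε ^ 3)) ∧
  (∀ i, (fun ε : ℝ => (Z ε).leftVec i - (Z₀.leftVec i + ε * Z₁.leftVec i
      + ε ^ 2 * Z₂.leftVec i)) =O[𝓝[≥] 0] (fun ε : ℝ => ε ^ 3))

/-- `b₁₁⁺ + b₂₂⁺`, for a first-order term with matrices `B^±`. -/
def trR (Z₁ : PWL) : ℝ := Z₁.rightMat 0 0 + Z₁.rightMat 1 1

/-- `b₁₁⁻ + b₂₂⁻`. -/
def trL (Z₁ : PWL) : ℝ := Z₁.leftMat 0 0 + Z₁.leftMat 1 1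

/-- The parameter `K₀`; here `v₁^±` are the first components of the constant terms of `Z₁`. -/
def K0 (b d e ξ : ℝ) (Z₁ : PWL) : ℝ :=
  2 * d * (ξ ^ 2 * (2 * Z₁.leftVec 0 * b - b * e * Z₁.trL + 2 * Z₁.rightVec 0) + b * d * Z₁.trR)
    / (e * ξ)

/-- The parameter `K₁`. -/
def K1 (b e ξ : ℝ) (Z₁ : PWL) : ℝ := b * e * ξ ^ 2 * Z₁.trL

/-- The parameter `K₂`. -/
def K2 (b d e ξ : ℝ) (Z₁ : PWL) : ℝ := -(b * d ^ 2 * Z₁.trR / (e * ξ))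

end PWL

end

/-!
The flows in the two zones are explicit, so the first return map is studied through its two
half-returns, parametrized by the angle `θ = ω t` of the passage. For a focus with ratio `g` of real
and imaginary part of the eigenvalues, the orbit that leaves `Σ` with normalized speed `speed g θ`
comes back after the angle `θ` with speed `speed (-g) θ`; the angle lies in `(0, π)` for a virtual
focus and in `realAngles g ⊆ (π, 2π)` for a real one. The mean `s` of the two speeds is a strictly monotone
function of the angle, and half their difference is the gain of speed. With the mean speed `s` of the
left passage as coordinate on `Σ` (`height`), a loop closes if and only if the gains in the two zones
and the offset between the two fields on `Σ` add up to zero: this sum is the displacement function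
`disp`, which is analytic in `s` and depends analytically on the field.

Uniqueness of trajectories identifies the crossing limit cycles with the isolated zeros of `disp`
(`IsGood.isCrossingLimitCycle_iff`) and the multiplicities with the orders of the zeros
(`IsGood.hasMultiplicity`). The sign of `disp` is that of the displacement of the return map
(`IsGood.ret_sign`). Hence its sign changes decide the stability of the limit cycles and its sign far
out decides that of infinity (`IsGood.infinityStable_of_disp`); unstable objects are stable for the
time-reversed field, which a reflection brings back to the same form with displacement `-disp`
(`mirror`, `disp_mirror`). A hyperbolic limit cycle is a simple zero, so the sign of `disp` beyond the
last zero, or before the first one, fixes its stability (`IsGood.highest`, `IsGood.lowestAbove`).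

For a perturbation of the canonical form, `disp s = ε * reduced q s`, where the parameters `q` have a
limit given by the first-order term (`IsPerturbation.tendsto_params`), and `reduced` is continuous up
to `ε = 0`. For small `s` the damping of the left zone dominates, and the offset if that damping
vanishes; for large `s` the total damping dominates. These estimates are uniform in the parameters
(`exists_reduced_sign_zero`, `exists_rest_sign_zero`, `exists_reduced_sign_atTop`), which gives the
statements on the extreme limit cycles and on infinity.

The configurations are realized in the limit, where `reduced` is
`1 + (π - arctan s) (s + 1/s) + c (arctan (k s) (k s + 1/(k s)) - 1)/k + β` with `k = e ξ / d`, after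
the damping in the left zone is normalized. Its critical points are the zeros of `slope`, whose own
critical points are the zeros of the function `curv`, monotone for `c ≤ 0`; so `slope` has at most two
zeros, and for `k < 1` both one double and two simple ones occur (`exists_isZeroPattern`). By the
uniform estimates at both ends and an iterated theorem of Rolle, no zeros are created under small
perturbations beyond the orders in the limit, and simple zeros persist
(`IsZeroPattern.eventually_hasConfiguration_of_simple`). A multiple zero is kept exactly along a curve
`ε ↦ (r ε, β ε)` in a two-parameter unfolding of the linear perturbation, which starts at the origin
and therefore does not change the first-order term (`exists_multiple_zero`, `exists_family`).
-/

namespace PWL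

attribute [local fun_prop] analyticAt_fst analyticAt_snd

/-! ### The implicit function theorem for one real unknown -/

/-- The implicit function theorem for an analytic equation in one real unknown. -/
lemma exists_analyticAt_implicit {E : Type*} [NormedAddCommGroup E] [NormedSpace ℝ E]
    [CompleteSpace E] {f : E × ℝ → ℝ} {x₀ : E} {y₀ d : ℝ} (hf : AnalyticAt ℝ f (x₀, y₀))
    (h0 : f (x₀, y₀) = 0) (hd : HasDerivAt (fun y => f (x₀, y)) d y₀) (hd0 : d ≠ 0) :
    ∃ t : E → ℝ, AnalyticAt ℝ t x₀ ∧ t x₀ = y₀ ∧ ∀ᶠ x in 𝓝 x₀, f (x, t x) = 0 := by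
  have cdf : ContDiffAt ℝ ⊤ f (x₀, y₀) := hf.contDiffAt
  have hfd : HasFDerivAt f (fderiv ℝ f (x₀, y₀)) (x₀, y₀) := hf.differentiableAt.hasFDerivAt
  have hcomp : HasFDerivAt (fun y => f (x₀, y))
      ((fderiv ℝ f (x₀, y₀)).comp (ContinuousLinearMap.inr ℝ E ℝ)) y₀ :=
    HasFDerivAt.comp y₀ hfd (hasFDerivAt_prodMk_right x₀ y₀)
  have heq := hcomp.unique hd.hasFDerivAt
  have hinv : (fderiv ℝ f (x₀, y₀) ∘L .inr ℝ E ℝ).IsInvertible := by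
    refine ⟨ContinuousLinearEquiv.unitsEquivAut ℝ (Units.mk0 d hd0), ?_⟩
    rw [heq]
    ext
    simp
  refine ⟨cdf.implicitFunction (by simp) hinv, ?_, ?_, ?_⟩
  · exact (cdf.contDiffAt_implicitFunction (by simp) hinv).analyticAt
  · exact cdf.implicitFunction_apply_self (by simp) hinv
  · have := cdf.eventually_apply_implicitFunction (by simp) hinv
    rw [h0] at this
    exact this

/-- A fibrewise inverse of an analytic function whose derivative along the fibres does not vanish
is jointly analytic in the parameter and the value. -/
lemma analyticAt_fiber_inverse {c : ℝ → ℝ → ℝ} {W : Set (ℝ × ℝ)} (hW : IsOpen W) {Θ : ℝ → ℝ → ℝ}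
    (inj : ∀ g θ θ', (g, θ) ∈ W → (g, θ') ∈ W → c g θ = c g θ' → θ = θ')
    (hΘ : ∀ g θ, (g, θ) ∈ W → (g, Θ g (c g θ)) ∈ W ∧ c g (Θ g (c g θ)) = c g θ)
    {g θ d : ℝ} (h : (g, θ) ∈ W) (hc : AnalyticAt ℝ (fun p : ℝ × ℝ => c p.1 p.2) (g, θ))
    (hd : HasDerivAt (c g) d θ) (hd0 : d ≠ 0) :
    AnalyticAt ℝ (fun p : ℝ × ℝ => Θ p.1 p.2) (g, c g θ) := by
  let f : (ℝ × ℝ) × ℝ → ℝ := fun q => c q.1.1 q.2 - q.1.2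
  have hf : AnalyticAt ℝ f ((g, c g θ), θ) := by
    have h1 : AnalyticAt ℝ (fun q : (ℝ × ℝ) × ℝ => (q.1.1, q.2)) ((g, c g θ), θ) := by fun_prop
    have h2 : AnalyticAt ℝ (fun q : (ℝ × ℝ) × ℝ => c q.1.1 q.2) ((g, c g θ), θ) :=
      AnalyticAt.comp (f := fun q : (ℝ × ℝ) × ℝ => (q.1.1, q.2))
        (g := fun p : ℝ × ℝ => c p.1 p.2) hc h1
    exact h2.sub (by fun_prop)
  obtain ⟨t, ht, ht0, hev⟩ := exists_analyticAt_implicit hf (by simp [f]) (hd.sub_const _) hd0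
  have hmem : ∀ᶠ p : ℝ × ℝ in 𝓝 (g, c g θ), (p.1, t p) ∈ W := by
    have : ContinuousAt (fun p : ℝ × ℝ => (p.1, t p)) (g, c g θ) :=
      continuousAt_fst.prodMk ht.continuousAt
    exact this.eventually (hW.mem_nhds (by simpa [ht0] using h))
  refine ht.congr ?_
  filter_upwards [hev, hmem] with p hp hpW
  have hs : c p.1 (t p) = p.2 := by simpa [f, sub_eq_zero] using hp
  have := hΘ _ _ hpW
  rw [hs] at this
  exact inj _ _ _ hpW this.1 (hs.trans this.2.symm)

/-! ### The scalar functions of a half-return -/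

/-- Andronov's function `1 - e^{gθ}(cos θ - g sin θ)`. -/
noncomputable def andronov (g θ : ℝ) : ℝ :=
  1 - Real.exp (g * θ) * (Real.cos θ - g * Real.sin θ)

/-- The normalized speed: an orbit of a focus with `γ / ω = g` that leaves `Σ` with `|x'| = h U(g, θ)`
comes back after the angle `θ`, with speed `|x'| = h U(-g, θ)`; here `h / ω` is the distance from
`Σ` to the focus. -/
noncomputable def speed (g θ : ℝ) : ℝ :=
  (Real.exp (-(g * θ)) - Real.cos θ + g * Real.sin θ) / Real.sin θ

/-- The mean of the two normalized speeds of a half-return. -/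
noncomputable def meanSpeed (g θ : ℝ) : ℝ := (Real.cosh (g * θ) - Real.cos θ) / Real.sin θ

/-- Half the gain of normalized speed in a half-return. -/
noncomputable def gain (g θ : ℝ) : ℝ := (Real.sinh (g * θ) - g * Real.sin θ) / Real.sin θ

lemma speed_eq_sub {g θ : ℝ} : speed g θ = meanSpeed g θ - gain g θ := by
  rw [speed, meanSpeed, gain, ← sub_div, Real.cosh_eq, Real.sinh_eq]; congr 1; ring

lemma speed_neg_eq_add {g θ : ℝ} : speed (-g) θ = meanSpeed g θ + gain g θ := by
  rw [speed, meanSpeed, gain, ← add_div, Real.cosh_eq, Real.sinh_eq]; congr 1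
  simp only [neg_mul, neg_neg]; ring

lemma speed_eq {g θ : ℝ} : speed g θ = Real.exp (-(g * θ)) * andronov g θ / Real.sin θ := by
  have : Real.exp (-(g * θ)) * Real.exp (g * θ) = 1 := by rw [← Real.exp_add]; simp
  rw [speed, andronov]; congr 1
  linear_combination (Real.cos θ - g * Real.sin θ) * this

lemma hasDerivAt_andronov (g θ : ℝ) :
    HasDerivAt (andronov g) (Real.exp (g * θ) * ((1 + g ^ 2) * Real.sin θ)) θ := by
  have h1 : HasDerivAt (fun t => Real.exp (g * t)) (Real.exp (g * θ) * g) θ := by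
    simpa using ((hasDerivAt_id θ).const_mul g).exp
  have h2 := (Real.hasDerivAt_cos θ).sub ((Real.hasDerivAt_sin θ).const_mul g)
  refine ((h1.mul h2).const_sub 1).congr_deriv ?_
  simp; ring

lemma continuous_andronov : Continuous fun p : ℝ × ℝ => andronov p.1 p.2 := by
  unfold andronov; fun_prop

lemma hasDerivAt_speed (g : ℝ) {θ : ℝ} (h : Real.sin θ ≠ 0) :
    HasDerivAt (speed g) (andronov (-g) θ / Real.sin θ ^ 2) θ := by
  have h1 : HasDerivAt (fun t => Real.exp (-(g * t))) (Real.exp (-(g * θ)) * (-g)) θ := by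
    simpa using ((hasDerivAt_id θ).const_mul g).neg.exp
  have h2 := ((h1.sub (Real.hasDerivAt_cos θ)).add ((Real.hasDerivAt_sin θ).const_mul g)).div
    (Real.hasDerivAt_sin θ) h
  refine h2.congr_deriv ?_
  congr 1
  simp only [andronov, neg_mul, Pi.sub_apply, Pi.add_apply, sub_neg_eq_add]
  linear_combination Real.sin_sq_add_cos_sq θ

lemma hasDerivAt_meanSpeed (g : ℝ) {θ : ℝ} (h : Real.sin θ ≠ 0) :
    HasDerivAt (meanSpeed g) ((andronov g θ + andronov (-g) θ) / (2 * Real.sin θ ^ 2)) θ := by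
  have h1 := ((hasDerivAt_speed g h).add (hasDerivAt_speed (-g) h)).div_const 2
  rw [neg_neg] at h1
  refine (h1.congr_deriv (by field_simp; ring)).congr_of_eventuallyEq (Eventually.of_forall fun t => ?_)
  simp only [Pi.add_apply]
  rw [speed_neg_eq_add, speed_eq_sub]; ring

@[simp] lemma andronov_zero (g : ℝ) : andronov g 0 = 0 := by simp [andronov]

lemma andronov_pi_pos (g : ℝ) : 0 < andronov g Real.pi := by
  simp [andronov]; positivity

lemma andronov_pos {g θ : ℝ} (h0 : 0 < θ) (h1 : θ ≤ Real.pi) : 0 < andronov g θ := by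
  have : StrictMonoOn (andronov g) (Set.Icc 0 Real.pi) := by
    refine strictMonoOn_of_deriv_pos (convex_Icc _ _)
      (fun x _ => (hasDerivAt_andronov g x).continuousAt.continuousWithinAt) fun x hx => ?_
    rw [interior_Icc] at hx
    rw [(hasDerivAt_andronov g x).deriv]
    have := Real.sin_pos_of_mem_Ioo hx
    positivity
  simpa using this ⟨le_rfl, Real.pi_pos.le⟩ ⟨h0.le, h1⟩ h0

lemma sin_neg_of_mem_Ioo {θ : ℝ} (h : θ ∈ Set.Ioo Real.pi (2 * Real.pi)) : Real.sin θ < 0 := by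
  have := Real.sin_pos_of_pos_of_lt_pi (x := θ - Real.pi) (by linarith [h.1]) (by linarith [h.2])
  rw [Real.sin_sub_pi] at this; linarith

lemma andronov_strictAntiOn (g : ℝ) :
    StrictAntiOn (andronov g) (Set.Icc Real.pi (2 * Real.pi)) := by
  refine strictAntiOn_of_deriv_neg (convex_Icc _ _)
    (fun x _ => (hasDerivAt_andronov g x).continuousAt.continuousWithinAt) fun x hx => ?_
  rw [interior_Icc] at hx
  rw [(hasDerivAt_andronov g x).deriv]
  have h1 := sin_neg_of_mem_Ioo hx
  have h2 : (1 + g ^ 2) * Real.sin x < 0 := mul_neg_of_pos_of_neg (by positivity) h1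
  exact mul_neg_of_pos_of_neg (Real.exp_pos _) h2

/-- The angles of the passages through the zone of a real focus: both speeds must be positive. -/
def realAngles (g : ℝ) : Set ℝ :=
  {θ | θ ∈ Set.Ioo Real.pi (2 * Real.pi) ∧ 0 < andronov g θ ∧ 0 < andronov (-g) θ}

lemma realAngles_neg (g : ℝ) : realAngles (-g) = realAngles g := by
  ext θ; simp [realAngles, and_comm]

lemma realAngles_of_le {g θ θ' : ℝ} (h : θ ∈ realAngles g) (h0 : Real.pi < θ') (h1 : θ' ≤ θ) :
    θ' ∈ realAngles g := by
  obtain ⟨⟨ha, hb⟩, hc, hd⟩ := h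
  have m : θ ∈ Set.Icc Real.pi (2 * Real.pi) := ⟨ha.le, hb.le⟩
  have m' : θ' ∈ Set.Icc Real.pi (2 * Real.pi) := ⟨h0.le, by linarith⟩
  exact ⟨⟨h0, by linarith⟩, hc.trans_le ((andronov_strictAntiOn g).antitoneOn m' m h1),
    hd.trans_le ((andronov_strictAntiOn (-g)).antitoneOn m' m h1)⟩

lemma ordConnected_realAngles (g : ℝ) : (realAngles g).OrdConnected :=
  ⟨fun _ hx _ hy _ hz => realAngles_of_le hy (hx.1.1.trans_le hz.1) hz.2⟩

lemma isOpen_realAngles_prod : IsOpen {p : ℝ × ℝ | p.2 ∈ realAngles p.1} := by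
  have h1 : IsOpen {p : ℝ × ℝ | 0 < andronov p.1 p.2} :=
    isOpen_lt continuous_const continuous_andronov
  have h2 : IsOpen {p : ℝ × ℝ | 0 < andronov (-p.1) p.2} :=
    isOpen_lt continuous_const (continuous_andronov.comp (by fun_prop : Continuous fun p : ℝ × ℝ => (-p.1, p.2)))
  have h3 : IsOpen {p : ℝ × ℝ | p.2 ∈ Set.Ioo Real.pi (2 * Real.pi)} :=
    isOpen_Ioo.preimage continuous_snd
  exact h3.inter (h1.inter h2)

lemma isOpen_realAngles (g : ℝ) : IsOpen (realAngles g) :=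
  isOpen_realAngles_prod.preimage (by fun_prop : Continuous fun θ : ℝ => (g, θ))

lemma realAngles_mem_nhdsGT (g : ℝ) : realAngles g ∈ 𝓝[>] Real.pi := by
  have h1 : ∀ g, ∀ᶠ θ in 𝓝[>] Real.pi, 0 < andronov g θ := fun g =>
    ((hasDerivAt_andronov g Real.pi).continuousAt.eventually (lt_mem_nhds (andronov_pi_pos g))).filter_mono
      nhdsWithin_le_nhds
  filter_upwards [h1 g, h1 (-g), Ioo_mem_nhdsGT (by linarith [Real.pi_pos] : Real.pi < 2 * Real.pi)]
    with θ a b c using ⟨c, a, b⟩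

lemma sin_ne_zero_of_realAngles {g θ : ℝ} (h : θ ∈ realAngles g) : Real.sin θ ≠ 0 :=
  (sin_neg_of_mem_Ioo h.1).ne

lemma sin_ne_zero_of_Ioo {θ : ℝ} (h : θ ∈ Set.Ioo 0 Real.pi) : Real.sin θ ≠ 0 :=
  (Real.sin_pos_of_mem_Ioo h).ne'

lemma speed_strictMonoOn_Ioo (g : ℝ) : StrictMonoOn (speed g) (Set.Ioo 0 Real.pi) := by
  refine strictMonoOn_of_deriv_pos (convex_Ioo _ _)
    (fun x hx => (hasDerivAt_speed g (sin_ne_zero_of_Ioo hx)).continuousAt.continuousWithinAt)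
    fun x hx => ?_
  rw [interior_Ioo] at hx
  rw [(hasDerivAt_speed g (sin_ne_zero_of_Ioo hx)).deriv]
  have := andronov_pos (g := -g) hx.1 hx.2.le
  have := sin_ne_zero_of_Ioo hx
  positivity

lemma speed_strictMonoOn_realAngles (g : ℝ) : StrictMonoOn (speed g) (realAngles g) := by
  refine strictMonoOn_of_deriv_pos (ordConnected_realAngles g).convex
    (fun x hx => (hasDerivAt_speed g (sin_ne_zero_of_realAngles hx)).continuousAt.continuousWithinAt)
    fun x hx => ?_
  replace hx := interior_subset hx
  rw [(hasDerivAt_speed g (sin_ne_zero_of_realAngles hx)).deriv]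
  have := hx.2.2
  have := sin_ne_zero_of_realAngles hx
  positivity

lemma meanSpeed_eq {g θ : ℝ} : meanSpeed g θ = (speed g θ + speed (-g) θ) / 2 := by
  rw [speed_neg_eq_add, speed_eq_sub]; ring

lemma meanSpeed_strictMonoOn_Ioo (g : ℝ) : StrictMonoOn (meanSpeed g) (Set.Ioo 0 Real.pi) := by
  intro x hx y hy h
  rw [meanSpeed_eq, meanSpeed_eq]
  linarith [speed_strictMonoOn_Ioo g hx hy h, speed_strictMonoOn_Ioo (-g) hx hy h]

lemma meanSpeed_strictMonoOn_realAngles (g : ℝ) : StrictMonoOn (meanSpeed g) (realAngles g) := by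
  intro x hx y hy h
  rw [meanSpeed_eq, meanSpeed_eq]
  linarith [speed_strictMonoOn_realAngles g hx hy h,
    speed_strictMonoOn_realAngles (-g) (by rwa [realAngles_neg]) (by rwa [realAngles_neg]) h]

lemma speed_pos_Ioo (g : ℝ) {θ : ℝ} (h : θ ∈ Set.Ioo 0 Real.pi) : 0 < speed g θ := by
  rw [speed_eq]
  have := andronov_pos (g := g) h.1 h.2.le
  have := Real.sin_pos_of_mem_Ioo h
  positivity

lemma speed_neg_of_realAngles {g θ : ℝ} (h : θ ∈ realAngles g) : speed g θ < 0 := by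
  rw [speed_eq]
  exact div_neg_of_pos_of_neg (mul_pos (Real.exp_pos _) h.2.1) (sin_neg_of_mem_Ioo h.1)

lemma speed_neg_neg_of_realAngles {g θ : ℝ} (h : θ ∈ realAngles g) : speed (-g) θ < 0 :=
  speed_neg_of_realAngles (by rwa [realAngles_neg])

lemma meanSpeed_pos_Ioo (g : ℝ) {θ : ℝ} (h : θ ∈ Set.Ioo 0 Real.pi) : 0 < meanSpeed g θ := by
  rw [meanSpeed_eq]; linarith [speed_pos_Ioo g h, speed_pos_Ioo (-g) h]

lemma meanSpeed_neg_of_realAngles {g θ : ℝ} (h : θ ∈ realAngles g) : meanSpeed g θ < 0 := by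
  rw [meanSpeed_eq]; linarith [speed_neg_of_realAngles h, speed_neg_neg_of_realAngles h]

lemma tendsto_speed_zero (g : ℝ) : Tendsto (speed g) (𝓝[>] 0) (𝓝 0) := by
  have hn : HasDerivAt (fun t => Real.exp (-(g * t)) - Real.cos t + g * Real.sin t) 0 0 := by
    have h1 : HasDerivAt (fun t => Real.exp (-(g * t))) (-g) 0 := by
      simpa using ((hasDerivAt_id (0 : ℝ)).const_mul g).neg.exp
    exact ((h1.sub (Real.hasDerivAt_cos 0)).add ((Real.hasDerivAt_sin 0).const_mul g)).congr_deriv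
      (by simp)
  have h1 := hn.tendsto_slope_zero_right
  have h2 := (Real.hasDerivAt_sin 0).tendsto_slope_zero_right
  have h3 := h1.div h2 (by simp)
  simp only [Real.cos_zero, zero_div] at h3
  refine h3.congr' ?_
  filter_upwards [self_mem_nhdsWithin] with t ht
  have : t ≠ 0 := ne_of_gt ht
  simp [speed]
  field_simp

lemma tendsto_sin_pi_left : Tendsto Real.sin (𝓝[<] Real.pi) (𝓝[>] 0) := by
  refine tendsto_nhdsWithin_iff.2 ⟨?_, ?_⟩
  · have := Real.continuous_sin.tendsto Real.pi
    rw [Real.sin_pi] at this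
    exact this.mono_left nhdsWithin_le_nhds
  · filter_upwards [Ioo_mem_nhdsLT Real.pi_pos] with t ht using Real.sin_pos_of_mem_Ioo ht

lemma tendsto_sin_pi_right : Tendsto Real.sin (𝓝[>] Real.pi) (𝓝[<] 0) := by
  refine tendsto_nhdsWithin_iff.2 ⟨?_, ?_⟩
  · have := Real.continuous_sin.tendsto Real.pi
    rw [Real.sin_pi] at this
    exact this.mono_left nhdsWithin_le_nhds
  · filter_upwards [Ioo_mem_nhdsGT (by linarith [Real.pi_pos] : Real.pi < 2 * Real.pi)] with t ht
      using sin_neg_of_mem_Ioo ht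

lemma tendsto_speed_num (g : ℝ) :
    Tendsto (fun t => Real.exp (-(g * t)) - Real.cos t + g * Real.sin t) (𝓝 Real.pi)
      (𝓝 (Real.exp (-(g * Real.pi)) + 1)) := by
  have : Continuous (fun t => Real.exp (-(g * t)) - Real.cos t + g * Real.sin t) := by fun_prop
  simpa using this.tendsto Real.pi

lemma tendsto_speed_pi_left (g : ℝ) : Tendsto (speed g) (𝓝[<] Real.pi) atTop :=
  ((tendsto_speed_num g).mono_left nhdsWithin_le_nhds).pos_mul_atTop (by positivity)
    (tendsto_inv_nhdsGT_zero.comp tendsto_sin_pi_left)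

lemma tendsto_speed_pi_right (g : ℝ) : Tendsto (speed g) (𝓝[>] Real.pi) atBot :=
  ((tendsto_speed_num g).mono_left nhdsWithin_le_nhds).pos_mul_atBot (by positivity)
    (tendsto_inv_nhdsLT_zero.comp tendsto_sin_pi_right)

lemma tendsto_meanSpeed_zero (g : ℝ) : Tendsto (meanSpeed g) (𝓝[>] 0) (𝓝 0) := by
  have := ((tendsto_speed_zero g).add (tendsto_speed_zero (-g))).div_const 2
  simpa [← meanSpeed_eq] using this

lemma tendsto_meanSpeed_pi_left (g : ℝ) : Tendsto (meanSpeed g) (𝓝[<] Real.pi) atTop := by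
  have := ((tendsto_speed_pi_left g).atTop_add_atTop (tendsto_speed_pi_left (-g))).atTop_div_const
    (r := 2) (by norm_num)
  simpa [← meanSpeed_eq] using this

lemma tendsto_meanSpeed_pi_right (g : ℝ) : Tendsto (meanSpeed g) (𝓝[>] Real.pi) atBot := by
  have := ((tendsto_speed_pi_right g).atBot_add_atBot (tendsto_speed_pi_right (-g))).atBot_div_const
    (r := 2) (by norm_num)
  simpa [← meanSpeed_eq] using this

lemma analyticAt_speed {g θ : ℝ} (h : Real.sin θ ≠ 0) :
    AnalyticAt ℝ (fun p : ℝ × ℝ => speed p.1 p.2) (g, θ) := by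
  unfold speed
  have : AnalyticAt ℝ (fun p : ℝ × ℝ => Real.exp (-(p.1 * p.2)) - Real.cos p.2 + p.1 * Real.sin p.2)
    (g, θ) := by fun_prop
  exact this.div (by fun_prop) h

lemma analyticAt_meanSpeed {g θ : ℝ} (h : Real.sin θ ≠ 0) :
    AnalyticAt ℝ (fun p : ℝ × ℝ => meanSpeed p.1 p.2) (g, θ) := by
  simp only [meanSpeed_eq]
  have h2 : AnalyticAt ℝ (fun p : ℝ × ℝ => speed (-p.1) p.2) (g, θ) :=
    AnalyticAt.comp (f := fun p : ℝ × ℝ => (-p.1, p.2)) (g := fun p : ℝ × ℝ => speed p.1 p.2)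
      (analyticAt_speed h) (by fun_prop)
  have h3 := (analyticAt_speed (g := g) h).add h2
  exact h3.div analyticAt_const (by norm_num)

/-! ### Linear flows of focus or center type -/

/-- Half the trace. -/
noncomputable def damping (M : Matrix (Fin 2) (Fin 2) ℝ) : ℝ := (M 0 0 + M 1 1) / 2

/-- The determinant, written out. -/
noncomputable def stiffness (M : Matrix (Fin 2) (Fin 2) ℝ) : ℝ := M 0 0 * M 1 1 - M 0 1 * M 1 0

/-- The imaginary part of the eigenvalues (when they are not real). -/
noncomputable def freq (M : Matrix (Fin 2) (Fin 2) ℝ) : ℝ := √(stiffness M - damping M ^ 2)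

/-- The ratio of the real and the imaginary part of the eigenvalues. -/
noncomputable def ratio (M : Matrix (Fin 2) (Fin 2) ℝ) : ℝ := damping M / freq M

/-- The frequency times the signed distance from the equilibrium of `p ↦ M p + v` to `Σ`, positive
when the equilibrium lies in `x < 0`. -/
noncomputable def reach (M : Matrix (Fin 2) (Fin 2) ℝ) (v : Fin 2 → ℝ) : ℝ :=
  (M 1 1 * v 0 - M 0 1 * v 1) / stiffness M * freq M

/-- The matrix has non-real eigenvalues and rotates counterclockwise. -/
def IsRotating (M : Matrix (Fin 2) (Fin 2) ℝ) : Prop :=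
  M 0 1 < 0 ∧ damping M ^ 2 < stiffness M

lemma IsRotating.freq_pos {M} (h : IsRotating M) : 0 < freq M := Real.sqrt_pos.2 (by linarith [h.2])

lemma IsRotating.stiffness_pos {M} (h : IsRotating M) : 0 < stiffness M :=
  (sq_nonneg _).trans_lt h.2

lemma IsRotating.damping_eq {M} (h : IsRotating M) : damping M = ratio M * freq M := by
  rw [ratio, div_mul_cancel₀ _ h.freq_pos.ne']

lemma IsRotating.stiffness_eq {M} (h : IsRotating M) :
    stiffness M = freq M ^ 2 * (1 + ratio M ^ 2) := by
  have h1 : freq M ^ 2 = stiffness M - damping M ^ 2 := Real.sq_sqrt (by linarith [h.2])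
  rw [h.damping_eq] at h1
  linear_combination -h1

lemma IsRotating.reach_eq {M} (h : IsRotating M) (v : Fin 2 → ℝ) :
    M 1 1 * v 0 - M 0 1 * v 1 = freq M * (1 + ratio M ^ 2) * reach M v := by
  have := h.stiffness_pos.ne'
  have h2 := h.stiffness_eq
  have h3 : reach M v * stiffness M = (M 1 1 * v 0 - M 0 1 * v 1) * freq M := by
    rw [reach]; field_simp
  have h4 := h.freq_pos.ne'
  apply mul_right_cancel₀ h4
  rw [← h3, h2]; ring

/-- The abscissa at time `t` of a solution with abscissa `x` and horizontal velocity `v` at time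
`0`. -/
noncomputable def solX (ω g h x v t : ℝ) : ℝ :=
  -(h / ω) + Real.exp (g * (ω * t)) * (Real.cos (ω * t) * (x + h / ω)
    + Real.sin (ω * t) / ω * (v - g * ω * (x + h / ω)))

/-- The horizontal velocity at time `t` of a solution with abscissa `x` and horizontal velocity `v`
at time `0`. -/
noncomputable def solV (ω g h x v t : ℝ) : ℝ :=
  Real.exp (g * (ω * t)) * (Real.cos (ω * t) * v
    + Real.sin (ω * t) * (g * v - ω * (1 + g ^ 2) * (x + h / ω)))

lemma hasDerivAt_solX {ω : ℝ} (hω : ω ≠ 0) (g h x v t : ℝ) :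
    HasDerivAt (solX ω g h x v) (solV ω g h x v t) t := by
  have h0 : HasDerivAt (fun s => ω * s) ω t := by simpa using (hasDerivAt_id t).const_mul ω
  have h1 := (h0.const_mul g).exp
  have h2 := (h0.cos.mul_const (x + h / ω)).add
    ((h0.sin.div_const ω).mul_const (v - g * ω * (x + h / ω)))
  refine ((h1.mul h2).const_add (-(h / ω))).congr_deriv ?_
  simp only [Pi.add_apply, solV]
  field_simp
  ring

lemma hasDerivAt_solV {ω : ℝ} (hω : ω ≠ 0) (g h x v t : ℝ) :
    HasDerivAt (solV ω g h x v) (2 * (g * ω) * solV ω g h x v t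
      - ω ^ 2 * (1 + g ^ 2) * (solX ω g h x v t + h / ω)) t := by
  have h0 : HasDerivAt (fun s => ω * s) ω t := by simpa using (hasDerivAt_id t).const_mul ω
  have h1 := (h0.const_mul g).exp
  have h2 := (h0.cos.mul_const v).add
    (h0.sin.mul_const (g * v - ω * (1 + g ^ 2) * (x + h / ω)))
  refine (h1.mul h2).congr_deriv ?_
  simp only [Pi.add_apply, solV, solX]
  field_simp
  ring

/-- The flow of `p ↦ M p + v`. -/
noncomputable def flow (M : Matrix (Fin 2) (Fin 2) ℝ) (v : Fin 2 → ℝ) (t : ℝ) (p : Fin 2 → ℝ) :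
    Fin 2 → ℝ :=
  let x := solX (freq M) (ratio M) (reach M v) (p 0) ((M *ᵥ p + v) 0) t
  ![x, (solV (freq M) (ratio M) (reach M v) (p 0) ((M *ᵥ p + v) 0) t - M 0 0 * x - v 0) / M 0 1]

lemma field_zero (M : Matrix (Fin 2) (Fin 2) ℝ) (v p : Fin 2 → ℝ) :
    (M *ᵥ p + v) 0 = M 0 0 * p 0 + M 0 1 * p 1 + v 0 := by
  simp

lemma field_one (M : Matrix (Fin 2) (Fin 2) ℝ) (v p : Fin 2 → ℝ) :
    (M *ᵥ p + v) 1 = M 1 0 * p 0 + M 1 1 * p 1 + v 1 := by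
  simp

lemma flow_apply_zero (M v t p) : flow M v t p 0 =
    solX (freq M) (ratio M) (reach M v) (p 0) ((M *ᵥ p + v) 0) t := rfl

lemma flow_apply_one (M v t p) : flow M v t p 1 =
    (solV (freq M) (ratio M) (reach M v) (p 0) ((M *ᵥ p + v) 0) t - M 0 0 *
      solX (freq M) (ratio M) (reach M v) (p 0) ((M *ᵥ p + v) 0) t - v 0) / M 0 1 := rfl

lemma field_flow_zero {M} (h : IsRotating M) (v t p) : (M *ᵥ flow M v t p + v) 0 =
    solV (freq M) (ratio M) (reach M v) (p 0) ((M *ᵥ p + v) 0) t := by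
  have := h.1.ne
  rw [field_zero]
  simp only [flow, Matrix.cons_val_zero, Matrix.cons_val_one]
  field_simp
  ring

lemma flow_zero {M} (h : IsRotating M) (v p) : flow M v 0 p = p := by
  have h1 := h.1.ne
  ext i
  fin_cases i
  · simp [flow, solX]
  · simp only [flow, solX, solV, field_zero]
    simp
    field_simp
    ring

lemma hasDerivAt_flow {M} (h : IsRotating M) (v p t) :
    HasDerivAt (fun s => flow M v s p) (M *ᵥ flow M v t p + v) t := by
  have hω := h.freq_pos.ne'
  have h1 := h.1.ne
  have hX := hasDerivAt_solX hω (ratio M) (reach M v) (p 0) ((M *ᵥ p + v) 0) t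
  have hV := hasDerivAt_solV hω (ratio M) (reach M v) (p 0) ((M *ᵥ p + v) 0) t
  rw [hasDerivAt_pi]
  intro i
  fin_cases i
  · exact hX.congr_deriv (field_flow_zero h v t p).symm
  · refine (((hV.sub (hX.const_mul (M 0 0))).sub_const (v 0)).div_const (M 0 1)).congr_deriv ?_
    have e1 := h.stiffness_eq
    have e2 := h.damping_eq
    have e3 := h.reach_eq v
    rw [stiffness] at e1
    rw [damping] at e2
    simp only [Fin.mk_one, field_one, flow, Matrix.cons_val_zero, Matrix.cons_val_one]
    set X := solX (freq M) (ratio M) (reach M v) (p 0) ((M *ᵥ p + v) 0) t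
    set V := solV (freq M) (ratio M) (reach M v) (p 0) ((M *ᵥ p + v) 0) t
    have e4 : freq M ^ 2 * (1 + ratio M ^ 2) * (X + reach M v / freq M) =
        freq M ^ 2 * (1 + ratio M ^ 2) * X + freq M * (1 + ratio M ^ 2) * reach M v := by
      field_simp
    rw [e4, ← e1, ← e3, ← e2]
    field_simp
    ring

lemma continuous_flow (M v) : Continuous fun q : ℝ × (Fin 2 → ℝ) => flow M v q.1 q.2 := by
  refine continuous_pi fun i => ?_
  fin_cases i
  · simp only [flow, solX, field_zero]
    simp only [Fin.zero_eta, Matrix.cons_val_zero]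
    fun_prop
  · simp only [flow, solX, solV, field_zero]
    simp only [Fin.mk_one, Matrix.cons_val_one]
    fun_prop

/-- Uniqueness of the solutions of a linear field, for curves that have only one-sided derivatives. -/
lemma eqOn_flow {M} (h : IsRotating M) (v) {γ : ℝ → Fin 2 → ℝ} {a b : ℝ}
    (hc : ContinuousOn γ (Set.Icc a b))
    (hd : ∀ t ∈ Set.Ico a b, HasDerivWithinAt γ (M *ᵥ γ t + v) (Set.Ici t) t) :
    Set.EqOn γ (fun t => flow M v (t - a) (γ a)) (Set.Icc a b) := by
  have hL : LipschitzWith ‖(Matrix.toLin' M).toContinuousLinearMap‖₊ fun p : Fin 2 → ℝ => M *ᵥ p + v := by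
    have := (Matrix.toLin' M).toContinuousLinearMap.lipschitz
    exact LipschitzWith.of_dist_le_mul fun x y => by
      rw [dist_add_right]; exact this.dist_le_mul x y
  have hder : ∀ t, HasDerivAt (fun t => flow M v (t - a) (γ a))
      (M *ᵥ flow M v (t - a) (γ a) + v) t := fun t =>
    (hasDerivAt_flow h v (γ a) (t - a)).comp_sub_const t a
  refine ODE_solution_unique_of_mem_Icc_right (v := fun _ p => M *ᵥ p + v) (s := fun _ => Set.univ)
    (fun t _ => hL.lipschitzOnWith) hc hd (fun _ _ => trivial)
    (fun t _ => (hder t).continuousAt.continuousWithinAt)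
    (fun t _ => (hder t).hasDerivWithinAt) (fun _ _ => trivial) ?_
  simp [flow_zero h]

/-- Starting on `Σ`, the abscissa after the angle `θ = ω t`. -/
lemma solX_zero {ω : ℝ} (hω : ω ≠ 0) (g h v t : ℝ) :
    ω * solX ω g h 0 v t =
      v * Real.exp (g * (ω * t)) * Real.sin (ω * t) - h * andronov g (ω * t) := by
  rw [solX, andronov]; field_simp; ring

/-! ### Crossing trajectories -/

/-- The rotation of the plane by `π`, which exchanges the two zones. -/
noncomputable def rot (Z : PWL) : PWL := ⟨Z.leftMat, -Z.leftVec, Z.rightMat, -Z.rightVec⟩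

lemma rot_right (Z : PWL) (p) : Z.rot.right p = -Z.left (-p) := by
  simp only [rot, right, left, Matrix.mulVec_neg, neg_add, neg_neg]

lemma rot_left (Z : PWL) (p) : Z.rot.left p = -Z.right (-p) := by
  simp only [rot, right, left, Matrix.mulVec_neg, neg_add, neg_neg]

@[simp] lemma rot_rot (Z : PWL) : Z.rot.rot = Z := by simp [rot]

lemma rot_crossing {Z : PWL} {p} : p ∈ Z.rot.crossingRegion ↔ -p ∈ Z.crossingRegion := by
  simp [crossingRegion, rot_right, rot_left, mul_comm]

lemma field_right {Z : PWL} {p} (h : 0 < p 0 ∨ (p 0 = 0 ∧ 0 < Z.right p 0)) :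
    Z.field p = Z.right p := if_pos h

lemma field_left {Z : PWL} {p} (h : p 0 < 0 ∨ (p 0 = 0 ∧ Z.right p 0 ≤ 0)) :
    Z.field p = Z.left p := by
  refine if_neg fun hh => ?_
  rcases h with h | ⟨h, h'⟩ <;> rcases hh with hh | ⟨hh, hh'⟩ <;> linarith

lemma left_neg_of_crossing {Z : PWL} {p} (h : p ∈ Z.crossingRegion) (h1 : Z.right p 0 < 0) :
    Z.left p 0 < 0 := by
  have := h.2
  by_contra hh
  nlinarith [mul_nonneg (neg_nonneg.2 h1.le) (not_lt.1 hh)]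

lemma left_pos_of_crossing {Z : PWL} {p} (h : p ∈ Z.crossingRegion) (h1 : 0 < Z.right p 0) :
    0 < Z.left p 0 := (pos_iff_pos_of_mul_pos h.2).1 h1

lemma right_neg_of_crossing {Z : PWL} {p} (h : p ∈ Z.crossingRegion) (h1 : Z.left p 0 < 0) :
    Z.right p 0 < 0 := (neg_iff_neg_of_mul_pos h.2).2 h1

lemma right_pos_of_crossing {Z : PWL} {p} (h : p ∈ Z.crossingRegion) (h1 : 0 < Z.left p 0) :
    0 < Z.right p 0 := (pos_iff_pos_of_mul_pos h.2).2 h1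

lemma right_ne_of_crossing {Z : PWL} {p} (h : p ∈ Z.crossingRegion) : Z.right p 0 ≠ 0 := by
  intro h0; have := h.2; simp [h0] at this

/-- On `Σ` the rotation exchanges the roles of the two fields, so the value of `field` there is
respected only at crossing points, where it is determined by the common direction. -/
lemma rot_field {Z : PWL} {p} (h : p 0 = 0 → p ∈ Z.crossingRegion) :
    Z.rot.field (-p) = -Z.field p := by
  rcases lt_trichotomy (p 0) 0 with h0 | h0 | h0
  · rw [field_left (Or.inl h0), field_right (Or.inl (by simpa using h0)), rot_right, neg_neg]
  · have hc := h h0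
    rcases (right_ne_of_crossing hc).lt_or_gt with h1 | h1
    · have := left_neg_of_crossing hc h1
      rw [field_left (Or.inr ⟨h0, h1.le⟩),
        field_right (Or.inr ⟨by simpa using h0, by simpa [rot_right] using this⟩), rot_right, neg_neg]
    · have := left_pos_of_crossing hc h1
      rw [field_right (Or.inr ⟨h0, h1⟩),
        field_left (Or.inr ⟨by simpa using h0, by simpa [rot_right] using this.le⟩), rot_left, neg_neg]
  · rw [field_right (Or.inl h0), field_left (Or.inl (by simpa using h0)), rot_left, neg_neg]

lemma IsCrossingTrajectory.rot {Z : PWL} {γ I} (h : Z.IsCrossingTrajectory γ I) :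
    Z.rot.IsCrossingTrajectory (fun t => -γ t) I := by
  refine ⟨h.1.neg, fun t ht => ⟨fun h0 => ?_, ?_⟩⟩
  · rw [rot_crossing, neg_neg]; exact (h.2 t ht).1 (by simpa using h0)
  · rw [rot_field (h.2 t ht).1]; exact (h.2 t ht).2.neg

lemma IsCrossingTrajectory.mono {Z : PWL} {γ I J} (h : Z.IsCrossingTrajectory γ I) (hJ : J ⊆ I) :
    Z.IsCrossingTrajectory γ J :=
  ⟨h.1.mono hJ, fun t ht => ⟨(h.2 t (hJ ht)).1, (h.2 t (hJ ht)).2.mono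
    (Set.inter_subset_inter_left _ hJ)⟩⟩

lemma IsCrossingTrajectory.comp_add {Z : PWL} {γ I J} (h : Z.IsCrossingTrajectory γ I) (a : ℝ)
    (hJ : ∀ t ∈ J, t + a ∈ I) : Z.IsCrossingTrajectory (fun t => γ (t + a)) J := by
  refine ⟨h.1.comp (by fun_prop) hJ, fun t ht => ⟨(h.2 _ (hJ t ht)).1, ?_⟩⟩
  have := (h.2 _ (hJ t ht)).2
  have h2 : HasDerivWithinAt (fun s : ℝ => s + a) 1 (J ∩ Set.Ici t) t :=
    ((hasDerivAt_id t).add_const a).hasDerivWithinAt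
  have := HasDerivWithinAt.scomp t this h2 (fun s hs => show s + a ∈ I ∩ Set.Ici (t + a) from
    ⟨hJ s hs.1, add_le_add_left hs.2 a⟩)
  simpa [Function.comp_def] using this

lemma exists_pos_right_of_hasDerivWithinAt {f : ℝ → ℝ} {a b d : ℝ} (hab : a < b)
    (hf : HasDerivWithinAt f d (Set.Icc a b ∩ Set.Ici a) a) (h0 : f a = 0) (hd : 0 < d) :
    ∀ᶠ t in 𝓝[>] a, 0 < f t := by
  have h1 : HasDerivWithinAt f d (Set.Ioi a) a := by
    have : HasDerivWithinAt f d (Set.Icc a b) a :=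
      hf.mono fun x hx => ⟨hx, hx.1⟩
    exact (this.mono_of_mem_nhdsWithin (Icc_mem_nhdsGE hab)).Ioi_of_Ici
  have h2 := (hasDerivWithinAt_iff_tendsto_slope' (by simp)).1 h1
  filter_upwards [h2.eventually (lt_mem_nhds hd), self_mem_nhdsWithin] with t ht hta
  rw [slope_def_field, h0, sub_zero] at ht
  exact (div_pos_iff_of_pos_right (sub_pos.2 hta)).1 ht

/-- A trajectory that enters `x > 0` at time `a` and next meets `Σ` at time `b` follows the linear
flow of the right zone. -/
lemma IsCrossingTrajectory.right_passage {Z : PWL} (hM : IsRotating Z.rightMat) {γ : ℝ → Fin 2 → ℝ}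
    {a b : ℝ} (hab : a < b) (h : Z.IsCrossingTrajectory γ (Set.Icc a b)) (h0 : γ a 0 = 0)
    (h1 : 0 < Z.right (γ a) 0) (h2 : ∀ t ∈ Set.Ioo a b, γ t 0 ≠ 0) (h3 : γ b 0 = 0) :
    (∀ t ∈ Set.Icc a b, γ t = flow Z.rightMat Z.rightVec (t - a) (γ a)) ∧
      (∀ t ∈ Set.Ioo a b, 0 < γ t 0) ∧ Z.right (γ b) 0 < 0 := by
  have hcont : ContinuousOn (fun t => γ t 0) (Set.Icc a b) :=
    (continuous_apply 0).comp_continuousOn h.1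
  have hstart : ∀ᶠ t in 𝓝[>] a, 0 < γ t 0 := by
    have := (h.2 a ⟨le_rfl, hab.le⟩).2
    rw [field_right (Or.inr ⟨h0, h1⟩)] at this
    exact exists_pos_right_of_hasDerivWithinAt hab (hasDerivWithinAt_pi.1 this 0) h0 h1
  have hpos : ∀ t ∈ Set.Ioo a b, 0 < γ t 0 := by
    intro t ht
    obtain ⟨s, hs, hsI⟩ := (hstart.and (Ioo_mem_nhdsGT ht.1)).exists
    by_contra hneg
    have hsub : Set.Icc s t ⊆ Set.Icc a b := Set.Icc_subset_Icc hsI.1.le ht.2.le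
    obtain ⟨r, hr, hr0⟩ := intermediate_value_Icc' hsI.2.le (hcont.mono hsub)
      (show (0 : ℝ) ∈ Set.Icc (γ t 0) (γ s 0) from ⟨not_lt.1 hneg, hs.le⟩)
    exact h2 r ⟨hsI.1.trans_le hr.1, hr.2.trans_lt ht.2⟩ hr0
  have hflow : ∀ t ∈ Set.Icc a b, γ t = flow Z.rightMat Z.rightVec (t - a) (γ a) := by
    refine eqOn_flow hM Z.rightVec h.1 fun t ht => ?_
    have := (h.2 t ⟨ht.1, ht.2.le⟩).2
    rw [field_right (by
      rcases ht.1.eq_or_lt with rfl | hlt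
      · exact Or.inr ⟨h0, h1⟩
      · exact Or.inl (hpos t ⟨hlt, ht.2⟩))] at this
    refine this.mono_of_mem_nhdsWithin ?_
    refine mem_of_superset (Icc_mem_nhdsGE ht.2) fun x hx => ⟨⟨ht.1.trans hx.1, hx.2⟩, hx.1⟩
  refine ⟨hflow, hpos, ?_⟩
  have hb := (h.2 b ⟨hab.le, le_rfl⟩).1 h3
  refine lt_of_le_of_ne ?_ (right_ne_of_crossing hb)
  -- the abscissa is positive before time `b` and vanishes there
  have hder : HasDerivAt (fun t => flow Z.rightMat Z.rightVec (t - a) (γ a) 0) (Z.right (γ b) 0) b := by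
    have := (hasDerivAt_flow hM Z.rightVec (γ a) (b - a)).comp_sub_const b a
    rw [← hflow b ⟨hab.le, le_rfl⟩] at this
    exact hasDerivAt_pi.1 this 0
  have hsl := (hasDerivWithinAt_iff_tendsto_slope' (s := Set.Iio b) (by simp)).1 hder.hasDerivWithinAt
  refine le_of_tendsto hsl ?_
  filter_upwards [Ioo_mem_nhdsLT hab] with t ht
  rw [slope_def_field, ← hflow b ⟨hab.le, le_rfl⟩, ← hflow t ⟨ht.1.le, ht.2.le⟩, h3]
  exact div_nonpos_of_nonneg_of_nonpos (by simpa using (hpos t ht).le) (by linarith [ht.2])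

/-- Conversely, the linear flow of the right zone is a crossing trajectory while the abscissa is
positive. -/
lemma isCrossingTrajectory_flow_right {Z : PWL} (hM : IsRotating Z.rightMat) {p : Fin 2 → ℝ} {T : ℝ}
    (h0 : 0 < p 0 ∨ (p 0 = 0 ∧ 0 < Z.right p 0 ∧ 0 < Z.left p 0))
    (hpos : ∀ t ∈ Set.Ioo 0 T, 0 < flow Z.rightMat Z.rightVec t p 0)
    (hT : 0 < flow Z.rightMat Z.rightVec T p 0 ∨ flow Z.rightMat Z.rightVec T p ∈ Z.crossingRegion) :
    Z.IsCrossingTrajectory (fun t => flow Z.rightMat Z.rightVec t p) (Set.Icc 0 T) := by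
  have hder := hasDerivAt_flow hM Z.rightVec p
  refine ⟨fun t _ => (hder t).continuousAt.continuousWithinAt, fun t ht => ⟨fun hz => ?_, ?_⟩⟩
  · beta_reduce at hz ⊢
    rcases ht.1.eq_or_lt with rfl | h1
    · rw [flow_zero hM] at hz ⊢
      rcases h0 with h0 | h0
      · exact absurd hz h0.ne'
      · exact ⟨hz, mul_pos h0.2.1 h0.2.2⟩
    · rcases ht.2.eq_or_lt with rfl | h2
      · exact hT.resolve_left (by rw [hz]; simp)
      · exact absurd hz (hpos t ⟨h1, h2⟩).ne'
  · beta_reduce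
    rcases ht.2.eq_or_lt with rfl | h2
    · -- at the right end only one point is left
      refine HasFDerivWithinAt.of_subsingleton fun s hs r hr => ?_
      exact (le_antisymm hs.1.2 hs.2).trans (le_antisymm hr.1.2 hr.2).symm
    · rw [field_right]
      · exact (hder t).hasDerivWithinAt
      · rcases ht.1.eq_or_lt with rfl | h1
        · rw [flow_zero hM]; exact h0.imp_right fun h => ⟨h.1, h.2.1⟩
        · exact Or.inl (hpos t ⟨h1, h2⟩)

/-- Concatenation of trajectories. -/
lemma IsCrossingTrajectory.append {Z : PWL} {γ₁ γ₂ : ℝ → Fin 2 → ℝ} {S T : ℝ} (hS : 0 ≤ S) (hT : 0 ≤ T)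
    (h₁ : Z.IsCrossingTrajectory γ₁ (Set.Icc 0 S)) (h₂ : Z.IsCrossingTrajectory γ₂ (Set.Icc 0 T))
    (h : γ₁ S = γ₂ 0) :
    Z.IsCrossingTrajectory (fun t => if t < S then γ₁ t else γ₂ (t - S)) (Set.Icc 0 (S + T)) := by
  have h₂' : Z.IsCrossingTrajectory (fun t => γ₂ (t - S)) (Set.Icc S (S + T)) :=
    h₂.comp_add (-S) fun t ht => ⟨by linarith [ht.1], by linarith [ht.2]⟩
  have e2 : ∀ t ∈ Set.Icc S (S + T), (if t < S then γ₁ t else γ₂ (t - S)) = γ₂ (t - S) :=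
    fun t ht => if_neg (not_lt.2 ht.1)
  have e1 : ∀ t ∈ Set.Icc 0 S, (if t < S then γ₁ t else γ₂ (t - S)) = γ₁ t := by
    intro t ht
    rcases ht.2.eq_or_lt with rfl | hlt
    · simp [h]
    · exact if_pos hlt
  refine ⟨?_, fun t ht => ?_⟩
  · rw [show Set.Icc 0 (S + T) = Set.Icc 0 S ∪ Set.Icc S (S + T) from
      (Set.Icc_union_Icc_eq_Icc hS (by linarith)).symm]
    exact (h₁.1.congr e1).union_of_isClosed (h₂'.1.congr e2) isClosed_Icc isClosed_Icc
  · rcases lt_or_ge t S with hlt | hge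
    · have ht1 : t ∈ Set.Icc 0 S := ⟨ht.1, hlt.le⟩
      beta_reduce
      rw [e1 t ht1]
      refine ⟨(h₁.2 t ht1).1, ?_⟩
      refine ((h₁.2 t ht1).2.congr (fun s hs => e1 s hs.1) (e1 t ht1)).mono_of_mem_nhdsWithin ?_
      have : Set.Iio S ∈ 𝓝[Set.Icc 0 (S + T) ∩ Set.Ici t] t :=
        mem_nhdsWithin_of_mem_nhds (Iio_mem_nhds hlt)
      filter_upwards [this, self_mem_nhdsWithin] with s hs hs'
      exact ⟨⟨hs'.1.1, le_of_lt hs⟩, hs'.2⟩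
    · have ht1 : t ∈ Set.Icc S (S + T) := ⟨hge, ht.2⟩
      beta_reduce
      rw [e2 t ht1]
      refine ⟨(h₂'.2 t ht1).1, ?_⟩
      refine ((h₂'.2 t ht1).2.congr (fun s hs => e2 s hs.1) (e2 t ht1)).mono ?_
      exact fun s hs => ⟨⟨hge.trans hs.2, hs.1.2⟩, hs.2⟩

/-! ### Half-returns -/

/-- The sign of the abscissa after the angle `θ`, for an orbit that leaves `Σ` with horizontal
velocity `s`. -/
noncomputable def chi (g h s θ : ℝ) : ℝ := s * Real.exp (g * θ) * Real.sin θ - h * andronov g θ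

lemma chi_eq_zero_iff {g h s θ : ℝ} (hs : Real.sin θ ≠ 0) : chi g h s θ = 0 ↔ s = h * speed g θ := by
  rw [chi, speed_eq, Real.exp_neg]
  constructor
  · intro h1; field_simp; linarith
  · intro h1; rw [h1]; field_simp; ring

lemma chi_eq_mul {g h s θ : ℝ} (hs : Real.sin θ ≠ 0) :
    chi g h s θ = Real.exp (g * θ) * Real.sin θ * (s - h * speed g θ) := by
  rw [chi, speed_eq, Real.exp_neg]
  field_simp

lemma speed_neg_of_chi_eq_zero {g h s θ : ℝ} (hs : Real.sin θ ≠ 0) (h0 : s = h * speed g θ) :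
    Real.exp (g * θ) * (Real.cos θ * s + Real.sin θ * (g * s - (1 + g ^ 2) * h)) =
      -(h * speed (-g) θ) := by
  have e : Real.exp (g * θ) * Real.exp (-(g * θ)) = 1 := by rw [← Real.exp_add]; simp
  rw [h0, speed, speed]
  simp only [neg_mul, neg_neg]
  field_simp
  linear_combination (h * (Real.cos θ + g * Real.sin θ)) * e
    - h * Real.exp (g * θ) * (1 + g^2) * (Real.sin_sq_add_cos_sq θ) +
    h * Real.exp (g * θ) * g^2 * (Real.sin_sq_add_cos_sq θ)

/-- A full turn multiplies the distance to the equilibrium, which is at `-h`, by `exp (2 π g)`. -/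
lemma chi_add_two_pi {g h s θ : ℝ} : chi g h s (θ + 2 * Real.pi) =
    -h * (1 - Real.exp (g * (2 * Real.pi))) + Real.exp (g * (2 * Real.pi)) * chi g h s θ := by
  simp only [chi, andronov, mul_add, Real.exp_add, Real.sin_add_two_pi, Real.cos_add_two_pi]
  ring

/-- First return from the zone of a virtual focus: the angle is less than `π`. -/
lemma mem_Ioo_of_chi {g h s θ : ℝ} (hh : 0 < h) (h0 : 0 < θ) (hpos : ∀ t ∈ Set.Ioo 0 θ, 0 < chi g h s t)
    (hz : chi g h s θ = 0) : θ ∈ Set.Ioo 0 Real.pi := by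
  refine ⟨h0, ?_⟩
  by_contra hge
  have : 0 ≤ chi g h s Real.pi := by
    rcases (not_lt.1 hge).eq_or_lt with h1 | h1
    · rw [h1, hz]
    · exact (hpos _ ⟨Real.pi_pos, h1⟩).le
  have h2 := andronov_pi_pos g
  simp only [chi, Real.sin_pi, mul_zero, zero_sub] at this
  nlinarith

lemma chi_pos_of_speed_Ioo {g h s θ t : ℝ} (hh : 0 < h) (hθ : θ ∈ Set.Ioo 0 Real.pi)
    (hs : s = h * speed g θ) (ht : t ∈ Set.Ioo 0 θ) : 0 < chi g h s t := by
  have ht' : t ∈ Set.Ioo 0 Real.pi := ⟨ht.1, ht.2.trans hθ.2⟩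
  have h1 := Real.sin_pos_of_mem_Ioo ht'
  rw [chi_eq_mul h1.ne', hs, ← mul_sub]
  have := sub_pos.2 (speed_strictMonoOn_Ioo g ht' hθ ht.2)
  positivity

/-- First return from the zone of a real focus. -/
lemma mem_realAngles_of_chi {g h s θ : ℝ} (hh : h < 0) (hs0 : 0 < s) (h0 : 0 < θ)
    (hpos : ∀ t ∈ Set.Ioo 0 θ, 0 < chi g h s t) (hz : chi g h s θ = 0)
    (hv : Real.exp (g * θ) * (Real.cos θ * s + Real.sin θ * (g * s - (1 + g ^ 2) * h)) < 0) :
    θ ∈ realAngles g := by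
  have h1 : Real.pi < θ := by
    by_contra hle
    have a := andronov_pos (g := g) h0 (not_lt.1 hle)
    have b := Real.sin_nonneg_of_nonneg_of_le_pi h0.le (not_lt.1 hle)
    have c : 0 ≤ s * Real.exp (g * θ) * Real.sin θ := by positivity
    rw [chi] at hz
    nlinarith
  have h2 : θ < 2 * Real.pi := by
    by_contra hge
    rw [not_lt] at hge
    have hnn : ∀ t, 0 ≤ t → t ≤ θ → 0 ≤ chi g h s t := by
      intro t ht ht'
      rcases ht.eq_or_lt with rfl | h3
      · simp [chi]
      rcases ht'.eq_or_lt with rfl | h4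
      · rw [hz]
      · exact (hpos t ⟨h3, h4⟩).le
    have e2 : chi g h s (2 * Real.pi) = -h * (1 - Real.exp (g * (2 * Real.pi))) := by
      have := chi_add_two_pi (g := g) (h := h) (s := s) (θ := 0)
      simpa [chi] using this
    rcases lt_trichotomy g 0 with hg | hg | hg
    · have h3 := hnn (θ - 2 * Real.pi) (by linarith) (by linarith [Real.pi_pos])
      have h4 := chi_add_two_pi (g := g) (h := h) (s := s) (θ := θ - 2 * Real.pi)
      rw [sub_add_cancel, hz] at h4
      have h5 : Real.exp (g * (2 * Real.pi)) < 1 := by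
        simpa using Real.exp_lt_exp.2 (by nlinarith [Real.pi_pos] : g * (2 * Real.pi) < 0)
      have h6 : 0 ≤ Real.exp (g * (2 * Real.pi)) * chi g h s (θ - 2 * Real.pi) := by positivity
      nlinarith
    · subst hg
      have h3 : θ = 2 * Real.pi := by
        by_contra hne
        have := hpos (2 * Real.pi) ⟨by positivity, lt_of_le_of_ne hge (Ne.symm hne)⟩
        rw [e2] at this; simp at this
      rw [h3] at hv
      simp at hv; linarith
    · have h3 := hnn (2 * Real.pi) (by positivity) hge
      have h5 : 1 < Real.exp (g * (2 * Real.pi)) := Real.one_lt_exp_iff.2 (by positivity)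
      rw [e2] at h3
      nlinarith
  have hsin := sin_neg_of_mem_Ioo ⟨h1, h2⟩
  have hsp := (chi_eq_zero_iff hsin.ne).1 hz
  rw [speed_neg_of_chi_eq_zero hsin.ne hsp] at hv
  have aux : ∀ k, speed k θ < 0 → 0 < andronov k θ := by
    intro k hk
    rw [speed_eq, div_neg_iff] at hk
    rcases hk with hk | hk
    · exact (mul_pos_iff_of_pos_left (Real.exp_pos _)).1 hk.1
    · linarith [hk.2]
  refine ⟨⟨h1, h2⟩, aux _ ?_, aux _ ?_⟩
  · by_contra hn; nlinarith
  · by_contra hn; nlinarith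

lemma chi_pos_of_speed_realAngles {g h s θ t : ℝ} (hh : h < 0) (hθ : θ ∈ realAngles g)
    (hs : s = h * speed g θ) (ht : t ∈ Set.Ioo 0 θ) : 0 < chi g h s t := by
  rcases le_or_gt t Real.pi with h1 | h1
  · have a := andronov_pos (g := g) ht.1 h1
    have b := Real.sin_nonneg_of_nonneg_of_le_pi ht.1.le h1
    have d : 0 < s := by rw [hs]; exact mul_pos_of_neg_of_neg hh (speed_neg_of_realAngles hθ)
    have c : 0 ≤ s * Real.exp (g * t) * Real.sin t := by positivity
    rw [chi]
    nlinarith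
  · have ht' := realAngles_of_le hθ h1 ht.2.le
    have h2 := sin_neg_of_mem_Ioo ht'.1
    rw [chi_eq_mul h2.ne, hs, ← mul_sub]
    have h3 := sub_pos.2 (speed_strictMonoOn_realAngles g ht' hθ ht.2)
    exact mul_pos_of_neg_of_neg (mul_neg_of_pos_of_neg (Real.exp_pos _) h2) (mul_neg_of_neg_of_pos hh h3)

lemma flow_section_zero {M} (h : IsRotating M) (v : Fin 2 → ℝ) (y t : ℝ) :
    freq M * flow M v t ![0, y] 0 = chi (ratio M) (reach M v) (M 0 1 * y + v 0) (freq M * t) := by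
  rw [flow_apply_zero, field_zero]
  simp only [Matrix.cons_val_zero, Matrix.cons_val_one, mul_zero, zero_add]
  rw [solX_zero h.freq_pos.ne', chi]

lemma field_flow_section_zero {M} (h : IsRotating M) (v : Fin 2 → ℝ) (y t : ℝ) :
    (M *ᵥ flow M v t ![0, y] + v) 0 = Real.exp (ratio M * (freq M * t)) *
      (Real.cos (freq M * t) * (M 0 1 * y + v 0) + Real.sin (freq M * t) *
        (ratio M * (M 0 1 * y + v 0) - (1 + ratio M ^ 2) * reach M v)) := by
  have := h.freq_pos.ne'
  rw [field_flow_zero h, field_zero]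
  simp only [Matrix.cons_val_zero, Matrix.cons_val_one, mul_zero, zero_add, solV]
  congr 3
  field_simp

lemma eq_section {p : Fin 2 → ℝ} (h : p 0 = 0) : p = ![0, p 1] := by
  ext i; fin_cases i <;> simp [h]

lemma reach_neg (M v) : reach M (-v) = -reach M v := by simp [reach]; ring

lemma flow_neg (M v t p) : flow M (-v) t (-p) = -flow M v t p := by
  have h0 : (M *ᵥ (-p) + -v) 0 = -(M *ᵥ p + v) 0 := by
    simp only [Matrix.mulVec_neg, ← neg_add, Pi.neg_apply]
  have hX : ∀ ω g h x v t, solX ω g (-h) (-x) (-v) t = -solX ω g h x v t := by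
    intros; simp only [solX]; ring
  have hV : ∀ ω g h x v t, solV ω g (-h) (-x) (-v) t = -solV ω g h x v t := by
    intros; simp only [solV]; ring
  ext i
  fin_cases i
  · simp only [flow, h0, reach_neg, Pi.neg_apply, hX, Matrix.cons_val_zero, Fin.zero_eta]
  · simp only [Fin.mk_one, Pi.neg_apply, flow_apply_one, h0, reach_neg, hX, hV]
    rw [← neg_div]; congr 1; ring

/-- The fields for which the half-returns are studied: foci or centers on both sides, the left one
real, the right one virtual, turning counterclockwise. -/
structure IsGood (Z : PWL) : Prop where
  rotL : IsRotating Z.leftMat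
  rotR : IsRotating Z.rightMat
  reachL : 0 < reach Z.leftMat Z.leftVec
  reachR : 0 < reach Z.rightMat Z.rightVec

/-- The damping ratio of the left zone. -/
noncomputable def gL (Z : PWL) : ℝ := ratio Z.leftMat
/-- The damping ratio of the right zone. -/
noncomputable def gR (Z : PWL) : ℝ := ratio Z.rightMat
/-- The reach of the left zone: the scale in which horizontal velocities on `Σ` are measured there. -/
noncomputable def hL (Z : PWL) : ℝ := reach Z.leftMat Z.leftVec
/-- The reach of the right zone: the scale in which horizontal velocities on `Σ` are measured there. -/
noncomputable def hR (Z : PWL) : ℝ := reach Z.rightMat Z.rightVec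

/-- The horizontal velocity of the left field on `Σ`. -/
noncomputable def uL (Z : PWL) (y : ℝ) : ℝ := Z.leftMat 0 1 * y + Z.leftVec 0

/-- The horizontal velocity of the right field on `Σ`. -/
noncomputable def uR (Z : PWL) (y : ℝ) : ℝ := Z.rightMat 0 1 * y + Z.rightVec 0

lemma left_section (Z : PWL) (y : ℝ) : Z.left ![0, y] 0 = Z.uL y := by
  rw [left, field_zero]; simp [uL]

lemma right_section (Z : PWL) (y : ℝ) : Z.right ![0, y] 0 = Z.uR y := by
  rw [right, field_zero]; simp [uR]

lemma mem_crossingRegion_section {Z : PWL} {y : ℝ} :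
    ![0, y] ∈ Z.crossingRegion ↔ 0 < Z.uR y * Z.uL y := by
  simp only [crossingRegion, Set.mem_ofPred_eq, right_section, left_section]; simp

/-- The left field turns `(0, y)` into `(0, y₁)` by the angle `θ`. -/
def LeftHalf (Z : PWL) (θ y y₁ : ℝ) : Prop :=
  θ ∈ realAngles Z.gL ∧ Z.uL y = Z.hL * speed Z.gL θ ∧ Z.uL y₁ = -(Z.hL * speed (-Z.gL) θ)

/-- The right field turns `(0, y₁)` into `(0, y₂)` by the angle `θ`. -/
def RightHalf (Z : PWL) (θ y₁ y₂ : ℝ) : Prop :=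
  θ ∈ Set.Ioo 0 Real.pi ∧ Z.uR y₁ = Z.hR * speed Z.gR θ ∧ Z.uR y₂ = -(Z.hR * speed (-Z.gR) θ)

lemma rot_rightFlow (Z : PWL) (t p) :
    flow Z.rot.rightMat Z.rot.rightVec t (-p) = -flow Z.leftMat Z.leftVec t p := flow_neg _ _ _ _

lemma neg_section (y : ℝ) : -(![0, y] : Fin 2 → ℝ) = ![0, -y] := by simp

/-- A half-return: the orbit that leaves `Σ` with normalized speed `speed g θ` comes back after the
angle `θ` with normalized speed `speed (-g) θ`. -/
lemma flow_eq_section {M} (h : IsRotating M) {v : Fin 2 → ℝ} {y y₁ θ : ℝ} (hs : Real.sin θ ≠ 0)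
    (h0 : M 0 1 * y + v 0 = reach M v * speed (ratio M) θ)
    (h1 : M 0 1 * y₁ + v 0 = -(reach M v * speed (-ratio M) θ)) :
    flow M v (θ / freq M) ![0, y] = ![0, y₁] := by
  have hω := h.freq_pos.ne'
  have ht : freq M * (θ / freq M) = θ := by field_simp
  have hx : flow M v (θ / freq M) ![0, y] 0 = 0 := by
    have := flow_section_zero h v y (θ / freq M)
    rw [ht, (chi_eq_zero_iff hs).2 h0] at this
    exact (mul_eq_zero.1 this).resolve_left hω
  have hv := field_flow_section_zero h v y (θ / freq M)
  rw [ht, speed_neg_of_chi_eq_zero hs h0, field_zero, hx, ← h1] at hv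
  rw [eq_section hx]
  congr 2
  have := h.1.ne
  have h2 : M 0 1 * flow M v (θ / freq M) ![0, y] 1 = M 0 1 * y₁ := by linarith
  exact mul_left_cancel₀ this h2

section Passages

variable {Z : PWL} (hZ : Z.IsGood) {γ : ℝ → Fin 2 → ℝ} {a b y y₁ θ : ℝ}
include hZ

/-- A trajectory in `x > 0` between two consecutive hits of `Σ`. -/
lemma IsGood.rightHalf_of_trajectory (hab : a < b) (h : Z.IsCrossingTrajectory γ (Set.Icc a b))
    (h0 : γ a = ![0, y]) (h1 : 0 < Z.uR y) (h2 : ∀ t ∈ Set.Ioo a b, γ t 0 ≠ 0) (h3 : γ b 0 = 0) :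
    Z.RightHalf (freq Z.rightMat * (b - a)) y (γ b 1) ∧
      (∀ t ∈ Set.Icc a b, γ t = flow Z.rightMat Z.rightVec (t - a) ![0, y]) ∧
      ∀ t ∈ Set.Ioo a b, 0 < γ t 0 := by
  obtain ⟨hf, hpos, hend⟩ := h.right_passage hZ.rotR hab (by simp [h0])
    (by rw [h0, right_section]; exact h1) h2 h3
  rw [h0] at hf
  have hω := hZ.rotR.freq_pos
  set θ := freq Z.rightMat * (b - a) with hθ
  have hchi : ∀ t ∈ Set.Icc a b, freq Z.rightMat * γ t 0 =
      chi Z.gR Z.hR (Z.uR y) (freq Z.rightMat * (t - a)) := by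
    intro t ht; rw [hf t ht, flow_section_zero hZ.rotR]; rfl
  have hz : chi Z.gR Z.hR (Z.uR y) θ = 0 := by rw [← hchi b ⟨hab.le, le_rfl⟩, h3, mul_zero]
  have hθ0 : 0 < θ := mul_pos hω (sub_pos.2 hab)
  have hmem : θ ∈ Set.Ioo 0 Real.pi := by
    refine mem_Ioo_of_chi hZ.reachR hθ0 (fun t ht => ?_) hz
    have hs : a + t / freq Z.rightMat ∈ Set.Ioo a b := by
      refine ⟨by have := div_pos ht.1 hω; linarith, ?_⟩
      have := (div_lt_iff₀ hω).2 (by rw [mul_comm]; exact ht.2 : t < (b - a) * freq Z.rightMat)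
      linarith
    have := hchi _ (Set.Ioo_subset_Icc_self hs)
    rw [show freq Z.rightMat * (a + t / freq Z.rightMat - a) = t by field_simp; ring] at this
    change 0 < chi Z.gR Z.hR (Z.uR y) t
    rw [← this]
    exact mul_pos hω (hpos _ hs)
  have hsin := sin_ne_zero_of_Ioo hmem
  have hsp := (chi_eq_zero_iff hsin).1 hz
  refine ⟨⟨hmem, hsp, ?_⟩, hf, hpos⟩
  have hv := field_flow_section_zero hZ.rotR Z.rightVec y (b - a)
  rw [← hf b ⟨hab.le, le_rfl⟩, eq_section h3] at hv
  have e := speed_neg_of_chi_eq_zero hsin hsp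
  exact (right_section Z _).symm.trans (hv.trans e)

/-- A trajectory in `x < 0` between two consecutive hits of `Σ`. -/
lemma IsGood.leftHalf_of_trajectory (hab : a < b) (h : Z.IsCrossingTrajectory γ (Set.Icc a b))
    (h0 : γ a = ![0, y]) (h1 : Z.uL y < 0) (h2 : ∀ t ∈ Set.Ioo a b, γ t 0 ≠ 0) (h3 : γ b 0 = 0) :
    Z.LeftHalf (freq Z.leftMat * (b - a)) y (γ b 1) ∧
      (∀ t ∈ Set.Icc a b, γ t = flow Z.leftMat Z.leftVec (t - a) ![0, y]) ∧
      ∀ t ∈ Set.Ioo a b, γ t 0 < 0 := by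
  obtain ⟨hf, hpos, hend⟩ := h.rot.right_passage (Z := Z.rot) hZ.rotL hab (by simp [h0])
    (by rw [rot_right, neg_neg, h0]; simpa [left_section] using h1)
    (by simpa using h2) (by simpa using h3)
  replace hf : ∀ t ∈ Set.Icc a b, γ t = flow Z.leftMat Z.leftVec (t - a) ![0, y] := by
    intro t ht
    have := hf t ht
    rw [rot_rightFlow, h0] at this
    exact neg_inj.1 this
  replace hpos : ∀ t ∈ Set.Ioo a b, γ t 0 < 0 := fun t ht => by simpa using hpos t ht
  rw [rot_right, neg_neg, eq_section h3, Pi.neg_apply, left_section, neg_neg_iff_pos] at hend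
  have hω := hZ.rotL.freq_pos
  set θ := freq Z.leftMat * (b - a) with hθ
  have hchi : ∀ t ∈ Set.Icc a b, freq Z.leftMat * -γ t 0 =
      chi Z.gL (-Z.hL) (-Z.uL y) (freq Z.leftMat * (t - a)) := by
    intro t ht
    have := flow_section_zero hZ.rotL Z.leftVec y (t - a)
    rw [hf t ht, mul_neg, this]
    simp only [chi, gL, hL, uL]; ring
  have hz : chi Z.gL (-Z.hL) (-Z.uL y) θ = 0 := by rw [← hchi b ⟨hab.le, le_rfl⟩, h3]; simp
  have hθ0 : 0 < θ := mul_pos hω (sub_pos.2 hab)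
  have hv := field_flow_section_zero hZ.rotL Z.leftVec y (b - a)
  rw [← hf b ⟨hab.le, le_rfl⟩, eq_section h3] at hv
  replace hv := (left_section Z _).symm.trans hv
  have hmem : θ ∈ realAngles Z.gL := by
    refine mem_realAngles_of_chi (h := -Z.hL) (s := -Z.uL y) (neg_neg_of_pos hZ.reachL) (by linarith)
      hθ0 (fun t ht => ?_) hz ?_
    · have hs : a + t / freq Z.leftMat ∈ Set.Ioo a b := by
        refine ⟨by have := div_pos ht.1 hω; linarith, ?_⟩
        have := (div_lt_iff₀ hω).2 (by rw [mul_comm]; exact ht.2 : t < (b - a) * freq Z.leftMat)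
        linarith
      have := hchi _ (Set.Ioo_subset_Icc_self hs)
      rw [show freq Z.leftMat * (a + t / freq Z.leftMat - a) = t by field_simp; ring] at this
      rw [← this]
      have := hpos _ hs
      exact mul_pos hω (by linarith)
    · rw [hv] at hend
      refine lt_of_eq_of_lt ?_ (neg_neg_of_pos hend)
      simp only [gL, hL, uL, θ]; ring
  have hsin := sin_ne_zero_of_realAngles hmem
  have hsp := (chi_eq_zero_iff hsin).1 hz
  have hsp' : Z.uL y = Z.hL * speed Z.gL θ := by linarith
  refine ⟨⟨hmem, hsp', ?_⟩, hf, hpos⟩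
  exact hv.trans (speed_neg_of_chi_eq_zero hsin hsp')

lemma IsGood.trajectory_of_rightHalf (h : Z.RightHalf θ y y₁) (hy : ![0, y] ∈ Z.crossingRegion)
    (hy₁ : ![0, y₁] ∈ Z.crossingRegion) :
    Z.IsCrossingTrajectory (fun t => flow Z.rightMat Z.rightVec t ![0, y])
      (Set.Icc 0 (θ / freq Z.rightMat)) ∧
    flow Z.rightMat Z.rightVec (θ / freq Z.rightMat) ![0, y] = ![0, y₁] ∧
    ∀ t ∈ Set.Ioo 0 (θ / freq Z.rightMat), 0 < flow Z.rightMat Z.rightVec t ![0, y] 0 := by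
  have hω := hZ.rotR.freq_pos
  have hend : flow Z.rightMat Z.rightVec (θ / freq Z.rightMat) ![0, y] = ![0, y₁] :=
    flow_eq_section hZ.rotR (sin_ne_zero_of_Ioo h.1) h.2.1 h.2.2
  have hpos : ∀ t ∈ Set.Ioo 0 (θ / freq Z.rightMat), 0 < flow Z.rightMat Z.rightVec t ![0, y] 0 := by
    intro t ht
    have h1 := flow_section_zero hZ.rotR Z.rightVec y t
    have h2 : 0 < chi Z.gR Z.hR (Z.uR y) (freq Z.rightMat * t) :=
      chi_pos_of_speed_Ioo hZ.reachR h.1 h.2.1 ⟨mul_pos hω ht.1, by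
        rw [mul_comm]; exact (lt_div_iff₀ hω).1 ht.2⟩
    replace h2 := lt_of_lt_of_eq h2 h1.symm
    exact (mul_pos_iff_of_pos_left hω).1 h2
  have hu : 0 < Z.uR y := by rw [h.2.1]; exact mul_pos hZ.reachR (speed_pos_Ioo _ h.1)
  refine ⟨isCrossingTrajectory_flow_right hZ.rotR (Or.inr ⟨by simp, ?_, ?_⟩) hpos
    (Or.inr (by rw [hend]; exact hy₁)), hend, hpos⟩
  · rwa [right_section]
  · exact left_pos_of_crossing hy (by rwa [right_section])

lemma IsGood.trajectory_of_leftHalf (h : Z.LeftHalf θ y y₁) (hy : ![0, y] ∈ Z.crossingRegion)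
    (hy₁ : ![0, y₁] ∈ Z.crossingRegion) :
    Z.IsCrossingTrajectory (fun t => flow Z.leftMat Z.leftVec t ![0, y])
      (Set.Icc 0 (θ / freq Z.leftMat)) ∧
    flow Z.leftMat Z.leftVec (θ / freq Z.leftMat) ![0, y] = ![0, y₁] ∧
    ∀ t ∈ Set.Ioo 0 (θ / freq Z.leftMat), flow Z.leftMat Z.leftVec t ![0, y] 0 < 0 := by
  have hω := hZ.rotL.freq_pos
  have hend : flow Z.leftMat Z.leftVec (θ / freq Z.leftMat) ![0, y] = ![0, y₁] :=
    flow_eq_section hZ.rotL (sin_ne_zero_of_realAngles h.1) h.2.1 h.2.2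
  have hneg : ∀ t ∈ Set.Ioo 0 (θ / freq Z.leftMat), flow Z.leftMat Z.leftVec t ![0, y] 0 < 0 := by
    intro t ht
    have h1 := flow_section_zero hZ.rotL Z.leftVec y t
    have h2 : 0 < chi Z.gL (-Z.hL) (-Z.uL y) (freq Z.leftMat * t) :=
      chi_pos_of_speed_realAngles (neg_neg_of_pos hZ.reachL) h.1 (by rw [h.2.1]; ring)
        ⟨mul_pos hω ht.1, by rw [mul_comm]; exact (lt_div_iff₀ hω).1 ht.2⟩
    have h3 : chi Z.gL (-Z.hL) (-Z.uL y) (freq Z.leftMat * t) =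
      -(freq Z.leftMat * flow Z.leftMat Z.leftVec t ![0, y] 0) := by
      rw [h1]; simp only [chi, gL, hL, uL]; ring
    rw [h3] at h2
    by_contra hn
    nlinarith [mul_nonneg hω.le (not_lt.1 hn)]
  have hu : Z.uL y < 0 := by
    rw [h.2.1]; exact mul_neg_of_pos_of_neg hZ.reachL (speed_neg_of_realAngles h.1)
  have hl : Z.left ![0, y] 0 < 0 := by rwa [left_section]
  have hr := right_neg_of_crossing hy hl
  have key := isCrossingTrajectory_flow_right (Z := Z.rot) hZ.rotL (p := -![0, y])
    (T := θ / freq Z.leftMat)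
    (Or.inr ⟨by simp, by rw [rot_right, neg_neg]; simpa using hl,
      by rw [rot_left, neg_neg]; simpa using hr⟩)
    (fun t ht => by rw [rot_rightFlow]; simpa using hneg t ht)
    (Or.inr (by rw [rot_rightFlow, hend, rot_crossing, neg_neg]; exact hy₁))
  refine ⟨?_, hend, hneg⟩
  have := key.rot
  simp only [rot_rightFlow, rot_rot, neg_neg] at this
  exact this

end Passages

/-! ### Gluing of trajectories -/

/-- Being a crossing trajectory is a local property, to be checked on both sides of each time. -/
lemma isCrossingTrajectory_of_local {Z : PWL} {γ : ℝ → Fin 2 → ℝ} {I : Set ℝ}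
    (hr : ∀ t ∈ I, ∃ b > t, Z.IsCrossingTrajectory γ (Set.Icc t b))
    (hl : ∀ t ∈ I, (∀ s ∈ I, t ≤ s) ∨ ∃ a < t, Z.IsCrossingTrajectory γ (Set.Icc a t)) :
    Z.IsCrossingTrajectory γ I := by
  refine ⟨fun t ht => ?_, fun t ht => ?_⟩
  · obtain ⟨b, hb, hγ⟩ := hr t ht
    have h1 : ContinuousWithinAt γ (Set.Ici t) t :=
      (hγ.1 t ⟨le_rfl, hb.le⟩).mono_of_mem_nhdsWithin (Icc_mem_nhdsGE hb)
    rcases hl t ht with hm | ⟨a, ha, hγ'⟩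
    · exact h1.mono hm
    · have h2 : ContinuousWithinAt γ (Set.Iic t) t :=
        (hγ'.1 t ⟨ha.le, le_rfl⟩).mono_of_mem_nhdsWithin (Icc_mem_nhdsLE ha)
      have := h2.union h1
      rw [Set.Iic_union_Ici] at this
      exact this.mono (Set.subset_univ _)
  · obtain ⟨b, hb, hγ⟩ := hr t ht
    have h0 := hγ.2 t ⟨le_rfl, hb.le⟩
    refine ⟨h0.1, ?_⟩
    have h1 : HasDerivWithinAt γ (Z.field (γ t)) (Set.Ici t) t :=
      h0.2.mono_of_mem_nhdsWithin (mem_of_superset (Icc_mem_nhdsGE hb) fun x hx => ⟨hx, hx.1⟩)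
    exact h1.mono Set.inter_subset_right

lemma IsCrossingTrajectory.congr {Z : PWL} {γ γ' : ℝ → Fin 2 → ℝ} {I : Set ℝ}
    (h : Z.IsCrossingTrajectory γ I) (he : ∀ t ∈ I, γ' t = γ t) : Z.IsCrossingTrajectory γ' I := by
  refine ⟨h.1.congr he, fun t ht => ?_⟩
  rw [he t ht]
  exact ⟨(h.2 t ht).1, (h.2 t ht).2.congr (fun s hs => he s hs.1) (he t ht)⟩

/-- A trajectory that closes up can be repeated periodically. -/
lemma exists_periodic_trajectory {Z : PWL} {γ : ℝ → Fin 2 → ℝ} {T : ℝ} (hT : 0 < T)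
    (h : Z.IsCrossingTrajectory γ (Set.Icc 0 T)) (h0 : γ 0 = γ T) :
    ∃ γ' : ℝ → Fin 2 → ℝ, Z.IsCrossingTrajectory γ' Set.univ ∧ (∀ t, γ' (t + T) = γ' t) ∧
      (∀ t ∈ Set.Icc 0 T, γ' t = γ t) := by
  let γ' : ℝ → Fin 2 → ℝ := fun t => γ (t - ⌊t / T⌋ * T)
  have key : ∀ (k : ℤ), ∀ t ∈ Set.Icc (k * T) ((k + 1) * T), γ' t = γ (t - k * T) := by
    intro k t ht
    rcases ht.2.eq_or_lt with he | hlt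
    · have h1 : ⌊t / T⌋ = k + 1 := by
        rw [he, mul_div_cancel_right₀ _ hT.ne']
        exact_mod_cast Int.floor_intCast (R := ℝ) (k + 1)
      simp only [γ', h1]
      rw [he]
      push_cast
      rw [sub_self, h0]
      congr 1
      ring
    · have h1 : ⌊t / T⌋ = k := by
        rw [Int.floor_eq_iff]
        exact ⟨(le_div_iff₀ hT).2 ht.1, (div_lt_iff₀ hT).2 hlt⟩
      simp only [γ', h1]
  have traj : ∀ k : ℤ, Z.IsCrossingTrajectory γ' (Set.Icc (k * T) ((k + 1) * T)) := by
    intro k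
    refine IsCrossingTrajectory.congr (γ := fun t => γ (t + -(k * T))) (h.comp_add (-(k * T)) ?_) ?_
    · intro t ht; exact ⟨by linarith [ht.1], by linarith [ht.2]⟩
    · intro t ht; rw [key k t ht, sub_eq_add_neg]
  refine ⟨γ', isCrossingTrajectory_of_local (fun t _ => ?_) (fun t _ => Or.inr ?_), fun t => ?_,
    fun t ht => ?_⟩
  · have h1 := (le_div_iff₀ hT).1 (Int.floor_le (t / T))
    have h2 := (div_lt_iff₀ hT).1 (Int.lt_floor_add_one (t / T))
    exact ⟨_, h2, (traj ⌊t / T⌋).mono (Set.Icc_subset_Icc_left h1)⟩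
  · -- the left neighbourhood of `t` lies in the period that ends at or after `t`
    have h2 := (div_le_iff₀ hT).1 (Int.le_ceil (t / T))
    have h3 : (⌈t / T⌉ - 1 : ℝ) * T < t :=
      (lt_div_iff₀ hT).1 (by linarith [Int.ceil_lt_add_one (t / T)])
    have := traj (⌈t / T⌉ - 1)
    push_cast at this
    rw [sub_add_cancel] at this
    exact ⟨_, h3, this.mono (Set.Icc_subset_Icc_right h2)⟩
  · simp only [γ']
    rw [add_div, div_self hT.ne', Int.floor_add_one]
    congr 1; push_cast; ring
  · simpa using key 0 t (by simpa using ht)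

/-- Infinite concatenation of trajectories. -/
lemma exists_chain {Z : PWL} (γ : ℕ → ℝ → Fin 2 → ℝ) (T : ℕ → ℝ) (hT : ∀ n, 0 ≤ T n)
    (hsum : Tendsto (fun n => ∑ i ∈ Finset.range n, T i) atTop atTop)
    (h : ∀ n, Z.IsCrossingTrajectory (γ n) (Set.Icc 0 (T n))) (h0 : ∀ n, γ n (T n) = γ (n + 1) 0) :
    ∃ γ' : ℝ → Fin 2 → ℝ, Z.IsCrossingTrajectory γ' (Set.Ici 0) ∧
      (∀ t, 0 ≤ t → ∃ n, ∃ s ∈ Set.Icc 0 (T n), γ' t = γ n s ∧ ∑ i ∈ Finset.range n, T i ≤ t ∧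
        t < ∑ i ∈ Finset.range (n + 1), T i) ∧ γ' 0 = γ 0 0 := by
  classical
  set S : ℕ → ℝ := fun n => ∑ i ∈ Finset.range n, T i with hS
  have hS0 : S 0 = 0 := by simp [hS]
  have hSs : ∀ n, S (n + 1) = S n + T n := fun n => Finset.sum_range_succ _ _
  have hSm : Monotone S := monotone_nat_of_le_succ fun n => by rw [hSs]; linarith [hT n]
  have hex : ∀ t, ∃ n, t < S (n + 1) := fun t =>
    ((hsum.comp (tendsto_add_atTop_nat 1)).eventually (eventually_gt_atTop t)).exists
  let N : ℝ → ℕ := fun t => Nat.find (hex t)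
  have hN : ∀ t, t < S (N t + 1) := fun t => Nat.find_spec (hex t)
  have hN' : ∀ t, 0 ≤ t → S (N t) ≤ t := by
    intro t ht
    rcases Nat.eq_zero_or_pos (N t) with h1 | h1
    · rw [h1, hS0]; exact ht
    · have := Nat.find_min (hex t) (Nat.sub_lt h1 one_pos)
      rw [show Nat.find (hex t) - 1 + 1 = N t from Nat.succ_pred_eq_of_pos h1] at this
      exact not_lt.1 this
  have hNu : ∀ t n, S n ≤ t → t < S (n + 1) → N t = n := by
    intro t n h1 h2
    refine le_antisymm (Nat.find_min' _ h2) ?_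
    by_contra hlt
    have := hSm (Nat.succ_le_of_lt (not_le.1 hlt))
    linarith [hN t, this]
  let γ' : ℝ → Fin 2 → ℝ := fun t => γ (N t) (t - S (N t))
  -- pieces of length zero do not change the starting point of the next one
  have hstart : ∀ n m, n ≤ m → S m = S n → γ m 0 = γ n 0 := by
    intro n m hnm
    induction m, hnm using Nat.le_induction with
    | base => intro _; rfl
    | succ m hm ih =>
      intro he
      have h1 : S m = S n := le_antisymm (he ▸ hSm (Nat.le_succ m)) (hSm hm)
      have h2 : T m = 0 := by have := hSs m; linarith
      rw [← h0 m, h2]; exact ih h1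
  have key : ∀ n, ∀ t ∈ Set.Icc (S n) (S (n + 1)), γ' t = γ n (t - S n) := by
    intro n t ht
    rcases ht.2.eq_or_lt with he | hlt
    · have ht0 : 0 ≤ t := hS0 ▸ (hSm (Nat.zero_le n)).trans ht.1
      have hle : n + 1 ≤ N t := by
        by_contra hlt
        have h1 := hSm (show N t + 1 ≤ n + 1 by omega)
        linarith [hN t]
      have h2 : S (N t) = S (n + 1) := le_antisymm (he ▸ hN' t ht0) (hSm hle)
      have h3 := hstart _ _ hle h2
      simp only [γ']
      rw [h2, he, sub_self, ← he, h3, ← h0 n, he]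
      congr 1; rw [hSs]; ring
    · simp only [γ', hNu t n ht.1 hlt]
  have traj : ∀ n, Z.IsCrossingTrajectory γ' (Set.Icc (S n) (S (n + 1))) := by
    intro n
    refine IsCrossingTrajectory.congr (γ := fun t => γ n (t + -S n)) ((h n).comp_add (-S n) ?_) ?_
    · intro t ht
      rw [hSs] at ht
      exact ⟨by linarith [ht.1], by linarith [ht.2]⟩
    · intro t ht; rw [key n t ht, sub_eq_add_neg]
  refine ⟨γ', isCrossingTrajectory_of_local (fun t ht => ?_) (fun t ht => ?_), fun t ht => ?_, ?_⟩
  · exact ⟨_, hN t, (traj (N t)).mono (Set.Icc_subset_Icc_left (hN' t ht))⟩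
  · rcases (show (0 : ℝ) ≤ t from ht).eq_or_lt with rfl | h1
    · exact Or.inl fun s hs => hs
    · right
      -- the first index whose right end reaches `t`
      have hex' : ∃ n, t ≤ S (n + 1) := (hex t).imp fun _ => le_of_lt
      have h2 := Nat.find_spec hex'
      have h3 : S (Nat.find hex') < t := by
        rcases Nat.eq_zero_or_pos (Nat.find hex') with h4 | h4
        · rw [h4, hS0]; exact h1
        · have := Nat.find_min hex' (Nat.sub_lt h4 one_pos)
          rw [show Nat.find hex' - 1 + 1 = Nat.find hex' from Nat.succ_pred_eq_of_pos h4] at this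
          exact not_le.1 this
      exact ⟨_, h3, (traj _).mono (Set.Icc_subset_Icc_right h2)⟩
  · refine ⟨N t, t - S (N t), ⟨by linarith [hN' t ht], ?_⟩, rfl, hN' t ht, hN t⟩
    have := hN t; rw [hSs] at this; linarith
  · have h1 := hN' 0 le_rfl
    have h2 : S (N 0) = 0 := le_antisymm h1 (hS0 ▸ hSm (Nat.zero_le _))
    simp only [γ']
    rw [h2, sub_zero]
    exact hstart 0 _ (Nat.zero_le _) (h2.trans hS0.symm)

/-- The next hit of `Σ`. -/
lemma IsCrossingTrajectory.exists_next_hit {Z : PWL} {γ : ℝ → Fin 2 → ℝ} {a c : ℝ}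
    (h : Z.IsCrossingTrajectory γ Set.univ) (ha : γ a 0 = 0) (hac : a < c) (hc : γ c 0 = 0) :
    ∃ b > a, γ b 0 = 0 ∧ ∀ t ∈ Set.Ioo a b, γ t 0 ≠ 0 := by
  have hcont : Continuous fun t => γ t 0 :=
    (continuous_apply 0).comp (continuousOn_univ.1 h.1)
  have hne : ∀ᶠ t in 𝓝[>] a, γ t 0 ≠ 0 := by
    have h1 := (h.2 a trivial).2
    have hcr := (h.2 a trivial).1 ha
    have h2 := hasDerivWithinAt_pi.1 h1 0
    have h3 : Z.field (γ a) 0 ≠ 0 := by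
      rcases (right_ne_of_crossing hcr).lt_or_gt with h4 | h4
      · rw [field_left (Or.inr ⟨ha, h4.le⟩)]; exact (left_neg_of_crossing hcr h4).ne
      · rw [field_right (Or.inr ⟨ha, h4⟩)]; exact h4.ne'
    have := h2.eventually_ne (c := 0) h3
    rw [Set.univ_inter, Set.Ici_sdiff_left] at this
    exact this
  obtain ⟨δ, hδ, hδ'⟩ := (mem_nhdsGT_iff_exists_Ioo_subset' hac).1 hne
  have hcδ : δ ≤ c := by
    by_contra hlt
    exact hδ' ⟨hac, not_le.1 hlt⟩ hc
  have hcomp : IsCompact ({t | γ t 0 = 0} ∩ Set.Icc δ c) :=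
    isCompact_Icc.inter_left (isClosed_eq hcont continuous_const)
  obtain ⟨b, hb, hmin⟩ := hcomp.exists_isLeast ⟨c, hc, hcδ, le_rfl⟩
  refine ⟨b, lt_of_lt_of_le hδ hb.2.1, hb.1, fun t ht h0 => ?_⟩
  rcases lt_or_ge t δ with h1 | h1
  · exact hδ' ⟨ht.1, h1⟩ h0
  · exact absurd (hmin ⟨h0, h1, ht.2.le.trans hb.2.2⟩) (not_le.2 ht.2)

/-! ### The return map -/

/-- The inverse of the normalized speed for passages through the zone of the real focus. -/
noncomputable def realAngle (g s : ℝ) : ℝ := Function.invFunOn (speed g) (realAngles g) s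

/-- The inverse of the normalized speed for passages through the zone of the virtual focus. -/
noncomputable def virtualAngle (g s : ℝ) : ℝ := Function.invFunOn (speed g) (Set.Ioo 0 Real.pi) s

lemma realAngle_speed {g θ : ℝ} (h : θ ∈ realAngles g) : realAngle g (speed g θ) = θ :=
  (speed_strictMonoOn_realAngles g).injOn (Function.invFunOn_mem ⟨θ, h, rfl⟩) h
    (Function.invFunOn_eq ⟨θ, h, rfl⟩)

lemma virtualAngle_speed {g θ : ℝ} (h : θ ∈ Set.Ioo 0 Real.pi) : virtualAngle g (speed g θ) = θ :=
  (speed_strictMonoOn_Ioo g).injOn (Function.invFunOn_mem ⟨θ, h, rfl⟩) h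
    (Function.invFunOn_eq ⟨θ, h, rfl⟩)

lemma exists_speed_eq {g s : ℝ} (hs : 0 < s) : ∃ θ ∈ Set.Ioo 0 Real.pi, speed g θ = s := by
  have h1 : (𝓝[>] (0:ℝ)) ≤ 𝓟 (Set.Ioo 0 Real.pi) := le_principal_iff.2 (Ioo_mem_nhdsGT Real.pi_pos)
  have h2 : (𝓝[<] Real.pi) ≤ 𝓟 (Set.Ioo 0 Real.pi) := le_principal_iff.2 (Ioo_mem_nhdsLT Real.pi_pos)
  have := isPreconnected_Ioo.intermediate_value_Ioi h1 h2 (f := speed g)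
    (fun x hx => (hasDerivAt_speed g (sin_ne_zero_of_Ioo hx)).continuousAt.continuousWithinAt)
    (tendsto_speed_zero g) (tendsto_speed_pi_left g)
  exact this hs

lemma exists_speed_eq_real {g s θ : ℝ} (h : θ ∈ realAngles g) (hs : s ≤ speed g θ) :
    ∃ θ' ∈ realAngles g, speed g θ' = s := by
  have h1 : (𝓝[>] Real.pi) ≤ 𝓟 (realAngles g) := le_principal_iff.2 (realAngles_mem_nhdsGT g)
  have := (ordConnected_realAngles g).isPreconnected.intermediate_value_Iic h h1 (f := speed g)
    (fun x hx => (hasDerivAt_speed g (sin_ne_zero_of_realAngles hx)).continuousAt.continuousWithinAt)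
    (tendsto_speed_pi_right g)
  exact this hs

lemma analyticAt_realAngle {g θ : ℝ} (h : θ ∈ realAngles g) :
    AnalyticAt ℝ (fun p : ℝ × ℝ => realAngle p.1 p.2) (g, speed g θ) := by
  refine analyticAt_fiber_inverse isOpen_realAngles_prod (c := speed)
    (fun g θ θ' h h' => (speed_strictMonoOn_realAngles g).injOn h h')
    (fun g θ h => by rw [realAngle_speed h]; exact ⟨h, rfl⟩) h
    (analyticAt_speed (sin_ne_zero_of_realAngles h))
    (hasDerivAt_speed g (sin_ne_zero_of_realAngles h)) ?_
  exact div_ne_zero h.2.2.ne' (pow_ne_zero _ (sin_ne_zero_of_realAngles h))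

lemma analyticAt_virtualAngle {g θ : ℝ} (h : θ ∈ Set.Ioo 0 Real.pi) :
    AnalyticAt ℝ (fun p : ℝ × ℝ => virtualAngle p.1 p.2) (g, speed g θ) := by
  refine analyticAt_fiber_inverse (W := {p | p.2 ∈ Set.Ioo 0 Real.pi})
    (isOpen_Ioo.preimage continuous_snd) (c := speed)
    (fun g θ θ' h h' => (speed_strictMonoOn_Ioo g).injOn h h')
    (fun g θ h => by rw [virtualAngle_speed h]; exact ⟨h, rfl⟩) h
    (analyticAt_speed (sin_ne_zero_of_Ioo h)) (hasDerivAt_speed g (sin_ne_zero_of_Ioo h)) ?_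
  exact div_ne_zero (andronov_pos h.1 h.2.le).ne' (pow_ne_zero _ (sin_ne_zero_of_Ioo h))

/-- The angle of the left passage from `(0, y)`. -/
noncomputable def angleL (Z : PWL) (y : ℝ) : ℝ := realAngle Z.gL (Z.uL y / Z.hL)

/-- The ordinate of the end point of the left passage from `(0, y)`. -/
noncomputable def lower (Z : PWL) (y : ℝ) : ℝ :=
  (-(Z.hL * speed (-Z.gL) (Z.angleL y)) - Z.leftVec 0) / Z.leftMat 0 1

/-- The angle of the right passage from `(0, y)`. -/
noncomputable def angleR (Z : PWL) (y : ℝ) : ℝ := virtualAngle Z.gR (Z.uR y / Z.hR)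

/-- The ordinate of the end point of the right passage from `(0, y)`. -/
noncomputable def upper (Z : PWL) (y : ℝ) : ℝ :=
  (-(Z.hR * speed (-Z.gR) (Z.angleR y)) - Z.rightVec 0) / Z.rightMat 0 1

/-- The first return map on the part of `Σ` where both fields point to the left. -/
noncomputable def ret (Z : PWL) (y : ℝ) : ℝ := Z.upper (Z.lower y)

/-- The ordinates from which the orbit traverses both zones. -/
def domain (Z : PWL) : Set ℝ :=
  {y | (∃ θ ∈ realAngles Z.gL, Z.uL y = Z.hL * speed Z.gL θ) ∧ 0 < Z.uR (Z.lower y) ∧ Z.uR y < 0}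

section ReturnMap

variable {Z : PWL} (hZ : Z.IsGood) {y y₁ y₂ y' θ : ℝ}
include hZ

lemma IsGood.uL_strictAnti : StrictAnti Z.uL := fun _ _ h => by
  have := hZ.rotL.1
  simp only [uL]; nlinarith

lemma IsGood.uR_strictAnti : StrictAnti Z.uR := fun _ _ h => by
  have := hZ.rotR.1
  simp only [uR]; nlinarith

lemma IsGood.uL_lower (y : ℝ) : Z.uL (Z.lower y) = -(Z.hL * speed (-Z.gL) (Z.angleL y)) := by
  have := hZ.rotL.1.ne
  rw [uL, lower]; field_simp; ring

lemma IsGood.uR_upper (y : ℝ) : Z.uR (Z.upper y) = -(Z.hR * speed (-Z.gR) (Z.angleR y)) := by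
  have := hZ.rotR.1.ne
  rw [uR, upper]; field_simp; ring

lemma IsGood.hL_pos : 0 < Z.hL := hZ.reachL

lemma IsGood.hR_pos : 0 < Z.hR := hZ.reachR

lemma IsGood.angleL_eq (h : θ ∈ realAngles Z.gL) (h' : Z.uL y = Z.hL * speed Z.gL θ) :
    Z.angleL y = θ := by
  have := hZ.hL_pos.ne'
  rw [angleL, h', mul_div_cancel_left₀ _ this, realAngle_speed h]

lemma IsGood.angleR_eq (h : θ ∈ Set.Ioo 0 Real.pi) (h' : Z.uR y = Z.hR * speed Z.gR θ) :
    Z.angleR y = θ := by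
  have := hZ.hR_pos.ne'
  rw [angleR, h', mul_div_cancel_left₀ _ this, virtualAngle_speed h]

lemma IsGood.leftHalf (h : y ∈ Z.domain) : Z.LeftHalf (Z.angleL y) y (Z.lower y) := by
  obtain ⟨θ, hθ, h'⟩ := h.1
  have := hZ.angleL_eq hθ h'
  exact ⟨this ▸ hθ, this ▸ h', hZ.uL_lower y⟩

lemma IsGood.rightHalf (h : 0 < Z.uR y) : Z.RightHalf (Z.angleR y) y (Z.upper y) := by
  obtain ⟨θ, hθ, h'⟩ := exists_speed_eq (g := Z.gR) (div_pos h hZ.hR_pos)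
  have h'' : Z.uR y = Z.hR * speed Z.gR θ := by rw [h']; field_simp [hZ.hR_pos.ne']
  have := hZ.angleR_eq hθ h''
  exact ⟨this ▸ hθ, this ▸ h'', hZ.uR_upper y⟩

lemma IsGood.lower_eq (h : Z.LeftHalf θ y y₁) : Z.angleL y = θ ∧ Z.lower y = y₁ := by
  have h1 := hZ.angleL_eq h.1 h.2.1
  refine ⟨h1, hZ.uL_strictAnti.injective ?_⟩
  rw [hZ.uL_lower, h1, h.2.2]

lemma IsGood.upper_eq (h : Z.RightHalf θ y y₁) : Z.angleR y = θ ∧ Z.upper y = y₁ := by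
  have h1 := hZ.angleR_eq h.1 h.2.1
  refine ⟨h1, hZ.uR_strictAnti.injective ?_⟩
  rw [hZ.uR_upper, h1, h.2.2]

lemma IsGood.uL_neg (h : y ∈ Z.domain) : Z.uL y < 0 := by
  obtain ⟨θ, hθ, h'⟩ := h.1
  rw [h']; exact mul_neg_of_pos_of_neg hZ.hL_pos (speed_neg_of_realAngles hθ)

lemma IsGood.uL_lower_pos (h : y ∈ Z.domain) : 0 < Z.uL (Z.lower y) := by
  rw [hZ.uL_lower, neg_pos]
  exact mul_neg_of_pos_of_neg hZ.hL_pos (speed_neg_neg_of_realAngles (hZ.leftHalf h).1)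

lemma IsGood.crossing (h : y ∈ Z.domain) : ![0, y] ∈ Z.crossingRegion :=
  mem_crossingRegion_section.2 (mul_pos_of_neg_of_neg h.2.2 (hZ.uL_neg h))

lemma IsGood.crossing_lower (h : y ∈ Z.domain) : ![0, Z.lower y] ∈ Z.crossingRegion :=
  mem_crossingRegion_section.2 (mul_pos h.2.1 (hZ.uL_lower_pos h))

lemma IsGood.uR_ret_neg (h : y ∈ Z.domain) : Z.uR (Z.ret y) < 0 := by
  rw [ret, hZ.uR_upper, neg_neg_iff_pos]
  exact mul_pos hZ.hR_pos (speed_pos_Ioo _ (hZ.rightHalf h.2.1).1)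

lemma IsGood.lower_lt (h : y ∈ Z.domain) : Z.lower y < y := by
  by_contra hn
  have := hZ.uL_strictAnti.antitone (not_lt.1 hn)
  linarith [hZ.uL_neg h, hZ.uL_lower_pos h]

/-- The end points of left passages are ordered opposite to the starting points; both normalized
speeds are monotone functions of the angle. -/
lemma IsGood.lower_strictAnti' {θ θ' : ℝ} (hθ : θ ∈ realAngles Z.gL) (hθ' : θ' ∈ realAngles Z.gL)
    (h : Z.uL y = Z.hL * speed Z.gL θ) (h' : Z.uL y' = Z.hL * speed Z.gL θ') (hlt : y < y') :
    Z.lower y' < Z.lower y := by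
  have h1 := hZ.uL_strictAnti hlt
  rw [h, h'] at h1
  have h2 : θ' < θ := (speed_strictMonoOn_realAngles Z.gL).lt_iff_lt hθ' hθ |>.1
    (lt_of_mul_lt_mul_left h1 hZ.hL_pos.le)
  refine hZ.uL_strictAnti.lt_iff_gt.1 ?_
  rw [hZ.uL_lower, hZ.uL_lower, hZ.angleL_eq hθ h, hZ.angleL_eq hθ' h']
  have h3 := speed_strictMonoOn_realAngles (-Z.gL) (by rwa [realAngles_neg]) (by rwa [realAngles_neg]) h2
  have := mul_lt_mul_of_pos_left h3 hZ.hL_pos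
  linarith

lemma IsGood.domain_of_le (h : y ∈ Z.domain) (hle : y ≤ y') : y' ∈ Z.domain := by
  rcases hle.eq_or_lt with rfl | hlt
  · exact h
  obtain ⟨θ, hθ, h1⟩ := h.1
  obtain ⟨θ', hθ', h2⟩ := exists_speed_eq_real (s := Z.uL y' / Z.hL) hθ (by
    rw [div_le_iff₀ hZ.hL_pos, mul_comm, ← h1]; exact (hZ.uL_strictAnti hlt).le)
  have h3 : Z.uL y' = Z.hL * speed Z.gL θ' := by rw [h2]; field_simp [hZ.hL_pos.ne']
  exact ⟨⟨θ', hθ', h3⟩, h.2.1.trans (hZ.uR_strictAnti (hZ.lower_strictAnti' hθ hθ' h1 h3 hlt)),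
    (hZ.uR_strictAnti hlt).trans h.2.2⟩

lemma IsGood.lower_strictAntiOn : StrictAntiOn Z.lower Z.domain := fun _ hx _ hy h =>
  hZ.lower_strictAnti' (hZ.leftHalf hx).1 (hZ.leftHalf hy).1 (hZ.leftHalf hx).2.1 (hZ.leftHalf hy).2.1 h

lemma IsGood.ret_strictMonoOn : StrictMonoOn Z.ret Z.domain := by
  intro x hx y hy h
  have h1 := hZ.rightHalf hx.2.1
  have h2 := hZ.rightHalf hy.2.1
  have h3 := hZ.uR_strictAnti (hZ.lower_strictAntiOn hx hy h)
  rw [h1.2.1, h2.2.1] at h3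
  have h4 := ((speed_strictMonoOn_Ioo Z.gR).lt_iff_lt h1.1 h2.1).1
    (lt_of_mul_lt_mul_left h3 hZ.hR_pos.le)
  refine hZ.uR_strictAnti.lt_iff_gt.1 ?_
  rw [ret, ret, h1.2.2, h2.2.2]
  have := mul_lt_mul_of_pos_left (speed_strictMonoOn_Ioo (-Z.gR) h1.1 h2.1 h4) hZ.hR_pos
  linarith

lemma IsGood.analyticAt_angleL (h : y ∈ Z.domain) : AnalyticAt ℝ Z.angleL y := by
  have h1 := hZ.leftHalf h
  have h2 : Z.uL y / Z.hL = speed Z.gL (Z.angleL y) := by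
    rw [h1.2.1]; field_simp [hZ.hL_pos.ne']
  have h3 : AnalyticAt ℝ (fun z => (Z.gL, Z.uL z / Z.hL)) y := by unfold uL; fun_prop
  exact AnalyticAt.fun_comp (f := fun z => (Z.gL, Z.uL z / Z.hL)) (g := fun p : ℝ × ℝ => realAngle p.1 p.2)
    (by rw [h2]; exact analyticAt_realAngle h1.1) h3

lemma IsGood.analyticAt_lower (h : y ∈ Z.domain) : AnalyticAt ℝ Z.lower y := by
  have h1 := hZ.leftHalf h
  have h5 : AnalyticAt ℝ (fun z => speed (-Z.gL) (Z.angleL z)) y :=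
    AnalyticAt.fun_comp (f := fun z => (-Z.gL, Z.angleL z)) (g := fun p : ℝ × ℝ => speed p.1 p.2)
      (analyticAt_speed (sin_ne_zero_of_realAngles h1.1)) (AnalyticAt.prod analyticAt_const (hZ.analyticAt_angleL h))
  unfold lower
  exact ((analyticAt_const.mul h5).neg.sub analyticAt_const).div_const

lemma IsGood.analyticAt_angleR (h : 0 < Z.uR y) : AnalyticAt ℝ Z.angleR y := by
  have h1 := hZ.rightHalf h
  have h2 : Z.uR y / Z.hR = speed Z.gR (Z.angleR y) := by
    rw [h1.2.1]; field_simp [hZ.hR_pos.ne']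
  have h3 : AnalyticAt ℝ (fun z => (Z.gR, Z.uR z / Z.hR)) y := by unfold uR; fun_prop
  exact AnalyticAt.fun_comp (f := fun z => (Z.gR, Z.uR z / Z.hR))
    (g := fun p : ℝ × ℝ => virtualAngle p.1 p.2) (by rw [h2]; exact analyticAt_virtualAngle h1.1) h3

lemma IsGood.analyticAt_upper (h : 0 < Z.uR y) : AnalyticAt ℝ Z.upper y := by
  have h1 := hZ.rightHalf h
  have h5 : AnalyticAt ℝ (fun z => speed (-Z.gR) (Z.angleR z)) y :=
    AnalyticAt.fun_comp (f := fun z => (-Z.gR, Z.angleR z)) (g := fun p : ℝ × ℝ => speed p.1 p.2)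
      (analyticAt_speed (sin_ne_zero_of_Ioo h1.1)) (AnalyticAt.prod analyticAt_const (hZ.analyticAt_angleR h))
  unfold upper
  exact ((analyticAt_const.mul h5).neg.sub analyticAt_const).div_const

lemma IsGood.analyticAt_ret (h : y ∈ Z.domain) : AnalyticAt ℝ Z.ret y :=
  AnalyticAt.fun_comp (f := Z.lower) (g := Z.upper) (hZ.analyticAt_upper h.2.1) (hZ.analyticAt_lower h)

lemma IsGood.domain_mem_nhds (h : y ∈ Z.domain) : Z.domain ∈ 𝓝 y := by
  have h1 : ∀ᶠ z in 𝓝 y, ∃ θ ∈ realAngles Z.gL, Z.uL z = Z.hL * speed Z.gL θ := by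
    have h1 := hZ.leftHalf h
    obtain ⟨θ, hθ, hlt⟩ : ∃ θ ∈ realAngles Z.gL, Z.angleL y < θ := by
      have h2 : ∀ᶠ θ in 𝓝[>] Z.angleL y, θ ∈ realAngles Z.gL :=
        mem_nhdsWithin_of_mem_nhds ((isOpen_realAngles Z.gL).mem_nhds h1.1)
      exact (h2.and self_mem_nhdsWithin).exists
    have h2 : Z.uL y < Z.hL * speed Z.gL θ := by
      rw [h1.2.1]; exact mul_lt_mul_of_pos_left (speed_strictMonoOn_realAngles _ h1.1 hθ hlt) hZ.hL_pos
    have h3 : Continuous Z.uL := by unfold uL; fun_prop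
    filter_upwards [h3.continuousAt.eventually (gt_mem_nhds h2)] with z hz
    obtain ⟨θ', hθ', h4⟩ := exists_speed_eq_real (s := Z.uL z / Z.hL) hθ (by
      rw [div_le_iff₀ hZ.hL_pos, mul_comm]; exact hz.le)
    exact ⟨θ', hθ', by rw [h4]; field_simp [hZ.hL_pos.ne']⟩
  have hc : Continuous Z.uR := by unfold uR; fun_prop
  have h2 : ∀ᶠ z in 𝓝 y, 0 < Z.uR (Z.lower z) :=
    (hc.continuousAt.comp (hZ.analyticAt_lower h).continuousAt).eventually (lt_mem_nhds h.2.1)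
  have h3 : ∀ᶠ z in 𝓝 y, Z.uR z < 0 := hc.continuousAt.eventually (gt_mem_nhds h.2.2)
  filter_upwards [h1, h2, h3] with z a b c using ⟨a, b, c⟩

end ReturnMap

/-! ### Crossing periodic orbits and fixed points of the return map -/

/-- The duration of the left passage from `(0, y)`. -/
noncomputable def timeL (Z : PWL) (y : ℝ) : ℝ := Z.angleL y / freq Z.leftMat
/-- The duration of the right passage from `(0, y)`. -/
noncomputable def timeR (Z : PWL) (y : ℝ) : ℝ := Z.angleR y / freq Z.rightMat

/-- The arc of orbit from `(0, y)` to its first return. -/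
noncomputable def orbit (Z : PWL) (y : ℝ) : Set (Fin 2 → ℝ) :=
  (fun t => flow Z.leftMat Z.leftVec t ![0, y]) '' Set.Icc 0 (Z.timeL y) ∪
    (fun t => flow Z.rightMat Z.rightVec t ![0, Z.lower y]) '' Set.Icc 0 (Z.timeR (Z.lower y))

lemma HasAmplitude.unique {Γ : Set (Fin 2 → ℝ)} {y y' : ℝ} (h : HasAmplitude Γ y)
    (h' : HasAmplitude Γ y') : y = y' := IsGreatest.unique h h'

section Loops

variable {Z : PWL} (hZ : Z.IsGood) {y y' : ℝ}
include hZ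

lemma IsGood.timeL_pos (h : y ∈ Z.domain) : 0 < Z.timeL y :=
  div_pos (Real.pi_pos.trans (hZ.leftHalf h).1.1.1) hZ.rotL.freq_pos

/-- Left passages take at least half a turn. Hence the times of consecutive turns do not accumulate. -/
lemma IsGood.le_timeL (h : y ∈ Z.domain) : Real.pi / freq Z.leftMat ≤ Z.timeL y :=
  div_le_div_of_nonneg_right (hZ.leftHalf h).1.1.1.le hZ.rotL.freq_pos.le

lemma IsGood.timeR_pos (h : 0 < Z.uR y) : 0 < Z.timeR y :=
  div_pos (hZ.rightHalf h).1.1 hZ.rotR.freq_pos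

lemma IsGood.trajectoryL (h : y ∈ Z.domain) :
    Z.IsCrossingTrajectory (fun t => flow Z.leftMat Z.leftVec t ![0, y]) (Set.Icc 0 (Z.timeL y)) ∧
    flow Z.leftMat Z.leftVec (Z.timeL y) ![0, y] = ![0, Z.lower y] ∧
    ∀ t ∈ Set.Ioo 0 (Z.timeL y), flow Z.leftMat Z.leftVec t ![0, y] 0 < 0 :=
  hZ.trajectory_of_leftHalf (hZ.leftHalf h) (hZ.crossing h) (hZ.crossing_lower h)

lemma IsGood.crossing_ret (h : y ∈ Z.domain) (h' : Z.uL (Z.ret y) < 0) :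
    ![0, Z.ret y] ∈ Z.crossingRegion :=
  mem_crossingRegion_section.2 (mul_pos_of_neg_of_neg (hZ.uR_ret_neg h) h')

lemma IsGood.trajectoryR (h : y ∈ Z.domain) (h' : Z.uL (Z.ret y) < 0) :
    Z.IsCrossingTrajectory (fun t => flow Z.rightMat Z.rightVec t ![0, Z.lower y])
      (Set.Icc 0 (Z.timeR (Z.lower y))) ∧
    flow Z.rightMat Z.rightVec (Z.timeR (Z.lower y)) ![0, Z.lower y] = ![0, Z.ret y] ∧
    ∀ t ∈ Set.Ioo 0 (Z.timeR (Z.lower y)), 0 < flow Z.rightMat Z.rightVec t ![0, Z.lower y] 0 :=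
  hZ.trajectory_of_rightHalf (hZ.rightHalf h.2.1) (hZ.crossing_lower h) (hZ.crossing_ret h h')

/-- One turn around the two zones. -/
lemma IsGood.exists_loop (h : y ∈ Z.domain) (h' : Z.uL (Z.ret y) < 0) :
    ∃ (γ : ℝ → Fin 2 → ℝ) (s T : ℝ), 0 < s ∧ s < T ∧ Real.pi / freq Z.leftMat ≤ T ∧
      Z.IsCrossingTrajectory γ (Set.Icc 0 T) ∧ γ 0 = ![0, y] ∧ γ s = ![0, Z.lower y] ∧
      γ T = ![0, Z.ret y] ∧ (∀ t ∈ Set.Ioo 0 s, γ t 0 < 0) ∧ (∀ t ∈ Set.Ioo s T, 0 < γ t 0) ∧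
      γ '' Set.Icc 0 T = Z.orbit y := by
  obtain ⟨a1, a2, a3⟩ := hZ.trajectoryL h
  obtain ⟨b1, b2, b3⟩ := hZ.trajectoryR h h'
  have hs := hZ.timeL_pos h
  have hr := hZ.timeR_pos h.2.1
  set s := Z.timeL y
  set r := Z.timeR (Z.lower y)
  let γ : ℝ → Fin 2 → ℝ := fun t => if t < s then flow Z.leftMat Z.leftVec t ![0, y] else
    flow Z.rightMat Z.rightVec (t - s) ![0, Z.lower y]
  have e1 : ∀ t ∈ Set.Icc 0 s, γ t = flow Z.leftMat Z.leftVec t ![0, y] := by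
    intro t ht
    rcases ht.2.eq_or_lt with rfl | hlt
    · simp only [γ, lt_irrefl, if_false, sub_self, flow_zero hZ.rotR, a2]
    · exact if_pos hlt
  have e2 : ∀ t, s ≤ t → γ t = flow Z.rightMat Z.rightVec (t - s) ![0, Z.lower y] :=
    fun t ht => if_neg (not_lt.2 ht)
  refine ⟨γ, s, s + r, hs, by linarith, (hZ.le_timeL h).trans (by linarith), ?_, ?_, ?_, ?_, ?_, ?_, ?_⟩
  · exact a1.append hs.le hr.le b1 (by rw [a2, flow_zero hZ.rotR])
  · rw [e1 0 ⟨le_rfl, hs.le⟩, flow_zero hZ.rotL]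
  · rw [e1 s ⟨hs.le, le_rfl⟩, a2]
  · rw [e2 _ (by linarith), add_sub_cancel_left, b2]
  · intro t ht; rw [e1 t ⟨ht.1.le, ht.2.le⟩]; exact a3 t ht
  · intro t ht; rw [e2 t ht.1.le]; exact b3 _ ⟨by linarith [ht.1], by linarith [ht.2]⟩
  · ext p
    constructor
    · rintro ⟨t, ht, rfl⟩
      rcases le_total t s with h1 | h1
      · exact Or.inl ⟨t, ⟨ht.1, h1⟩, (e1 t ⟨ht.1, h1⟩).symm⟩
      · exact Or.inr ⟨t - s, ⟨by linarith, by linarith [ht.2]⟩, (e2 t h1).symm⟩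
    · rintro (⟨t, ht, rfl⟩ | ⟨t, ht, rfl⟩)
      · exact ⟨t, ⟨ht.1, ht.2.trans (by linarith)⟩, e1 t ht⟩
      · refine ⟨t + s, ⟨by linarith [ht.1], by linarith [ht.2]⟩, ?_⟩
        rw [e2 _ (by linarith [ht.1]), add_sub_cancel_right]

/-- The arc of a loop meets `Σ` only in its three distinguished points. -/
lemma IsGood.eq_of_mem_orbit (h : y ∈ Z.domain) (h' : Z.uL (Z.ret y) < 0) {s : ℝ}
    (hs : ![0, s] ∈ Z.orbit y) : s = y ∨ s = Z.lower y ∨ s = Z.ret y := by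
  obtain ⟨γ, a, T, h1, h2, -, -, h3, h4, h5, h6, h7, h8⟩ := hZ.exists_loop h h'
  rw [← h8] at hs
  obtain ⟨t, ht, he⟩ := hs
  have inj : ∀ {x z : ℝ}, (![0, x] : Fin 2 → ℝ) = ![0, z] → x = z := fun h => by
    simpa using congrFun h 1
  rcases ht.1.eq_or_lt with rfl | ht1
  · exact Or.inl (inj (he.symm.trans h3))
  rcases ht.2.eq_or_lt with rfl | ht2
  · exact Or.inr (Or.inr (inj (he.symm.trans h5)))
  rcases lt_trichotomy t a with hta | rfl | hta
  · have := h6 t ⟨ht1, hta⟩; rw [he] at this; simp at this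
  · exact Or.inr (Or.inl (inj (he.symm.trans h4)))
  · have := h7 t ⟨hta, ht2⟩; rw [he] at this; simp at this

lemma IsGood.section_mem_orbit (h : y ∈ Z.domain) : ![0, y] ∈ Z.orbit y :=
  Or.inl ⟨0, ⟨le_rfl, (hZ.timeL_pos h).le⟩, flow_zero hZ.rotL _ _⟩

lemma IsGood.returns (h : y ∈ Z.domain) (h' : Z.uL (Z.ret y) < 0) : Z.Returns y (Z.ret y) := by
  obtain ⟨γ, a, T, h1, h2, -, h0, h3, h4, h5, h6, h7, -⟩ := hZ.exists_loop h h'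
  refine ⟨γ, a, T, h1, h2, h0, h3, by simp [h4], h5, fun t ht hta => ?_⟩
  rcases lt_or_gt_of_ne hta with h8 | h8
  · exact (h6 t ⟨ht.1, h8⟩).ne
  · exact (h7 t ⟨h8, ht.2⟩).ne'

/-- A trajectory through both zones follows the return map. -/
lemma IsGood.ret_of_trajectory {γ : ℝ → Fin 2 → ℝ} {a b c : ℝ} (hab : a < b) (hbc : b < c)
    (h : Z.IsCrossingTrajectory γ (Set.Icc a c)) (h0 : γ a = ![0, y]) (h1 : Z.uL y < 0)
    (hb : γ b 0 = 0) (hc : γ c 0 = 0) (h2 : ∀ t ∈ Set.Ioo a b, γ t 0 ≠ 0)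
    (h3 : ∀ t ∈ Set.Ioo b c, γ t 0 ≠ 0) :
    y ∈ Z.domain ∧ γ c = ![0, Z.ret y] ∧ b - a = Z.timeL y ∧ Z.uL (Z.ret y) < 0 ∧
      γ '' Set.Icc a c = Z.orbit y := by
  have hcr : ![0, y] ∈ Z.crossingRegion := h0 ▸ (h.2 a ⟨le_rfl, by linarith⟩).1 (by simp [h0])
  have hl := hZ.leftHalf_of_trajectory hab (h.mono (Set.Icc_subset_Icc_right hbc.le)) h0 h1 h2 hb
  obtain ⟨hl1, hl2⟩ := hZ.lower_eq hl.1
  have hγb : γ b = ![0, Z.lower y] := by rw [hl2]; exact eq_section hb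
  have hcrb : ![0, Z.lower y] ∈ Z.crossingRegion := hγb ▸ (h.2 b ⟨hab.le, hbc.le⟩).1 hb
  have hub : 0 < Z.uL (Z.lower y) := by
    rw [hl2, hl.1.2.2, neg_pos]
    exact mul_neg_of_pos_of_neg hZ.hL_pos (speed_neg_neg_of_realAngles hl.1.1)
  have hurb : 0 < Z.uR (Z.lower y) := by
    have := right_pos_of_crossing hcrb (by rwa [left_section])
    rwa [right_section] at this
  have hury : Z.uR y < 0 := by
    have := right_neg_of_crossing hcr (by rwa [left_section])
    rwa [right_section] at this
  have hdom : y ∈ Z.domain := ⟨⟨_, hl.1.1, hl.1.2.1⟩, hurb, hury⟩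
  have hr := hZ.rightHalf_of_trajectory hbc (h.mono (Set.Icc_subset_Icc_left hab.le)) hγb hurb h3 hc
  obtain ⟨hr1, hr2⟩ := hZ.upper_eq hr.1
  have hγc : γ c = ![0, Z.ret y] := by rw [ret, hr2]; exact eq_section hc
  have htL : b - a = Z.timeL y := by
    rw [timeL, hl1]; field_simp [hZ.rotL.freq_pos.ne']
  have htR : c - b = Z.timeR (Z.lower y) := by
    rw [timeR, hr1]; field_simp [hZ.rotR.freq_pos.ne']
  refine ⟨hdom, hγc, htL, ?_, ?_⟩
  · have h4 := left_neg_of_crossing (hγc ▸ (h.2 c ⟨by linarith, le_rfl⟩).1 hc :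
      ![0, Z.ret y] ∈ Z.crossingRegion) (by rw [right_section]; exact hZ.uR_ret_neg hdom)
    rwa [left_section] at h4
  · rw [orbit, ← htL, ← htR]
    ext p
    constructor
    · rintro ⟨t, ht, rfl⟩
      rcases le_total t b with h5 | h5
      · exact Or.inl ⟨t - a, ⟨by linarith [ht.1], by linarith⟩, (hl.2.1 t ⟨ht.1, h5⟩).symm⟩
      · exact Or.inr ⟨t - b, ⟨by linarith, by linarith [ht.2]⟩, (hr.2.1 t ⟨h5, ht.2⟩).symm⟩
    · rintro (⟨t, ht, rfl⟩ | ⟨t, ht, rfl⟩)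
      · refine ⟨t + a, ⟨by linarith [ht.1], by linarith [ht.2]⟩, ?_⟩
        rw [hl.2.1 _ ⟨by linarith [ht.1], by linarith [ht.2]⟩, add_sub_cancel_right]
      · refine ⟨t + b, ⟨by linarith [ht.1], by linarith [ht.2]⟩, ?_⟩
        rw [hr.2.1 _ ⟨by linarith [ht.1], by linarith [ht.2]⟩, add_sub_cancel_right]

lemma IsGood.ret_of_returns (h : Z.Returns y y') (h1 : Z.uL y < 0) :
    y ∈ Z.domain ∧ y' = Z.ret y ∧ Z.uL y' < 0 := by
  obtain ⟨γ, s, T, hs, hT, hγ, h0, hs0, hT0, hne⟩ := h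
  obtain ⟨a, b, -, c, -⟩ := hZ.ret_of_trajectory hs hT hγ h0 h1 hs0 (by simp [hT0])
    (fun t ht => hne t ⟨ht.1, ht.2.trans hT⟩ ht.2.ne) (fun t ht => hne t ⟨hs.trans ht.1, ht.2⟩ ht.1.ne')
  have h2 : y' = Z.ret y := by simpa using congrFun (hT0.symm.trans b) 1
  exact ⟨a, h2, h2 ▸ c⟩

/-- The next turn of a trajectory that keeps returning to `Σ`. -/
lemma IsGood.exists_next_turn {γ : ℝ → Fin 2 → ℝ} {a : ℝ} (h : Z.IsCrossingTrajectory γ Set.univ)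
    (hrec : ∀ t, ∃ s > t, γ s 0 = 0) (h0 : γ a = ![0, y]) (h1 : Z.uL y < 0) :
    ∃ c, a + Real.pi / freq Z.leftMat ≤ c ∧ y ∈ Z.domain ∧ γ c = ![0, Z.ret y] ∧
      Z.uL (Z.ret y) < 0 ∧ γ '' Set.Icc a c = Z.orbit y := by
  obtain ⟨s, hs, hs0⟩ := hrec a
  obtain ⟨b, hab, hb, hb'⟩ := h.exists_next_hit (by simp [h0]) hs hs0
  obtain ⟨s, hs, hs0⟩ := hrec b
  obtain ⟨c, hbc, hc, hc'⟩ := h.exists_next_hit hb hs hs0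
  obtain ⟨h2, h3, h4, h5, h6⟩ := hZ.ret_of_trajectory hab hbc (h.mono (Set.subset_univ _)) h0 h1 hb hc
    hb' hc'
  exact ⟨c, by linarith [hZ.le_timeL h2], h2, h3, h5, h6⟩

/-- Everything after an upper hit stays in any set that contains the turns allowed by an invariant
of the return map. -/
lemma IsGood.mem_of_invariant {γ : ℝ → Fin 2 → ℝ} {a : ℝ} (h : Z.IsCrossingTrajectory γ Set.univ)
    (hrec : ∀ t, ∃ s > t, γ s 0 = 0) (h0 : γ a = ![0, y]) (h1 : Z.uL y < 0) (Q : ℝ → Prop)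
    (S : Set (Fin 2 → ℝ)) (hy : Q y) (hQ : ∀ z ∈ Z.domain, Q z → Q (Z.ret z))
    (hS : ∀ z ∈ Z.domain, Z.uL (Z.ret z) < 0 → Q z → Z.orbit z ⊆ S) : ∀ t, a ≤ t → γ t ∈ S := by
  have hω := div_pos Real.pi_pos hZ.rotL.freq_pos
  have claim : ∀ n : ℕ, ∃ c z, a + n * (Real.pi / freq Z.leftMat) ≤ c ∧ γ c = ![0, z] ∧
      Z.uL z < 0 ∧ Q z ∧ ∀ t ∈ Set.Ico a c, γ t ∈ S := by
    intro n
    induction n with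
    | zero => exact ⟨a, y, by simp, h0, h1, hy, fun t ht => absurd ht.1 (not_le.2 ht.2)⟩
    | succ n ih =>
      obtain ⟨c, z, hc, hcz, hz, hQz, hall⟩ := ih
      obtain ⟨c', h2, h3, h4, h5, h6⟩ := hZ.exists_next_turn h hrec hcz hz
      refine ⟨c', Z.ret z, by push_cast; linarith, h4, h5, hQ z h3 hQz, fun t ht => ?_⟩
      rcases lt_or_ge t c with h7 | h7
      · exact hall t ⟨ht.1, h7⟩
      · exact hS z h3 h5 hQz (h6 ▸ ⟨t, ⟨h7, ht.2.le⟩, rfl⟩)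
  intro t ht
  obtain ⟨n, hn⟩ := exists_nat_gt ((t - a) / (Real.pi / freq Z.leftMat))
  obtain ⟨c, z, hc, -, -, -, hall⟩ := claim n
  rw [div_lt_iff₀ hω] at hn
  exact hall t ⟨ht, by linarith⟩

/-- Every crossing periodic orbit is the loop through a fixed point of the return map. -/
lemma IsGood.exists_fixed_of_periodic {Γ : Set (Fin 2 → ℝ)} (hΓ : Z.IsCrossingPeriodicOrbit Γ) :
    ∃ y ∈ Z.domain, Z.ret y = y ∧ Γ = Z.orbit y := by
  obtain ⟨γ, T, hT, h, hper, ⟨t₀, ht₀⟩, rfl⟩ := hΓ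
  have hperk : ∀ (k : ℕ) t, γ (t + k * T) = γ t := by
    intro k
    induction k with
    | zero => simp
    | succ k ih => intro t; rw [← ih t, ← hper (t + k * T)]; congr 1; push_cast; ring
  have hlarge : ∀ s t : ℝ, ∃ k : ℕ, s < t + k * T := by
    intro s t
    obtain ⟨k, hk⟩ := exists_nat_gt ((s - t) / T)
    rw [div_lt_iff₀ hT] at hk
    exact ⟨k, by linarith⟩
  have hrec : ∀ t, ∃ s > t, γ s 0 = 0 := by
    intro t
    obtain ⟨k, hk⟩ := hlarge t t₀
    exact ⟨_, hk, by rw [hperk, ht₀]⟩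
  obtain ⟨a, y, h0, h1⟩ : ∃ a y, γ a = ![0, y] ∧ Z.uL y < 0 := by
    have hcr := (h.2 t₀ trivial).1 ht₀
    rcases (right_ne_of_crossing hcr).lt_or_gt with h2 | h2
    · refine ⟨t₀, γ t₀ 1, eq_section ht₀, ?_⟩
      have := left_neg_of_crossing hcr h2
      rw [eq_section ht₀, left_section] at this
      exact this
    · obtain ⟨s, hs, hs0⟩ := hrec t₀
      obtain ⟨b, hb, hb0, hb'⟩ := h.exists_next_hit ht₀ hs hs0
      have h3 := (h.mono (Set.subset_univ (Set.Icc t₀ b))).right_passage hZ.rotR hb ht₀ h2 hb' hb0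
      have h4 := left_neg_of_crossing ((h.2 b trivial).1 hb0) h3.2.2
      rw [eq_section hb0, left_section] at h4
      exact ⟨b, _, eq_section hb0, h4⟩
  obtain ⟨c, hc, hdom, hγc, huc, himg⟩ := hZ.exists_next_turn h hrec h0 h1
  -- if the first return were not the starting point, the orbit could never come back to it
  have nofix : ∀ Q : ℝ → Prop, Q (Z.ret y) → (∀ z ∈ Z.domain, Q z → Q (Z.ret z)) → Q y := by
    intro Q hQ0 hQ
    obtain ⟨k, hk⟩ := hlarge c a
    have := hZ.mem_of_invariant h hrec hγc huc Q {p | p 0 = 0 → Z.uL (p 1) < 0 → Q (p 1)} hQ0 hQ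
      (fun z hz hz' hQz p hp hp0 hpu => by
        rw [eq_section hp0] at hp
        rcases hZ.eq_of_mem_orbit hz hz' hp with h2 | h2 | h2
        · rw [h2]; exact hQz
        · rw [h2] at hpu; linarith [hZ.uL_lower_pos hz]
        · rw [h2]; exact hQ z hz hQz) _ hk.le
    rw [hperk, h0] at this
    simpa using this (by simp) (by simpa using h1)
  have hfix : Z.ret y = y := by
    rcases lt_trichotomy (Z.ret y) y with hlt | he | hlt
    · refine absurd (nofix (fun z => z < y) hlt fun z hz hzy => ?_) (lt_irrefl _)
      exact (hZ.ret_strictMonoOn hz hdom hzy).trans hlt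
    · exact he
    · refine absurd (nofix (fun z => y < z) hlt fun z hz hzy => ?_) (lt_irrefl _)
      exact hlt.trans (hZ.ret_strictMonoOn hdom hz hzy)
  refine ⟨y, hdom, hfix, Set.Subset.antisymm ?_ ?_⟩
  · rintro _ ⟨t, rfl⟩
    obtain ⟨k, hk⟩ := hlarge a t
    rw [← hperk k t]
    refine hZ.mem_of_invariant h hrec h0 h1 (fun z => z = y) _ rfl (fun z _ hz => ?_)
      (fun z _ _ hz => ?_) _ hk.le
    · rw [hz, hfix]
    · rw [hz]
  · rw [← himg]; exact Set.image_subset_range _ _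

lemma IsGood.periodic_of_fixed (h : y ∈ Z.domain) (h' : Z.ret y = y) :
    Z.IsCrossingPeriodicOrbit (Z.orbit y) := by
  obtain ⟨γ, s, T, h1, h2, -, h0, h3, h4, h5, h6, h7, h8⟩ :=
    hZ.exists_loop h (by rw [h']; exact hZ.uL_neg h)
  obtain ⟨γ', a1, a2, a3⟩ := exists_periodic_trajectory (h1.trans h2) h0 (by rw [h3, h5, h'])
  have hT := h1.trans h2
  refine ⟨γ', T, hT, a1, a2, ⟨0, by rw [a3 0 ⟨le_rfl, hT.le⟩, h3]; simp⟩, ?_⟩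
  rw [← h8]
  ext p
  constructor
  · rintro ⟨t, ht, rfl⟩; exact ⟨t, a3 t ht⟩
  · rintro ⟨t, rfl⟩
    have hperi : Function.Periodic γ' T := a2
    obtain ⟨s', hs', he⟩ := hperi.exists_mem_Ico₀ hT t
    exact ⟨s', Set.Ico_subset_Icc_self hs', by rw [he, a3 s' (Set.Ico_subset_Icc_self hs')]⟩

lemma IsGood.hasAmplitude (h : y ∈ Z.domain) (h' : Z.ret y = y) : HasAmplitude (Z.orbit y) y := by
  refine ⟨hZ.section_mem_orbit h, fun s hs => ?_⟩
  rcases hZ.eq_of_mem_orbit h (by rw [h']; exact hZ.uL_neg h) hs with h1 | h1 | h1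
  · exact h1.le
  · exact h1 ▸ (hZ.lower_lt h).le
  · exact (h1.trans h').le

/-- An isolated fixed point gives an isolated orbit: nearby periodic orbits meet `Σ` nearby. -/
lemma IsGood.limitCycle_of_isolated (h : y ∈ Z.domain) (h' : Z.ret y = y)
    (hiso : ∀ᶠ z in 𝓝[≠] y, Z.ret z ≠ z) : Z.IsCrossingLimitCycle (Z.orbit y) := by
  refine ⟨hZ.periodic_of_fixed h h', ?_⟩
  obtain ⟨δ, hδ, hδ'⟩ := Metric.mem_nhds_iff.1 (eventually_nhdsWithin_iff.1 hiso)
  have hc : Continuous Z.uL := by unfold uL; fun_prop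
  obtain ⟨η, hη, hη'⟩ := Metric.mem_nhds_iff.1 (hc.continuousAt.eventually (lt_mem_nhds (hZ.uL_lower_pos h)))
  refine ⟨{p | p 0 ≠ 0} ∪ ((fun p : Fin 2 → ℝ => p 1) ⁻¹' Metric.ball y δ ∪
    (fun p : Fin 2 → ℝ => p 1) ⁻¹' Metric.ball (Z.lower y) η), ?_, ?_, ?_⟩
  · exact (isOpen_ne_fun (continuous_apply 0) continuous_const).union
      ((Metric.isOpen_ball.preimage (continuous_apply 1)).union
        (Metric.isOpen_ball.preimage (continuous_apply 1)))
  · intro p hp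
    by_cases h0 : p 0 = 0
    · right
      rw [eq_section h0] at hp
      rcases hZ.eq_of_mem_orbit h (by rw [h']; exact hZ.uL_neg h) hp with h1 | h1 | h1
      · left; rw [Set.mem_preimage, h1]; exact Metric.mem_ball_self hδ
      · right; rw [Set.mem_preimage, h1]; exact Metric.mem_ball_self hη
      · left; rw [Set.mem_preimage, h1, h']; exact Metric.mem_ball_self hδ
    · exact Or.inl h0
  · intro Γ' hΓ' hsub
    obtain ⟨z, hz, hzf, rfl⟩ := hZ.exists_fixed_of_periodic hΓ'
    have h1 : z ∈ Metric.ball y δ := by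
      have := hsub (hZ.section_mem_orbit hz)
      simp only [Set.mem_union, Set.mem_preimage, Set.mem_ofPred_eq, Matrix.cons_val_zero,
        Matrix.cons_val_one, ne_eq, not_true_eq_false, false_or] at this
      refine this.resolve_right fun h2 => ?_
      have h3 : 0 < Z.uL z := hη' h2
      linarith [hZ.uL_neg hz]
    by_contra hne
    exact hδ' h1 (fun he => hne (by rw [he])) hzf

end Loops

/-! ### The displacement function -/

/-- The inverse of the mean speed for passages through the zone of the real focus. -/
noncomputable def meanAngleL (g s : ℝ) : ℝ := Function.invFunOn (meanSpeed g) (realAngles g) (-s)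

/-- The inverse of the mean speed for passages through the zone of the virtual focus. -/
noncomputable def meanAngleR (g s : ℝ) : ℝ := Function.invFunOn (meanSpeed g) (Set.Ioo 0 Real.pi) s

/-- The normalized mean speeds of the passages through the zone of the real focus. -/
def meanDomain (g : ℝ) : Set ℝ := {s | ∃ θ ∈ realAngles g, meanSpeed g θ = -s}

/-- Half the normalized gain of speed in the zone of the real focus, in terms of the mean speed. -/
noncomputable def gainL (g s : ℝ) : ℝ := -gain g (meanAngleL g s)

/-- Half the normalized gain of speed in the zone of the virtual focus, in terms of the mean
speed. -/
noncomputable def gainR (g s : ℝ) : ℝ := gain g (meanAngleR g s)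

lemma meanAngleL_mem {g s : ℝ} (h : s ∈ meanDomain g) : meanAngleL g s ∈ realAngles g :=
  Function.invFunOn_mem h

lemma meanSpeed_meanAngleL {g s : ℝ} (h : s ∈ meanDomain g) : meanSpeed g (meanAngleL g s) = -s :=
  Function.invFunOn_eq h

lemma meanAngleL_eq {g s θ : ℝ} (h : θ ∈ realAngles g) (h' : meanSpeed g θ = -s) :
    meanAngleL g s = θ :=
  (meanSpeed_strictMonoOn_realAngles g).injOn (meanAngleL_mem ⟨θ, h, h'⟩) h
    ((meanSpeed_meanAngleL ⟨θ, h, h'⟩).trans h'.symm)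

lemma exists_meanSpeed_eq {g s : ℝ} (hs : 0 < s) : ∃ θ ∈ Set.Ioo 0 Real.pi, meanSpeed g θ = s := by
  have h1 : (𝓝[>] (0:ℝ)) ≤ 𝓟 (Set.Ioo 0 Real.pi) := le_principal_iff.2 (Ioo_mem_nhdsGT Real.pi_pos)
  have h2 : (𝓝[<] Real.pi) ≤ 𝓟 (Set.Ioo 0 Real.pi) := le_principal_iff.2 (Ioo_mem_nhdsLT Real.pi_pos)
  exact isPreconnected_Ioo.intermediate_value_Ioi h1 h2 (f := meanSpeed g)
    (fun x hx => (hasDerivAt_meanSpeed g (sin_ne_zero_of_Ioo hx)).continuousAt.continuousWithinAt)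
    (tendsto_meanSpeed_zero g) (tendsto_meanSpeed_pi_left g) hs

lemma meanAngleR_mem {g s : ℝ} (h : 0 < s) : meanAngleR g s ∈ Set.Ioo 0 Real.pi :=
  Function.invFunOn_mem (exists_meanSpeed_eq h)

lemma meanSpeed_meanAngleR {g s : ℝ} (h : 0 < s) : meanSpeed g (meanAngleR g s) = s :=
  Function.invFunOn_eq (exists_meanSpeed_eq h)

lemma meanAngleR_eq {g s θ : ℝ} (h : θ ∈ Set.Ioo 0 Real.pi) (h' : meanSpeed g θ = s) :
    meanAngleR g s = θ := by
  have hs : 0 < s := h' ▸ meanSpeed_pos_Ioo g h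
  exact (meanSpeed_strictMonoOn_Ioo g).injOn (meanAngleR_mem hs) h
    ((meanSpeed_meanAngleR hs).trans h'.symm)

lemma meanDomain_of_le {g s s' : ℝ} (h : s ∈ meanDomain g) (hs : s ≤ s') : s' ∈ meanDomain g := by
  obtain ⟨θ, hθ, h'⟩ := h
  have h1 : (𝓝[>] Real.pi) ≤ 𝓟 (realAngles g) := le_principal_iff.2 (realAngles_mem_nhdsGT g)
  exact (ordConnected_realAngles g).isPreconnected.intermediate_value_Iic hθ h1 (f := meanSpeed g)
    (fun x hx => (hasDerivAt_meanSpeed g (sin_ne_zero_of_realAngles hx)).continuousAt.continuousWithinAt)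
    (tendsto_meanSpeed_pi_right g) (show -s' ≤ _ by rw [h']; linarith)

lemma pos_of_mem_meanDomain {g s : ℝ} (h : s ∈ meanDomain g) : 0 < s := by
  obtain ⟨θ, hθ, h'⟩ := h
  linarith [meanSpeed_neg_of_realAngles hθ]

lemma meanSpeed_neg (g θ : ℝ) : meanSpeed (-g) θ = meanSpeed g θ := by simp [meanSpeed]

lemma gain_neg (g θ : ℝ) : gain (-g) θ = -gain g θ := by
  simp only [gain, neg_mul, Real.sinh_neg, ← neg_div]; ring

lemma meanDomain_neg (g : ℝ) : meanDomain (-g) = meanDomain g := by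
  simp only [meanDomain, realAngles_neg, meanSpeed_neg]

lemma gainL_neg (g s : ℝ) : gainL (-g) s = -gainL g s := by
  have : meanSpeed (-g) = meanSpeed g := funext (meanSpeed_neg g)
  simp only [gainL, meanAngleL, realAngles_neg, this, gain_neg]

lemma gainR_neg (g s : ℝ) : gainR (-g) s = -gainR g s := by
  have : meanSpeed (-g) = meanSpeed g := funext (meanSpeed_neg g)
  simp only [gainR, meanAngleR, this, gain_neg]

lemma analyticAt_meanAngleL {g s : ℝ} (h : s ∈ meanDomain g) :
    AnalyticAt ℝ (fun p : ℝ × ℝ => meanAngleL p.1 p.2) (g, s) := by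
  obtain ⟨θ, hθ, h'⟩ := h
  have hsin := sin_ne_zero_of_realAngles hθ
  have hs : s = -meanSpeed g θ := by rw [h', neg_neg]
  have hd := (hasDerivAt_meanSpeed g hsin).neg
  rw [hs]
  refine analyticAt_fiber_inverse isOpen_realAngles_prod (c := fun g θ => -meanSpeed g θ)
    (fun g θ θ' h h' he => (meanSpeed_strictMonoOn_realAngles g).injOn h h' (neg_inj.1 he))
    (fun g θ h => by rw [meanAngleL_eq h (by ring)]; exact ⟨h, rfl⟩) hθ
    (analyticAt_meanSpeed hsin).neg hd ?_
  rw [neg_ne_zero]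
  exact div_ne_zero (add_pos hθ.2.1 hθ.2.2).ne' (mul_ne_zero two_ne_zero (pow_ne_zero _ hsin))

lemma analyticAt_meanAngleR {g s : ℝ} (h : 0 < s) :
    AnalyticAt ℝ (fun p : ℝ × ℝ => meanAngleR p.1 p.2) (g, s) := by
  obtain ⟨θ, hθ, rfl⟩ := exists_meanSpeed_eq (g := g) h
  have hsin := sin_ne_zero_of_Ioo hθ
  refine analyticAt_fiber_inverse (W := {p | p.2 ∈ Set.Ioo 0 Real.pi})
    (isOpen_Ioo.preimage continuous_snd) (c := meanSpeed)
    (fun g θ θ' h h' => (meanSpeed_strictMonoOn_Ioo g).injOn h h')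
    (fun g θ h => by rw [meanAngleR_eq h rfl]; exact ⟨h, rfl⟩) hθ
    (analyticAt_meanSpeed hsin) (hasDerivAt_meanSpeed g hsin) ?_
  exact div_ne_zero (add_pos (andronov_pos hθ.1 hθ.2.le) (andronov_pos hθ.1 hθ.2.le)).ne'
    (mul_ne_zero two_ne_zero (pow_ne_zero _ hsin))

lemma isOpen_meanDomain_prod : IsOpen {p : ℝ × ℝ | p.2 ∈ meanDomain p.1} := by
  rw [isOpen_iff_mem_nhds]
  rintro ⟨g, s⟩ h
  obtain ⟨θ, hθ, h'⟩ := h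
  obtain ⟨θ', hlt, hθ'⟩ : ∃ θ', θ < θ' ∧ θ' ∈ realAngles g := by
    have h2 : ∀ᶠ θ' in 𝓝[>] θ, θ' ∈ realAngles g :=
      mem_nhdsWithin_of_mem_nhds ((isOpen_realAngles g).mem_nhds hθ)
    obtain ⟨θ', h3, h4⟩ := (h2.and self_mem_nhdsWithin).exists
    exact ⟨θ', h4, h3⟩
  have h1 : ∀ᶠ p : ℝ × ℝ in 𝓝 (g, s), θ' ∈ realAngles p.1 :=
    (isOpen_realAngles_prod.preimage (by fun_prop : Continuous fun p : ℝ × ℝ => (p.1, θ'))).mem_nhds hθ'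
  have h2 : ∀ᶠ p : ℝ × ℝ in 𝓝 (g, s), -meanSpeed p.1 θ' < p.2 := by
    have hc : ContinuousAt (fun p : ℝ × ℝ => -meanSpeed p.1 θ' - p.2) (g, s) := by
      unfold meanSpeed
      have := sin_ne_zero_of_realAngles hθ'
      fun_prop
    have hlt' : -meanSpeed g θ' - s < 0 := by
      have := meanSpeed_strictMonoOn_realAngles g hθ hθ' hlt
      linarith
    filter_upwards [hc.eventually (gt_mem_nhds hlt')] with p hp
    linarith
  filter_upwards [h1, h2] with p hp1 hp2
  exact meanDomain_of_le ⟨θ', hp1, (neg_neg _).symm⟩ hp2.le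

lemma isOpen_meanDomain (g : ℝ) : IsOpen (meanDomain g) :=
  isOpen_meanDomain_prod.preimage (by fun_prop : Continuous fun s : ℝ => (g, s))

lemma analyticAt_gain {g θ : ℝ} (h : Real.sin θ ≠ 0) :
    AnalyticAt ℝ (fun p : ℝ × ℝ => gain p.1 p.2) (g, θ) := by
  have h1 : ∀ p : ℝ × ℝ, gain p.1 p.2 = meanSpeed p.1 p.2 - speed p.1 p.2 := fun p => by
    rw [speed_eq_sub]; ring
  simp only [h1]
  exact (analyticAt_meanSpeed h).sub (analyticAt_speed h)

lemma analyticAt_gainL {g s : ℝ} (h : s ∈ meanDomain g) :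
    AnalyticAt ℝ (fun p : ℝ × ℝ => gainL p.1 p.2) (g, s) := by
  refine AnalyticAt.neg (AnalyticAt.fun_comp (f := fun p : ℝ × ℝ => (p.1, meanAngleL p.1 p.2))
    (g := fun p : ℝ × ℝ => gain p.1 p.2) ?_ (analyticAt_fst.prod (analyticAt_meanAngleL h)))
  exact analyticAt_gain (sin_ne_zero_of_realAngles (meanAngleL_mem h))

lemma analyticAt_gainR {g s : ℝ} (h : 0 < s) :
    AnalyticAt ℝ (fun p : ℝ × ℝ => gainR p.1 p.2) (g, s) := by
  refine AnalyticAt.fun_comp (f := fun p : ℝ × ℝ => (p.1, meanAngleR p.1 p.2))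
    (g := fun p : ℝ × ℝ => gain p.1 p.2) ?_ (analyticAt_fst.prod (analyticAt_meanAngleR h))
  exact analyticAt_gain (sin_ne_zero_of_Ioo (meanAngleR_mem h))

lemma speed_meanAngleL {g s : ℝ} (h : s ∈ meanDomain g) :
    speed g (meanAngleL g s) = -(s - gainL g s) := by
  rw [speed_eq_sub, meanSpeed_meanAngleL h, gainL]; ring

lemma speed_neg_meanAngleL {g s : ℝ} (h : s ∈ meanDomain g) :
    speed (-g) (meanAngleL g s) = -(s + gainL g s) := by
  rw [speed_neg_eq_add, meanSpeed_meanAngleL h, gainL]; ring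

lemma speed_meanAngleR {g s : ℝ} (h : 0 < s) : speed g (meanAngleR g s) = s - gainR g s := by
  rw [speed_eq_sub, meanSpeed_meanAngleR h, gainR]

lemma speed_neg_meanAngleR {g s : ℝ} (h : 0 < s) : speed (-g) (meanAngleR g s) = s + gainR g s := by
  rw [speed_neg_eq_add, meanSpeed_meanAngleR h, gainR]

/-- The ratio of the horizontal velocities of the two fields on `Σ`, up to the offset `beta`. -/
noncomputable def rho (Z : PWL) : ℝ := Z.rightMat 0 1 / Z.leftMat 0 1

/-- The offset between the horizontal velocities of the two fields on `Σ`. -/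
noncomputable def beta (Z : PWL) : ℝ := Z.rightVec 0 - Z.rho * Z.leftVec 0

/-- The ratio of the length scales of the two zones. -/
noncomputable def kappa (Z : PWL) : ℝ := Z.rho * Z.hL / Z.hR

/-- The normalized offset. -/
noncomputable def offset (Z : PWL) : ℝ := Z.beta / (Z.rho * Z.hL)

/-- The displacement function: the gain of speed in the left zone, the gain of speed that the right
zone would have to compensate, and the offset, as a function of the mean speed `s` in the left
zone. Its zeros are the crossing periodic orbits. -/
noncomputable def disp (Z : PWL) (s : ℝ) : ℝ :=
  gainL Z.gL s + gainR Z.gR (Z.kappa * s) / Z.kappa + Z.offset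

/-- The ordinate from which the left passage has normalized mean speed `s`. -/
noncomputable def height (Z : PWL) (s : ℝ) : ℝ :=
  (-(Z.hL * (s - gainL Z.gL s)) - Z.leftVec 0) / Z.leftMat 0 1

lemma analyticAt_height {Z : PWL} {s : ℝ} (h : s ∈ meanDomain Z.gL) : AnalyticAt ℝ Z.height s := by
  have h1 : AnalyticAt ℝ (fun s => gainL Z.gL s) s :=
    AnalyticAt.fun_comp (f := fun s => (Z.gL, s)) (g := fun p : ℝ × ℝ => gainL p.1 p.2)
      (analyticAt_gainL h) (AnalyticAt.prod analyticAt_const analyticAt_id)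
  unfold height
  exact ((analyticAt_const.mul (analyticAt_id.sub h1)).neg.sub analyticAt_const).div_const

section Displacement

variable {Z : PWL} (hZ : Z.IsGood) {y s s' : ℝ}
include hZ

lemma IsGood.rho_pos : 0 < Z.rho := div_pos_of_neg_of_neg hZ.rotR.1 hZ.rotL.1

lemma IsGood.kappa_pos : 0 < Z.kappa := div_pos (mul_pos hZ.rho_pos hZ.hL_pos) hZ.hR_pos

lemma IsGood.uR_eq (y : ℝ) : Z.uR y = Z.rho * Z.uL y + Z.beta := by
  have := hZ.rotL.1.ne
  rw [uR, uL, beta, rho]; field_simp; ring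

lemma IsGood.uL_height (s : ℝ) : Z.uL (Z.height s) = -(Z.hL * (s - gainL Z.gL s)) := by
  have := hZ.rotL.1.ne
  rw [uL, height]; field_simp; ring

lemma IsGood.uL_height' (h : s ∈ meanDomain Z.gL) :
    Z.uL (Z.height s) = Z.hL * speed Z.gL (meanAngleL Z.gL s) := by
  rw [hZ.uL_height, speed_meanAngleL h]; ring

lemma IsGood.angleL_height (h : s ∈ meanDomain Z.gL) :
    Z.angleL (Z.height s) = meanAngleL Z.gL s :=
  hZ.angleL_eq (meanAngleL_mem h) (hZ.uL_height' h)

lemma IsGood.uL_lower_height (h : s ∈ meanDomain Z.gL) :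
    Z.uL (Z.lower (Z.height s)) = Z.hL * (s + gainL Z.gL s) := by
  rw [hZ.uL_lower, hZ.angleL_height h, speed_neg_meanAngleL h]; ring

lemma IsGood.height_strictMonoOn : StrictMonoOn Z.height (meanDomain Z.gL) := by
  intro s hs s' hs' hlt
  refine hZ.uL_strictAnti.lt_iff_gt.1 ?_
  rw [hZ.uL_height' hs, hZ.uL_height' hs']
  refine mul_lt_mul_of_pos_left ?_ hZ.hL_pos
  refine speed_strictMonoOn_realAngles _ (meanAngleL_mem hs') (meanAngleL_mem hs) ?_
  refine ((meanSpeed_strictMonoOn_realAngles _).lt_iff_lt (meanAngleL_mem hs') (meanAngleL_mem hs)).1 ?_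
  rw [meanSpeed_meanAngleL hs, meanSpeed_meanAngleL hs']
  linarith

lemma IsGood.exists_height (h : y ∈ Z.domain) : ∃ s ∈ meanDomain Z.gL, Z.height s = y := by
  obtain ⟨θ, hθ, h'⟩ := h.1
  have hs : -meanSpeed Z.gL θ ∈ meanDomain Z.gL := ⟨θ, hθ, (neg_neg _).symm⟩
  refine ⟨_, hs, hZ.uL_strictAnti.injective ?_⟩
  rw [hZ.uL_height' hs, meanAngleL_eq hθ (neg_neg _).symm, h']

lemma IsGood.analyticAt_disp (h : s ∈ meanDomain Z.gL) : AnalyticAt ℝ Z.disp s := by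
  have h1 : AnalyticAt ℝ (fun s => gainL Z.gL s) s :=
    AnalyticAt.fun_comp (f := fun s => (Z.gL, s)) (g := fun p : ℝ × ℝ => gainL p.1 p.2)
      (analyticAt_gainL h) (AnalyticAt.prod analyticAt_const analyticAt_id)
  have h2 : AnalyticAt ℝ (fun s => gainR Z.gR (Z.kappa * s)) s :=
    AnalyticAt.fun_comp (f := fun s => (Z.gR, Z.kappa * s)) (g := fun p : ℝ × ℝ => gainR p.1 p.2)
      (analyticAt_gainR (mul_pos hZ.kappa_pos (pos_of_mem_meanDomain h)))
      (AnalyticAt.prod analyticAt_const (analyticAt_const.mul analyticAt_id))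
  unfold disp
  exact (h1.add h2.div_const).add analyticAt_const

/-- The ordinates on the loop in terms of the displacement function: the speed at which the orbit
enters the right zone differs by `κ disp` from the one that would close the orbit. -/
lemma IsGood.speed_angleR_sub (h : s ∈ meanDomain Z.gL) (hd : Z.height s ∈ Z.domain) :
    speed Z.gR (Z.angleR (Z.lower (Z.height s))) - speed Z.gR (meanAngleR Z.gR (Z.kappa * s)) =
      Z.kappa * Z.disp s := by
  have h1 := (hZ.rightHalf hd.2.1).2.1
  have hκ := hZ.kappa_pos
  rw [hZ.uR_eq, hZ.uL_lower_height h] at h1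
  rw [speed_meanAngleR (mul_pos hκ (pos_of_mem_meanDomain h))]
  have hR := hZ.hR_pos.ne'
  have hL := hZ.hL_pos.ne'
  have hρ := hZ.rho_pos.ne'
  have h2 : speed Z.gR (Z.angleR (Z.lower (Z.height s))) =
      (Z.rho * (Z.hL * (s + gainL Z.gL s)) + Z.beta) / Z.hR := by
    rw [h1]; field_simp
  have h3 : Z.kappa * Z.disp s =
      Z.kappa * gainL Z.gL s + gainR Z.gR (Z.kappa * s) + Z.kappa * Z.offset := by
    rw [disp]; field_simp
  rw [h2, h3]
  generalize gainR Z.gR (Z.kappa * s) = G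
  rw [offset, kappa]
  field_simp
  ring

/-- At the lower end of a left passage of mean speed `s` the right passage has the true angle
`angleR`; the loop closes if and only if its mean speed is `κ s`. -/
lemma IsGood.uR_sub_uR_ret (h : s ∈ meanDomain Z.gL) (hd : Z.height s ∈ Z.domain) :
    Z.uR (Z.height s) - Z.uR (Z.ret (Z.height s)) =
      2 * Z.hR * (meanSpeed Z.gR (Z.angleR (Z.lower (Z.height s))) -
        meanSpeed Z.gR (meanAngleR Z.gR (Z.kappa * s))) := by
  have h1 := (hZ.rightHalf hd.2.1).2.1
  have hκ := hZ.kappa_pos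
  rw [hZ.uR_eq, hZ.uL_lower_height h] at h1
  rw [meanSpeed_meanAngleR (mul_pos hκ (pos_of_mem_meanDomain h)), meanSpeed_eq, ret, hZ.uR_upper,
    hZ.uR_eq (Z.height s), hZ.uL_height]
  have hR := hZ.hR_pos.ne'
  have h3 : Z.hR * (Z.kappa * s) = Z.rho * Z.hL * s := by rw [kappa]; field_simp
  linear_combination h1 + 2 * h3

/-- The sign of the displacement function is that of the displacement `P(y) - y` of the return map. -/
lemma IsGood.ret_sign (h : s ∈ meanDomain Z.gL) (hd : Z.height s ∈ Z.domain) :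
    (Z.height s < Z.ret (Z.height s) ↔ 0 < Z.disp s) ∧
      (Z.ret (Z.height s) < Z.height s ↔ Z.disp s < 0) := by
  have h1 := hZ.speed_angleR_sub h hd
  have h2 := hZ.uR_sub_uR_ret h hd
  have hκ := hZ.kappa_pos
  have hR := hZ.hR_pos
  set a := Z.angleR (Z.lower (Z.height s))
  set b := meanAngleR Z.gR (Z.kappa * s)
  have ha : a ∈ Set.Ioo 0 Real.pi := (hZ.rightHalf hd.2.1).1
  have hb : b ∈ Set.Ioo 0 Real.pi := meanAngleR_mem (mul_pos hκ (pos_of_mem_meanDomain h))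
  constructor
  · rw [← hZ.uR_strictAnti.lt_iff_gt, ← sub_pos, h2, mul_pos_iff_of_pos_left (by positivity), sub_pos,
      (meanSpeed_strictMonoOn_Ioo _).lt_iff_lt hb ha, ← (speed_strictMonoOn_Ioo Z.gR).lt_iff_lt hb ha,
      ← sub_pos, h1, mul_pos_iff_of_pos_left hκ]
  · rw [← hZ.uR_strictAnti.lt_iff_gt, ← sub_neg, h2, ← neg_pos, ← mul_neg,
      mul_pos_iff_of_pos_left (by positivity), neg_pos, sub_neg,
      (meanSpeed_strictMonoOn_Ioo _).lt_iff_lt ha hb, ← (speed_strictMonoOn_Ioo Z.gR).lt_iff_lt ha hb,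
      ← sub_neg, h1, ← neg_pos, ← mul_neg, mul_pos_iff_of_pos_left hκ, neg_pos]

lemma IsGood.ret_eq_iff (h : s ∈ meanDomain Z.gL) (hd : Z.height s ∈ Z.domain) :
    Z.ret (Z.height s) = Z.height s ↔ Z.disp s = 0 := by
  have := hZ.ret_sign h hd
  constructor
  · intro he
    rcases lt_trichotomy (Z.disp s) 0 with h1 | h1 | h1
    · exact absurd (this.2.2 h1) (by rw [he]; exact lt_irrefl _)
    · exact h1
    · exact absurd (this.1.2 h1) (by rw [he]; exact lt_irrefl _)
  · intro he
    rcases lt_trichotomy (Z.ret (Z.height s)) (Z.height s) with h1 | h1 | h1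
    · have := this.2.1 h1; linarith
    · exact h1
    · have := this.1.1 h1; linarith

/-- At a zero of the displacement function the orbit does traverse both zones. -/
lemma IsGood.height_mem_domain (h : s ∈ meanDomain Z.gL) (h0 : Z.disp s = 0) :
    Z.height s ∈ Z.domain := by
  have hκ := hZ.kappa_pos
  have hR := hZ.hR_pos.ne'
  have hL := hZ.hL_pos.ne'
  have hρ := hZ.rho_pos.ne'
  have hs := mul_pos hκ (pos_of_mem_meanDomain h)
  have h1 := speed_meanAngleR (g := Z.gR) hs
  have h2 := speed_neg_meanAngleR (g := Z.gR) hs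
  have h3 := speed_pos_Ioo Z.gR (meanAngleR_mem (g := Z.gR) hs)
  have h4 := speed_pos_Ioo (-Z.gR) (meanAngleR_mem (g := Z.gR) hs)
  rw [h1] at h3
  rw [h2] at h4
  have h5 : gainR Z.gR (Z.kappa * s) = -(Z.kappa * (gainL Z.gL s + Z.offset)) := by
    rw [disp] at h0
    field_simp at h0
    linarith
  have h6 : Z.beta = Z.offset * (Z.rho * Z.hL) := by rw [offset]; field_simp
  have h7 : Z.rho * Z.hL = Z.kappa * Z.hR := by rw [kappa]; field_simp
  refine ⟨⟨_, meanAngleL_mem h, hZ.uL_height' h⟩, ?_, ?_⟩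
  · rw [hZ.uR_eq, hZ.uL_lower_height h, h6, ← mul_assoc, h7]
    have := mul_pos hZ.hR_pos h3
    rw [h5] at this
    linarith
  · rw [hZ.uR_eq, hZ.uL_height, h6, mul_neg, ← mul_assoc, h7]
    have := mul_pos hZ.hR_pos h4
    rw [h5] at this
    linarith

/-- Far enough out, all orbits traverse both zones. -/
lemma IsGood.domain_nonempty : Z.domain.Nonempty := by
  have h1 := tendsto_speed_pi_right Z.gL
  have h2 := tendsto_speed_pi_right (-Z.gL)
  have hρ := mul_pos hZ.rho_pos hZ.hL_pos
  have h0 : ∀ᶠ θ in 𝓝[>] Real.pi, θ ∈ realAngles Z.gL := realAngles_mem_nhdsGT _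
  obtain ⟨θ, hθ, h3, h4⟩ := (h0.and
    ((h1.eventually (eventually_lt_atBot (-Z.beta / (Z.rho * Z.hL)))).and
    (h2.eventually (eventually_lt_atBot (Z.beta / (Z.rho * Z.hL)))))).exists
  rw [lt_div_iff₀ hρ] at h3 h4
  have hs : -meanSpeed Z.gL θ ∈ meanDomain Z.gL := ⟨θ, hθ, (neg_neg _).symm⟩
  have he := meanAngleL_eq hθ (neg_neg (meanSpeed Z.gL θ)).symm
  refine ⟨Z.height (-meanSpeed Z.gL θ), ⟨_, hθ, by rw [hZ.uL_height' hs, he]⟩, ?_, ?_⟩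
  · rw [hZ.uR_eq, hZ.uL_lower, hZ.angleL_height hs, he]; linarith
  · rw [hZ.uR_eq, hZ.uL_height' hs, he]; linarith

end Displacement

/-! ### Time reversal -/

/-- The reflection of the time-reversed field in the `x`-axis, which turns counterclockwise
again. -/
noncomputable def mirror (Z : PWL) : PWL :=
  ⟨!![-Z.rightMat 0 0, Z.rightMat 0 1; Z.rightMat 1 0, -Z.rightMat 1 1], ![-Z.rightVec 0, Z.rightVec 1],
    !![-Z.leftMat 0 0, Z.leftMat 0 1; Z.leftMat 1 0, -Z.leftMat 1 1], ![-Z.leftVec 0, Z.leftVec 1]⟩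

/-- The reflection in the `x`-axis. -/
def reflect (p : Fin 2 → ℝ) : Fin 2 → ℝ := ![p 0, -p 1]

@[simp] lemma reflect_reflect (p) : reflect (reflect p) = p := by
  ext i; fin_cases i <;> simp [reflect]

@[simp] lemma reflect_zero (p) : reflect p 0 = p 0 := rfl

@[simp] lemma reflect_section (y : ℝ) : reflect ![0, y] = ![0, -y] := by simp [reflect]

lemma continuous_reflect : Continuous reflect := by
  unfold reflect
  refine continuous_pi fun i => ?_
  fin_cases i
  · exact continuous_apply 0
  · exact (continuous_apply 1).neg

lemma norm_reflect (p) : ‖reflect p‖ = ‖p‖ := by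
  have : ∀ q : Fin 2 → ℝ, ‖q‖ = max ‖q 0‖ ‖q 1‖ := fun q => by
    refine le_antisymm ((pi_norm_le_iff_of_nonneg (by positivity)).2 fun i => ?_)
      (max_le (norm_le_pi_norm _ _) (norm_le_pi_norm _ _))
    fin_cases i
    · exact le_max_left _ _
    · exact le_max_right _ _
  rw [this, this]; simp [reflect]

lemma reverse_right_reflect (Z : PWL) (p) : Z.reverse.right (reflect p) = reflect (Z.mirror.right p) := by
  ext i
  fin_cases i
  · simp [right, reverse, mirror, reflect, dotProduct, Fin.sum_univ_two]
  · simp [right, reverse, mirror, reflect, dotProduct, Fin.sum_univ_two]; ring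

lemma reverse_left_reflect (Z : PWL) (p) : Z.reverse.left (reflect p) = reflect (Z.mirror.left p) := by
  ext i
  fin_cases i
  · simp [left, reverse, mirror, reflect, dotProduct, Fin.sum_univ_two]
  · simp [left, reverse, mirror, reflect, dotProduct, Fin.sum_univ_two]; ring

lemma reverse_field_reflect (Z : PWL) (p) : Z.reverse.field (reflect p) = reflect (Z.mirror.field p) := by
  have e : Z.reverse.right (reflect p) 0 = Z.mirror.right p 0 := by rw [reverse_right_reflect]; rfl
  by_cases h : 0 < p 0 ∨ (p 0 = 0 ∧ 0 < Z.mirror.right p 0)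
  · rw [field, if_pos (by rwa [e, reflect_zero]), field, if_pos h, reverse_right_reflect]
  · rw [field, if_neg (by rwa [e, reflect_zero]), field, if_neg h, reverse_left_reflect]

/-- The reflection turns crossing trajectories of the mirrored field into crossing trajectories of the
time-reversed field. -/
lemma IsCrossingTrajectory.reflect {Z : PWL} {γ I} (h : Z.mirror.IsCrossingTrajectory γ I) :
    Z.reverse.IsCrossingTrajectory (fun t => PWL.reflect (γ t)) I := by
  refine ⟨continuous_reflect.comp_continuousOn h.1, fun t ht => ⟨fun h0 => ?_, ?_⟩⟩
  · have := (h.2 t ht).1 h0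
    refine ⟨h0, ?_⟩
    rw [reverse_right_reflect, reverse_left_reflect]
    exact this.2
  · rw [reverse_field_reflect]
    have := hasDerivWithinAt_pi.1 (h.2 t ht).2
    refine hasDerivWithinAt_pi.2 fun i => ?_
    fin_cases i
    · exact this 0
    · exact (this 1).neg

lemma isStable_reverse {Z : PWL} {Γ : Set (Fin 2 → ℝ)} (h : Z.mirror.IsStable (reflect '' Γ)) :
    Z.reverse.IsStable Γ := by
  intro U hU hΓU
  obtain ⟨V, hV, hΓV, hVγ⟩ := h (reflect ⁻¹' U) (hU.preimage continuous_reflect) (by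
    rintro _ ⟨p, hp, rfl⟩; simpa using hΓU hp)
  refine ⟨reflect ⁻¹' V, hV.preimage continuous_reflect, fun p hp => hΓV ⟨p, hp, rfl⟩, fun p hp => ?_⟩
  obtain ⟨γ, h0, h1, h2, h3⟩ := hVγ _ hp
  refine ⟨fun t => reflect (γ t), by simp [h0], h1.reflect, h2, ?_⟩
  have hiso : Isometry reflect := by
    refine Isometry.of_dist_eq fun p q => ?_
    rw [dist_eq_norm, dist_eq_norm, ← norm_reflect (p - q)]
    congr 1
    ext i; fin_cases i <;> simp [reflect]; ring
  refine h3.congr fun t => ?_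
  have := Metric.infDist_image hiso (x := reflect (γ t)) (t := Γ)
  rwa [reflect_reflect] at this

lemma infinityStable_reverse {Z : PWL} (h : Z.mirror.InfinityStable) : Z.reverse.InfinityStable := by
  intro R
  obtain ⟨R', hR'⟩ := h R
  refine ⟨R', fun p hp => ?_⟩
  obtain ⟨γ, h0, h1, h2, h3⟩ := hR' (reflect p) (by rwa [norm_reflect])
  exact ⟨fun t => reflect (γ t), by simp [h0], h1.reflect, fun t ht => by rw [norm_reflect]; exact h2 t ht,
    by simpa only [norm_reflect] using h3⟩

/-- The matrix part of `mirror`. -/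
def mirrorMat (M : Matrix (Fin 2) (Fin 2) ℝ) : Matrix (Fin 2) (Fin 2) ℝ :=
  !![-M 0 0, M 0 1; M 1 0, -M 1 1]

lemma damping_mirror (M) : damping (mirrorMat M) = -damping M := by
  simp [damping, mirrorMat]; ring

lemma stiffness_mirror (M) : stiffness (mirrorMat M) = stiffness M := by
  simp [stiffness, mirrorMat]

lemma freq_mirror (M) : freq (mirrorMat M) = freq M := by
  simp [freq, damping_mirror, stiffness_mirror]

lemma ratio_mirror (M) : ratio (mirrorMat M) = -ratio M := by
  simp [ratio, damping_mirror, freq_mirror, neg_div]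

lemma reach_mirror (M) (v : Fin 2 → ℝ) : reach (mirrorMat M) ![-v 0, v 1] = reach M v := by
  simp [reach, freq_mirror, stiffness_mirror]; simp [mirrorMat]

lemma isRotating_mirror {M} (h : IsRotating M) : IsRotating (mirrorMat M) := by
  refine ⟨by simpa [mirrorMat] using h.1, ?_⟩
  rw [damping_mirror, stiffness_mirror, neg_sq]; exact h.2

lemma IsGood.mirror {Z : PWL} (hZ : Z.IsGood) : Z.mirror.IsGood :=
  ⟨isRotating_mirror hZ.rotL, isRotating_mirror hZ.rotR, by
    have := hZ.reachL; rw [← reach_mirror] at this; exact this, by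
    have := hZ.reachR; rw [← reach_mirror] at this; exact this⟩

lemma gL_mirror (Z : PWL) : Z.mirror.gL = -Z.gL := ratio_mirror _
lemma gR_mirror (Z : PWL) : Z.mirror.gR = -Z.gR := ratio_mirror _
lemma hL_mirror (Z : PWL) : Z.mirror.hL = Z.hL := reach_mirror _ _
lemma hR_mirror (Z : PWL) : Z.mirror.hR = Z.hR := reach_mirror _ _
lemma rho_mirror (Z : PWL) : Z.mirror.rho = Z.rho := by simp [rho, mirror]
lemma beta_mirror (Z : PWL) : Z.mirror.beta = -Z.beta := by
  rw [beta, rho_mirror, beta]; simp [mirror]; ring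
lemma kappa_mirror (Z : PWL) : Z.mirror.kappa = Z.kappa := by
  rw [kappa, rho_mirror, hL_mirror, hR_mirror, kappa]
lemma offset_mirror (Z : PWL) : Z.mirror.offset = -Z.offset := by
  rw [offset, rho_mirror, hL_mirror, beta_mirror, offset, neg_div]

lemma disp_mirror (Z : PWL) (s : ℝ) : Z.mirror.disp s = -Z.disp s := by
  rw [disp, gL_mirror, gR_mirror, kappa_mirror, offset_mirror, gainL_neg, gainR_neg, disp]; ring

lemma flow_mirror (M : Matrix (Fin 2) (Fin 2) ℝ) (v t p) :
    flow (mirrorMat M) ![-v 0, v 1] t (reflect p) = reflect (flow M v (-t) p) := by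
  have h0 : (mirrorMat M *ᵥ reflect p + ![-v 0, v 1]) 0 = -(M *ᵥ p + v) 0 := by
    rw [field_zero, field_zero]; simp [mirrorMat, reflect]; ring
  have hX : ∀ ω g h x V t, solX ω (-g) h x (-V) t = solX ω g h x V (-t) := by
    intros; simp only [solX, mul_neg, Real.sin_neg, Real.cos_neg, neg_mul]; ring
  have hV : ∀ ω g h x V t, solV ω (-g) h x (-V) t = -solV ω g h x V (-t) := by
    intros; simp only [solV, mul_neg, Real.sin_neg, Real.cos_neg, neg_mul]; ring
  ext i
  fin_cases i
  · simp only [Fin.zero_eta, reflect_zero, flow_apply_zero, h0, freq_mirror, ratio_mirror, reach_mirror, hX]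
  · have e : ∀ q, reflect q 1 = -q 1 := fun q => rfl
    simp only [Fin.mk_one, flow_apply_one, e, reflect_zero, h0, freq_mirror, ratio_mirror, reach_mirror, hX, hV]
    simp [mirrorMat]
    rw [← neg_div]; congr 1; ring

lemma flow_add {M} (h : IsRotating M) (v p) (s : ℝ) {t : ℝ} (ht : 0 ≤ t) :
    flow M v (s + t) p = flow M v t (flow M v s p) := by
  have hd := hasDerivAt_flow h v p
  have := eqOn_flow h v (γ := fun r => flow M v r p) (a := s) (b := s + t)
    (fun r _ => (hd r).continuousAt.continuousWithinAt) (fun r _ => (hd r).hasDerivWithinAt)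
    (show s + t ∈ Set.Icc s (s + t) from ⟨by linarith, le_rfl⟩)
  simpa using this

lemma flow_neg_flow {M} (h : IsRotating M) (v) {t : ℝ} (ht : 0 ≤ t) (p) :
    flow M v (-t) (flow M v t p) = p := by
  have h1 := flow_add (isRotating_mirror h) ![-v 0, v 1] (reflect p) (-t) ht
  rw [neg_add_cancel, flow_zero (isRotating_mirror h), flow_mirror M v (-t) p, neg_neg, flow_mirror] at h1
  simpa using congrArg reflect h1.symm

/-- An arc of orbit of the mirrored field is the reflection of an arc of orbit, run backwards. -/
lemma flow_image_mirror {M} (h : IsRotating M) (v : Fin 2 → ℝ) {p q : Fin 2 → ℝ} {T : ℝ}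
    (hq : flow M v T p = q) :
    (fun t => flow (mirrorMat M) ![-v 0, v 1] t (reflect q)) '' Set.Icc 0 T =
      reflect '' ((fun t => flow M v t p) '' Set.Icc 0 T) := by
  have key : ∀ t ∈ Set.Icc 0 T, flow M v (-t) q = flow M v (T - t) p := by
    intro t ht
    rw [← flow_neg_flow h v ht.1 (flow M v (T - t) p), ← flow_add h v p (T - t) ht.1, sub_add_cancel, hq]
  ext r
  constructor
  · rintro ⟨t, ht, rfl⟩
    refine ⟨_, ⟨T - t, ⟨by linarith [ht.2], by linarith [ht.1]⟩, rfl⟩, ?_⟩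
    simp only
    rw [flow_mirror, key t ht]
  · rintro ⟨_, ⟨t, ht, rfl⟩, rfl⟩
    have ht' : T - t ∈ Set.Icc 0 T := ⟨by linarith [ht.2], by linarith [ht.1]⟩
    refine ⟨T - t, ht', ?_⟩
    simp only
    rw [flow_mirror, key _ ht', sub_sub_cancel]

lemma uL_mirror (Z : PWL) (y : ℝ) : Z.mirror.uL y = -Z.uL (-y) := by simp [uL, mirror]; ring
lemma uR_mirror (Z : PWL) (y : ℝ) : Z.mirror.uR y = -Z.uR (-y) := by simp [uR, mirror]; ring

section Mirror

variable {Z : PWL} (hZ : Z.IsGood) {y s : ℝ}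
include hZ

/-- The loop of a fixed point, run backwards. -/
lemma IsGood.orbit_mirror (h : s ∈ meanDomain Z.gL) (h0 : Z.disp s = 0) :
    Z.mirror.orbit (Z.mirror.height s) = reflect '' Z.orbit (Z.height s) := by
  have hd := hZ.height_mem_domain h h0
  have hfix := (hZ.ret_eq_iff h hd).2 h0
  set y := Z.height s
  have hl := hZ.leftHalf hd
  have hr := hZ.rightHalf hd.2.1
  change Z.RightHalf _ _ (Z.ret y) at hr
  rw [hfix] at hr
  have hl' : Z.mirror.LeftHalf (Z.angleL y) (-Z.lower y) (-y) := by
    refine ⟨by rw [gL_mirror, realAngles_neg]; exact hl.1, ?_, ?_⟩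
    · rw [uL_mirror, neg_neg, hl.2.2, hL_mirror, gL_mirror, neg_neg]
    · rw [uL_mirror, neg_neg, hl.2.1, hL_mirror, gL_mirror, neg_neg]
  have hr' : Z.mirror.RightHalf (Z.angleR (Z.lower y)) (-y) (-Z.lower y) := by
    refine ⟨hr.1, ?_, ?_⟩
    · rw [uR_mirror, neg_neg, hr.2.2, hR_mirror, gR_mirror, neg_neg]
    · rw [uR_mirror, neg_neg, hr.2.1, hR_mirror, gR_mirror, neg_neg]
  have e0 : Z.mirror.height s = -Z.lower y := by
    refine hZ.mirror.uL_strictAnti.injective ?_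
    rw [hZ.mirror.uL_height, gL_mirror, gainL_neg, hL_mirror, uL_mirror, neg_neg, hZ.uL_lower_height h]
    ring
  obtain ⟨e1, e2⟩ := hZ.mirror.lower_eq hl'
  obtain ⟨e3, -⟩ := hZ.mirror.upper_eq hr'
  have t1 : Z.mirror.timeL (-Z.lower y) = Z.timeL y := by
    rw [timeL, e1, timeL]; exact congrArg _ (freq_mirror _)
  have t2 : Z.mirror.timeR (-y) = Z.timeR (Z.lower y) := by
    rw [timeR, e3, timeR]; exact congrArg _ (freq_mirror _)
  have f1 := flow_image_mirror hZ.rotL Z.leftVec (hZ.trajectoryL hd).2.1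
  have f2 := flow_image_mirror hZ.rotR Z.rightVec
    (hZ.trajectoryR hd (by rw [hfix]; exact hZ.uL_neg hd)).2.1
  rw [reflect_section] at f1 f2
  rw [hfix] at f2
  rw [e0, orbit, e2, t1, t2, orbit, Set.image_union, ← f1, ← f2]
  rfl

end Mirror

/-! ### Hitting the section -/

/-- The points from which the orbit enters `x > 0`. -/
def RightStart (Z : PWL) (p : Fin 2 → ℝ) : Prop :=
  0 < p 0 ∨ (p 0 = 0 ∧ 0 < Z.right p 0 ∧ 0 < Z.left p 0)

/-- The points from which the orbit enters `x < 0`. -/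
def LeftStart (Z : PWL) (p : Fin 2 → ℝ) : Prop :=
  p 0 < 0 ∨ (p 0 = 0 ∧ Z.right p 0 < 0 ∧ Z.left p 0 < 0)

lemma rightStart_rot {Z : PWL} {p} : Z.rot.RightStart (-p) ↔ Z.LeftStart p := by
  simp [RightStart, LeftStart, rot_right, rot_left, and_comm]

/-- A crossing trajectory leads from `p` to `q` within `S`. -/
def Reaches (Z : PWL) (S : Set (Fin 2 → ℝ)) (p q : Fin 2 → ℝ) : Prop :=
  ∃ (γ : ℝ → Fin 2 → ℝ) (T : ℝ), 0 ≤ T ∧ Z.IsCrossingTrajectory γ (Set.Icc 0 T) ∧ γ 0 = p ∧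
    γ T = q ∧ ∀ t ∈ Set.Icc 0 T, γ t ∈ S

lemma Reaches.trans {Z : PWL} {S : Set (Fin 2 → ℝ)} {p q r} (h : Z.Reaches S p q)
    (h' : Z.Reaches S q r) : Z.Reaches S p r := by
  obtain ⟨γ, T, hT, hγ, h0, h1, h2⟩ := h
  obtain ⟨γ', T', hT', hγ', h0', h1', h2'⟩ := h'
  refine ⟨_, T + T', by linarith, hγ.append hT hT' hγ' (h1.trans h0'.symm), ?_, ?_, fun t ht => ?_⟩
  · rcases hT.eq_or_lt with rfl | hlt
    · simp [h0', ← h1, h0]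
    · simp [hlt, h0]
  · simp [not_lt.2 hT', h1']
  · split_ifs with hlt
    · exact h2 t ⟨ht.1, hlt.le⟩
    · exact h2' _ ⟨by linarith, by linarith [ht.2]⟩

lemma Reaches.mono {Z : PWL} {S S' : Set (Fin 2 → ℝ)} {p q} (h : Z.Reaches S p q) (hS : S ⊆ S') :
    Z.Reaches S' p q := by
  obtain ⟨γ, T, hT, hγ, h0, h1, h2⟩ := h
  exact ⟨γ, T, hT, hγ, h0, h1, fun t ht => hS (h2 t ht)⟩

lemma Reaches.rot {Z : PWL} {S : Set (Fin 2 → ℝ)} {p q} (h : Z.Reaches S p q) :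
    Z.rot.Reaches (-S) (-p) (-q) := by
  obtain ⟨γ, T, hT, hγ, h0, h1, h2⟩ := h
  exact ⟨fun t => -γ t, T, hT, hγ.rot, by simp [h0], by simp [h1], fun t ht => by simpa using h2 t ht⟩

lemma continuous_flow_left (M v p) : Continuous fun t => flow M v t p :=
  (continuous_flow M v).comp (by fun_prop : Continuous fun t : ℝ => (t, p))

lemma continuous_right (Z : PWL) : Continuous fun p => Z.right p 0 := by
  simp only [right, field_zero]; fun_prop

lemma continuous_left (Z : PWL) : Continuous fun p => Z.left p 0 := by
  simp only [left, field_zero]; fun_prop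

/-- The first time at which an orbit that starts into the right zone is back on `Σ`. -/
lemma exists_first_hit {Z : PWL} (hM : IsRotating Z.rightMat) {p : Fin 2 → ℝ} {t₁ : ℝ}
    (hp : Z.RightStart p) (ht₁ : 0 < t₁) (h : flow Z.rightMat Z.rightVec t₁ p 0 ≤ 0) :
    ∃ T ∈ Set.Ioc 0 t₁, flow Z.rightMat Z.rightVec T p 0 = 0 ∧
      ∀ t ∈ Set.Ioo 0 T, 0 < flow Z.rightMat Z.rightVec t p 0 := by
  have hc : Continuous fun t => flow Z.rightMat Z.rightVec t p 0 :=
    (continuous_apply 0).comp (continuous_flow_left _ _ _)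
  have hev : ∀ᶠ t in 𝓝[>] 0, 0 < flow Z.rightMat Z.rightVec t p 0 := by
    rcases hp with hp | hp
    · refine nhdsWithin_le_nhds (hc.continuousAt.eventually (lt_mem_nhds ?_))
      simpa only [flow_zero hM] using hp
    · have hd := hasDerivAt_pi.1 (hasDerivAt_flow hM Z.rightVec p 0) 0
      rw [flow_zero hM] at hd
      have hsl := (hasDerivWithinAt_iff_tendsto_slope' (s := Set.Ioi 0) (by simp)).1 hd.hasDerivWithinAt
      filter_upwards [hsl.eventually (lt_mem_nhds hp.2.1), self_mem_nhdsWithin] with t h1 h2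
      rw [slope_def_field, flow_zero hM, hp.1, sub_zero, sub_zero] at h1
      exact (div_pos_iff_of_pos_right h2).1 h1
  obtain ⟨δ, hδ, hδ'⟩ := (mem_nhdsGT_iff_exists_Ioo_subset' ht₁).1 hev
  have hcomp : IsCompact ({t | flow Z.rightMat Z.rightVec t p 0 ≤ 0} ∩ Set.Icc (min δ t₁) t₁) :=
    isCompact_Icc.inter_left (isClosed_le hc continuous_const)
  obtain ⟨T, hT, hmin⟩ := hcomp.exists_isLeast ⟨t₁, h, min_le_right _ _, le_rfl⟩
  have hT0 : 0 < T := lt_of_lt_of_le (lt_min hδ ht₁) hT.2.1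
  have hpos : ∀ t ∈ Set.Ioo 0 T, 0 < flow Z.rightMat Z.rightVec t p 0 := by
    intro t ht
    rcases lt_or_ge t (min δ t₁) with h1 | h1
    · exact hδ' ⟨ht.1, h1.trans_le (min_le_left _ _)⟩
    · by_contra hn
      exact absurd (hmin ⟨not_lt.1 hn, h1, ht.2.le.trans hT.2.2⟩) (not_le.2 ht.2)
  refine ⟨T, ⟨hT0, hT.2.2⟩, le_antisymm hT.1 ?_, hpos⟩
  refine ge_of_tendsto (hc.continuousAt.tendsto.mono_left (nhdsWithin_le_nhds (s := Set.Iio T))) ?_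
  filter_upwards [Ioo_mem_nhdsLT hT0] with t ht using (hpos t ht).le

/-- If the orbit of `q` runs through the right zone to a crossing point, then the orbits that start
near `q` into the right zone do so, too. -/
lemma eventually_reaches_right {Z : PWL} (hM : IsRotating Z.rightMat) {q : Fin 2 → ℝ} {τ : ℝ}
    {U W : Set (Fin 2 → ℝ)} (hτ : 0 ≤ τ) (hU : IsOpen U)
    (hUq : ∀ t ∈ Set.Icc 0 τ, flow Z.rightMat Z.rightVec t q ∈ U)
    (hpos : ∀ t ∈ Set.Ioo 0 τ, 0 < flow Z.rightMat Z.rightVec t q 0)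
    (hq : τ = 0 ∨ 0 < q 0 ∨ 0 < Z.right q 0)
    (h1 : Z.right (flow Z.rightMat Z.rightVec τ q) 0 < 0)
    (h2 : Z.left (flow Z.rightMat Z.rightVec τ q) 0 < 0)
    (h0 : flow Z.rightMat Z.rightVec τ q 0 = 0) (hW : W ∈ 𝓝 (flow Z.rightMat Z.rightVec τ q)) :
    ∀ᶠ p in 𝓝 q, Z.RightStart p → ∃ r ∈ W, r 0 = 0 ∧ Z.right r 0 < 0 ∧ Z.left r 0 < 0 ∧
      Z.Reaches U p r := by
  have hcf := continuous_flow Z.rightMat Z.rightVec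
  have hcf' : Continuous fun x : (Fin 2 → ℝ) × ℝ => flow Z.rightMat Z.rightVec x.2 x.1 :=
    hcf.comp continuous_swap
  have hcq := continuous_flow_left Z.rightMat Z.rightVec q
  obtain ⟨W', hW'W, hW'o, hW'⟩ : ∃ W' ⊆ W ∩ U ∩ {r | Z.right r 0 < 0 ∧ Z.left r 0 < 0}, IsOpen W' ∧
      flow Z.rightMat Z.rightVec τ q ∈ W' := by
    refine mem_nhds_iff.1 (inter_mem (inter_mem hW (hU.mem_nhds (hUq τ ⟨hτ, le_rfl⟩))) ?_)
    exact ((continuous_right Z).continuousAt.eventually (gt_mem_nhds h1)).and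
      ((continuous_left Z).continuousAt.eventually (gt_mem_nhds h2))
  -- the orbit of `q` can be followed a little beyond the crossing point
  obtain ⟨t₁, ht₁, hX₁, hin⟩ : ∃ t₁ > τ, flow Z.rightMat Z.rightVec t₁ q 0 < 0 ∧
      ∀ t ∈ Set.Icc τ t₁, flow Z.rightMat Z.rightVec t q ∈ W' := by
    have hd := hasDerivAt_pi.1 (hasDerivAt_flow hM Z.rightVec q τ) 0
    have hsl := (hasDerivWithinAt_iff_tendsto_slope' (s := Set.Ioi τ) (by simp)).1 hd.hasDerivWithinAt
    obtain ⟨η, hη, hη'⟩ := Metric.mem_nhds_iff.1 (hcq.continuousAt.eventually (hW'o.mem_nhds hW'))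
    obtain ⟨t, ht, ht'⟩ := ((hsl.eventually (gt_mem_nhds h1)).and
      (Ioo_mem_nhdsGT (show τ < τ + η by linarith))).exists
    refine ⟨t, ht'.1, ?_, fun s hs => hη' ?_⟩
    · rw [slope_def_field, h0, sub_zero] at ht
      by_contra hn
      exact absurd ht (not_lt.2 (div_nonneg (not_lt.1 hn) (by linarith [ht'.1])))
    · rw [Metric.mem_ball, Real.dist_eq, abs_of_nonneg (by linarith [hs.1])]
      linarith [hs.2, ht'.2]
  have ht₁0 : 0 < t₁ := hτ.trans_lt ht₁
  have hloc : ∀ t₀ ∈ Set.Icc 0 t₁, ∀ᶠ x : (Fin 2 → ℝ) × ℝ in 𝓝 (q, t₀),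
      0 ≤ x.1 0 → 0 ≤ x.2 → flow Z.rightMat Z.rightVec x.2 x.1 ∈ U ∧
        (0 < x.2 → flow Z.rightMat Z.rightVec x.2 x.1 0 = 0 → flow Z.rightMat Z.rightVec x.2 x.1 ∈ W') := by
    intro t₀ ht₀
    rcases le_or_gt τ t₀ with h3 | h3
    · filter_upwards [hcf'.continuousAt.eventually (hW'o.mem_nhds (hin t₀ ⟨h3, ht₀.2⟩))] with x hx _ _
      exact ⟨(hW'W hx).1.2, fun _ _ => hx⟩
    · have hU' := (hcf'.continuousAt (x := (q, t₀))).eventually (hU.mem_nhds (hUq t₀ ⟨ht₀.1, h3.le⟩))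
      have hX : ∀ᶠ x : (Fin 2 → ℝ) × ℝ in 𝓝 (q, t₀), 0 ≤ x.1 0 → 0 < x.2 →
          0 < flow Z.rightMat Z.rightVec x.2 x.1 0 := by
        have hcX := (continuous_apply (0 : Fin 2)).comp hcf'
        by_cases h4 : 0 < flow Z.rightMat Z.rightVec t₀ q 0
        · filter_upwards [(hcX.continuousAt (x := (q, t₀))).eventually (lt_mem_nhds h4)] with x hx _ _
          exact hx
        · have h5 : t₀ = 0 := by
            by_contra h5
            exact h4 (hpos t₀ ⟨lt_of_le_of_ne ht₀.1 (Ne.symm h5), h3⟩)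
          subst h5
          rw [flow_zero hM] at h4
          have h5 : 0 < Z.right q 0 := (hq.resolve_left h3.ne').resolve_left h4
          have hcV := (continuous_right Z).comp hcf'
          have h6 := (hcV.continuousAt (x := (q, (0:ℝ)))).eventually (lt_mem_nhds (a := 0) (by
            simpa [flow_zero hM] using h5))
          rw [nhds_prod_eq, eventually_prod_iff] at h6
          obtain ⟨pa, hpa, pb, hpb, hab⟩ := h6
          obtain ⟨δ, hδ, hδ'⟩ := Metric.eventually_nhds_iff.1 hpb
          rw [nhds_prod_eq]
          filter_upwards [hpa.prod_mk (Metric.ball_mem_nhds (0:ℝ) hδ)] with x hx h7 h8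
          have hd := fun s => hasDerivAt_pi.1 (hasDerivAt_flow hM Z.rightVec x.1 s) 0
          have hmono : StrictMonoOn (fun s => flow Z.rightMat Z.rightVec s x.1 0) (Set.Icc 0 x.2) := by
            refine strictMonoOn_of_deriv_pos (convex_Icc _ _)
              (fun s _ => (hd s).continuousAt.continuousWithinAt) fun s hs => ?_
            rw [interior_Icc] at hs
            rw [(hd s).deriv]
            refine hab hx.1 (hδ' ?_)
            have := Metric.mem_ball.1 hx.2
            rw [Real.dist_eq, sub_zero] at this ⊢
            rw [abs_of_pos hs.1]
            exact hs.2.trans (lt_of_abs_lt this)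
          have := hmono ⟨le_rfl, h8.le⟩ ⟨h8.le, le_rfl⟩ h8
          simp only [flow_zero hM] at this
          linarith
      filter_upwards [hU', hX] with x hx hx' h4 _
      exact ⟨hx, fun h5 h6 => absurd h6 (hx' h4 h5).ne'⟩
  have hall := isCompact_Icc.eventually_forall_of_forall_eventually (P := fun p t =>
    0 ≤ p 0 → 0 ≤ t → flow Z.rightMat Z.rightVec t p ∈ U ∧
      (0 < t → flow Z.rightMat Z.rightVec t p 0 = 0 → flow Z.rightMat Z.rightVec t p ∈ W')) hloc
  have hcX : Continuous fun p => flow Z.rightMat Z.rightVec t₁ p 0 :=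
    (continuous_apply 0).comp (hcf.comp (by fun_prop : Continuous fun p : Fin 2 → ℝ => (t₁, p)))
  filter_upwards [hall, hcX.continuousAt.eventually (gt_mem_nhds hX₁)] with p hp hp₁ hs
  have hp0 : 0 ≤ p 0 := by
    rcases hs with h | h
    · exact h.le
    · exact h.1.ge
  obtain ⟨T, hT, hT0, hTpos⟩ := exists_first_hit hM hs ht₁0 hp₁.le
  have hTW := hW'W ((hp T ⟨hT.1.le, hT.2⟩ hp0 hT.1.le).2 hT.1 hT0)
  refine ⟨_, hTW.1.1, hT0, hTW.2.1, hTW.2.2, _, T, hT.1.le, ?_, flow_zero hM _ _, rfl, fun t ht =>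
    (hp t ⟨ht.1, ht.2.trans hT.2⟩ hp0 ht.1).1⟩
  exact isCrossingTrajectory_flow_right hM hs hTpos (Or.inr ⟨hT0, mul_pos_of_neg_of_neg hTW.2.1 hTW.2.2⟩)

/-- The statement for the left zone, by the rotation of the plane. -/
lemma eventually_reaches_left {Z : PWL} (hM : IsRotating Z.leftMat) {q : Fin 2 → ℝ} {τ : ℝ}
    {U W : Set (Fin 2 → ℝ)} (hτ : 0 ≤ τ) (hU : IsOpen U)
    (hUq : ∀ t ∈ Set.Icc 0 τ, flow Z.leftMat Z.leftVec t q ∈ U)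
    (hpos : ∀ t ∈ Set.Ioo 0 τ, flow Z.leftMat Z.leftVec t q 0 < 0)
    (hq : τ = 0 ∨ q 0 < 0 ∨ Z.left q 0 < 0)
    (h1 : 0 < Z.right (flow Z.leftMat Z.leftVec τ q) 0)
    (h2 : 0 < Z.left (flow Z.leftMat Z.leftVec τ q) 0)
    (h0 : flow Z.leftMat Z.leftVec τ q 0 = 0) (hW : W ∈ 𝓝 (flow Z.leftMat Z.leftVec τ q)) :
    ∀ᶠ p in 𝓝 q, Z.LeftStart p → ∃ r ∈ W, r 0 = 0 ∧ 0 < Z.right r 0 ∧ 0 < Z.left r 0 ∧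
      Z.Reaches U p r := by
  have e := rot_rightFlow Z
  have := eventually_reaches_right (Z := Z.rot) hM (q := -q) (τ := τ) (U := -U) (W := -W) hτ hU.neg
    (fun t ht => by rw [e]; simpa using hUq t ht) (fun t ht => by rw [e]; simpa using hpos t ht)
    (by simpa [rot_right] using hq) (by rw [e, rot_right]; simpa using h2)
    (by rw [e, rot_left]; simpa using h1) (by rw [e]; simpa using h0)
    (by rw [e]; exact continuous_neg.continuousAt.preimage_mem_nhds (by simpa using hW))
  have hn : Tendsto (fun p : Fin 2 → ℝ => -p) (𝓝 q) (𝓝 (-q)) := continuous_neg.continuousAt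
  filter_upwards [hn.eventually this] with p hp hs
  obtain ⟨r, hr, h3, h4, h5, h6⟩ := hp (rightStart_rot.2 hs)
  refine ⟨-r, hr, by simpa using h3, ?_, ?_, by simpa using h6.rot⟩
  · simpa [rot_left] using h5
  · simpa [rot_right] using h4

/-! ### Stability of loops -/

section Stability

variable {Z : PWL} (hZ : Z.IsGood) {y : ℝ}
include hZ

/-- The loops depend continuously on their starting points. -/
lemma IsGood.eventually_orbit_subset (h : y ∈ Z.domain) {U : Set (Fin 2 → ℝ)} (hU : IsOpen U)
    (hΓ : Z.orbit y ⊆ U) : ∀ᶠ z in 𝓝 y, Z.orbit z ⊆ U := by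
  have hsec : Continuous fun z : ℝ => (![0, z] : Fin 2 → ℝ) :=
    continuous_pi fun i => by fin_cases i <;> simp <;> fun_prop
  have key : ∀ (M : Matrix (Fin 2) (Fin 2) ℝ) (v : Fin 2 → ℝ) (τ η : ℝ → ℝ), ContinuousAt τ y →
      ContinuousAt η y → 0 ≤ τ y → (∀ t ∈ Set.Icc 0 (τ y), flow M v t ![0, η y] ∈ U) →
      ∀ᶠ z in 𝓝 y, ∀ σ ∈ Set.Icc (0:ℝ) 1, flow M v (σ * τ z) ![0, η z] ∈ U := by
    intro M v τ η hτ hη hτ0 hin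
    refine isCompact_Icc.eventually_forall_of_forall_eventually fun σ hσ => ?_
    have h1 : ContinuousAt (fun x : ℝ × ℝ => (x.2 * τ x.1, (![0, η x.1] : Fin 2 → ℝ))) (y, σ) :=
      (continuousAt_snd.mul (hτ.comp continuousAt_fst)).prodMk
        (hsec.continuousAt.comp (hη.comp continuousAt_fst))
    exact ((continuous_flow M v).continuousAt.comp h1).eventually (hU.mem_nhds
      (hin _ ⟨mul_nonneg hσ.1 hτ0, mul_le_of_le_one_left hτ0 hσ.2⟩))
  have hlow := (hZ.analyticAt_lower h).continuousAt
  have hL := key Z.leftMat Z.leftVec Z.timeL id ((hZ.analyticAt_angleL h).continuousAt.div_const _)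
    continuousAt_id (hZ.timeL_pos h).le (fun t ht => hΓ (Or.inl ⟨t, ht, rfl⟩))
  have hR := key Z.rightMat Z.rightVec (fun z => Z.timeR (Z.lower z)) Z.lower
    (((hZ.analyticAt_angleR h.2.1).continuousAt.comp hlow).div_const _) hlow
    (hZ.timeR_pos h.2.1).le (fun t ht => hΓ (Or.inr ⟨t, ht, rfl⟩))
  filter_upwards [hL, hR, hZ.domain_mem_nhds h] with z h1 h2 h3
  rintro _ (⟨t, ht, rfl⟩ | ⟨t, ht, rfl⟩)
  · have hp := hZ.timeL_pos h3
    have := h1 (t / Z.timeL z) ⟨div_nonneg ht.1 hp.le, (div_le_one hp).2 ht.2⟩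
    rwa [div_mul_cancel₀ _ hp.ne'] at this
  · have hp := hZ.timeR_pos h3.2.1
    have := h2 (t / Z.timeR (Z.lower z)) ⟨div_nonneg ht.1 hp.le, (div_le_one hp).2 ht.2⟩
    rwa [div_mul_cancel₀ _ hp.ne'] at this

/-- The orbits that start near a closed loop reach `Σ` near its upper point. -/
lemma IsGood.exists_nhds_reaches (h : y ∈ Z.domain) (hfix : Z.ret y = y) {U : Set (Fin 2 → ℝ)}
    (hU : IsOpen U) (hΓ : Z.orbit y ⊆ U) {W : Set ℝ} (hW : W ∈ 𝓝 y) :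
    ∃ V : Set (Fin 2 → ℝ), IsOpen V ∧ Z.orbit y ⊆ V ∧
      ∀ p ∈ V, ∃ z ∈ W, Z.Reaches U p ![0, z] := by
  obtain ⟨-, hL, hLneg⟩ := hZ.trajectoryL h
  obtain ⟨-, hR, hRpos⟩ := hZ.trajectoryR h (by rw [hfix]; exact hZ.uL_neg h)
  rw [hfix] at hR
  have hTL := hZ.timeL_pos h
  have hTR := hZ.timeR_pos h.2.1
  have hΓL : ∀ t ∈ Set.Icc 0 (Z.timeL y), flow Z.leftMat Z.leftVec t ![0, y] ∈ U :=
    fun t ht => hΓ (Or.inl ⟨t, ht, rfl⟩)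
  have hΓR : ∀ t ∈ Set.Icc 0 (Z.timeR (Z.lower y)), flow Z.rightMat Z.rightVec t ![0, Z.lower y] ∈ U :=
    fun t ht => hΓ (Or.inr ⟨t, ht, rfl⟩)
  have hA : ∀ t ∈ Set.Icc 0 (Z.timeR (Z.lower y)),
      ∀ᶠ p in 𝓝 (flow Z.rightMat Z.rightVec t ![0, Z.lower y]), Z.RightStart p →
        ∃ z ∈ W, Z.Reaches U p ![0, z] := by
    intro t ht
    have e : ∀ s, 0 ≤ s → flow Z.rightMat Z.rightVec s (flow Z.rightMat Z.rightVec t ![0, Z.lower y]) =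
        flow Z.rightMat Z.rightVec (t + s) ![0, Z.lower y] := fun s hs => (flow_add hZ.rotR _ _ _ hs).symm
    have eτ := e (Z.timeR (Z.lower y) - t) (by linarith [ht.2])
    rw [add_sub_cancel, hR] at eτ
    have := eventually_reaches_right (Z := Z) hZ.rotR
      (q := flow Z.rightMat Z.rightVec t ![0, Z.lower y]) (τ := Z.timeR (Z.lower y) - t) (U := U)
      (W := (fun r : Fin 2 → ℝ => r 1) ⁻¹' W) (by linarith [ht.2]) hU
      (fun s hs => by rw [e s hs.1]; exact hΓR _ ⟨by linarith [ht.1, hs.1], by linarith [hs.2]⟩)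
      (fun s hs => by rw [e s hs.1.le]; exact hRpos _ ⟨by linarith [ht.1, hs.1], by linarith [hs.2]⟩)
      (by
        rcases ht.1.eq_or_lt with rfl | h1
        · right; right; rw [flow_zero hZ.rotR, right_section]; exact h.2.1
        rcases ht.2.eq_or_lt with rfl | h2
        · left; simp
        · exact Or.inr (Or.inl (hRpos t ⟨h1, h2⟩)))
      (by rw [eτ, right_section]; exact h.2.2) (by rw [eτ, left_section]; exact hZ.uL_neg h)
      (by rw [eτ]; rfl)
      (by rw [eτ]; exact (continuous_apply 1).continuousAt.preimage_mem_nhds (by simpa using hW))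
    filter_upwards [this] with p hp hs
    obtain ⟨r, hr, hr0, -, -, hreach⟩ := hp hs
    exact ⟨r 1, hr, eq_section hr0 ▸ hreach⟩
  have hB : ∀ t ∈ Set.Icc 0 (Z.timeL y),
      ∀ᶠ p in 𝓝 (flow Z.leftMat Z.leftVec t ![0, y]), Z.LeftStart p →
        ∃ z ∈ W, Z.Reaches U p ![0, z] := by
    intro t ht
    have e : ∀ s, 0 ≤ s → flow Z.leftMat Z.leftVec s (flow Z.leftMat Z.leftVec t ![0, y]) =
        flow Z.leftMat Z.leftVec (t + s) ![0, y] := fun s hs => (flow_add hZ.rotL _ _ _ hs).symm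
    have eτ := e (Z.timeL y - t) (by linarith [ht.2])
    rw [add_sub_cancel, hL] at eτ
    have hA0 := hA 0 ⟨le_rfl, hTR.le⟩
    rw [flow_zero hZ.rotR] at hA0
    have := eventually_reaches_left (Z := Z) hZ.rotL
      (q := flow Z.leftMat Z.leftVec t ![0, y]) (τ := Z.timeL y - t) (U := U)
      (W := {r | Z.RightStart r → ∃ z ∈ W, Z.Reaches U r ![0, z]}) (by linarith [ht.2]) hU
      (fun s hs => by rw [e s hs.1]; exact hΓL _ ⟨by linarith [ht.1, hs.1], by linarith [hs.2]⟩)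
      (fun s hs => by rw [e s hs.1.le]; exact hLneg _ ⟨by linarith [ht.1, hs.1], by linarith [hs.2]⟩)
      (by
        rcases ht.1.eq_or_lt with rfl | h1
        · right; right; rw [flow_zero hZ.rotL, left_section]; exact hZ.uL_neg h
        rcases ht.2.eq_or_lt with rfl | h2
        · left; simp
        · exact Or.inr (Or.inl (hLneg t ⟨h1, h2⟩)))
      (by rw [eτ, right_section]; exact h.2.1) (by rw [eτ, left_section]; exact hZ.uL_lower_pos h)
      (by rw [eτ]; rfl) (by rw [eτ]; exact hA0)
    filter_upwards [this] with p hp hs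
    obtain ⟨r, hr, hr0, h1, h2, hreach⟩ := hp hs
    obtain ⟨z, hz, hz'⟩ := hr (Or.inr ⟨hr0, h1, h2⟩)
    exact ⟨z, hz, hreach.trans hz'⟩
  have hc0 : Continuous fun p : Fin 2 → ℝ => p 0 := continuous_apply 0
  have hup : ∀ᶠ p in 𝓝 (![0, y] : Fin 2 → ℝ), ∃ z ∈ W, Z.Reaches U p ![0, z] := by
    have h1 := hB 0 ⟨le_rfl, hTL.le⟩
    have h2 := hA _ ⟨hTR.le, le_rfl⟩
    rw [flow_zero hZ.rotL] at h1
    rw [hR] at h2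
    have h3 : Z.right ![0, y] 0 < 0 := by rw [right_section]; exact h.2.2
    have h4 : Z.left ![0, y] 0 < 0 := by rw [left_section]; exact hZ.uL_neg h
    filter_upwards [h1, h2, (continuous_right Z).continuousAt.eventually (gt_mem_nhds h3),
      (continuous_left Z).continuousAt.eventually (gt_mem_nhds h4)] with p a b c d
    rcases lt_trichotomy (p 0) 0 with h0 | h0 | h0
    · exact a (Or.inl h0)
    · exact a (Or.inr ⟨h0, c, d⟩)
    · exact b (Or.inl h0)
  have hdown : ∀ᶠ p in 𝓝 (![0, Z.lower y] : Fin 2 → ℝ), ∃ z ∈ W, Z.Reaches U p ![0, z] := by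
    have h1 := hB _ ⟨hTL.le, le_rfl⟩
    have h2 := hA 0 ⟨le_rfl, hTR.le⟩
    rw [hL] at h1
    rw [flow_zero hZ.rotR] at h2
    have h3 : 0 < Z.right ![0, Z.lower y] 0 := by rw [right_section]; exact h.2.1
    have h4 : 0 < Z.left ![0, Z.lower y] 0 := by rw [left_section]; exact hZ.uL_lower_pos h
    filter_upwards [h1, h2, (continuous_right Z).continuousAt.eventually (lt_mem_nhds h3),
      (continuous_left Z).continuousAt.eventually (lt_mem_nhds h4)] with p a b c d
    rcases lt_trichotomy (p 0) 0 with h0 | h0 | h0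
    · exact a (Or.inl h0)
    · exact b (Or.inr ⟨h0, c, d⟩)
    · exact b (Or.inl h0)
  refine ⟨interior {p | ∃ z ∈ W, Z.Reaches U p ![0, z]}, isOpen_interior, ?_,
    fun p hp => by have := interior_subset hp; exact this⟩
  rintro _ (⟨t, ht, rfl⟩ | ⟨t, ht, rfl⟩) <;> rw [mem_interior_iff_mem_nhds] <;> beta_reduce
  · rcases ht.1.eq_or_lt with rfl | h1
    · rw [flow_zero hZ.rotL]; exact hup
    rcases ht.2.eq_or_lt with rfl | h2
    · rw [hL]; exact hdown
    · filter_upwards [hB t ht, hc0.continuousAt.eventually (gt_mem_nhds (hLneg t ⟨h1, h2⟩))] with p a b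
      exact a (Or.inl b)
  · rcases ht.1.eq_or_lt with rfl | h1
    · rw [flow_zero hZ.rotR]; exact hdown
    rcases ht.2.eq_or_lt with rfl | h2
    · rw [hR]; exact hup
    · filter_upwards [hA t ht, hc0.continuousAt.eventually (lt_mem_nhds (hRpos t ⟨h1, h2⟩))] with p a b
      exact a (Or.inl b)

/-- A trajectory that reaches `Σ` goes on along the loops of the return map. -/
lemma IsGood.exists_forward {p : Fin 2 → ℝ} {S : Set (Fin 2 → ℝ)} {z : ℕ → ℝ}
    (hp : Z.Reaches S p ![0, z 0]) (hret : ∀ n, z (n + 1) = Z.ret (z n)) (hz : ∀ n, z n ∈ Z.domain)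
    (hS : ∀ n, Z.orbit (z n) ⊆ S) :
    ∃ γ : ℝ → Fin 2 → ℝ, γ 0 = p ∧ Z.IsCrossingTrajectory γ (Set.Ici 0) ∧ (∀ t, 0 ≤ t → γ t ∈ S) ∧
      ∀ N, ∃ t₀, ∀ t ≥ t₀, ∃ n ≥ N, γ t ∈ Z.orbit (z n) := by
  have hloop : ∀ n, ∃ (γ : ℝ → Fin 2 → ℝ) (T : ℝ), Real.pi / freq Z.leftMat ≤ T ∧
      Z.IsCrossingTrajectory γ (Set.Icc 0 T) ∧ γ 0 = ![0, z n] ∧ γ T = ![0, z (n + 1)] ∧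
      γ '' Set.Icc 0 T = Z.orbit (z n) := by
    intro n
    obtain ⟨γ, s, T, -, -, h3, h4, h5, -, h7, -, -, h8⟩ :=
      hZ.exists_loop (hz n) (by rw [← hret]; exact hZ.uL_neg (hz (n + 1)))
    exact ⟨γ, T, h3, h4, h5, by rw [h7, hret], h8⟩
  choose γ T hT hγ h0 h1 himg using hloop
  obtain ⟨γ₀, T₀, hT₀, hγ₀, h00, h01, hS₀⟩ := hp
  have hω := div_pos Real.pi_pos hZ.rotL.freq_pos
  let G : ℕ → ℝ → Fin 2 → ℝ := fun n => Nat.casesOn n γ₀ γ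
  let L : ℕ → ℝ := fun n => Nat.casesOn n T₀ T
  have hL0 : ∀ n, 0 ≤ L n := fun n => by
    cases n with
    | zero => exact hT₀
    | succ n => exact hω.le.trans (hT n)
  have hsum : Tendsto (fun n => ∑ i ∈ Finset.range n, L i) atTop atTop := by
    refine (tendsto_add_atTop_iff_nat 1).1 ?_
    refine tendsto_atTop_mono (f := fun n : ℕ => n * (Real.pi / freq Z.leftMat)) (fun n => ?_)
      (tendsto_natCast_atTop_atTop.atTop_mul_const hω)
    rw [Finset.sum_range_succ']
    have : ∑ i ∈ Finset.range n, Real.pi / freq Z.leftMat ≤ ∑ i ∈ Finset.range n, L (i + 1) :=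
      Finset.sum_le_sum fun i _ => hT i
    rw [Finset.sum_const, Finset.card_range, nsmul_eq_mul] at this
    have := hL0 0
    linarith
  obtain ⟨γ', hγ', hall, hγ'0⟩ := exists_chain G L hL0 hsum
    (fun n => by cases n with
      | zero => exact hγ₀
      | succ n => exact hγ n)
    (fun n => by cases n with
      | zero => exact h01.trans (h0 0).symm
      | succ n => exact (h1 n).trans (h0 (n + 1)).symm)
  refine ⟨γ', hγ'0.trans h00, hγ', fun t ht => ?_, fun N => ⟨∑ i ∈ Finset.range (N + 1), L i, fun t ht => ?_⟩⟩
  · obtain ⟨n, s, hs, he, -, -⟩ := hall t ht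
    rw [he]
    cases n with
    | zero => exact hS₀ s hs
    | succ n => exact hS n (himg n ▸ ⟨s, hs, rfl⟩)
  · obtain ⟨n, s, hs, he, -, hlt⟩ := hall t ((Finset.sum_nonneg fun i _ => hL0 i).trans ht)
    have hn : N + 1 ≤ n := by
      by_contra hn
      have : ∑ i ∈ Finset.range (n + 1), L i ≤ ∑ i ∈ Finset.range (N + 1), L i :=
        Finset.sum_le_sum_of_subset_of_nonneg (Finset.range_mono (by omega)) fun i _ _ => hL0 i
      linarith
    obtain ⟨m, rfl⟩ : ∃ m, n = m + 1 := ⟨n - 1, by omega⟩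
    exact ⟨m, by omega, by rw [he, ← himg m]; exact ⟨s, hs, rfl⟩⟩

omit hZ in
/-- The iterates of a monotone map that moves all points towards the fixed point `y` converge to it:
they are monotone, and the limit is a fixed point. -/
lemma tendsto_iterate_of_attracting {f : ℝ → ℝ} {y δ : ℝ} {z : ℕ → ℝ} (hz : ∀ n, z (n + 1) = f (z n))
    (hy : f y = y) (hf : ContinuousOn f (Metric.ball y δ)) (hm : StrictMonoOn f (Metric.ball y δ))
    (hr : ∀ x ∈ Metric.ball y δ, y < x → f x < x) (hl : ∀ x ∈ Metric.ball y δ, x < y → x < f x)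
    (h0 : z 0 ∈ Metric.ball y δ) : (∀ n, z n ∈ Metric.ball y δ) ∧ Tendsto z atTop (𝓝 y) := by
  rw [Real.ball_eq_Ioo] at *
  have hyb : y ∈ Set.Ioo (y - δ) (y + δ) := by constructor <;> linarith [h0.1, h0.2]
  have hfix : ∀ x ∈ Set.Ioo (y - δ) (y + δ), f x = x → x = y := by
    intro x hx he
    rcases lt_trichotomy x y with h | h | h
    · linarith [hl x hx h]
    · exact h
    · linarith [hr x hx h]
  have hlim : ∀ l ∈ Set.Ioo (y - δ) (y + δ), Tendsto z atTop (𝓝 l) → l = y := by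
    intro l hl h
    refine hfix l hl (tendsto_nhds_unique (f := fun n => z (n + 1)) (l := atTop) ?_
      (h.comp (tendsto_add_atTop_nat 1)))
    simp only [hz]
    exact (hf.continuousAt (Ioo_mem_nhds hl.1 hl.2)).tendsto.comp h
  rcases le_total y (z 0) with hc | hc
  · have hin : ∀ n, y ≤ z n ∧ z n ≤ z 0 ∧ z (n + 1) ≤ z n := by
      intro n
      have step : ∀ x, y ≤ x → x ≤ z 0 → f x ≤ x := by
        intro x h1 h2
        rcases h1.eq_or_lt with rfl | h1
        · exact hy.le
        · exact (hr x ⟨by linarith [hyb.1], by linarith [h0.2]⟩ h1).le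
      induction n with
      | zero => exact ⟨hc, le_rfl, by rw [hz]; exact step _ hc le_rfl⟩
      | succ n ih =>
        have h1 : y ≤ z (n + 1) := by
          rw [hz, ← hy]
          exact hm.monotoneOn hyb ⟨by linarith [hyb.1, ih.1], by linarith [h0.2, ih.2.1]⟩ ih.1
        exact ⟨h1, ih.2.2.trans ih.2.1, by rw [hz (n + 1)]; exact step _ h1 (ih.2.2.trans ih.2.1)⟩
    refine ⟨fun n => ⟨by linarith [(hin n).1, hyb.1], by linarith [(hin n).2.1, h0.2]⟩, ?_⟩
    have ht := tendsto_atTop_ciInf (antitone_nat_of_succ_le fun n => (hin n).2.2)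
      ⟨y, by rintro _ ⟨n, rfl⟩; exact (hin n).1⟩
    have h1 := ge_of_tendsto' ht fun n => (hin n).1
    have h2 := le_of_tendsto' ht fun n => (hin n).2.1
    exact hlim _ ⟨by linarith [hyb.1], by linarith [h0.2]⟩ ht ▸ ht
  · have hin : ∀ n, z n ≤ y ∧ z 0 ≤ z n ∧ z n ≤ z (n + 1) := by
      intro n
      have step : ∀ x, x ≤ y → z 0 ≤ x → x ≤ f x := by
        intro x h1 h2
        rcases h1.eq_or_lt with rfl | h1
        · exact hy.ge
        · exact (hl x ⟨by linarith [h0.1], by linarith [hyb.2]⟩ h1).le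
      induction n with
      | zero => exact ⟨hc, le_rfl, by rw [hz]; exact step _ hc le_rfl⟩
      | succ n ih =>
        have h1 : z (n + 1) ≤ y := by
          rw [hz, ← hy]
          exact hm.monotoneOn ⟨by linarith [h0.1, ih.2.1], by linarith [hyb.2, ih.1]⟩ hyb ih.1
        exact ⟨h1, ih.2.1.trans ih.2.2, by rw [hz (n + 1)]; exact step _ h1 (ih.2.1.trans ih.2.2)⟩
    refine ⟨fun n => ⟨by linarith [(hin n).2.1, h0.1], by linarith [(hin n).1, hyb.2]⟩, ?_⟩
    have ht := tendsto_atTop_ciSup (monotone_nat_of_le_succ fun n => (hin n).2.2)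
      ⟨y, by rintro _ ⟨n, rfl⟩; exact (hin n).1⟩
    have h1 := le_of_tendsto' ht fun n => (hin n).1
    have h2 := ge_of_tendsto' ht fun n => (hin n).2.1
    exact hlim _ ⟨by linarith [h0.1], by linarith [hyb.2]⟩ ht ▸ ht

/-- A loop that the return map approaches from both sides is stable. -/
lemma IsGood.isStable (h : y ∈ Z.domain) (hfix : Z.ret y = y) (hr : ∀ᶠ z in 𝓝[>] y, Z.ret z < z)
    (hl : ∀ᶠ z in 𝓝[<] y, z < Z.ret z) : Z.IsStable (Z.orbit y) := by
  intro U hU hΓ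
  rw [eventually_nhdsWithin_iff] at hr hl
  have hdom : ∀ᶠ z in 𝓝 y, z ∈ Z.domain := hZ.domain_mem_nhds h
  obtain ⟨δ, hδ, hδ'⟩ := Metric.eventually_nhds_iff_ball.1 (hr.and (hl.and
    (hdom.and (hZ.eventually_orbit_subset h hU hΓ))))
  obtain ⟨V, hV, hΓV, hreach⟩ := hZ.exists_nhds_reaches h hfix hU hΓ (Metric.ball_mem_nhds y hδ)
  refine ⟨V, hV, hΓV, fun p hp => ?_⟩
  obtain ⟨z₀, hz₀, hpz⟩ := hreach p hp
  let z : ℕ → ℝ := fun n => Z.ret^[n] z₀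
  have hret : ∀ n, z (n + 1) = Z.ret (z n) := fun n => Function.iterate_succ_apply' _ _ _
  obtain ⟨hball, hlim⟩ := tendsto_iterate_of_attracting hret hfix
    (fun x hx => (hZ.analyticAt_ret (hδ' x hx).2.2.1).continuousAt.continuousWithinAt)
    (hZ.ret_strictMonoOn.mono fun x hx => (hδ' x hx).2.2.1) (fun x hx => (hδ' x hx).1)
    (fun x hx => (hδ' x hx).2.1) hz₀
  obtain ⟨γ, h0, h1, h2, h3⟩ := hZ.exists_forward (z := z) hpz hret (fun n => (hδ' _ (hball n)).2.2.1)
    (fun n => (hδ' _ (hball n)).2.2.2)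
  refine ⟨γ, h0, h1, h2, ?_⟩
  rw [Metric.tendsto_atTop]
  intro ε hε
  obtain ⟨N, hN⟩ := eventually_atTop.1 (hlim.eventually (hZ.eventually_orbit_subset h
    (Metric.isOpen_thickening (δ := ε)) (Metric.self_subset_thickening hε _)))
  obtain ⟨t₀, ht₀⟩ := h3 N
  refine ⟨t₀, fun t ht => ?_⟩
  obtain ⟨n, hn, hmem⟩ := ht₀ t ht
  have hne : (Z.orbit y).Nonempty := ⟨_, hZ.section_mem_orbit h⟩
  rw [Real.dist_0_eq_abs, abs_of_nonneg Metric.infDist_nonneg]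
  exact (Metric.mem_thickening_iff_infDist_lt hne).1 (hN n hn hmem)

end Stability

/-! ### Stability of infinity -/

/-- Orbits of a linear field that start far out stay far out for a bounded time. -/
lemma exists_flow_far {M} (h : IsRotating M) (v : Fin 2 → ℝ) (T R : ℝ) :
    ∃ C, ∀ p, C ≤ ‖p‖ → ∀ t ∈ Set.Icc 0 T, R ≤ ‖flow M v t p‖ := by
  obtain ⟨C, hC⟩ := (((isCompact_Icc (a := (0:ℝ)) (b := T)).prod (isCompact_closedBall (0 : Fin 2 → ℝ) R)).image
    ((continuous_flow M v).comp (by fun_prop : Continuous fun x : ℝ × (Fin 2 → ℝ) => (-x.1, x.2)))).isBounded.exists_norm_le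
  refine ⟨C + 1, fun p hp t ht => ?_⟩
  by_contra hn
  have := hC p ⟨(t, flow M v t p), ⟨ht, by simpa using (not_le.1 hn).le⟩, flow_neg_flow h v ht.1 p⟩
  linarith

/-- Orbits of a linear field that start far out in `x ≥ 0` leave this half plane within one turn. -/
lemma exists_return_time {M} (h : IsRotating M) (v : Fin 2 → ℝ) :
    ∃ C, ∀ p : Fin 2 → ℝ, 0 ≤ p 0 → C ≤ ‖p‖ →
      ∃ t ∈ Set.Ioc 0 (2 * Real.pi / freq M), flow M v t p 0 ≤ 0 := by
  have hω := h.freq_pos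
  have hM := h.1.ne
  set ω := freq M with hωdef
  set g := ratio M with hg
  set H := reach M v with hH
  let K : ℝ := |H / ω|
  let P : ℝ × ℝ → Fin 2 → ℝ := fun x =>
    ![x.1 - H / ω, (ω * x.2 + g * ω * x.1 - M 0 0 * (x.1 - H / ω) - v 0) / M 0 1]
  have hP : Continuous P := by
    refine continuous_pi fun i => ?_
    fin_cases i
    · simp only [P, Fin.zero_eta, Matrix.cons_val_zero]; fun_prop
    · simp only [P, Fin.mk_one, Matrix.cons_val_one]; fun_prop
  let L : ℝ := K * (1 + Real.exp (-(g * Real.pi)) + Real.exp (-(g * (Real.pi / 2))) +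
    Real.exp (-(g * (3 * Real.pi / 2))))
  obtain ⟨C, hC⟩ := (((isCompact_Icc (a := -L) (b := L)).prod (isCompact_Icc (a := -L) (b := L))).image
    hP).isBounded.exists_norm_le
  refine ⟨C + 1, fun p hp0 hp => ?_⟩
  let a := p 0 + H / ω
  let b := ((M *ᵥ p + v) 0 - g * ω * a) / ω
  have hPp : P (a, b) = p := by
    ext i
    fin_cases i
    · simp [P, a]
    · change (ω * b + g * ω * a - M 0 0 * (a - H / ω) - v 0) / M 0 1 = p 1
      simp only [a, b, field_zero]; field_simp; ring
  have hX : ∀ t, flow M v t p 0 = -(H / ω) + Real.exp (g * (ω * t)) * (Real.cos (ω * t) * a +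
      Real.sin (ω * t) * b) := by
    intro t
    rw [flow_apply_zero, solX]
    simp only [a, b, ← hωdef, ← hg, ← hH]
    ring
  have hK : 0 ≤ K := abs_nonneg _
  have hK1 : -K ≤ H / ω := neg_abs_le _
  have e0 := Real.exp_pos (-(g * Real.pi))
  have e1 := Real.exp_pos (-(g * (Real.pi / 2)))
  have e2 := Real.exp_pos (-(g * (3 * Real.pi / 2)))
  have hexp : ∀ θ r, K * Real.exp (-(g * θ)) ≤ r → -(H / ω) - Real.exp (g * θ) * r ≤ 0 := by
    intro θ r hr
    have h1 := mul_le_mul_of_nonneg_left hr (Real.exp_pos (g * θ)).le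
    have h2 : Real.exp (g * θ) * (K * Real.exp (-(g * θ))) = K := by
      rw [mul_left_comm, ← Real.exp_add, add_neg_cancel, Real.exp_zero, mul_one]
    linarith
  have hpi := Real.pi_pos
  have htime : ∀ θ, 0 < θ → θ ≤ 2 * Real.pi → θ / ω ∈ Set.Ioc 0 (2 * Real.pi / ω) := fun θ h1 h2 =>
    ⟨div_pos h1 hω, div_le_div_of_nonneg_right h2 hω.le⟩
  have hcos : Real.cos (3 * Real.pi / 2) = 0 := by
    rw [show 3 * Real.pi / 2 = Real.pi / 2 + Real.pi by ring, Real.cos_add_pi, Real.cos_pi_div_two, neg_zero]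
  have hsin : Real.sin (3 * Real.pi / 2) = -1 := by
    rw [show 3 * Real.pi / 2 = Real.pi / 2 + Real.pi by ring, Real.sin_add_pi, Real.sin_pi_div_two]
  have hL : ∀ c, 0 ≤ c → c ≤ Real.exp (-(g * Real.pi)) + Real.exp (-(g * (Real.pi / 2))) +
      Real.exp (-(g * (3 * Real.pi / 2))) → K * c ≤ L := fun c _ hc =>
    mul_le_mul_of_nonneg_left (by linarith) hK
  by_cases ha : L < a
  · refine ⟨Real.pi / ω, htime _ hpi (by linarith), ?_⟩
    rw [hX, mul_div_cancel₀ _ hω.ne', Real.cos_pi, Real.sin_pi]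
    have := hexp Real.pi a ((hL _ e0.le (by linarith)).trans ha.le)
    linarith
  by_cases hb : L < b
  · refine ⟨3 * Real.pi / 2 / ω, htime _ (by linarith) (by linarith), ?_⟩
    rw [hX, mul_div_cancel₀ _ hω.ne', hcos, hsin]
    have := hexp (3 * Real.pi / 2) b ((hL _ e2.le (by linarith)).trans hb.le)
    linarith
  by_cases hb' : b < -L
  · refine ⟨Real.pi / 2 / ω, htime _ (by linarith) (by linarith), ?_⟩
    rw [hX, mul_div_cancel₀ _ hω.ne', Real.cos_pi_div_two, Real.sin_pi_div_two]
    have := hexp (Real.pi / 2) (-b) ((hL _ e1.le (by linarith)).trans (by linarith))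
    linarith
  · exfalso
    have haL : -L ≤ a := by
      have : K * 1 ≤ L := mul_le_mul_of_nonneg_left (by linarith) hK
      simp only [a]; linarith
    have := hC p ⟨(a, b), ⟨⟨haL, not_lt.1 ha⟩, ⟨not_lt.1 hb', not_lt.1 hb⟩⟩, hPp⟩
    linarith

lemma norm_section (z : ℝ) : ‖(![0, z] : Fin 2 → ℝ)‖ = |z| := by
  refine le_antisymm ((pi_norm_le_iff_of_nonneg (abs_nonneg z)).2 fun i => ?_) ?_
  · fin_cases i <;> simp
  · simpa using norm_le_pi_norm (![0, z] : Fin 2 → ℝ) 1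

/-- Far out both fields point to the left on the upper part of `Σ` and to the right on the lower
part. -/
lemma exists_section_sign {Z : PWL} (hR : Z.rightMat 0 1 < 0) (hL : Z.leftMat 0 1 < 0) :
    ∃ K > 0, (∀ z, K ≤ z → Z.uR z < 0 ∧ Z.uL z < 0) ∧ ∀ z, z ≤ -K → 0 < Z.uR z ∧ 0 < Z.uL z := by
  have key : ∀ m v z : ℝ, m < 0 → |v| / (-m) < z → m * z + v < 0 ∧ 0 < m * (-z) + v := by
    intro m v z hm hz
    rw [div_lt_iff₀ (by linarith)] at hz
    have := le_abs_self v
    have := neg_abs_le v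
    constructor <;> nlinarith
  refine ⟨|Z.rightVec 0| / (-Z.rightMat 0 1) + |Z.leftVec 0| / (-Z.leftMat 0 1) + 1, ?_, ?_, ?_⟩
  · have := div_nonneg (abs_nonneg (Z.rightVec 0)) (by linarith : 0 ≤ -Z.rightMat 0 1)
    have := div_nonneg (abs_nonneg (Z.leftVec 0)) (by linarith : 0 ≤ -Z.leftMat 0 1)
    linarith
  all_goals
    intro z hz
    have h1 := div_nonneg (abs_nonneg (Z.rightVec 0)) (by linarith : 0 ≤ -Z.rightMat 0 1)
    have h2 := div_nonneg (abs_nonneg (Z.leftVec 0)) (by linarith : 0 ≤ -Z.leftMat 0 1)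
  · exact ⟨(key _ _ z hR (by linarith)).1, (key _ _ z hL (by linarith)).1⟩
  · have a1 := (key _ (Z.rightVec 0) (-z) hR (by linarith)).2
    have a2 := (key _ (Z.leftVec 0) (-z) hL (by linarith)).2
    rw [neg_neg] at a1 a2
    exact ⟨a1, a2⟩

/-- An orbit that enters the right zone far out reaches the upper part of `Σ`, still far out. -/
lemma exists_reaches_far_right {Z : PWL} (hR : IsRotating Z.rightMat) (hL : Z.leftMat 0 1 < 0) (R : ℝ) :
    ∃ R', ∀ p, Z.RightStart p → R' ≤ ‖p‖ → ∃ z ≥ R, Z.Reaches {q | R ≤ ‖q‖} p ![0, z] := by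
  obtain ⟨K, hK, hK1, hK2⟩ := exists_section_sign hR.1 hL
  obtain ⟨C, hC⟩ := exists_return_time hR Z.rightVec
  obtain ⟨D, hD⟩ := exists_flow_far hR Z.rightVec (2 * Real.pi / freq Z.rightMat) (max R K)
  refine ⟨max C D, fun p hp hpn => ?_⟩
  have hp0 : 0 ≤ p 0 := by
    rcases hp with h | h
    · exact h.le
    · exact h.1.ge
  obtain ⟨t, ht, ht0⟩ := hC p hp0 ((le_max_left _ _).trans hpn)
  obtain ⟨T, hT, hT0, hpos⟩ := exists_first_hit hR hp ht.1 ht0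
  have hfar := hD p ((le_max_right _ _).trans hpn)
  set z := flow Z.rightMat Z.rightVec T p 1
  have hz : flow Z.rightMat Z.rightVec T p = ![0, z] := eq_section hT0
  have hzn : max R K ≤ |z| := by
    rw [← norm_section, ← hz]; exact hfar T ⟨hT.1.le, hT.2.trans ht.2⟩
  -- at the hit the abscissa is not increasing
  have hle : Z.uR z ≤ 0 := by
    have hd := hasDerivAt_pi.1 (hasDerivAt_flow hR Z.rightVec p T) 0
    have hsl := (hasDerivWithinAt_iff_tendsto_slope' (s := Set.Iio T) (by simp)).1 hd.hasDerivWithinAt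
    have : Z.right (flow Z.rightMat Z.rightVec T p) 0 ≤ 0 := by
      refine le_of_tendsto hsl ?_
      filter_upwards [Ioo_mem_nhdsLT hT.1] with s hs
      rw [slope_def_field, hT0, sub_zero]
      exact div_nonpos_of_nonneg_of_nonpos (hpos s hs).le (by linarith [hs.2])
    rwa [hz, right_section] at this
  have hz0 : max R K ≤ z := by
    rcases le_total 0 z with h | h
    · rwa [abs_of_nonneg h] at hzn
    · rw [abs_of_nonpos h] at hzn
      have := (hK2 z (by linarith [le_max_right R K])).1
      linarith
  have hs := hK1 z ((le_max_right _ _).trans hz0)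
  refine ⟨z, (le_max_left _ _).trans hz0, _, T, hT.1.le, isCrossingTrajectory_flow_right hR hp hpos
    (Or.inr ?_), flow_zero hR _ _, hz, fun s hs' => (le_max_left _ _).trans
      (hfar s ⟨hs'.1, hs'.2.trans (hT.2.trans ht.2)⟩)⟩
  rw [hz, mem_crossingRegion_section]
  exact mul_pos_of_neg_of_neg hs.1 hs.2

lemma exists_reaches_far_left {Z : PWL} (hR : Z.rightMat 0 1 < 0) (hL : IsRotating Z.leftMat) (R : ℝ) :
    ∃ R', ∀ p, Z.LeftStart p → R' ≤ ‖p‖ → ∃ z ≤ -R, Z.Reaches {q | R ≤ ‖q‖} p ![0, z] := by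
  obtain ⟨R', hR'⟩ := exists_reaches_far_right (Z := Z.rot) hL hR R
  refine ⟨R', fun p hp hpn => ?_⟩
  obtain ⟨z, hz, h⟩ := hR' (-p) (rightStart_rot.2 hp) (by rwa [norm_neg])
  refine ⟨-z, by linarith, ?_⟩
  have := h.rot
  rw [rot_rot, neg_neg, neg_section] at this
  exact this.mono fun q hq => by simpa using hq

section Infinity

variable {Z : PWL} (hZ : Z.IsGood) {y : ℝ}
include hZ

/-- Every orbit that starts far out reaches the upper part of `Σ`, staying far out until then. -/
lemma IsGood.exists_reaches_far (R : ℝ) :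
    ∃ R', ∀ p : Fin 2 → ℝ, R' ≤ ‖p‖ → ∃ z ≥ R, Z.Reaches {q | R ≤ ‖q‖} p ![0, z] := by
  obtain ⟨K, hK, hK1, hK2⟩ := exists_section_sign hZ.rotR.1 hZ.rotL.1
  obtain ⟨A, hA⟩ := exists_reaches_far_right hZ.rotR hZ.rotL.1 R
  obtain ⟨B, hB⟩ := exists_reaches_far_left hZ.rotR.1 hZ.rotL (max (max A R) K)
  have hright : ∀ z, z ≤ -K → Z.RightStart ![0, z] := fun z hz =>
    Or.inr ⟨rfl, by rw [right_section]; exact (hK2 z hz).1, by rw [left_section]; exact (hK2 z hz).2⟩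
  have hleft : ∀ p, Z.LeftStart p → B ≤ ‖p‖ → ∃ z ≥ R, Z.Reaches {q | R ≤ ‖q‖} p ![0, z] := by
    intro p hp hpn
    obtain ⟨z, hz, h⟩ := hB p hp hpn
    have h1 : z ≤ -K := hz.trans (neg_le_neg (le_max_right _ _))
    obtain ⟨z', hz', h'⟩ := hA ![0, z] (hright z h1) (by
      rw [norm_section, abs_of_nonpos (by linarith)]
      linarith [le_max_left (max A R) K, le_max_left A R])
    refine ⟨z', hz', (h.mono fun q hq => ?_).trans h'⟩
    exact ((le_max_right A R).trans (le_max_left _ K)).trans hq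
  refine ⟨max (max A B) K, fun p hp => ?_⟩
  have hpA : A ≤ ‖p‖ := ((le_max_left _ _).trans (le_max_left _ _)).trans hp
  have hpB : B ≤ ‖p‖ := ((le_max_right _ _).trans (le_max_left _ _)).trans hp
  have hpK : K ≤ ‖p‖ := (le_max_right _ _).trans hp
  rcases lt_trichotomy (p 0) 0 with h0 | h0 | h0
  · exact hleft p (Or.inl h0) hpB
  · rw [eq_section h0] at hpA hpB hpK ⊢
    rw [norm_section] at hpK
    rcases le_total 0 (p 1) with h1 | h1
    · rw [abs_of_nonneg h1] at hpK
      exact hleft _ (Or.inr ⟨rfl, by rw [right_section]; exact (hK1 _ hpK).1,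
        by rw [left_section]; exact (hK1 _ hpK).2⟩) hpB
    · rw [abs_of_nonpos h1] at hpK
      exact hA _ (hright _ (by linarith)) hpA
  · exact hA p (Or.inl h0) hpA

/-- The loops through high points of `Σ` stay far out. -/
lemma IsGood.exists_orbit_far (R : ℝ) :
    ∃ y₀, ∀ z ∈ Z.domain, y₀ ≤ z → Z.orbit z ⊆ {q | R ≤ ‖q‖} := by
  obtain ⟨A, hA⟩ := exists_flow_far hZ.rotR Z.rightVec (Real.pi / freq Z.rightMat) R
  obtain ⟨B, hB⟩ := exists_flow_far hZ.rotL Z.leftVec (2 * Real.pi / freq Z.leftMat) (max A R)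
  refine ⟨max B 0, fun z hz hzB => ?_⟩
  have hfar := hB ![0, z] (by
    rw [norm_section, abs_of_nonneg ((le_max_right _ _).trans hzB)]; exact (le_max_left _ _).trans hzB)
  have hTL : Z.timeL z ≤ 2 * Real.pi / freq Z.leftMat :=
    div_le_div_of_nonneg_right (hZ.leftHalf hz).1.1.2.le hZ.rotL.freq_pos.le
  have hTR : Z.timeR (Z.lower z) ≤ Real.pi / freq Z.rightMat :=
    div_le_div_of_nonneg_right (hZ.rightHalf hz.2.1).1.2.le hZ.rotR.freq_pos.le
  rintro _ (⟨t, ht, rfl⟩ | ⟨t, ht, rfl⟩)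
  · exact (le_max_right _ _).trans (hfar t ⟨ht.1, ht.2.trans hTL⟩)
  · refine hA _ ?_ t ⟨ht.1, ht.2.trans hTR⟩
    rw [← (hZ.trajectoryL hz).2.1]
    exact (le_max_left _ _).trans (hfar _ ⟨(hZ.timeL_pos hz).le, hTL⟩)

/-- If the return map moves all points far out further out, infinity is stable. -/
lemma IsGood.infinityStable (hy : y ∈ Z.domain) (h : ∀ z, y ≤ z → z < Z.ret z) : Z.InfinityStable := by
  intro R
  obtain ⟨y₀, hy₀⟩ := hZ.exists_orbit_far R
  obtain ⟨R', hR'⟩ := hZ.exists_reaches_far (max R (max y y₀))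
  refine ⟨R', fun p hp => ?_⟩
  obtain ⟨z₀, hz₀, hpz⟩ := hR' p hp
  let z : ℕ → ℝ := fun n => Z.ret^[n] z₀
  have hret : ∀ n, z (n + 1) = Z.ret (z n) := fun n => Function.iterate_succ_apply' _ _ _
  have hz : ∀ n, max y y₀ ≤ z n ∧ z n < z (n + 1) := by
    intro n
    induction n with
    | zero =>
      have h0 : max y y₀ ≤ z 0 := (le_max_right _ _).trans hz₀
      exact ⟨h0, by rw [hret]; exact h _ ((le_max_left _ _).trans h0)⟩
    | succ n ih =>
      have h0 := ih.1.trans ih.2.le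
      exact ⟨h0, by rw [hret (n + 1)]; exact h _ ((le_max_left _ _).trans h0)⟩
  have hdom : ∀ w, y ≤ w → w ∈ Z.domain := fun w hw => hZ.domain_of_le hy hw
  have hyz : ∀ n, y ≤ z n := fun n => (le_max_left _ _).trans (hz n).1
  have hmono : Monotone z := monotone_nat_of_le_succ fun n => (hz n).2.le
  have hlim : Tendsto z atTop atTop := by
    rcases tendsto_atTop_of_monotone hmono with hl | ⟨l, hl⟩
    · exact hl
    · exfalso
      have hyl : y ≤ l := ge_of_tendsto' hl hyz
      refine (h l hyl).ne (tendsto_nhds_unique (f := fun n => z (n + 1)) (l := atTop)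
        (hl.comp (tendsto_add_atTop_nat 1)) ?_)
      simp only [hret]
      exact (hZ.analyticAt_ret (hdom l hyl)).continuousAt.tendsto.comp hl
  obtain ⟨γ, h0, h1, h2, h3⟩ := hZ.exists_forward (z := z) (S := {q | R ≤ ‖q‖})
    (hpz.mono fun q hq => (le_max_left R (max y y₀)).trans hq) hret (fun n => hdom _ (hyz n))
    (fun n => hy₀ _ (hdom _ (hyz n)) ((le_max_right _ _).trans (hz n).1))
  refine ⟨γ, h0, h1, h2, tendsto_atTop.2 fun A => ?_⟩
  obtain ⟨yA, hyA⟩ := hZ.exists_orbit_far A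
  obtain ⟨N, hN⟩ := eventually_atTop.1 (hlim.eventually (eventually_ge_atTop yA))
  obtain ⟨t₀, ht₀⟩ := h3 N
  filter_upwards [eventually_ge_atTop t₀] with t ht
  obtain ⟨n, hn, hmem⟩ := ht₀ t ht
  exact hyA _ (hdom _ (hyz n)) (hN n hn) hmem

end Infinity

/-! ### Limit cycles and zeros of the displacement function -/

lemma AnalyticAt.isTheta_pow {f : ℝ → ℝ} {x : ℝ} {n : ℕ} (hf : AnalyticAt ℝ f x)
    (h : analyticOrderAt f x = n) : f =Θ[𝓝 x] fun z => (z - x) ^ n := by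
  obtain ⟨g, hg, hg0, he⟩ := hf.analyticOrderAt_eq_natCast.1 h
  have h1 : g =Θ[𝓝 x] fun _ => (1 : ℝ) := by
    have := hg.continuousAt.tendsto
    exact ⟨this.isBigO_one ℝ, (isBigO_const_left_iff_pos_le_norm one_ne_zero).2 ⟨‖g x‖ / 2, by positivity,
      (this.norm.eventually (le_mem_nhds (half_lt_self (norm_pos_iff.2 hg0))))⟩⟩
  have h2 : (fun z => (z - x) ^ n * g z) =Θ[𝓝 x] fun z => (z - x) ^ n * 1 := (isTheta_refl _ _).mul h1
  simp only [mul_one] at h2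
  have he' : (fun z => (z - x) ^ n * g z) =ᶠ[𝓝 x] f := he.mono fun z hz => hz.symm
  exact ⟨h2.1.congr' he' EventuallyEq.rfl, h2.2.congr' EventuallyEq.rfl he'⟩

/-- Functions of the same growth at a point have the same order there. -/
lemma analyticOrderAt_eq_of_isTheta {f g : ℝ → ℝ} {x : ℝ} (hf : AnalyticAt ℝ f x)
    (hg : AnalyticAt ℝ g x) (h : f =Θ[𝓝 x] g) : analyticOrderAt f x = analyticOrderAt g x := by
  have htop : ∀ {f g : ℝ → ℝ}, f =O[𝓝 x] g → analyticOrderAt g x = ⊤ → analyticOrderAt f x = ⊤ := by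
    intro f g h hg
    rw [analyticOrderAt_eq_top] at hg ⊢
    exact h.eq_zero_imp.mp (hg.mono fun z hz h => h hz)
  have hlt : ∀ m n : ℕ, m < n → ¬ (fun z => (z - x) ^ m) =O[𝓝 x] fun z => (z - x) ^ n := by
    intro m n hmn hO
    have h1 : (fun z => (z - x) ^ n) =o[𝓝 x] fun z => (z - x) ^ m := by
      have : Tendsto (fun z : ℝ => z - x) (𝓝 x) (𝓝 0) := by
        have : ContinuousAt (fun z : ℝ => z - x) x := by fun_prop
        simpa using this.tendsto
      exact (isLittleO_pow_pow hmn).comp_tendsto this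
    have h3 : ∀ᶠ z in 𝓝 x, (z - x) ^ m = 0 := by
      have := (hO.trans_isLittleO h1).def (c := 1 / 2) (by norm_num)
      filter_upwards [this] with z hz
      have := norm_nonneg ((z - x) ^ m)
      exact norm_eq_zero.1 (by linarith)
    obtain ⟨z, hz, hz'⟩ := ((h3.filter_mono nhdsWithin_le_nhds : ∀ᶠ z in 𝓝[≠] x, _).and
      self_mem_nhdsWithin).exists
    exact pow_ne_zero _ (sub_ne_zero.2 hz') hz
  cases hF : analyticOrderAt f x with
  | top => exact (htop h.2 hF).symm
  | coe m =>
    cases hG : analyticOrderAt g x with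
    | top => exact absurd (htop h.1 hG) (by rw [hF]; exact ENat.natCast_ne_top m)
    | coe n =>
      have h1 := (AnalyticAt.isTheta_pow hf hF).symm.trans (h.trans (AnalyticAt.isTheta_pow hg hG))
      rcases lt_trichotomy m n with hlt' | rfl | hlt'
      · exact absurd h1.1 (hlt m n hlt')
      · rfl
      · exact absurd h1.2 (hlt n m hlt')

/-- An analytic function with nonvanishing derivative distorts differences by bounded factors only. -/
lemma isTheta_comp_sub {f : ℝ → ℝ} {x f' : ℝ} (hf : AnalyticAt ℝ f x) (hd : HasDerivAt f f' x)
    (h0 : f' ≠ 0) {ι : Type*} {l : Filter ι} {a b : ι → ℝ} (ha : Tendsto a l (𝓝 x))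
    (hb : Tendsto b l (𝓝 x)) : (fun i => f (a i) - f (b i)) =Θ[l] fun i => a i - b i := by
  have h1 : HasStrictDerivAt f f' x := by
    have := hf.hasStrictDerivAt
    rwa [hd.deriv] at this
  have h2 := (h1.hasStrictFDerivAt_equiv h0).isTheta_sub
    (ContinuousLinearEquiv.unitsEquivAut ℝ (Units.mk0 f' h0)).toHomeomorph.isInducing
  have h3 : Tendsto (fun i => (a i, b i)) l (𝓝 (x, x)) := by
    rw [nhds_prod_eq]; exact ha.prodMk hb
  exact ⟨h2.1.comp_tendsto h3, h2.2.comp_tendsto h3⟩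

section Zeros

variable {Z : PWL} (hZ : Z.IsGood) {s : ℝ} {Γ : Set (Fin 2 → ℝ)}
include hZ

lemma IsGood.deriv_height_ne_zero (h : s ∈ meanDomain Z.gL) : deriv Z.height s ≠ 0 := by
  have hA : AnalyticAt ℝ (fun s => meanAngleL Z.gL s) s :=
    AnalyticAt.fun_comp (f := fun s => (Z.gL, s)) (g := fun p : ℝ × ℝ => meanAngleL p.1 p.2)
      (analyticAt_meanAngleL h) (AnalyticAt.prod analyticAt_const analyticAt_id)
  have hθ := meanAngleL_mem h
  have hsin := sin_ne_zero_of_realAngles hθ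
  have hd := hA.differentiableAt.hasDerivAt
  have hdom : ∀ᶠ s' in 𝓝 s, s' ∈ meanDomain Z.gL := (isOpen_meanDomain _).mem_nhds h
  have h1 : deriv (fun s => meanAngleL Z.gL s) s ≠ 0 := by
    intro h0
    rw [h0] at hd
    have h2 := (hasDerivAt_meanSpeed Z.gL hsin).comp s hd
    have h3 : HasDerivAt (fun s : ℝ => -s) (-1) s := (hasDerivAt_id s).neg
    have h4 := h3.congr_of_eventuallyEq (f₁ := meanSpeed Z.gL ∘ fun s => meanAngleL Z.gL s)
      (hdom.mono fun s' hs' => meanSpeed_meanAngleL hs')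
    have := h2.unique h4
    simp at this
  have h2 := (hasDerivAt_speed Z.gL hsin).comp s hd
  have h3 := ((h2.const_mul Z.hL).sub_const (Z.leftVec 0)).div_const (Z.leftMat 0 1)
  have h4 := h3.congr_of_eventuallyEq (f₁ := Z.height) (hdom.mono fun s' hs' => by
    change Z.height s' = (Z.hL * speed Z.gL (meanAngleL Z.gL s') - Z.leftVec 0) / Z.leftMat 0 1
    rw [height, speed_meanAngleL hs']; ring)
  rw [h4.deriv]
  have h5 : andronov (-Z.gL) (meanAngleL Z.gL s) ≠ 0 := by
    have := hθ.2
    first | exact this.1.ne' | exact this.2.ne'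
  exact div_ne_zero (mul_ne_zero hZ.hL_pos.ne' (mul_ne_zero (div_ne_zero h5 (pow_ne_zero _ hsin)) h1))
    hZ.rotL.1.ne

/-- The points of `Σ` near the height of `s` are the heights of the mean speeds near `s`. -/
lemma IsGood.eventually_height {p : ℝ → Prop} (h : s ∈ meanDomain Z.gL) (hd : Z.height s ∈ Z.domain)
    (hp : ∀ᶠ s' in 𝓝 s, p s') :
    ∀ᶠ z in 𝓝 (Z.height s), ∃ s' ∈ meanDomain Z.gL, Z.height s' = z ∧ z ∈ Z.domain ∧ p s' := by
  have hdom : ∀ᶠ s' in 𝓝 s, s' ∈ meanDomain Z.gL := (isOpen_meanDomain _).mem_nhds h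
  obtain ⟨δ, hδ, hδ'⟩ := Metric.eventually_nhds_iff_ball.1 (hp.and hdom)
  rw [Real.ball_eq_Ioo] at hδ'
  have h1 : s - δ / 2 ∈ Set.Ioo (s - δ) (s + δ) := by constructor <;> linarith
  have h2 : s + δ / 2 ∈ Set.Ioo (s - δ) (s + δ) := by constructor <;> linarith
  have h3 := hZ.height_strictMonoOn (hδ' _ h1).2 h (by linarith)
  have h4 := hZ.height_strictMonoOn h (hδ' _ h2).2 (by linarith)
  filter_upwards [hZ.domain_mem_nhds hd, Ioo_mem_nhds h3 h4] with z hz hz'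
  obtain ⟨s', hs', rfl⟩ := hZ.exists_height hz
  have h5 := (hZ.height_strictMonoOn.lt_iff_lt (hδ' _ h1).2 hs').1 hz'.1
  have h6 := (hZ.height_strictMonoOn.lt_iff_lt hs' (hδ' _ h2).2).1 hz'.2
  exact ⟨s', hs', rfl, hz, (hδ' s' ⟨by linarith, by linarith⟩).1⟩

lemma IsGood.hasAmplitude_height (h : s ∈ meanDomain Z.gL) (h0 : Z.disp s = 0) :
    HasAmplitude (Z.orbit (Z.height s)) (Z.height s) :=
  hZ.hasAmplitude (hZ.height_mem_domain h h0) ((hZ.ret_eq_iff h (hZ.height_mem_domain h h0)).2 h0)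

/-- The crossing limit cycles are the loops through the isolated zeros of the displacement
function. -/
lemma IsGood.isCrossingLimitCycle_iff :
    Z.IsCrossingLimitCycle Γ ↔ ∃ s ∈ meanDomain Z.gL, Z.disp s = 0 ∧ (∀ᶠ s' in 𝓝[≠] s, Z.disp s' ≠ 0) ∧
      Γ = Z.orbit (Z.height s) := by
  constructor
  · rintro ⟨hper, U, hU, hΓU, huniq⟩
    obtain ⟨y, hy, hfix, rfl⟩ := hZ.exists_fixed_of_periodic hper
    obtain ⟨s, hs, rfl⟩ := hZ.exists_height hy
    have h0 := (hZ.ret_eq_iff hs hy).1 hfix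
    refine ⟨s, hs, h0, ?_, rfl⟩
    have h1 := (analyticAt_height hs).continuousAt.eventually (hZ.eventually_orbit_subset hy hU hΓU)
    have hdom : ∀ᶠ s' in 𝓝 s, s' ∈ meanDomain Z.gL := (isOpen_meanDomain _).mem_nhds hs
    rw [eventually_nhdsWithin_iff]
    filter_upwards [h1, hdom] with s' h2 hs' hne h3
    have hy' := hZ.height_mem_domain hs' h3
    have he := huniq _ (hZ.periodic_of_fixed hy' ((hZ.ret_eq_iff hs' hy').2 h3)) h2
    have ha := hZ.hasAmplitude_height hs' h3
    rw [he] at ha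
    exact hne (hZ.height_strictMonoOn.injOn hs' hs (ha.unique (hZ.hasAmplitude_height hs h0)))
  · rintro ⟨s, hs, h0, hiso, rfl⟩
    have hy := hZ.height_mem_domain hs h0
    refine hZ.limitCycle_of_isolated hy ((hZ.ret_eq_iff hs hy).2 h0) ?_
    rw [eventually_nhdsWithin_iff] at hiso ⊢
    filter_upwards [hZ.eventually_height hs hy hiso] with z ⟨s', hs', he, hz, hp⟩ hne hret
    rw [← he] at hz hret hne
    exact hp (fun h => hne (by rw [h]; rfl)) ((hZ.ret_eq_iff hs' hz).1 hret)

lemma IsGood.isStable_of_sign (h : s ∈ meanDomain Z.gL) (h0 : Z.disp s = 0)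
    (hr : ∀ᶠ s' in 𝓝[>] s, Z.disp s' < 0) (hl : ∀ᶠ s' in 𝓝[<] s, 0 < Z.disp s') :
    Z.IsStable (Z.orbit (Z.height s)) := by
  have hy := hZ.height_mem_domain h h0
  rw [eventually_nhdsWithin_iff] at hr hl
  refine hZ.isStable hy ((hZ.ret_eq_iff h hy).2 h0) ?_ ?_ <;> rw [eventually_nhdsWithin_iff]
  · filter_upwards [hZ.eventually_height h hy hr] with z ⟨s', hs', he, hz, hp⟩ hlt
    rw [← he] at hz hlt ⊢
    exact (hZ.ret_sign hs' hz).2.2 (hp ((hZ.height_strictMonoOn.lt_iff_lt h hs').1 hlt))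
  · filter_upwards [hZ.eventually_height h hy hl] with z ⟨s', hs', he, hz, hp⟩ hlt
    rw [← he] at hz hlt ⊢
    exact (hZ.ret_sign hs' hz).1.2 (hp ((hZ.height_strictMonoOn.lt_iff_lt hs' h).1 hlt))

lemma IsGood.isUnstable_of_sign (h : s ∈ meanDomain Z.gL) (h0 : Z.disp s = 0)
    (hr : ∀ᶠ s' in 𝓝[>] s, 0 < Z.disp s') (hl : ∀ᶠ s' in 𝓝[<] s, Z.disp s' < 0) :
    Z.IsUnstable (Z.orbit (Z.height s)) := by
  refine isStable_reverse ?_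
  rw [← hZ.orbit_mirror h h0]
  have h' : s ∈ meanDomain Z.mirror.gL := by rwa [gL_mirror, meanDomain_neg]
  refine hZ.mirror.isStable_of_sign h' (by rw [disp_mirror, h0, neg_zero]) ?_ ?_
  · filter_upwards [hr] with s' hs'; rw [disp_mirror]; linarith
  · filter_upwards [hl] with s' hs'; rw [disp_mirror]; linarith

lemma IsGood.meanDomain_nonempty : (meanDomain Z.gL).Nonempty := by
  obtain ⟨y, hy⟩ := hZ.domain_nonempty
  obtain ⟨s, hs, -⟩ := hZ.exists_height hy
  exact ⟨s, hs⟩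

lemma IsGood.infinityStable_of_disp (h : ∀ᶠ s in atTop, 0 < Z.disp s) : Z.InfinityStable := by
  obtain ⟨a, ha⟩ := eventually_atTop.1 h
  obtain ⟨s₀, hs₀⟩ := hZ.meanDomain_nonempty
  obtain ⟨y₀, hy₀⟩ := hZ.domain_nonempty
  have hs₁ : max a s₀ ∈ meanDomain Z.gL := meanDomain_of_le hs₀ (le_max_right _ _)
  refine hZ.infinityStable (y := max y₀ (Z.height (max a s₀))) (hZ.domain_of_le hy₀ (le_max_left _ _))
    fun z hz => ?_
  have hzd := hZ.domain_of_le hy₀ ((le_max_left _ _).trans hz)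
  obtain ⟨s, hs, rfl⟩ := hZ.exists_height hzd
  have := (hZ.height_strictMonoOn.le_iff_le hs₁ hs).1 ((le_max_right _ _).trans hz)
  exact (hZ.ret_sign hs hzd).1.2 (ha s ((le_max_left _ _).trans this))

lemma IsGood.infinityUnstable_of_disp (h : ∀ᶠ s in atTop, Z.disp s < 0) : Z.InfinityUnstable := by
  refine infinityStable_reverse (hZ.mirror.infinityStable_of_disp ?_)
  filter_upwards [h] with s hs
  rw [disp_mirror]; linarith

/-- The order of a zero of the displacement function is the multiplicity of the fixed point of the
return map. -/
lemma IsGood.analyticOrderAt_ret_sub (h : s ∈ meanDomain Z.gL) (h0 : Z.disp s = 0) :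
    analyticOrderAt (fun z => Z.ret z - z) (Z.height s) = analyticOrderAt Z.disp s := by
  have hy := hZ.height_mem_domain h h0
  have hκ := hZ.kappa_pos
  have hdom : ∀ᶠ s' in 𝓝 s, s' ∈ meanDomain Z.gL := (isOpen_meanDomain _).mem_nhds h
  have hH := analyticAt_height h
  have hdom' : ∀ᶠ s' in 𝓝 s, Z.height s' ∈ Z.domain := hH.continuousAt.eventually (hZ.domain_mem_nhds hy)
  have hret : AnalyticAt ℝ (fun z => Z.ret z - z) (Z.height s) := (hZ.analyticAt_ret hy).sub analyticAt_id
  rw [← analyticOrderAt_comp_of_deriv_ne_zero hH (hZ.deriv_height_ne_zero h)]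
  refine analyticOrderAt_eq_of_isTheta (hret.comp hH) (hZ.analyticAt_disp h) ?_
  let a : ℝ → ℝ := fun s' => Z.angleR (Z.lower (Z.height s'))
  let b : ℝ → ℝ := fun s' => meanAngleR Z.gR (Z.kappa * s')
  have hsp := mul_pos hκ (pos_of_mem_meanDomain h)
  have hb0 : b s ∈ Set.Ioo 0 Real.pi := meanAngleR_mem hsp
  have ha0 : a s = b s := by
    have h1 := hZ.speed_angleR_sub h hy
    rw [h0, mul_zero, sub_eq_zero] at h1
    exact (speed_strictMonoOn_Ioo _).injOn (hZ.rightHalf hy.2.1).1 hb0 h1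
  have ha : Tendsto a (𝓝 s) (𝓝 (b s)) := by
    rw [← ha0]
    have h1 : ContinuousAt Z.lower (Z.height s) := (hZ.analyticAt_lower hy).continuousAt
    have h2 : ContinuousAt Z.angleR (Z.lower (Z.height s)) := (hZ.analyticAt_angleR hy.2.1).continuousAt
    exact (h2.comp (f := Z.lower) h1).comp (f := Z.height) hH.continuousAt
  have hb : Tendsto b (𝓝 s) (𝓝 (b s)) := by
    have : AnalyticAt ℝ b s :=
      AnalyticAt.fun_comp (f := fun s => (Z.gR, Z.kappa * s)) (g := fun p : ℝ × ℝ => meanAngleR p.1 p.2)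
        (analyticAt_meanAngleR hsp) (AnalyticAt.prod analyticAt_const (analyticAt_const.mul analyticAt_id))
    exact this.continuousAt
  have hsin := sin_ne_zero_of_Ioo hb0
  have e1 : AnalyticAt ℝ (meanSpeed Z.gR) (b s) :=
    AnalyticAt.fun_comp (f := fun θ => (Z.gR, θ)) (g := fun p : ℝ × ℝ => meanSpeed p.1 p.2)
      (analyticAt_meanSpeed hsin) (AnalyticAt.prod analyticAt_const analyticAt_id)
  have e2 : AnalyticAt ℝ (speed Z.gR) (b s) :=
    AnalyticAt.fun_comp (f := fun θ => (Z.gR, θ)) (g := fun p : ℝ × ℝ => speed p.1 p.2)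
      (analyticAt_speed hsin) (AnalyticAt.prod analyticAt_const analyticAt_id)
  have hk := andronov_pos (g := Z.gR) hb0.1 hb0.2.le
  have hk' := andronov_pos (g := -Z.gR) hb0.1 hb0.2.le
  have t1 := isTheta_comp_sub e1 (hasDerivAt_meanSpeed _ hsin) (div_ne_zero (by positivity)
    (by positivity)) ha hb
  have t2 := isTheta_comp_sub e2 (hasDerivAt_speed _ hsin) (div_ne_zero (by positivity)
    (by positivity)) ha hb
  have t3 := t1.trans t2.symm
  have hm := hZ.rotR.1.ne
  have hR := hZ.hR_pos.ne'
  have c1 : ((fun z => Z.ret z - z) ∘ Z.height) =ᶠ[𝓝 s] fun s' => (-2 * Z.hR / Z.rightMat 0 1) *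
      (meanSpeed Z.gR (a s') - meanSpeed Z.gR (b s')) := by
    filter_upwards [hdom, hdom'] with s' h1 h2
    have h3 := hZ.uR_sub_uR_ret h1 h2
    simp only [uR] at h3
    simp only [Function.comp_apply, a, b]
    field_simp
    linear_combination -h3
  have c2 : Z.disp =ᶠ[𝓝 s] fun s' => Z.kappa⁻¹ * (speed Z.gR (a s') - speed Z.gR (b s')) := by
    filter_upwards [hdom, hdom'] with s' h1 h2
    rw [hZ.speed_angleR_sub h1 h2, inv_mul_cancel_left₀ hκ.ne']
  have hne : -2 * Z.hR / Z.rightMat 0 1 ≠ 0 := div_ne_zero (mul_ne_zero (by norm_num) hR) hm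
  have t4 := ((isTheta_const_mul_left hne).2 t3).trans
    ((isTheta_const_mul_left (inv_ne_zero hκ.ne')).2 (isTheta_refl _ _)).symm
  exact ⟨t4.1.congr' c1.symm c2.symm, t4.2.congr' c2.symm c1.symm⟩

/-- The first return map near a zero of the displacement function is `ret`, by the uniqueness of
trajectories. -/
lemma IsGood.eq_ret_of_isReturnMapNear {P : ℝ → ℝ} (h : s ∈ meanDomain Z.gL) (h0 : Z.disp s = 0)
    (hP : Z.IsReturnMapNear P (Z.height s)) : P =ᶠ[𝓝 (Z.height s)] Z.ret := by
  have hc : Continuous Z.uL := by unfold uL; fun_prop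
  filter_upwards [hP, hc.continuousAt.eventually (gt_mem_nhds (hZ.uL_neg (hZ.height_mem_domain h h0)))]
    with z h1 h2
  exact (hZ.ret_of_returns h1 h2).2.1

lemma IsGood.isReturnMapNear_ret (h : s ∈ meanDomain Z.gL) (h0 : Z.disp s = 0) :
    Z.IsReturnMapNear Z.ret (Z.height s) := by
  have hy := hZ.height_mem_domain h h0
  have hfix := (hZ.ret_eq_iff h hy).2 h0
  have hc : Continuous Z.uL := by unfold uL; fun_prop
  have h1 : ContinuousAt (fun z => Z.uL (Z.ret z)) (Z.height s) :=
    hc.continuousAt.comp (hZ.analyticAt_ret hy).continuousAt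
  have h2 : Z.uL (Z.ret (Z.height s)) < 0 := by rw [hfix]; exact hZ.uL_neg hy
  filter_upwards [hZ.domain_mem_nhds hy, h1.eventually (gt_mem_nhds h2)] with z hz hz'
  exact hZ.returns hz hz'

lemma IsGood.hasMultiplicity {m : ℕ} (h : s ∈ meanDomain Z.gL) (h0 : Z.disp s = 0)
    (hm : analyticOrderAt Z.disp s = m) : Z.HasMultiplicity (Z.orbit (Z.height s)) m := by
  have hy := hZ.height_mem_domain h h0
  have hret : AnalyticAt ℝ (fun z => Z.ret z - z) (Z.height s) := (hZ.analyticAt_ret hy).sub analyticAt_id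
  rw [← hZ.analyticOrderAt_ret_sub h h0, analyticOrderAt_eq_nat_iff_iteratedDeriv_eq_zero hret] at hm
  exact ⟨_, _, hZ.hasAmplitude_height h h0, hZ.isReturnMapNear_ret h h0,
    (hZ.analyticAt_ret hy).contDiffAt, hm.1, hm.2⟩

lemma IsGood.deriv_disp_ne_zero (h : s ∈ meanDomain Z.gL) (h0 : Z.disp s = 0)
    (hyp : Z.IsHyperbolic (Z.orbit (Z.height s))) : deriv Z.disp s ≠ 0 := by
  obtain ⟨y, P, κ, hamp, hP, hd, hκ⟩ := hyp
  rw [hamp.unique (hZ.hasAmplitude_height h h0)] at hP hd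
  have hy := hZ.height_mem_domain h h0
  have hret : AnalyticAt ℝ (fun z => Z.ret z - z) (Z.height s) := (hZ.analyticAt_ret hy).sub analyticAt_id
  have h1 : HasDerivAt (fun z => Z.ret z - z) (κ - 1) (Z.height s) :=
    (hd.congr_of_eventuallyEq (hZ.eq_ret_of_isReturnMapNear h h0 hP).symm).sub (hasDerivAt_id _)
  have h2 : analyticOrderAt (fun z => Z.ret z - z) (Z.height s) = 1 :=
    hret.analyticOrderAt_eq_one_of_zero_deriv_ne_zero
      (sub_eq_zero.2 ((hZ.ret_eq_iff h hy).2 h0)) (by rw [h1.deriv]; exact sub_ne_zero.2 hκ)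
  rw [hZ.analyticOrderAt_ret_sub h h0] at h2
  have := ((analyticOrderAt_eq_nat_iff_iteratedDeriv_eq_zero (n := 1) (hZ.analyticAt_disp h)).1
    (by exact_mod_cast h2)).2
  rwa [iteratedDeriv_one] at this

lemma IsGood.isStable_of_deriv_neg (h : s ∈ meanDomain Z.gL) (h0 : Z.disp s = 0)
    (hd : deriv Z.disp s < 0) : Z.IsStable (Z.orbit (Z.height s)) := by
  have hsl := hasDerivAt_iff_tendsto_slope.1 (hZ.analyticAt_disp h).differentiableAt.hasDerivAt
  have hev := hsl.eventually (gt_mem_nhds hd)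
  refine hZ.isStable_of_sign h h0 ?_ ?_
  · filter_upwards [hev.filter_mono (nhdsWithin_mono s fun x (hx : s < x) => hx.ne'),
      self_mem_nhdsWithin] with x hx hxs
    rw [slope_def_field, h0, sub_zero] at hx
    by_contra hn
    exact absurd hx (not_lt.2 (div_nonneg (not_lt.1 hn) (sub_nonneg.2 (le_of_lt hxs))))
  · filter_upwards [hev.filter_mono (nhdsWithin_mono s fun x (hx : x < s) => hx.ne),
      self_mem_nhdsWithin] with x hx hxs
    rw [slope_def_field, h0, sub_zero] at hx
    by_contra hn
    exact absurd hx (not_lt.2 (div_nonneg_of_nonpos (not_lt.1 hn) (sub_nonpos.2 (le_of_lt hxs))))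

lemma IsGood.isUnstable_of_deriv_pos (h : s ∈ meanDomain Z.gL) (h0 : Z.disp s = 0)
    (hd : 0 < deriv Z.disp s) : Z.IsUnstable (Z.orbit (Z.height s)) := by
  have hsl := hasDerivAt_iff_tendsto_slope.1 (hZ.analyticAt_disp h).differentiableAt.hasDerivAt
  have hev := hsl.eventually (lt_mem_nhds hd)
  refine hZ.isUnstable_of_sign h h0 ?_ ?_
  · filter_upwards [hev.filter_mono (nhdsWithin_mono s fun x (hx : s < x) => hx.ne'),
      self_mem_nhdsWithin] with x hx hxs
    rw [slope_def_field, h0, sub_zero] at hx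
    exact (div_pos_iff_of_pos_right (sub_pos.2 hxs)).1 hx
  · filter_upwards [hev.filter_mono (nhdsWithin_mono s fun x (hx : x < s) => hx.ne),
      self_mem_nhdsWithin] with x hx hxs
    rw [slope_def_field, h0, sub_zero] at hx
    by_contra hn
    exact absurd hx (not_lt.2 (div_nonpos_of_nonneg_of_nonpos (not_lt.1 hn) (sub_nonpos.2 (le_of_lt hxs))))

/-- If one zero of the displacement function is isolated, all are. -/
lemma IsGood.isolated_of_isolated (h : s ∈ meanDomain Z.gL) (hiso : ∀ᶠ s' in 𝓝[≠] s, Z.disp s' ≠ 0)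
    {s₁ : ℝ} (h₁ : s₁ ∈ meanDomain Z.gL) : ∀ᶠ s' in 𝓝[≠] s₁, Z.disp s' ≠ 0 := by
  by_contra hn
  have hf : AnalyticOnNhd ℝ Z.disp (meanDomain Z.gL) := fun x hx => hZ.analyticAt_disp hx
  have hpre : IsPreconnected (meanDomain Z.gL) :=
    Set.OrdConnected.isPreconnected ⟨fun x hx _ _ z hz => meanDomain_of_le hx hz.1⟩
  have hfreq : ∃ᶠ z in 𝓝[≠] s₁, Z.disp z = 0 := by
    rw [Filter.Frequently]; simpa using hn
  have heq := hf.eqOn_zero_of_preconnected_of_frequently_eq_zero hpre h₁ hfreq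
  have hdom : ∀ᶠ s' in 𝓝[≠] s, s' ∈ meanDomain Z.gL :=
    mem_nhdsWithin_of_mem_nhds ((isOpen_meanDomain _).mem_nhds h)
  obtain ⟨s', h1, h2⟩ := (hiso.and hdom).exists
  exact h1 (heq h2)

omit hZ in
lemma deriv_nonpos_of_pos_left {f : ℝ → ℝ} {x : ℝ} (hf : DifferentiableAt ℝ f x) (h0 : f x = 0)
    (h : ∀ᶠ t in 𝓝[<] x, 0 < f t) : deriv f x ≤ 0 := by
  have hsl := (hasDerivWithinAt_iff_tendsto_slope' (s := Set.Iio x) (by simp)).1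
    hf.hasDerivAt.hasDerivWithinAt
  refine le_of_tendsto hsl ?_
  filter_upwards [h, self_mem_nhdsWithin] with t ht hx
  rw [slope_def_field, h0, sub_zero]
  exact div_nonpos_of_nonneg_of_nonpos ht.le (sub_nonpos.2 (le_of_lt hx))

omit hZ in
lemma deriv_nonneg_of_pos_right {f : ℝ → ℝ} {x : ℝ} (hf : DifferentiableAt ℝ f x) (h0 : f x = 0)
    (h : ∀ᶠ t in 𝓝[>] x, 0 < f t) : 0 ≤ deriv f x := by
  have hsl := (hasDerivWithinAt_iff_tendsto_slope' (s := Set.Ioi x) (by simp)).1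
    hf.hasDerivAt.hasDerivWithinAt
  refine ge_of_tendsto hsl ?_
  filter_upwards [h, self_mem_nhdsWithin] with t ht hx
  rw [slope_def_field, h0, sub_zero]
  exact div_nonneg ht.le (sub_nonneg.2 (le_of_lt hx))

/-- The displacement function keeps its sign on an interval without zeros. -/
lemma IsGood.disp_pos_of_ne {a b : ℝ} (hab : a ≤ b) (ha : a ∈ meanDomain Z.gL)
    (hne : ∀ x ∈ Set.Icc a b, Z.disp x ≠ 0) : 0 < Z.disp a ↔ 0 < Z.disp b := by
  have hc : ContinuousOn Z.disp (Set.Icc a b) := fun x hx =>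
    (hZ.analyticAt_disp (meanDomain_of_le ha hx.1)).continuousAt.continuousWithinAt
  constructor
  · intro h
    by_contra hn
    obtain ⟨x, hx, h0⟩ := intermediate_value_Icc' hab hc ⟨not_lt.1 hn, h.le⟩
    exact hne x hx h0
  · intro h
    by_contra hn
    obtain ⟨x, hx, h0⟩ := intermediate_value_Icc hab hc ⟨not_lt.1 hn, h.le⟩
    exact hne x hx h0

/-- The limit cycle of highest amplitude and infinity have opposite stabilities. -/
lemma IsGood.highest (hΓ : Z.IsHighest Γ) (hyp : Z.IsHyperbolic Γ) :
    (Z.IsStable Γ ∧ ∀ᶠ s in atTop, Z.disp s < 0) ∨ (Z.IsUnstable Γ ∧ ∀ᶠ s in atTop, 0 < Z.disp s) := by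
  obtain ⟨hlc, y, hamp, hmax⟩ := hΓ
  obtain ⟨s, hs, h0, hiso, rfl⟩ := hZ.isCrossingLimitCycle_iff.1 hlc
  have hd := hZ.deriv_disp_ne_zero hs h0 hyp
  have hdiff := (hZ.analyticAt_disp hs).differentiableAt
  rw [hamp.unique (hZ.hasAmplitude_height hs h0)] at hmax
  have hne : ∀ s', s < s' → Z.disp s' ≠ 0 := by
    intro s' hlt h0'
    have hs' := meanDomain_of_le hs hlt.le
    have := hmax _ _ (hZ.isCrossingLimitCycle_iff.2 ⟨s', hs', h0', hZ.isolated_of_isolated hs hiso hs', rfl⟩)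
      (hZ.hasAmplitude_height hs' h0')
    linarith [hZ.height_strictMonoOn hs hs' hlt]
  have hsign : ∀ a b, s < a → s < b → 0 < Z.disp a → 0 < Z.disp b := by
    intro a b ha hb hpos
    rcases le_total a b with hab | hab
    · exact (hZ.disp_pos_of_ne hab (meanDomain_of_le hs ha.le) fun x hx => hne x (ha.trans_le hx.1)).1 hpos
    · exact (hZ.disp_pos_of_ne hab (meanDomain_of_le hs hb.le) fun x hx => hne x (hb.trans_le hx.1)).2 hpos
  by_cases hp : 0 < Z.disp (s + 1)
  · right
    have hall : ∀ a, s < a → 0 < Z.disp a := fun a ha => hsign _ a (by linarith) ha hp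
    refine ⟨hZ.isUnstable_of_deriv_pos hs h0 (lt_of_le_of_ne (deriv_nonneg_of_pos_right hdiff h0 ?_)
      hd.symm), (eventually_gt_atTop s).mono hall⟩
    filter_upwards [self_mem_nhdsWithin] with t ht using hall t ht
  · left
    have hall : ∀ a, s < a → Z.disp a < 0 := fun a ha =>
      lt_of_le_of_ne (not_lt.1 fun h => hp (hsign a _ ha (by linarith) h)) (hne a ha)
    refine ⟨hZ.isStable_of_deriv_neg hs h0 (lt_of_le_of_ne ?_ hd), (eventually_gt_atTop s).mono hall⟩
    have := deriv_nonneg_of_pos_right (f := fun s => -Z.disp s) hdiff.neg (by simp [h0])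
      (by filter_upwards [self_mem_nhdsWithin] with t ht; exact neg_pos.2 (hall t ht))
    rw [deriv.fun_neg] at this
    linarith

/-- The limit cycle of lowest amplitude above a level inherits its stability from the sign of the
displacement function below it. -/
lemma IsGood.lowestAbove {r s₁ : ℝ} (hΓ : Z.IsLowestAbove r Γ) (hyp : Z.IsHyperbolic Γ)
    (hs₁ : s₁ ∈ meanDomain Z.gL) (hr : r ≤ Z.height s₁)
    (hne : ∀ s ∈ meanDomain Z.gL, s ≤ s₁ → r ≤ Z.height s → Z.disp s ≠ 0) :
    (0 < Z.disp s₁ → Z.IsStable Γ) ∧ (Z.disp s₁ < 0 → Z.IsUnstable Γ) := by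
  obtain ⟨hlc, y, hamp, hry, hmin⟩ := hΓ
  obtain ⟨s, hs, h0, hiso, rfl⟩ := hZ.isCrossingLimitCycle_iff.1 hlc
  have hd := hZ.deriv_disp_ne_zero hs h0 hyp
  have hdiff := (hZ.analyticAt_disp hs).differentiableAt
  rw [hamp.unique (hZ.hasAmplitude_height hs h0)] at hmin hry
  have hlt : s₁ < s := not_le.1 fun hle => hne s hs hle hry h0
  have hne' : ∀ x, s₁ ≤ x → x < s → Z.disp x ≠ 0 := by
    intro x h1 h2 h0'
    have hx := meanDomain_of_le hs₁ h1
    have := hmin _ _ (hZ.isCrossingLimitCycle_iff.2 ⟨x, hx, h0', hZ.isolated_of_isolated hs hiso hx, rfl⟩)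
      (hZ.hasAmplitude_height hx h0') (hr.trans (hZ.height_strictMonoOn.monotoneOn hs₁ hx h1))
    linarith [hZ.height_strictMonoOn hx hs h2]
  have hsign : ∀ x, s₁ ≤ x → x < s → (0 < Z.disp s₁ ↔ 0 < Z.disp x) := fun x h1 h2 =>
    hZ.disp_pos_of_ne h1 hs₁ fun t ht => hne' t ht.1 (ht.2.trans_lt h2)
  constructor
  · intro hp
    refine hZ.isStable_of_deriv_neg hs h0 (lt_of_le_of_ne (deriv_nonpos_of_pos_left hdiff h0 ?_) hd)
    filter_upwards [Ioo_mem_nhdsLT hlt] with t ht using (hsign t ht.1.le ht.2).1 hp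
  · intro hp
    refine hZ.isUnstable_of_deriv_pos hs h0 (lt_of_le_of_ne ?_ hd.symm)
    have := deriv_nonpos_of_pos_left (f := fun s => -Z.disp s) hdiff.neg (by simp [h0]) (by
      filter_upwards [Ioo_mem_nhdsLT hlt] with t ht
      refine neg_pos.2 (lt_of_le_of_ne (not_lt.1 fun h => ?_) (hne' t ht.1.le ht.2))
      exact lt_asymm hp ((hsign t ht.1.le ht.2).2 h))
    rw [deriv.fun_neg] at this
    linarith

/-- At `r = 0` the angular velocity is a quadratic form in `(cos θ, sin θ)`, which is definite because
the eigenvalues are not real. -/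
lemma IsGood.infinityPeriodic : Z.InfinityPeriodic := by
  have key : ∀ (M : Matrix (Fin 2) (Fin 2) ℝ) (v : Fin 2 → ℝ), IsRotating M → ∀ θ,
      0 < 1 * bendixsonAngular M v 0 θ := by
    intro M v h θ
    have h1 := h.1
    have h2 := h.2
    rw [damping, stiffness] at h2
    have h3 : bendixsonAngular M v 0 θ = M 1 0 * Real.cos θ ^ 2 +
        (M 1 1 - M 0 0) * (Real.cos θ * Real.sin θ) - M 0 1 * Real.sin θ ^ 2 := by
      simp [bendixsonAngular]; ring
    rw [one_mul, h3]
    -- a definite quadratic form: complete the square in the sine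
    have h4 : 0 < -M 0 1 * (M 1 0 * Real.cos θ ^ 2 +
        (M 1 1 - M 0 0) * (Real.cos θ * Real.sin θ) - M 0 1 * Real.sin θ ^ 2) := by
      have h5 : -M 0 1 * (M 1 0 * Real.cos θ ^ 2 +
          (M 1 1 - M 0 0) * (Real.cos θ * Real.sin θ) - M 0 1 * Real.sin θ ^ 2) =
          (M 0 1 * Real.sin θ - (M 1 1 - M 0 0) / 2 * Real.cos θ) ^ 2 +
          (M 0 0 * M 1 1 - M 0 1 * M 1 0 - ((M 0 0 + M 1 1) / 2) ^ 2) * Real.cos θ ^ 2 := by ring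
      rw [h5]
      by_cases hc : Real.cos θ = 0
      · have hs : Real.sin θ ≠ 0 := fun hs => by
          have := Real.sin_sq_add_cos_sq θ
          rw [hc, hs] at this; norm_num at this
        rw [hc]
        have : 0 < (M 0 1 * Real.sin θ) ^ 2 := by have := mul_ne_zero h1.ne hs; positivity
        linarith
      · have := mul_pos (sub_pos.2 h2) (pow_pos (abs_pos.2 hc) 2)
        rw [sq_abs] at this
        positivity
    exact (pos_iff_pos_of_mul_pos h4).1 (by linarith)
  exact ⟨1, fun θ => ⟨fun _ => key _ _ hZ.rotR θ, fun _ => key _ _ hZ.rotL θ⟩⟩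

end Zeros

/-! ### The displacement per unit of damping -/

/-- `sinh z / z`. -/
noncomputable def shc (z : ℝ) : ℝ := dslope Real.sinh 0 z

lemma mul_shc (z : ℝ) : z * shc z = Real.sinh z := by
  have := sub_smul_dslope Real.sinh 0 z
  simpa [shc] using this

lemma analyticAt_shc (z : ℝ) : AnalyticAt ℝ shc z := by
  rcases eq_or_ne z 0 with rfl | hz
  · obtain ⟨p, hp⟩ : AnalyticAt ℝ Real.sinh 0 := by fun_prop
    exact ⟨_, hp.has_fpower_series_dslope_fslope⟩
  · have h1 : AnalyticAt ℝ (fun z => Real.sinh z / z) z := by fun_prop (disch := exact hz)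
    refine h1.congr ?_
    filter_upwards [isOpen_ne.mem_nhds hz] with w hw
    rw [← mul_shc w, mul_div_cancel_left₀ _ hw]

lemma one_le_shc (z : ℝ) : 1 ≤ shc z := by
  have hpos : ∀ z, 0 < z → 1 ≤ shc z := fun z hz => by
    have := (Real.self_le_sinh_iff).2 hz.le
    rw [← mul_shc] at this
    exact (le_mul_iff_one_le_right hz).1 this
  rcases lt_trichotomy z 0 with hz | rfl | hz
  · have h1 := hpos (-z) (by linarith)
    have h2 : shc (-z) = shc z := by
      apply mul_left_cancel₀ hz.ne
      have := mul_shc (-z)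
      rw [Real.sinh_neg, ← mul_shc z] at this
      linarith
    linarith
  · simp [shc]
  · exact hpos z hz

lemma shc_zero : shc 0 = 1 := by simp [shc]

/-- Half the normalized gain of speed in the zone of the real focus, per unit of damping. -/
noncomputable def phi (g s : ℝ) : ℝ :=
  1 - meanAngleL g s * shc (g * meanAngleL g s) / Real.sin (meanAngleL g s)

/-- Half the normalized gain of speed in the zone of the virtual focus, per unit of damping. -/
noncomputable def psi (g s : ℝ) : ℝ :=
  meanAngleR g s * shc (g * meanAngleR g s) / Real.sin (meanAngleR g s) - 1

lemma gainL_eq {g s : ℝ} (h : s ∈ meanDomain g) : gainL g s = g * phi g s := by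
  have hs := sin_ne_zero_of_realAngles (meanAngleL_mem h)
  rw [gainL, gain, phi, ← mul_shc]
  field_simp
  ring

lemma gainR_eq {g s : ℝ} (h : 0 < s) : gainR g s = g * psi g s := by
  have hs := sin_ne_zero_of_Ioo (meanAngleR_mem (g := g) h)
  rw [gainR, gain, psi, ← mul_shc]
  field_simp

lemma analyticAt_phi {g s : ℝ} (h : s ∈ meanDomain g) :
    AnalyticAt ℝ (fun p : ℝ × ℝ => phi p.1 p.2) (g, s) := by
  have h1 := analyticAt_meanAngleL h
  have h2 := sin_ne_zero_of_realAngles (meanAngleL_mem h)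
  have h3 : AnalyticAt ℝ (fun p : ℝ × ℝ => shc (p.1 * meanAngleL p.1 p.2)) (g, s) :=
    AnalyticAt.fun_comp (g := shc) (analyticAt_shc _) (analyticAt_fst.mul h1)
  have h4 : AnalyticAt ℝ (fun p : ℝ × ℝ => Real.sin (meanAngleL p.1 p.2)) (g, s) :=
    AnalyticAt.fun_comp (g := Real.sin) (by fun_prop) h1
  exact analyticAt_const.sub ((h1.mul h3).div h4 h2)

lemma analyticAt_psi {g s : ℝ} (h : 0 < s) : AnalyticAt ℝ (fun p : ℝ × ℝ => psi p.1 p.2) (g, s) := by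
  have h1 := analyticAt_meanAngleR (g := g) h
  have h2 := sin_ne_zero_of_Ioo (meanAngleR_mem (g := g) h)
  have h3 : AnalyticAt ℝ (fun p : ℝ × ℝ => shc (p.1 * meanAngleR p.1 p.2)) (g, s) :=
    AnalyticAt.fun_comp (g := shc) (analyticAt_shc _) (analyticAt_fst.mul h1)
  have h4 : AnalyticAt ℝ (fun p : ℝ × ℝ => Real.sin (meanAngleR p.1 p.2)) (g, s) :=
    AnalyticAt.fun_comp (g := Real.sin) (by fun_prop) h1
  exact ((h1.mul h3).div h4 h2).sub analyticAt_const

lemma meanSpeed_zero {x : ℝ} (h : Real.cos x ≠ 0) : meanSpeed 0 (2 * x) = Real.tan x := by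
  by_cases hs : Real.sin x = 0
  · simp [meanSpeed, Real.tan_eq_sin_div_cos, hs, Real.sin_two_mul]
  · rw [meanSpeed, Real.tan_eq_sin_div_cos, zero_mul, Real.cosh_zero, Real.sin_two_mul, Real.cos_two_mul,
      Real.cos_sq']
    field_simp
    ring

lemma realAngles_zero : realAngles 0 = Set.Ioo Real.pi (2 * Real.pi) := by
  ext θ
  refine ⟨fun h => h.1, fun h => ⟨h, ?_⟩⟩
  have h1 : Real.cos θ < 1 := by
    refine lt_of_le_of_ne (Real.cos_le_one θ) fun h1 => ?_
    have h2 := Real.sin_sq_add_cos_sq θ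
    have h3 := sin_neg_of_mem_Ioo h
    rw [h1] at h2
    nlinarith
  constructor <;> simp [andronov] <;> linarith

lemma meanAngleL_zero {s : ℝ} (h : 0 < s) :
    2 * (Real.pi - Real.arctan s) ∈ realAngles 0 ∧ meanSpeed 0 (2 * (Real.pi - Real.arctan s)) = -s := by
  have h1 := Real.arctan_pos.2 h
  have h2 := Real.arctan_lt_pi_div_two s
  refine ⟨?_, ?_⟩
  · rw [realAngles_zero]; constructor <;> linarith
  · have hc : Real.cos (Real.pi - Real.arctan s) ≠ 0 := by
      rw [Real.cos_pi_sub]; exact neg_ne_zero.2 (Real.cos_arctan_pos s).ne'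
    rw [meanSpeed_zero hc, Real.tan_pi_sub, Real.tan_arctan]

lemma mem_meanDomain_zero {s : ℝ} (h : 0 < s) : s ∈ meanDomain 0 :=
  ⟨_, (meanAngleL_zero h).1, (meanAngleL_zero h).2⟩

lemma sin_two_arctan (s : ℝ) : Real.sin (2 * Real.arctan s) = 2 * s / (1 + s ^ 2) := by
  rw [Real.sin_two_mul, Real.sin_arctan, Real.cos_arctan]
  have h : (√(1 + s ^ 2)) ^ 2 = 1 + s ^ 2 := Real.sq_sqrt (by positivity)
  field_simp
  rw [h]

lemma phi_zero {s : ℝ} (h : 0 < s) : phi 0 s = 1 + (Real.pi - Real.arctan s) * (s + 1 / s) := by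
  have h1 := meanAngleL_eq (meanAngleL_zero h).1 (meanAngleL_zero h).2
  have h2 : Real.sin (2 * (Real.pi - Real.arctan s)) = -(2 * s / (1 + s ^ 2)) := by
    rw [← sin_two_arctan, mul_sub, Real.sin_two_pi_sub]
  rw [phi, h1, zero_mul, shc_zero, h2]
  field_simp
  ring

lemma psi_zero {s : ℝ} (h : 0 < s) : psi 0 s = Real.arctan s * (s + 1 / s) - 1 := by
  have a1 := Real.arctan_pos.2 h
  have a2 := Real.arctan_lt_pi_div_two s
  have h1 : meanAngleR 0 s = 2 * Real.arctan s := by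
    refine meanAngleR_eq ⟨by linarith, by linarith⟩ ?_
    rw [meanSpeed_zero (Real.cos_arctan_pos s).ne', Real.tan_arctan]
  rw [psi, h1, zero_mul, shc_zero, sin_two_arctan]
  field_simp
  ring

lemma tendsto_meanAngleL_atTop :
    (∀ᶠ p : ℝ × ℝ in 𝓝 0 ×ˢ atTop, p.2 ∈ meanDomain p.1) ∧
    Tendsto (fun p : ℝ × ℝ => meanAngleL p.1 p.2) (𝓝 0 ×ˢ atTop) (𝓝 Real.pi) := by
  have key : ∀ θ ∈ Set.Ioo Real.pi (2 * Real.pi), ∀ᶠ p : ℝ × ℝ in 𝓝 0 ×ˢ atTop,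
      p.2 ∈ meanDomain p.1 ∧ Real.pi < meanAngleL p.1 p.2 ∧ meanAngleL p.1 p.2 < θ := by
    intro θ hθ
    rw [← realAngles_zero] at hθ
    have h1 : ∀ᶠ g in 𝓝 (0:ℝ), θ ∈ realAngles g :=
      (isOpen_realAngles_prod.preimage (by fun_prop : Continuous fun g : ℝ => (g, θ))).mem_nhds hθ
    have h2 : ∀ᶠ g in 𝓝 (0:ℝ), -meanSpeed g θ < -meanSpeed 0 θ + 1 := by
      have hc : Continuous fun g => -meanSpeed g θ := by unfold meanSpeed; fun_prop
      exact hc.continuousAt.eventually (gt_mem_nhds (lt_add_one _))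
    filter_upwards [(h1.and h2).prod_mk (eventually_ge_atTop (-meanSpeed 0 θ + 1))] with p hp
    have hlt := hp.1.2.trans_le hp.2
    have hmem : p.2 ∈ meanDomain p.1 := meanDomain_of_le ⟨θ, hp.1.1, (neg_neg _).symm⟩ hlt.le
    refine ⟨hmem, (meanAngleL_mem hmem).1.1, ?_⟩
    refine ((meanSpeed_strictMonoOn_realAngles _).lt_iff_lt (meanAngleL_mem hmem) hp.1.1).1 ?_
    rw [meanSpeed_meanAngleL hmem]; linarith
  have hpi := Real.pi_pos
  refine ⟨(key (3 * Real.pi / 2) ⟨by linarith, by linarith⟩).mono fun p hp => hp.1, ?_⟩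
  refine tendsto_order.2 ⟨fun a ha => ?_, fun a ha => ?_⟩
  · exact (key (3 * Real.pi / 2) ⟨by linarith, by linarith⟩).mono fun p hp => ha.trans hp.2.1
  · refine (key (min a (3 * Real.pi / 2)) ⟨lt_min ha (by linarith), ?_⟩).mono fun p hp =>
      hp.2.2.trans_le (min_le_left _ _)
    exact (min_le_right _ _).trans_lt (by linarith)

lemma tendsto_meanAngleR_atTop :
    Tendsto (fun p : ℝ × ℝ => meanAngleR p.1 p.2) (𝓝 0 ×ˢ atTop) (𝓝 Real.pi) := by
  have key : ∀ θ ∈ Set.Ioo 0 Real.pi, ∀ᶠ p : ℝ × ℝ in 𝓝 0 ×ˢ atTop,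
      θ < meanAngleR p.1 p.2 ∧ meanAngleR p.1 p.2 < Real.pi := by
    intro θ hθ
    have h2 : ∀ᶠ g in 𝓝 (0:ℝ), meanSpeed g θ < meanSpeed 0 θ + 1 := by
      have hc : Continuous fun g => meanSpeed g θ := by unfold meanSpeed; fun_prop
      exact hc.continuousAt.eventually (gt_mem_nhds (lt_add_one _))
    filter_upwards [h2.prod_mk ((eventually_ge_atTop (meanSpeed 0 θ + 1)).and (eventually_gt_atTop 0))]
      with p hp
    have hm := meanAngleR_mem (g := p.1) hp.2.2
    refine ⟨((meanSpeed_strictMonoOn_Ioo p.1).lt_iff_lt hθ hm).1 ?_, hm.2⟩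
    rw [meanSpeed_meanAngleR hp.2.2]
    exact hp.1.trans_le hp.2.1
  have hpi := Real.pi_pos
  refine tendsto_order.2 ⟨fun a ha => ?_, fun a ha => ?_⟩
  · refine (key (max a (Real.pi / 2)) ⟨?_, max_lt ha (by linarith)⟩).mono fun p hp =>
      (le_max_left _ _).trans_lt hp.1
    exact lt_of_lt_of_le (by linarith) (le_max_right _ _)
  · exact (key (Real.pi / 2) ⟨by linarith, by linarith⟩).mono fun p hp => hp.2.trans ha

/-- The common limit of `phi` and `psi` over the speed. -/
lemma tendsto_ratio {Θ : ℝ × ℝ → ℝ} (h : Tendsto Θ (𝓝 0 ×ˢ atTop) (𝓝 Real.pi)) :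
    Tendsto (fun p : ℝ × ℝ => Θ p * shc (p.1 * Θ p) / (Real.cosh (p.1 * Θ p) - Real.cos (Θ p)))
      (𝓝 0 ×ˢ atTop) (𝓝 (Real.pi / 2)) := by
  have h1 : Tendsto (fun p : ℝ × ℝ => p.1) (𝓝 0 ×ˢ atTop) (𝓝 0) := tendsto_fst
  have h2 : ContinuousAt (fun x : ℝ × ℝ => x.2 * shc (x.1 * x.2) / (Real.cosh (x.1 * x.2) - Real.cos x.2))
      (0, Real.pi) := by
    have h3 : ContinuousAt (fun x : ℝ × ℝ => shc (x.1 * x.2)) (0, Real.pi) :=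
      ContinuousAt.comp (g := shc) (analyticAt_shc _).continuousAt (by fun_prop)
    refine ContinuousAt.div (continuousAt_snd.mul h3) (by fun_prop) ?_
    simp
  have h4 := h2.tendsto.comp (show Tendsto (fun p : ℝ × ℝ => (p.1, Θ p)) (𝓝 0 ×ˢ atTop) (𝓝 (0, Real.pi)) by
    rw [nhds_prod_eq]; exact h1.prodMk h)
  simp only [zero_mul, shc_zero, Real.cosh_zero, Real.cos_pi, mul_one] at h4
  rw [show (1:ℝ) - -1 = 2 by norm_num] at h4
  exact h4

lemma tendsto_phi_div :
    Tendsto (fun p : ℝ × ℝ => phi p.1 p.2 / p.2) (𝓝 0 ×ˢ atTop) (𝓝 (Real.pi / 2)) := by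
  have h1 := tendsto_ratio tendsto_meanAngleL_atTop.2
  have h2 : Tendsto (fun p : ℝ × ℝ => p.2⁻¹) (𝓝 (0:ℝ) ×ˢ atTop) (𝓝 0) :=
    tendsto_inv_atTop_zero.comp tendsto_snd
  have h3 := h1.add h2
  rw [add_zero] at h3
  refine h3.congr' ?_
  filter_upwards [tendsto_meanAngleL_atTop.1] with p hp
  have hθ := meanAngleL_mem hp
  have hs := sin_ne_zero_of_realAngles hθ
  have h4 := meanSpeed_meanAngleL hp
  rw [meanSpeed, div_eq_iff hs] at h4
  rw [h4, phi]
  field_simp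
  ring

lemma tendsto_psi_div :
    Tendsto (fun p : ℝ × ℝ => psi p.1 p.2 / p.2) (𝓝 0 ×ˢ atTop) (𝓝 (Real.pi / 2)) := by
  have h1 := tendsto_ratio tendsto_meanAngleR_atTop
  have h2 : Tendsto (fun p : ℝ × ℝ => p.2⁻¹) (𝓝 (0:ℝ) ×ˢ atTop) (𝓝 0) :=
    tendsto_inv_atTop_zero.comp tendsto_snd
  have h3 := h1.sub h2
  rw [sub_zero] at h3
  refine h3.congr' ?_
  filter_upwards [(Eventually.of_forall fun _ => trivial : ∀ᶠ _ : ℝ in 𝓝 0, True).prod_mk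
    (eventually_gt_atTop (0:ℝ))] with p hp
  have hp0 := hp.2
  have hs := sin_ne_zero_of_Ioo (meanAngleR_mem (g := p.1) hp0)
  have h4 := meanSpeed_meanAngleR (g := p.1) hp0
  rw [meanSpeed, div_eq_iff hs] at h4
  rw [h4, psi]
  field_simp

/-- Near the real focus a passage lasts more than half a turn. -/
lemma le_phi {g s : ℝ} (h : s ∈ meanDomain g) : Real.pi / (2 * s) ≤ phi g s := by
  have hθ := meanAngleL_mem h
  have hs := sin_neg_of_mem_Ioo hθ.1
  have h4 := meanSpeed_meanAngleL h
  rw [meanSpeed, div_eq_iff hs.ne] at h4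
  set θ := meanAngleL g s
  have h5 := one_le_shc (g * θ)
  have h6 := Real.one_le_cosh (g * θ)
  have hpi := Real.pi_pos
  have h7 : -Real.sin θ ≤ 2 * s := by
    -- `s ≥ tan (half the angle that is missing)`
    have h8 := Real.sin_sq_add_cos_sq θ
    have h9 := Real.neg_one_le_cos θ
    have h10 : 1 - Real.cos θ ≤ s * -Real.sin θ := by linarith
    by_contra hn
    have := mul_pos (neg_pos.2 hs) (sub_pos.2 (not_le.1 hn))
    nlinarith [Real.cos_le_one θ]
  have h8 : phi g s = 1 + θ * shc (g * θ) / -Real.sin θ := by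
    rw [phi, div_neg]; ring
  rw [h8]
  have h9 : Real.pi ≤ θ * shc (g * θ) := by nlinarith [hθ.1.1]
  have h10 : Real.pi / (2 * s) ≤ θ * shc (g * θ) / -Real.sin θ := by
    have := neg_pos.2 hs
    have := hpi.le.trans h9
    gcongr
  linarith

/-- At small speeds the right passage takes a small angle and its gain vanishes, uniformly for small
damping ratios. -/
lemma tendsto_psi_zero :
    Tendsto (fun p : ℝ × ℝ => psi p.1 p.2) (𝓝 0 ×ˢ 𝓝[>] 0) (𝓝 0) := by
  have hpos : ∀ᶠ p : ℝ × ℝ in 𝓝 0 ×ˢ 𝓝[>] 0, 0 < p.2 :=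
    tendsto_snd.eventually (self_mem_nhdsWithin : ∀ᶠ s in 𝓝[>] (0:ℝ), 0 < s)
  have h1 : Tendsto (fun p : ℝ × ℝ => meanAngleR p.1 p.2) (𝓝 0 ×ˢ 𝓝[>] 0) (𝓝 0) := by
    have h2 : Tendsto (fun p : ℝ × ℝ => 2 * p.2) (𝓝 (0:ℝ) ×ˢ 𝓝[>] 0) (𝓝 0) := by
      have : Tendsto (fun s : ℝ => 2 * s) (𝓝[>] 0) (𝓝 0) := by
        have : ContinuousAt (fun s : ℝ => 2 * s) 0 := by fun_prop
        simpa using this.tendsto.mono_left nhdsWithin_le_nhds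
      exact this.comp tendsto_snd
    refine tendsto_of_tendsto_of_tendsto_of_le_of_le' tendsto_const_nhds h2
      (hpos.mono fun p hp => (meanAngleR_mem hp).1.le) (hpos.mono fun p hp => ?_)
    have hθ := meanAngleR_mem (g := p.1) hp
    have h3 := meanSpeed_meanAngleR (g := p.1) hp
    set θ := meanAngleR p.1 p.2
    have hs := Real.sin_pos_of_mem_Ioo hθ
    rw [meanSpeed, div_eq_iff hs.ne'] at h3
    have h4 := Real.one_le_cosh (p.1 * θ)
    have h5 : θ / 2 ≤ Real.tan (θ / 2) := Real.le_tan (by linarith [hθ.1]) (by linarith [hθ.2])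
    have hc : 0 < Real.cos (θ / 2) := Real.cos_pos_of_mem_Ioo ⟨by linarith [hθ.1, Real.pi_pos], by linarith [hθ.2]⟩
    have h6 := meanSpeed_zero hc.ne'
    rw [mul_div_cancel₀ _ two_ne_zero, meanSpeed, zero_mul, Real.cosh_zero, div_eq_iff hs.ne'] at h6
    have h7 : Real.tan (θ / 2) ≤ p.2 := by
      refine le_of_mul_le_mul_right ?_ hs
      linarith
    linarith
  have h2 : Tendsto (fun p : ℝ × ℝ => p.1 * meanAngleR p.1 p.2) (𝓝 0 ×ˢ 𝓝[>] 0) (𝓝 0) := by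
    simpa using (tendsto_fst (f := 𝓝 (0:ℝ)) (g := 𝓝[>] (0:ℝ))).mul h1
  have h3 := (analyticAt_shc 0).continuousAt.tendsto.comp h2
  have h4 : Tendsto (fun p : ℝ × ℝ => Real.sinc (meanAngleR p.1 p.2)) (𝓝 0 ×ˢ 𝓝[>] 0) (𝓝 1) := by
    have := Real.continuous_sinc.continuousAt.tendsto.comp h1
    simpa [Function.comp_def] using this
  have h5 := (h3.div h4 one_ne_zero).sub_const 1
  rw [shc_zero, div_one, sub_self] at h5
  refine h5.congr' ?_
  filter_upwards [hpos] with p hp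
  have hθ := meanAngleR_mem (g := p.1) hp
  have := hθ.1.ne'
  simp only [Function.comp_apply, Pi.div_apply]
  rw [psi, Real.sinc_of_ne_zero this]
  field_simp

/-- The normalized parameters of a field: the size `ε` of the perturbation, the damping ratios of the
two zones per `ε`, the ratio of the length scales, and the offset per `ε`. -/
abbrev Params : Type := ℝ × ℝ × ℝ × ℝ × ℝ

/-- The part of the displacement per `ε` that does not come from the damping in the left zone. -/
noncomputable def rest (q : Params) (s : ℝ) : ℝ :=
  q.2.2.1 * psi (q.1 * q.2.2.1) (q.2.2.2.1 * s) / q.2.2.2.1 + q.2.2.2.2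

/-- The displacement per `ε` in terms of the normalized parameters `(ε, c₋, c₊, κ, β)`. -/
noncomputable def reduced (q : Params) (s : ℝ) : ℝ :=
  q.2.1 * phi (q.1 * q.2.1) s + rest q s

lemma analyticAt_reduced {q : Params} {s : ℝ} (h : s ∈ meanDomain (q.1 * q.2.1)) (hk : 0 < q.2.2.2.1) :
    AnalyticAt ℝ (fun p : Params × ℝ => reduced p.1 p.2) (q, s) := by
  have h1 : AnalyticAt ℝ (fun p : Params × ℝ => phi (p.1.1 * p.1.2.1) p.2) (q, s) :=
    AnalyticAt.fun_comp (f := fun p : Params × ℝ => (p.1.1 * p.1.2.1, p.2))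
      (g := fun x : ℝ × ℝ => phi x.1 x.2) (analyticAt_phi h) (by fun_prop)
  have h2 : AnalyticAt ℝ (fun p : Params × ℝ => psi (p.1.1 * p.1.2.2.1) (p.1.2.2.2.1 * p.2)) (q, s) :=
    AnalyticAt.fun_comp (f := fun p : Params × ℝ => (p.1.1 * p.1.2.2.1, p.1.2.2.2.1 * p.2))
      (g := fun x : ℝ × ℝ => psi x.1 x.2) (analyticAt_psi (mul_pos hk (pos_of_mem_meanDomain h)))
      (by fun_prop)
  unfold reduced rest
  have hk' : (q, s).1.2.2.2.1 ≠ 0 := hk.ne'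
  fun_prop (disch := exact hk')

lemma disp_eq {Z : PWL} {q : Params} {s : ℝ} (hL : Z.gL = q.1 * q.2.1) (hR : Z.gR = q.1 * q.2.2.1)
    (hk : Z.kappa = q.2.2.2.1) (ho : Z.offset = q.1 * q.2.2.2.2) (hs : s ∈ meanDomain Z.gL)
    (hk0 : 0 < q.2.2.2.1) : Z.disp s = q.1 * reduced q s := by
  have h1 := pos_of_mem_meanDomain hs
  rw [disp, gainL_eq hs, gainR_eq (by rw [hk]; positivity), hk, ho, hL, hR, reduced, rest]
  ring

lemma tendsto_reduced_div {q₀ : Params} (h0 : q₀.1 = 0) (hk : 0 < q₀.2.2.2.1) :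
    Tendsto (fun p : Params × ℝ => reduced p.1 p.2 / p.2) (𝓝 q₀ ×ˢ atTop)
      (𝓝 ((q₀.2.1 + q₀.2.2.1) * (Real.pi / 2))) := by
  have e : ∀ f : Params → ℝ, Continuous f →
      Tendsto (fun p : Params × ℝ => f p.1) (𝓝 q₀ ×ˢ atTop) (𝓝 (f q₀)) := fun f hf =>
    (hf.tendsto q₀).comp tendsto_fst
  have hs : Tendsto (fun p : Params × ℝ => p.2) (𝓝 q₀ ×ˢ atTop) atTop := tendsto_snd
  have hkk := e (fun q => q.2.2.2.1) (by fun_prop)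
  have hx := e (fun q => q.1 * q.2.1) (by fun_prop)
  have hy := e (fun q => q.1 * q.2.2.1) (by fun_prop)
  simp only [h0, zero_mul] at hx hy
  have h1 := tendsto_phi_div.comp (hx.prodMk hs)
  have h2 := tendsto_psi_div.comp (hy.prodMk (hkk.pos_mul_atTop hk hs))
  have h3 : Tendsto (fun p : Params × ℝ => p.1.2.2.2.2 * p.2⁻¹) (𝓝 q₀ ×ˢ atTop) (𝓝 0) := by
    simpa using (e (fun q => q.2.2.2.2) (by fun_prop)).mul (tendsto_inv_atTop_zero.comp hs)
  have h4 := (((e (fun q => q.2.1) (by fun_prop)).mul h1).add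
    ((e (fun q => q.2.2.1) (by fun_prop)).mul h2)).add h3
  rw [add_zero, ← add_mul] at h4
  refine h4.congr' ?_
  filter_upwards [hs.eventually (eventually_gt_atTop 0), hkk.eventually (lt_mem_nhds hk)] with p hp1 hp2
  simp only [Function.comp_apply, reduced, rest]
  field_simp
  ring

lemma tendsto_rest {q₀ : Params} (h0 : q₀.1 = 0) (hk : 0 < q₀.2.2.2.1) :
    Tendsto (fun p : Params × ℝ => rest p.1 p.2) (𝓝 q₀ ×ˢ 𝓝[>] 0) (𝓝 q₀.2.2.2.2) := by
  have e : ∀ f : Params → ℝ, Continuous f →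
      Tendsto (fun p : Params × ℝ => f p.1) (𝓝 q₀ ×ˢ 𝓝[>] 0) (𝓝 (f q₀)) := fun f hf =>
    (hf.tendsto q₀).comp tendsto_fst
  have hs : Tendsto (fun p : Params × ℝ => p.2) (𝓝 q₀ ×ˢ 𝓝[>] 0) (𝓝[>] 0) := tendsto_snd
  have hkk := e (fun q => q.2.2.2.1) (by fun_prop)
  have hy := e (fun q => q.1 * q.2.2.1) (by fun_prop)
  simp only [h0, zero_mul] at hy
  have hks : Tendsto (fun p : Params × ℝ => p.1.2.2.2.1 * p.2) (𝓝 q₀ ×ˢ 𝓝[>] 0) (𝓝[>] 0) := by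
    refine tendsto_nhdsWithin_iff.2 ⟨?_, ?_⟩
    · simpa using hkk.mul (hs.mono_right nhdsWithin_le_nhds)
    · filter_upwards [hkk.eventually (lt_mem_nhds hk),
        hs.eventually (self_mem_nhdsWithin : ∀ᶠ s in 𝓝[>] (0:ℝ), 0 < s)] with p h1 h2 using mul_pos h1 h2
  have h2 := tendsto_psi_zero.comp (hy.prodMk hks)
  have h4 := (((e (fun q => q.2.2.1) (by fun_prop)).mul h2).div hkk hk.ne').add
    (e (fun q => q.2.2.2.2) (by fun_prop))
  simp only [mul_zero, zero_div, zero_add] at h4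
  exact h4

/-- Near the real focus the damping of the left zone decides the sign of the displacement. -/
lemma exists_reduced_sign_zero {q₀ : Params} (h0 : q₀.1 = 0) (hk : 0 < q₀.2.2.2.1)
    (hc : q₀.2.1 ≠ 0) :
    ∃ s₀ > 0, ∀ᶠ q in 𝓝 q₀, ∀ s ∈ meanDomain (q.1 * q.2.1), s ≤ s₀ → 0 < q₀.2.1 * reduced q s := by
  have h1 := tendsto_rest h0 hk
  have hc2 : 0 < q₀.2.1 * q₀.2.1 := mul_self_pos.2 hc
  have h2 : ∀ᶠ p : Params × ℝ in 𝓝 q₀ ×ˢ 𝓝[>] 0, p.2 ∈ meanDomain (p.1.1 * p.1.2.1) →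
      0 < q₀.2.1 * reduced p.1 p.2 := by
    have hfst : Tendsto (fun p : Params × ℝ => p.1) (𝓝 q₀ ×ˢ 𝓝[>] 0) (𝓝 q₀) := tendsto_fst
    have hcc : Tendsto (fun p : Params × ℝ => q₀.2.1 * p.1.2.1) (𝓝 q₀ ×ˢ 𝓝[>] 0) (𝓝 (q₀.2.1 * q₀.2.1)) :=
      ((by fun_prop : Continuous fun q : Params => q₀.2.1 * q.2.1).tendsto q₀).comp hfst
    have hR := h1.const_mul q₀.2.1
    have hinf : Tendsto (fun p : Params × ℝ => q₀.2.1 * p.1.2.1 * (Real.pi / (2 * p.2))) (𝓝 q₀ ×ˢ 𝓝[>] 0)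
        atTop := by
      refine hcc.pos_mul_atTop hc2 ?_
      have : Tendsto (fun s : ℝ => Real.pi / 2 * s⁻¹) (𝓝[>] 0) atTop :=
        tendsto_inv_nhdsGT_zero.const_mul_atTop (by positivity)
      refine (this.comp (tendsto_snd (f := 𝓝 q₀))).congr fun p => ?_
      simp only [Function.comp_apply, div_eq_mul_inv, mul_inv]; ring
    have hsum := hinf.atTop_add hR
    filter_upwards [hsum.eventually (eventually_gt_atTop 0), hcc.eventually (lt_mem_nhds hc2)]
      with p hp1 hp2 hs
    have := mul_le_mul_of_nonneg_left (le_phi hs) hp2.le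
    rw [reduced]
    linarith
  obtain ⟨pa, hpa, pb, hpb, hab⟩ := eventually_prod_iff.1 h2
  obtain ⟨s₀, hs₀, hs₀'⟩ := (mem_nhdsGT_iff_exists_Ioc_subset).1 hpb
  exact ⟨s₀, hs₀, hpa.mono fun q hq s hs hle => hab hq (hs₀' ⟨pos_of_mem_meanDomain hs, hle⟩) hs⟩

/-- Near the real focus the offset decides the sign of `rest`, which is the whole displacement if there
is no damping in the left zone. -/
lemma exists_rest_sign_zero {q₀ : Params} (h0 : q₀.1 = 0) (hk : 0 < q₀.2.2.2.1)
    (hc : q₀.2.2.2.2 ≠ 0) :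
    ∃ s₀ > 0, ∀ᶠ q in 𝓝 q₀, ∀ s, 0 < s → s ≤ s₀ → 0 < q₀.2.2.2.2 * rest q s := by
  have h1 := (tendsto_rest h0 hk).const_mul q₀.2.2.2.2
  obtain ⟨pa, hpa, pb, hpb, hab⟩ := eventually_prod_iff.1 (h1.eventually (lt_mem_nhds (mul_self_pos.2 hc)))
  obtain ⟨s₀, hs₀, hs₀'⟩ := (mem_nhdsGT_iff_exists_Ioc_subset).1 hpb
  exact ⟨s₀, hs₀, hpa.mono fun q hq s hs hle => hab hq (hs₀' ⟨hs, hle⟩)⟩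

/-- Far out the total damping decides the sign of the displacement. -/
lemma exists_reduced_sign_atTop {q₀ : Params} (h0 : q₀.1 = 0) (hk : 0 < q₀.2.2.2.1)
    (hc : q₀.2.1 + q₀.2.2.1 ≠ 0) :
    ∃ s₁ > 0, ∀ᶠ q in 𝓝 q₀, ∀ s, s₁ ≤ s → 0 < (q₀.2.1 + q₀.2.2.1) * reduced q s := by
  have h1 := (tendsto_reduced_div h0 hk).const_mul (q₀.2.1 + q₀.2.2.1)
  rw [← mul_assoc] at h1
  have h2 := h1.eventually (lt_mem_nhds (mul_pos (mul_self_pos.2 hc) (by positivity)))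
  obtain ⟨pa, hpa, pb, hpb, hab⟩ := eventually_prod_iff.1 h2
  obtain ⟨s₁, hs₁⟩ := eventually_atTop.1 hpb
  refine ⟨max s₁ 1, by positivity, hpa.mono fun q hq s hle => ?_⟩
  have := hab hq (hs₁ s ((le_max_left _ _).trans hle))
  rw [← mul_div_assoc] at this
  exact (div_pos_iff_of_pos_right (lt_of_lt_of_le (by positivity) ((le_max_right _ _).trans hle))).1 this

/-! ### Perturbations of the canonical form -/

/-- What is used of an expansion up to `O(ε³)`: the limit of the coefficient and of its difference
quotient. -/
lemma tendsto_of_expansion {f : ℝ → ℝ} {f₀ f₁ f₂ : ℝ}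
    (h : (fun ε : ℝ => f ε - (f₀ + ε * f₁ + ε ^ 2 * f₂)) =O[𝓝[≥] 0] (fun ε : ℝ => ε ^ 3)) :
    Tendsto f (𝓝[>] 0) (𝓝 f₀) ∧ Tendsto (fun ε => (f ε - f₀) / ε) (𝓝[>] 0) (𝓝 f₁) := by
  have hε : Tendsto (fun ε : ℝ => ε) (𝓝[>] 0) (𝓝 0) := nhdsWithin_le_nhds
  have hne : ∀ᶠ ε : ℝ in 𝓝[>] 0, ε ≠ 0 := by
    filter_upwards [self_mem_nhdsWithin] with ε hε using ne_of_gt hε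
  have h1 : (fun ε : ℝ => f ε - (f₀ + ε * f₁ + ε ^ 2 * f₂)) =O[𝓝[>] 0] (fun ε : ℝ => ε ^ 3) :=
    h.mono (nhdsWithin_mono _ Set.Ioi_subset_Ici_self)
  have h2 : (fun ε : ℝ => (f ε - (f₀ + ε * f₁ + ε ^ 2 * f₂)) / ε) =O[𝓝[>] 0] (fun ε : ℝ => ε ^ 2) := by
    refine (h1.mul (isBigO_refl (fun ε : ℝ => ε⁻¹) _)).congr' ?_ ?_
    · exact Eventually.of_forall fun ε => (div_eq_mul_inv _ _).symm
    · filter_upwards [hne] with ε hε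
      field_simp
  have h3 : Tendsto (fun ε : ℝ => (f ε - (f₀ + ε * f₁ + ε ^ 2 * f₂)) / ε) (𝓝[>] 0) (𝓝 0) :=
    h2.trans_tendsto (by simpa using hε.pow 2)
  have h4 : Tendsto (fun ε => (f ε - f₀) / ε) (𝓝[>] 0) (𝓝 f₁) := by
    have := (h3.add_const f₁).add (hε.mul_const f₂)
    simp only [zero_add, zero_mul, add_zero] at this
    refine this.congr' ?_
    filter_upwards [hne] with ε hε
    field_simp
    ring
  refine ⟨?_, h4⟩
  have := (hε.mul h4).const_add f₀
  simp only [zero_mul, add_zero] at this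
  refine this.congr' ?_
  filter_upwards [hne] with ε hε
  field_simp
  ring

lemma tendsto_freq {ι : Type*} {l : Filter ι} {M : ι → Matrix (Fin 2) (Fin 2) ℝ} {N : Matrix (Fin 2) (Fin 2) ℝ}
    (h : ∀ i j, Tendsto (fun x => M x i j) l (𝓝 (N i j))) :
    Tendsto (fun x => damping (M x)) l (𝓝 (damping N)) ∧
      Tendsto (fun x => stiffness (M x)) l (𝓝 (stiffness N)) ∧
      Tendsto (fun x => freq (M x)) l (𝓝 (freq N)) := by
  have h1 : Tendsto (fun x => damping (M x)) l (𝓝 (damping N)) := ((h 0 0).add (h 1 1)).div_const 2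
  have h2 : Tendsto (fun x => stiffness (M x)) l (𝓝 (stiffness N)) :=
    ((h 0 0).mul (h 1 1)).sub ((h 0 1).mul (h 1 0))
  exact ⟨h1, h2, (h2.sub (h1.pow 2)).sqrt⟩

/-- The normalized parameters of the member with parameter `ε` of a family of fields. -/
noncomputable def params (Z : PWL) (ε : ℝ) : Params :=
  (ε, Z.gL / ε, Z.gR / ε, Z.kappa, Z.offset / ε)

/-- The limit of the normalized parameters of a perturbation of the canonical form. -/
noncomputable def limitParams (b d e ξ : ℝ) (Z₁ : PWL) : Params :=
  (0, Z₁.trL / 2, Z₁.trR / (2 * ξ), e * ξ / d, (b * Z₁.leftVec 0 + Z₁.rightVec 0) / (-b * e))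

lemma disp_eq_params {Z : PWL} (hZ : Z.IsGood) {ε s : ℝ} (hε : 0 < ε) (hs : s ∈ meanDomain Z.gL) :
    Z.disp s = ε * reduced (Z.params ε) s := by
  refine disp_eq (q := Z.params ε) ?_ ?_ rfl ?_ hs hZ.kappa_pos <;>
  · simp only [params]; field_simp

lemma params_gL {Z : PWL} {ε : ℝ} (hε : 0 < ε) : (Z.params ε).1 * (Z.params ε).2.1 = Z.gL := by
  simp only [params]; field_simp

lemma tendsto_reach {ι : Type*} {l : Filter ι} {M : ι → Matrix (Fin 2) (Fin 2) ℝ} {N : Matrix (Fin 2) (Fin 2) ℝ}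
    {v : ι → Fin 2 → ℝ} {w : Fin 2 → ℝ} (h : ∀ i j, Tendsto (fun x => M x i j) l (𝓝 (N i j)))
    (hv : ∀ i, Tendsto (fun x => v x i) l (𝓝 (w i))) (hN : stiffness N ≠ 0) :
    Tendsto (fun x => reach (M x) (v x)) l (𝓝 (reach N w)) :=
  ((((h 1 1).mul (hv 0)).sub ((h 0 1).mul (hv 1))).div (tendsto_freq h).2.1 hN).mul (tendsto_freq h).2.2

lemma eventually_isRotating {ι : Type*} {l : Filter ι} {M : ι → Matrix (Fin 2) (Fin 2) ℝ}
    {N : Matrix (Fin 2) (Fin 2) ℝ} (h : ∀ i j, Tendsto (fun x => M x i j) l (𝓝 (N i j)))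
    (hN : IsRotating N) : ∀ᶠ x in l, IsRotating (M x) :=
  ((h 0 1).eventually (gt_mem_nhds hN.1)).and
    (((tendsto_freq h).1.pow 2).eventually_lt (tendsto_freq h).2.1 hN.2)

variable {a b c d e ξ : ℝ} {Z₁ Z₂ : PWL} {Z : ℝ → PWL}

lemma canonical_left : damping (canonical a b c d e).leftMat = 0 ∧
    stiffness (canonical a b c d e).leftMat = 1 ∧ freq (canonical a b c d e).leftMat = 1 ∧
    (canonical a b c d e).hL = e := by
  have h1 : damping (canonical a b c d e).leftMat = 0 := by simp [damping, canonical]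
  have h2 : stiffness (canonical a b c d e).leftMat = 1 := by simp [stiffness, canonical]
  have h3 : freq (canonical a b c d e).leftMat = 1 := by simp [freq, h1, h2]
  refine ⟨h1, h2, h3, ?_⟩
  rw [hL, reach, h2, h3]; simp [canonical]

lemma canonical_right (hξ : 0 < ξ) (habc : a ^ 2 + b * c = -ξ ^ 2) :
    damping (canonical a b c d e).rightMat = 0 ∧
    stiffness (canonical a b c d e).rightMat = ξ ^ 2 ∧ freq (canonical a b c d e).rightMat = ξ ∧
    (canonical a b c d e).hR = -b * d / ξ := by
  have h1 : damping (canonical a b c d e).rightMat = 0 := by simp [damping, canonical]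
  have h2 : stiffness (canonical a b c d e).rightMat = ξ ^ 2 := by
    simp [stiffness, canonical]; linarith
  have h3 : freq (canonical a b c d e).rightMat = ξ := by
    simp [freq, h1, h2, Real.sqrt_sq hξ.le]
  refine ⟨h1, h2, h3, ?_⟩
  rw [hR, reach, h2, h3]; simp [canonical]; field_simp

lemma isGood_canonical (hb : b < 0) (hd : 0 < d) (he : 0 < e) (hξ : 0 < ξ) (habc : a ^ 2 + b * c = -ξ ^ 2) :
    (canonical a b c d e).IsGood := by
  obtain ⟨l1, l2, l3, l4⟩ := @canonical_left a b c d e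
  obtain ⟨r1, r2, r3, r4⟩ := canonical_right (d := d) (e := e) hξ habc
  refine ⟨⟨by simp [canonical], by rw [l1, l2]; norm_num⟩, ⟨by simpa [canonical], by rw [r1, r2]; nlinarith⟩,
    ?_, ?_⟩
  · exact lt_of_lt_of_eq he l4.symm
  · exact lt_of_lt_of_eq (div_pos (mul_pos (neg_pos.2 hb) hd) hξ) r4.symm

/-- The coefficients of a perturbation converge. -/
lemma IsPerturbation.tendsto_coeff {Z₀ : PWL} (h : IsPerturbation Z₀ Z₁ Z₂ Z) :
    (∀ i j, Tendsto (fun ε => (Z ε).leftMat i j) (𝓝[>] 0) (𝓝 (Z₀.leftMat i j))) ∧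
    (∀ i, Tendsto (fun ε => (Z ε).leftVec i) (𝓝[>] 0) (𝓝 (Z₀.leftVec i))) ∧
    (∀ i j, Tendsto (fun ε => (Z ε).rightMat i j) (𝓝[>] 0) (𝓝 (Z₀.rightMat i j))) ∧
    (∀ i, Tendsto (fun ε => (Z ε).rightVec i) (𝓝[>] 0) (𝓝 (Z₀.rightVec i))) :=
  ⟨fun i j => (tendsto_of_expansion (h.2.2.1 i j)).1, fun i => (tendsto_of_expansion (h.2.2.2 i)).1,
    fun i j => (tendsto_of_expansion (h.1 i j)).1, fun i => (tendsto_of_expansion (h.2.1 i)).1⟩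

lemma IsPerturbation.eventually_isGood {Z₀ : PWL} (h : IsPerturbation Z₀ Z₁ Z₂ Z) (h0 : Z₀.IsGood) :
    ∀ᶠ ε in 𝓝[>] (0 : ℝ), (Z ε).IsGood := by
  obtain ⟨hl, hlv, hr, hrv⟩ := h.tendsto_coeff
  filter_upwards [eventually_isRotating hl h0.rotL, eventually_isRotating hr h0.rotR,
    (tendsto_reach hl hlv h0.rotL.stiffness_pos.ne').eventually (lt_mem_nhds h0.reachL),
    (tendsto_reach hr hrv h0.rotR.stiffness_pos.ne').eventually (lt_mem_nhds h0.reachR)]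
    with ε h1 h2 h3 h4 using ⟨h1, h2, h3, h4⟩

/-- The normalized parameters of a perturbation converge, to values that depend on the first-order
term only. -/
lemma IsPerturbation.tendsto_params (h : IsPerturbation (canonical a b c d e) Z₁ Z₂ Z)
    (hb : b < 0) (hd : 0 < d) (he : 0 < e) (hξ : 0 < ξ) (habc : a ^ 2 + b * c = -ξ ^ 2) :
    Tendsto (fun ε => (Z ε).params ε) (𝓝[>] 0) (𝓝 (limitParams b d e ξ Z₁)) := by
  obtain ⟨l1, l2, l3, l4⟩ := @canonical_left a b c d e
  obtain ⟨r1, r2, r3, r4⟩ := canonical_right (d := d) (e := e) hξ habc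
  obtain ⟨hl, hlv, hr, hrv⟩ := h.tendsto_coeff
  have hL := tendsto_reach hl hlv (by rw [l2]; norm_num)
  have hR := tendsto_reach hr hrv (by rw [r2]; positivity)
  have fL := (tendsto_freq hl).2.2
  have fR := (tendsto_freq hr).2.2
  have hrho : Tendsto (fun ε => (Z ε).rho) (𝓝[>] 0) (𝓝 (-b)) := by
    have := (hr 0 1).div (hl 0 1) (by simp [canonical])
    rw [show (canonical a b c d e).rightMat 0 1 / (canonical a b c d e).leftMat 0 1 = -b by
      simp [canonical, div_neg]] at this
    exact this
  change Tendsto (fun ε => (Z ε).hL) _ (𝓝 (canonical a b c d e).hL) at hL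
  change Tendsto (fun ε => (Z ε).hR) _ (𝓝 (canonical a b c d e).hR) at hR
  rw [l3] at fL
  rw [r3] at fR
  rw [l4] at hL
  rw [r4] at hR
  have hbn := neg_pos.2 hb
  have k1 : Tendsto (fun ε => (Z ε).gL / ε) (𝓝[>] 0) (𝓝 (Z₁.trL / 2)) := by
    have := ((((tendsto_of_expansion (h.2.2.1 0 0)).2.add (tendsto_of_expansion (h.2.2.1 1 1)).2).div_const
      2).div fL one_ne_zero)
    rw [div_one] at this
    refine this.congr fun ε => ?_
    simp only [Pi.div_apply, canonical, gL, ratio, damping]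
    simp
    ring
  have k2 : Tendsto (fun ε => (Z ε).gR / ε) (𝓝[>] 0) (𝓝 (Z₁.trR / (2 * ξ))) := by
    have := ((((tendsto_of_expansion (h.1 0 0)).2.add (tendsto_of_expansion (h.1 1 1)).2).div_const
      2).div fR hξ.ne')
    rw [div_div] at this
    refine this.congr fun ε => ?_
    simp only [Pi.div_apply, canonical, gR, ratio, damping]
    simp
    ring
  have k3 : Tendsto (fun ε => (Z ε).kappa) (𝓝[>] 0) (𝓝 (e * ξ / d)) := by
    have := (hrho.mul hL).div hR (div_ne_zero (mul_ne_zero hbn.ne' hd.ne') hξ.ne')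
    rw [show -b * e / (-b * d / ξ) = e * ξ / d by have := hb.ne; field_simp] at this
    exact this
  have k4 : Tendsto (fun ε => (Z ε).offset / ε) (𝓝[>] 0)
      (𝓝 ((b * Z₁.leftVec 0 + Z₁.rightVec 0) / (-b * e))) := by
    have := ((tendsto_of_expansion (h.2.1 0)).2.sub (hrho.mul (tendsto_of_expansion (h.2.2.2 0)).2)).div
      (hrho.mul hL) (mul_pos hbn he).ne'
    rw [show Z₁.rightVec 0 - -b * Z₁.leftVec 0 = b * Z₁.leftVec 0 + Z₁.rightVec 0 by ring] at this
    refine this.congr fun ε => ?_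
    simp only [Pi.div_apply, canonical, offset, beta]
    simp
    ring
  have k0 : Tendsto (fun ε : ℝ => ε) (𝓝[>] 0) (𝓝 0) := nhdsWithin_le_nhds
  exact k0.prodMk_nhds (k1.prodMk_nhds (k2.prodMk_nhds (k3.prodMk_nhds k4)))

lemma IsPerturbation.tendsto_gL (h : IsPerturbation (canonical a b c d e) Z₁ Z₂ Z) :
    Tendsto (fun ε => (Z ε).gL) (𝓝[>] 0) (𝓝 0) := by
  obtain ⟨l1, l2, l3, l4⟩ := @canonical_left a b c d e
  obtain ⟨hl, -, -, -⟩ := h.tendsto_coeff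
  have := (tendsto_freq hl).1.div (tendsto_freq hl).2.2 (by rw [l3]; norm_num)
  rw [l1, zero_div] at this
  exact this

lemma IsPerturbation.tendsto_height (h : IsPerturbation (canonical a b c d e) Z₁ Z₂ Z)
    {s : ℝ} (hs : 0 < s) : Tendsto (fun ε => (Z ε).height s) (𝓝[>] 0) (𝓝 (e * s)) := by
  obtain ⟨l1, l2, l3, l4⟩ := @canonical_left a b c d e
  obtain ⟨hl, hlv, -, -⟩ := h.tendsto_coeff
  have hL := tendsto_reach hl hlv (by rw [l2]; norm_num)
  change Tendsto (fun ε => (Z ε).hL) _ (𝓝 (canonical a b c d e).hL) at hL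
  rw [l4] at hL
  have hg := h.tendsto_gL
  have hG : Tendsto (fun ε => gainL (Z ε).gL s) (𝓝[>] 0) (𝓝 0) := by
    have h1 := (analyticAt_gainL (mem_meanDomain_zero hs)).continuousAt
    have h2 : gainL 0 s = 0 := by rw [gainL_eq (mem_meanDomain_zero hs), zero_mul]
    have h3 := h1.tendsto.comp (hg.prodMk_nhds (tendsto_const_nhds (x := s)))
    simp only [h2] at h3
    exact h3
  have h4 := ((hL.mul (hG.const_sub s)).neg.sub (hlv 0)).div (hl 0 1) (by simp [canonical])
  simp only [canonical] at h4
  simp at h4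
  exact h4

/-! ### Stability of the extreme limit cycles -/

lemma IsPerturbation.eventually_mem_meanDomain (h : IsPerturbation (canonical a b c d e) Z₁ Z₂ Z)
    {s : ℝ} (hs : 0 < s) : ∀ᶠ ε in 𝓝[>] (0 : ℝ), s ∈ meanDomain (Z ε).gL := by
  have h1 : ∀ᶠ g in 𝓝 (0:ℝ), s ∈ meanDomain g :=
    (isOpen_meanDomain_prod.preimage (by fun_prop : Continuous fun g : ℝ => (g, s))).mem_nhds
      (mem_meanDomain_zero hs)
  exact h.tendsto_gL.eventually h1

/-- Far out the displacement has the sign of the total damping. -/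
lemma IsPerturbation.eventually_disp_atTop (h : IsPerturbation (canonical a b c d e) Z₁ Z₂ Z)
    (hb : b < 0) (hd : 0 < d) (he : 0 < e) (hξ : 0 < ξ) (habc : a ^ 2 + b * c = -ξ ^ 2)
    (hc : ξ * Z₁.trL + Z₁.trR ≠ 0) :
    ∀ᶠ ε in 𝓝[>] (0 : ℝ), ∀ᶠ s in atTop, 0 < (ξ * Z₁.trL + Z₁.trR) * (Z ε).disp s := by
  have hsum : (limitParams b d e ξ Z₁).2.1 + (limitParams b d e ξ Z₁).2.2.1 =
      (ξ * Z₁.trL + Z₁.trR) / (2 * ξ) := by simp only [limitParams]; field_simp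
  obtain ⟨s₁, -, hs₁⟩ := exists_reduced_sign_atTop (q₀ := limitParams b d e ξ Z₁) rfl
    (div_pos (mul_pos he hξ) hd) (by rw [hsum]; exact div_ne_zero hc (by positivity))
  filter_upwards [(h.tendsto_params hb hd he hξ habc).eventually hs₁,
    h.eventually_isGood (isGood_canonical hb hd he hξ habc), self_mem_nhdsWithin] with ε h1 hZ hε
  obtain ⟨s₂, hs₂⟩ := hZ.meanDomain_nonempty
  filter_upwards [eventually_ge_atTop s₁, eventually_ge_atTop s₂] with s h2 h3
  have h4 := h1 s h2
  have hε' : 0 < ε := hε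
  rw [hsum] at h4
  rw [disp_eq_params hZ hε (meanDomain_of_le hs₂ h3)]
  have h5 := mul_pos h4 (mul_pos hε' (mul_pos two_pos hξ))
  refine h5.trans_eq ?_
  field_simp

lemma IsGood.lowestAbove_of_sign {Z : PWL} (hZ : Z.IsGood) {Γ : Set (Fin 2 → ℝ)} {σ r s₁ : ℝ}
    (hΓ : Z.IsLowestAbove r Γ) (hyp : Z.IsHyperbolic Γ) (hs₁ : s₁ ∈ meanDomain Z.gL)
    (hr : r ≤ Z.height s₁)
    (hpos : ∀ s ∈ meanDomain Z.gL, s ≤ s₁ → r ≤ Z.height s → 0 < σ * Z.disp s) :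
    (0 < σ → Z.IsStable Γ) ∧ (σ < 0 → Z.IsUnstable Γ) := by
  have h := hZ.lowestAbove hΓ hyp hs₁ hr fun s h1 h2 h3 => right_ne_zero_of_mul (hpos s h1 h2 h3).ne'
  have h1 := hpos s₁ hs₁ le_rfl hr
  exact ⟨fun hσ => h.1 ((pos_iff_pos_of_mul_pos h1).1 hσ),
    fun hσ => h.2 ((neg_iff_neg_of_mul_pos h1).1 hσ)⟩

lemma IsGood.lowest_of_sign {Z : PWL} (hZ : Z.IsGood) {Γ : Set (Fin 2 → ℝ)} {σ s₁ : ℝ}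
    (hΓ : Z.IsLowest Γ) (hyp : Z.IsHyperbolic Γ) (hs₁ : s₁ ∈ meanDomain Z.gL)
    (hpos : ∀ s ∈ meanDomain Z.gL, s ≤ s₁ → 0 < σ * Z.disp s) :
    (0 < σ → Z.IsStable Γ) ∧ (σ < 0 → Z.IsUnstable Γ) := by
  obtain ⟨hlc, y, hy, hmin⟩ := hΓ
  exact hZ.lowestAbove_of_sign (r := min y (Z.height s₁))
    ⟨hlc, y, hy, min_le_left _ _, fun Γ' y' h1 h2 _ => hmin Γ' y' h1 h2⟩ hyp hs₁ (min_le_right _ _)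
    fun s h1 h2 _ => hpos s h1 h2

/-- If the damping of the left zone does not vanish to first order, its sign decides the stability of
the limit cycle of lowest amplitude. -/
lemma IsPerturbation.eventually_lowest (h : IsPerturbation (canonical a b c d e) Z₁ Z₂ Z)
    (hb : b < 0) (hd : 0 < d) (he : 0 < e) (hξ : 0 < ξ) (habc : a ^ 2 + b * c = -ξ ^ 2)
    (hc : Z₁.trL ≠ 0) :
    ∀ᶠ ε in 𝓝[>] (0 : ℝ), ∀ Γ, (Z ε).IsLowest Γ → (Z ε).IsHyperbolic Γ →
      (0 < Z₁.trL → (Z ε).IsStable Γ) ∧ (Z₁.trL < 0 → (Z ε).IsUnstable Γ) := by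
  obtain ⟨s₀, hs₀, hev⟩ := exists_reduced_sign_zero (q₀ := limitParams b d e ξ Z₁) rfl
    (div_pos (mul_pos he hξ) hd) (div_ne_zero hc two_ne_zero)
  filter_upwards [(h.tendsto_params hb hd he hξ habc).eventually hev,
    h.eventually_isGood (isGood_canonical hb hd he hξ habc), self_mem_nhdsWithin,
    h.eventually_mem_meanDomain hs₀] with ε h1 hZ hε hmem Γ hΓ hyp
  have hε' : 0 < ε := hε
  refine hZ.lowest_of_sign (σ := Z₁.trL) hΓ hyp hmem fun s hs hle => ?_
  have h4 := h1 s (by rwa [params_gL hε']) hle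
  have h5 : 0 < Z₁.trL / 2 * reduced ((Z ε).params ε) s := h4
  rw [disp_eq_params hZ hε hs]
  refine (mul_pos h5 (mul_pos two_pos hε')).trans_eq ?_
  ring

lemma reduced_of_eq_zero {q : Params} (h : q.2.1 = 0) (s : ℝ) : reduced q s = rest q s := by
  rw [reduced, h, zero_mul, zero_add]

/-- A strict inequality for the reduced displacement of the limit persists on compact intervals. -/
lemma eventually_reduced_pos {q₀ : Params} (h0 : q₀.1 = 0) (hk : 0 < q₀.2.2.2.1) {K : Set ℝ}
    (hK : IsCompact K) {σ : ℝ} (hpos : ∀ s ∈ K, 0 < s ∧ 0 < σ * reduced q₀ s) :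
    ∀ᶠ q in 𝓝 q₀, ∀ s ∈ K, 0 < σ * reduced q s := by
  refine hK.eventually_forall_of_forall_eventually fun s hs => ?_
  have hd : s ∈ meanDomain (q₀.1 * q₀.2.1) := by
    rw [h0, zero_mul]; exact mem_meanDomain_zero (hpos s hs).1
  have := ((analyticAt_reduced hd hk).continuousAt.const_mul σ).eventually (lt_mem_nhds (hpos s hs).2)
  exact this

/-- If the damping of the left zone vanishes to first order, the offset takes over. Its higher order
terms may still create limit cycles of small amplitude, so these are excluded, unless the trace of the
left zone vanishes identically. -/
lemma IsPerturbation.eventually_lowestAbove (h : IsPerturbation (canonical a b c d e) Z₁ Z₂ Z)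
    (hb : b < 0) (hd : 0 < d) (he : 0 < e) (hξ : 0 < ξ) (habc : a ^ 2 + b * c = -ξ ^ 2)
    (hc : Z₁.trL = 0) (hv : b * Z₁.leftVec 0 + Z₁.rightVec 0 ≠ 0) :
    (∃ r₀ > 0, ∀ r ∈ Set.Ioo 0 r₀, ∀ᶠ ε in 𝓝[>] (0 : ℝ),
      ∀ Γ, (Z ε).IsLowestAbove r Γ → (Z ε).IsHyperbolic Γ →
      (0 < b * Z₁.leftVec 0 + Z₁.rightVec 0 → (Z ε).IsStable Γ) ∧
      (b * Z₁.leftVec 0 + Z₁.rightVec 0 < 0 → (Z ε).IsUnstable Γ)) ∧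
    ((∀ᶠ ε in 𝓝[>] (0 : ℝ), (Z ε).trL = 0) → ∀ᶠ ε in 𝓝[>] (0 : ℝ),
      ∀ Γ, (Z ε).IsLowest Γ → (Z ε).IsHyperbolic Γ →
      (0 < b * Z₁.leftVec 0 + Z₁.rightVec 0 → (Z ε).IsStable Γ) ∧
      (b * Z₁.leftVec 0 + Z₁.rightVec 0 < 0 → (Z ε).IsUnstable Γ)) := by
  set q₀ := limitParams b d e ξ Z₁ with hq₀
  have hk : 0 < q₀.2.2.2.1 := div_pos (mul_pos he hξ) hd
  have hbe : 0 < -b * e := mul_pos (neg_pos.2 hb) he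
  have hβ : q₀.2.2.2.2 = (b * Z₁.leftVec 0 + Z₁.rightVec 0) / (-b * e) := rfl
  have hβ0 : q₀.2.2.2.2 ≠ 0 := div_ne_zero hv hbe.ne'
  have hc0 : q₀.2.1 = 0 := by rw [hq₀, limitParams, hc, zero_div]
  have hq := h.tendsto_params hb hd he hξ habc
  obtain ⟨s₀, hs₀, hev⟩ := exists_rest_sign_zero (q₀ := q₀) rfl hk hβ0
  have hsign : ∀ {ε s : ℝ}, 0 < ε → (Z ε).IsGood → s ∈ meanDomain (Z ε).gL →
      0 < q₀.2.2.2.2 * reduced ((Z ε).params ε) s →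
      0 < (b * Z₁.leftVec 0 + Z₁.rightVec 0) * (Z ε).disp s := by
    intro ε s hε hZ hs hpos
    rw [disp_eq_params hZ hε hs]
    refine (mul_pos hpos (mul_pos hbe hε)).trans_eq ?_
    rw [hβ]
    have := hb.ne
    field_simp
  constructor
  · refine ⟨e * s₀, mul_pos he hs₀, fun r hr => ?_⟩
    have hs₂ : 0 < r / (2 * e) := div_pos hr.1 (by positivity)
    have hcomp := eventually_reduced_pos (q₀ := q₀) rfl hk (isCompact_Icc (a := r / (2 * e)) (b := s₀))
      (σ := q₀.2.2.2.2) fun s hs => by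
        have := hs₂.trans_le hs.1
        rw [reduced_of_eq_zero hc0]
        exact ⟨this, hev.self_of_nhds s this hs.2⟩
    have hlow := (h.tendsto_height hs₂).eventually (gt_mem_nhds (show e * (r / (2 * e)) < r by
      field_simp; linarith [hr.1]))
    filter_upwards [hq.eventually hcomp, h.eventually_isGood (isGood_canonical hb hd he hξ habc),
      self_mem_nhdsWithin, h.eventually_mem_meanDomain hs₀, h.eventually_mem_meanDomain hs₂, hlow,
      (h.tendsto_height hs₀).eventually (lt_mem_nhds hr.2)] with ε h1 hZ hε hm₀ hm₂ h2 h3 Γ hΓ hyp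
    refine hZ.lowestAbove_of_sign hΓ hyp hm₀ h3.le fun s hs hle hrs => hsign hε hZ hs (h1 s ⟨?_, hle⟩)
    by_contra hn
    linarith [hZ.height_strictMonoOn hs hm₂ (not_le.1 hn)]
  · intro htr
    filter_upwards [hq.eventually hev, h.eventually_isGood (isGood_canonical hb hd he hξ habc),
      self_mem_nhdsWithin, h.eventually_mem_meanDomain hs₀, htr] with ε h1 hZ hε hm₀ h2 Γ hΓ hyp
    refine hZ.lowest_of_sign hΓ hyp hm₀ fun s hs hle => hsign hε hZ hs ?_
    have hg : ((Z ε).params ε).2.1 = 0 := by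
      have : damping (Z ε).leftMat = 0 := by
        have : (Z ε).leftMat 0 0 + (Z ε).leftMat 1 1 = 0 := h2
        rw [damping, this, zero_div]
      simp only [params, gL, ratio, this, zero_div]
    rw [reduced_of_eq_zero hg]
    exact h1 s (pos_of_mem_meanDomain hs) hle

/-! ### Persistence of zeros of prescribed multiplicity -/

/-- Rolle's theorem, iterated: a zero of order at least `m` is the only zero on an interval where the
`m`-th derivative does not vanish. -/
lemma ne_zero_of_iteratedDeriv_ne_zero {m : ℕ} {f : ℝ → ℝ} {J : Set ℝ} (hJ : J.OrdConnected)
    (hf : ∀ x ∈ J, AnalyticAt ℝ f x) {τ : ℝ} (hτ : τ ∈ J) (h0 : ∀ j < m, iteratedDeriv j f τ = 0)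
    (hm : ∀ x ∈ J, iteratedDeriv m f x ≠ 0) : ∀ σ ∈ J, σ ≠ τ → f σ ≠ 0 := by
  induction m generalizing f with
  | zero => intro σ hσ _; simpa using hm σ hσ
  | succ m ih =>
    have h1 := ih (f := deriv f) (fun x hx => (hf x hx).deriv)
      (fun j hj => by rw [← iteratedDeriv_succ']; exact h0 (j + 1) (by omega))
      (fun x hx => by rw [← iteratedDeriv_succ']; exact hm x hx)
    have hτ0 : f τ = 0 := by simpa using h0 0 (by omega)
    have hc : ∀ x y, x ∈ J → y ∈ J → ContinuousOn f (Set.Icc x y) := fun x y hx hy z hz =>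
      (hf z (hJ.out hx hy hz)).continuousAt.continuousWithinAt
    intro σ hσ hne hσ0
    rcases hne.lt_or_gt with hlt | hlt
    · obtain ⟨c, hc1, hc2⟩ := exists_deriv_eq_zero hlt (hc _ _ hσ hτ) (hσ0.trans hτ0.symm)
      exact h1 c (hJ.out hσ hτ ⟨hc1.1.le, hc1.2.le⟩) hc1.2.ne hc2
    · obtain ⟨c, hc1, hc2⟩ := exists_deriv_eq_zero hlt (hc _ _ hτ hσ) (hτ0.trans hσ0.symm)
      exact h1 c (hJ.out hτ hσ ⟨hc1.1.le, hc1.2.le⟩) hc1.1.ne' hc2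

lemma analyticAt_slice {E : Type*} [NormedAddCommGroup E] [NormedSpace ℝ E] {F : E → ℝ → ℝ} {p : E × ℝ}
    (h : AnalyticAt ℝ (fun p : E × ℝ => F p.1 p.2) p) : AnalyticAt ℝ (F p.1) p.2 :=
  AnalyticAt.fun_comp (f := fun s => (p.1, s)) (g := fun p : E × ℝ => F p.1 p.2) h
    (AnalyticAt.prod analyticAt_const analyticAt_id)

lemma analyticAt_deriv_slice {E : Type*} [NormedAddCommGroup E] [NormedSpace ℝ E] [CompleteSpace E]
    {F : E → ℝ → ℝ} {p : E × ℝ}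
    (h : AnalyticAt ℝ (fun p : E × ℝ => F p.1 p.2) p) :
    AnalyticAt ℝ (fun p : E × ℝ => deriv (F p.1) p.2) p := by
  have h1 : AnalyticAt ℝ (fun x => fderiv ℝ (fun p : E × ℝ => F p.1 p.2) x (0, 1)) p :=
    ((ContinuousLinearMap.apply ℝ ℝ ((0, 1) : E × ℝ)).analyticAt _).comp h.fderiv
  refine h1.congr ?_
  filter_upwards [h.eventually_analyticAt] with x hx
  have h2 : HasFDerivAt (fun s : ℝ => (x.1, s)) (ContinuousLinearMap.inr ℝ E ℝ) x.2 :=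
    hasFDerivAt_prodMk_right x.1 x.2
  have h3 : HasFDerivAt (F x.1) _ x.2 :=
    HasFDerivAt.comp (g := fun p : E × ℝ => F p.1 p.2) x.2 hx.differentiableAt.hasFDerivAt h2
  rw [← fderiv_apply_one_eq_deriv, h3.fderiv]
  simp

lemma analyticAt_iteratedDeriv_slice {E : Type*} [NormedAddCommGroup E] [NormedSpace ℝ E] [CompleteSpace E]
    {F : E → ℝ → ℝ} {p : E × ℝ}
    (h : AnalyticAt ℝ (fun p : E × ℝ => F p.1 p.2) p) (m : ℕ) :
    AnalyticAt ℝ (fun p : E × ℝ => iteratedDeriv m (F p.1) p.2) p := by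
  induction m with
  | zero => simpa using h
  | succ m ih =>
    simp only [iteratedDeriv_succ]
    exact analyticAt_deriv_slice (F := fun q => iteratedDeriv m (F q)) ih

/-- The reduced displacement function of the unperturbed parameters `q₀` has the zeros `t i`, of the
multiplicities listed in `m`, and no others; moreover its behaviour at both ends of `(0, ∞)` is
governed by the dampings. -/
structure IsZeroPattern (q₀ : Params) (m : List ℕ) (t : Fin m.length → ℝ) : Prop where
  eps : q₀.1 = 0
  kappa_pos : 0 < q₀.2.2.2.1
  left_ne : q₀.2.1 ≠ 0
  total_ne : q₀.2.1 + q₀.2.2.1 ≠ 0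
  strictMono : StrictMono t
  pos : ∀ i, 0 < t i
  order : ∀ i, analyticOrderAt (reduced q₀) (t i) = m.get i
  complete : ∀ s, 0 < s → reduced q₀ s = 0 → ∃ i, s = t i

section Pattern

variable {q₀ : Params} {m : List ℕ} {t : Fin m.length → ℝ} (h : IsZeroPattern q₀ m t)
include h

lemma IsZeroPattern.analyticAt {s : ℝ} (hs : 0 < s) :
    AnalyticAt ℝ (fun p : Params × ℝ => reduced p.1 p.2) (q₀, s) :=
  analyticAt_reduced (by rw [h.eps, zero_mul]; exact mem_meanDomain_zero hs) h.kappa_pos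

/-- Around each zero of the limit there is an interval on which a derivative does not vanish, for all
nearby parameters. -/
lemma IsZeroPattern.exists_interval (i : Fin m.length) :
    ∃ δ > 0, ∀ᶠ q in 𝓝 q₀, ∀ s ∈ Set.Ioo (t i - δ) (t i + δ), s ∈ meanDomain (q.1 * q.2.1) ∧
      AnalyticAt ℝ (reduced q) s ∧ iteratedDeriv (m.get i) (reduced q) s ≠ 0 := by
  have hA := h.analyticAt (h.pos i)
  have h1 := (analyticOrderAt_eq_nat_iff_iteratedDeriv_eq_zero (analyticAt_slice hA)).1 (h.order i)
  have hdom : ∀ᶠ p : Params × ℝ in 𝓝 (q₀, t i), p.2 ∈ meanDomain (p.1.1 * p.1.2.1) :=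
    (isOpen_meanDomain_prod.preimage (by fun_prop :
      Continuous fun p : Params × ℝ => (p.1.1 * p.1.2.1, p.2))).mem_nhds
      (by simpa [h.eps] using mem_meanDomain_zero (h.pos i))
  have h2 := (analyticAt_iteratedDeriv_slice hA (m.get i)).continuousAt.eventually_ne h1.2
  have h3 := hdom.and ((hA.eventually_analyticAt.mono fun p hp => analyticAt_slice hp).and h2)
  rw [nhds_prod_eq] at h3
  obtain ⟨pa, hpa, pb, hpb, hab⟩ := eventually_prod_iff.1 h3
  obtain ⟨δ, hδ, hδ'⟩ := Metric.eventually_nhds_iff_ball.1 hpb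
  rw [Real.ball_eq_Ioo] at hδ'
  exact ⟨δ, hδ, hpa.mono fun q hq s hs => hab hq (hδ' s hs)⟩

/-- For nearby parameters all zeros lie near the zeros of the limit. -/
lemma IsZeroPattern.eventually_near {δ : Fin m.length → ℝ} (hδ : ∀ i, 0 < δ i) :
    ∀ᶠ q in 𝓝 q₀, ∀ s ∈ meanDomain (q.1 * q.2.1), reduced q s = 0 →
      ∃ i, s ∈ Set.Ioo (t i - δ i) (t i + δ i) := by
  obtain ⟨s₀, hs₀, h0⟩ := exists_reduced_sign_zero h.eps h.kappa_pos h.left_ne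
  obtain ⟨s₁, hs₁, h1⟩ := exists_reduced_sign_atTop h.eps h.kappa_pos h.total_ne
  have hK : IsCompact (Set.Icc s₀ s₁ \ ⋃ i, Set.Ioo (t i - δ i) (t i + δ i)) :=
    isCompact_Icc.diff (isOpen_iUnion fun i => isOpen_Ioo)
  have h2 : ∀ᶠ q in 𝓝 q₀, ∀ s ∈ Set.Icc s₀ s₁ \ ⋃ i, Set.Ioo (t i - δ i) (t i + δ i), reduced q s ≠ 0 := by
    refine hK.eventually_forall_of_forall_eventually fun s hs => ?_
    have hs0 : 0 < s := hs₀.trans_le hs.1.1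
    refine (h.analyticAt hs0).continuousAt.eventually_ne fun hz => ?_
    obtain ⟨i, rfl⟩ := h.complete s hs0 hz
    exact hs.2 (Set.mem_iUnion.2 ⟨i, by constructor <;> linarith [hδ i]⟩)
  filter_upwards [h0, h1, h2] with q h0 h1 h2 s hs hz
  by_contra hn
  have hlo : s₀ < s := not_le.1 fun hle => by simpa [hz] using h0 s hs hle
  have hhi : s < s₁ := not_le.1 fun hle => by simpa [hz] using h1 s hle
  exact h2 s ⟨⟨hlo.le, hhi.le⟩, by simpa using hn⟩ hz

/-- Zeros of the prescribed orders near those of the limit are all the zeros. -/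
lemma IsZeroPattern.eventually_zeros {ι : Type*} {l : Filter ι} {q : ι → Params} (hq : Tendsto q l (𝓝 q₀))
    {τ : ι → Fin m.length → ℝ} (hτ : ∀ i, Tendsto (fun x => τ x i) l (𝓝 (t i)))
    (h0 : ∀ i, ∀ j < m.get i, ∀ᶠ x in l, iteratedDeriv j (reduced (q x)) (τ x i) = 0)
    (h1 : ∀ i ∈ m, 1 ≤ i) :
    ∀ᶠ x in l, StrictMono (τ x) ∧
      (∀ i, τ x i ∈ meanDomain ((q x).1 * (q x).2.1) ∧ AnalyticAt ℝ (reduced (q x)) (τ x i) ∧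
        reduced (q x) (τ x i) = 0 ∧
        analyticOrderAt (reduced (q x)) (τ x i) = m.get i) ∧
      ∀ s ∈ meanDomain ((q x).1 * (q x).2.1), reduced (q x) s = 0 → ∃ i, s = τ x i := by
  choose δ hδ hδ' using h.exists_interval
  have e1 : ∀ᶠ x in l, StrictMono (τ x) := by
    have : ∀ᶠ x in l, ∀ i j, i < j → τ x i < τ x j := by
      refine eventually_all.2 fun i => eventually_all.2 fun j => ?_
      by_cases hij : i < j
      · exact ((hτ i).eventually_lt (hτ j) (h.strictMono hij)).mono fun x hx _ => hx
      · exact Eventually.of_forall fun x hx => absurd hx hij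
    exact this.mono fun x hx i j hij => hx i j hij
  have e2 : ∀ᶠ x in l, ∀ i, τ x i ∈ Set.Ioo (t i - δ i) (t i + δ i) :=
    eventually_all.2 fun i => (hτ i).eventually (Ioo_mem_nhds (by linarith [hδ i]) (by linarith [hδ i]))
  have e3 : ∀ᶠ x in l, ∀ i, ∀ j < m.get i, iteratedDeriv j (reduced (q x)) (τ x i) = 0 :=
    eventually_all.2 fun i => (eventually_all_finite (Set.finite_lt_nat (m.get i))).2 (h0 i)
  have e4 := hq.eventually (eventually_all.2 hδ')
  filter_upwards [e1, e2, e3, e4, hq.eventually (h.eventually_near hδ)] with x h2 h3 h4 h5 h6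
  refine ⟨h2, fun i => ?_, fun s hs hz => ?_⟩
  · obtain ⟨d1, d2, d3⟩ := h5 i _ (h3 i)
    refine ⟨d1, d2, ?_, (analyticOrderAt_eq_nat_iff_iteratedDeriv_eq_zero d2).2 ⟨h4 i, d3⟩⟩
    simpa using h4 i 0 (h1 _ (List.get_mem _ _))
  · obtain ⟨i, hi⟩ := h6 s hs hz
    refine ⟨i, by_contra fun hne => ?_⟩
    exact ne_zero_of_iteratedDeriv_ne_zero Set.ordConnected_Ioo (fun x hx => (h5 i x hx).2.1) (h3 i) (h4 i)
      (fun x hx => (h5 i x hx).2.2) s hi hne hz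

/-- A simple zero of the limit continues to nearby parameters. -/
lemma IsZeroPattern.exists_simple {i : Fin m.length} (hi : m.get i = 1) :
    ∃ σ : Params → ℝ, ContinuousAt σ q₀ ∧ σ q₀ = t i ∧ ∀ᶠ q in 𝓝 q₀, reduced q (σ q) = 0 := by
  have hA := h.analyticAt (h.pos i)
  have h1 := (analyticOrderAt_eq_nat_iff_iteratedDeriv_eq_zero (analyticAt_slice hA)).1 (h.order i)
  rw [hi] at h1
  have h2 : reduced q₀ (t i) = 0 := by simpa using h1.1 0 one_pos
  have h3 : deriv (reduced q₀) (t i) ≠ 0 := by simpa using h1.2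
  obtain ⟨σ, s1, s2, s3⟩ := exists_analyticAt_implicit (f := fun p : Params × ℝ => reduced p.1 p.2) hA h2
    (analyticAt_slice hA).differentiableAt.hasDerivAt h3
  exact ⟨σ, s1.continuousAt, s2, s3⟩

end Pattern

/-- The zeros of the reduced displacement function give the configuration of limit cycles. -/
lemma IsGood.hasConfiguration {Z : PWL} (hZ : Z.IsGood) {ε : ℝ} (hε : 0 < ε) {m : List ℕ}
    {τ : Fin m.length → ℝ} (hτ : StrictMono τ)
    (h1 : ∀ i, τ i ∈ meanDomain Z.gL ∧ AnalyticAt ℝ (reduced (Z.params ε)) (τ i) ∧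
      reduced (Z.params ε) (τ i) = 0 ∧ analyticOrderAt (reduced (Z.params ε)) (τ i) = m.get i)
    (h2 : ∀ s ∈ meanDomain Z.gL, reduced (Z.params ε) s = 0 → ∃ i, s = τ i) : Z.HasConfiguration m := by
  have hd0 : ∀ i, Z.disp (τ i) = 0 := fun i => by
    rw [disp_eq_params hZ hε (h1 i).1, (h1 i).2.2.1, mul_zero]
  have hord : ∀ i, analyticOrderAt Z.disp (τ i) = m.get i := fun i => by
    have hdom : ∀ᶠ s in 𝓝 (τ i), s ∈ meanDomain Z.gL := (isOpen_meanDomain _).mem_nhds (h1 i).1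
    have he : (fun s => ε * reduced (Z.params ε) s) =ᶠ[𝓝 (τ i)] Z.disp :=
      hdom.mono fun s hs => (disp_eq_params hZ hε hs).symm
    rw [← (h1 i).2.2.2]
    refine analyticOrderAt_eq_of_isTheta (hZ.analyticAt_disp (h1 i).1) (h1 i).2.1 ?_
    have := (isTheta_const_mul_left hε.ne').2 (isTheta_refl (reduced (Z.params ε)) (𝓝 (τ i)))
    exact ⟨this.1.congr' he EventuallyEq.rfl, this.2.congr' EventuallyEq.rfl he⟩
  refine ⟨fun i => Z.orbit (Z.height (τ i)), fun i => Z.height (τ i),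
    fun i j hij => hZ.height_strictMonoOn (h1 i).1 (h1 j).1 (hτ hij), fun i => ⟨?_, ?_, ?_⟩, ?_⟩
  · refine hZ.isCrossingLimitCycle_iff.2 ⟨τ i, (h1 i).1, hd0 i, ?_, rfl⟩
    refine (hZ.analyticAt_disp (h1 i).1).eventually_eq_zero_or_eventually_ne_zero.resolve_left fun h => ?_
    have := analyticOrderAt_eq_top.2 h
    rw [hord i] at this
    exact ENat.natCast_ne_top _ this
  · exact hZ.hasAmplitude_height (h1 i).1 (hd0 i)
  · exact hZ.hasMultiplicity (h1 i).1 (hd0 i) (hord i)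
  · intro Γ' hΓ'
    obtain ⟨s, hs, h0, -, rfl⟩ := hZ.isCrossingLimitCycle_iff.1 hΓ'
    rw [disp_eq_params hZ hε hs] at h0
    obtain ⟨i, rfl⟩ := h2 s hs ((mul_eq_zero.1 h0).resolve_left hε.ne')
    exact ⟨i, rfl⟩

/-- Zeros of the prescribed orders, close to those of the limit, give the configuration. -/
lemma IsZeroPattern.eventually_hasConfiguration {q₀ : Params} {m : List ℕ} {t : Fin m.length → ℝ}
    (h : IsZeroPattern q₀ m t) (hm : ∀ i ∈ m, 1 ≤ i) {Z : ℝ → PWL}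
    (hZ : ∀ᶠ ε in 𝓝[>] (0 : ℝ), (Z ε).IsGood)
    (hq : Tendsto (fun ε => (Z ε).params ε) (𝓝[>] 0) (𝓝 q₀)) {τ : ℝ → Fin m.length → ℝ}
    (hτ : ∀ i, Tendsto (fun ε => τ ε i) (𝓝[>] 0) (𝓝 (t i)))
    (h0 : ∀ i, ∀ j < m.get i, ∀ᶠ ε in 𝓝[>] (0 : ℝ),
      iteratedDeriv j (reduced ((Z ε).params ε)) (τ ε i) = 0) :
    ∀ᶠ ε in 𝓝[>] (0 : ℝ), (Z ε).HasConfiguration m := by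
  filter_upwards [hZ, self_mem_nhdsWithin, h.eventually_zeros hq hτ h0 hm] with ε hZ hε ⟨h1, h2, h3⟩
  rw [params_gL hε] at h3
  exact hZ.hasConfiguration hε h1 (fun i => by have := h2 i; rwa [params_gL hε] at this) h3

/-- If all zeros are simple every perturbation has the configuration. -/
lemma IsZeroPattern.eventually_hasConfiguration_of_simple {q₀ : Params} {m : List ℕ} {t : Fin m.length → ℝ}
    (h : IsZeroPattern q₀ m t) (hm : ∀ i ∈ m, i = 1) {Z : ℝ → PWL}
    (hZ : ∀ᶠ ε in 𝓝[>] (0 : ℝ), (Z ε).IsGood)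
    (hq : Tendsto (fun ε => (Z ε).params ε) (𝓝[>] 0) (𝓝 q₀)) :
    ∀ᶠ ε in 𝓝[>] (0 : ℝ), (Z ε).HasConfiguration m := by
  have hm' : ∀ i : Fin m.length, m.get i = 1 := fun i => hm _ (List.get_mem _ _)
  choose σ s1 s2 s3 using fun i => h.exists_simple (hm' i)
  refine h.eventually_hasConfiguration (fun i hi => (hm i hi).ge) hZ hq
    (τ := fun ε i => σ i ((Z ε).params ε)) (fun i => ?_) fun i j hj => ?_
  · have := (s1 i).tendsto.comp hq
    rwa [s2 i] at this
  · rw [hm' i, Nat.lt_one_iff] at hj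
    subst hj
    simpa using hq.eventually (s3 i)

/-! ### The zeros of the reduced displacement function in the limit -/

/-- `arctan x + x / (1 + x²)`. -/
noncomputable def tee (x : ℝ) : ℝ := Real.arctan x + x / (1 + x ^ 2)

/-- Minus the derivative of `slope`, over `2 s`. -/
noncomputable def curv (c k s : ℝ) : ℝ := Real.pi - tee s + c * tee (k * s)

/-- Minus `s²` times the derivative of the limit of the reduced displacement function. -/
noncomputable def slope (c k s : ℝ) : ℝ :=
  s + (Real.pi - Real.arctan s) * (1 - s ^ 2) + c * (Real.arctan (k * s) * (1 / k ^ 2 - s ^ 2) - s / k)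

lemma hasDerivAt_tee (x : ℝ) : HasDerivAt tee (2 / (1 + x ^ 2) ^ 2) x := by
  have hx : (1 + x ^ 2) ≠ 0 := by positivity
  have h1 := (Real.hasDerivAt_arctan x).add
    ((hasDerivAt_id x).div ((hasDerivAt_pow 2 x).const_add 1) hx)
  refine h1.congr_deriv ?_
  simp only [id]
  field_simp
  ring

lemma tee_strictMono : StrictMono tee :=
  strictMono_of_hasDerivAt_pos hasDerivAt_tee fun x => by positivity

lemma tee_zero : tee 0 = 0 := by simp [tee]

lemma tee_pos {x : ℝ} (h : 0 < x) : 0 < tee x := by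
  have := tee_strictMono h
  rwa [tee_zero] at this

lemma tendsto_div_one_add_sq : Tendsto (fun x : ℝ => x / (1 + x ^ 2)) atTop (𝓝 0) := by
  refine squeeze_zero' ?_ ?_ tendsto_inv_atTop_zero
  · filter_upwards [eventually_gt_atTop 0] with x hx; positivity
  · filter_upwards [eventually_gt_atTop 0] with x hx
    rw [div_le_iff₀ (by positivity), inv_mul_eq_div, le_div_iff₀ hx]
    nlinarith

lemma tendsto_tee : Tendsto tee atTop (𝓝 (Real.pi / 2)) := by
  have h1 : Tendsto Real.arctan atTop (𝓝 (Real.pi / 2)) :=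
    Real.tendsto_arctan_atTop.mono_right nhdsWithin_le_nhds
  have := h1.add tendsto_div_one_add_sq
  rw [add_zero] at this
  exact this

lemma tee_lt (x : ℝ) : tee x < Real.pi / 2 :=
  (tee_strictMono (lt_add_one x)).trans_le
    (tee_strictMono.monotone.ge_of_tendsto tendsto_tee _)

lemma hasDerivAt_curv (c k s : ℝ) :
    HasDerivAt (curv c k) (-(2 / (1 + s ^ 2) ^ 2) + c * (2 / (1 + (k * s) ^ 2) ^ 2 * k)) s := by
  have h1 := (hasDerivAt_tee (k * s)).comp s ((hasDerivAt_id s).const_mul k)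
  have h2 := ((hasDerivAt_tee s).const_sub Real.pi).add (h1.const_mul c)
  refine h2.congr_deriv ?_
  simp

lemma curv_strictAnti {c k : ℝ} (hc : c ≤ 0) (hk : 0 < k) : StrictAnti (curv c k) := by
  refine strictAnti_of_hasDerivAt_neg (hasDerivAt_curv c k) fun s => ?_
  have h1 : 0 < 2 / (1 + s ^ 2) ^ 2 := by positivity
  have h2 : 0 < 2 / (1 + (k * s) ^ 2) ^ 2 * k := by positivity
  nlinarith

lemma hasDerivAt_slope (c : ℝ) {k : ℝ} (hk : 0 < k) (s : ℝ) :
    HasDerivAt (slope c k) (-2 * s * curv c k s) s := by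
  have h1 := (Real.hasDerivAt_arctan (k * s)).comp s ((hasDerivAt_id s).const_mul k)
  have h2 := ((h1.mul ((hasDerivAt_pow 2 s).const_sub (1 / k ^ 2))).sub
    ((hasDerivAt_id s).div_const k)).const_mul c
  have h3 := (hasDerivAt_id s).add ((((Real.hasDerivAt_arctan s).const_sub Real.pi)).mul
    ((hasDerivAt_pow 2 s).const_sub 1))
  refine (h3.add h2).congr_deriv ?_
  simp only [curv, tee, Function.comp_apply]
  field_simp
  ring

lemma continuous_slope (c : ℝ) {k : ℝ} (hk : 0 < k) : Continuous (slope c k) :=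
  continuous_iff_continuousAt.2 fun s => (hasDerivAt_slope c hk s).continuousAt

/-- The limit of the normalized parameters, with the damping in the left zone normalized to one. -/
def limitPoint (c k β : ℝ) : Params := (0, 1, c, k, β)

/-- For `ε = 0` both zones are centers and the return angles are `2 (π - arctan s)` and
`2 arctan (k s)`. -/
lemma reduced_limitPoint {c k s : ℝ} (β : ℝ) (hk : 0 < k) (hs : 0 < s) :
    reduced (limitPoint c k β) s = 1 + (Real.pi - Real.arctan s) * (s + 1 / s) +
      c * (Real.arctan (k * s) * (k * s + 1 / (k * s)) - 1) / k + β := by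
  simp only [reduced, rest, limitPoint, zero_mul, one_mul]
  rw [phi_zero hs, psi_zero (mul_pos hk hs)]
  ring

lemma hasDerivAt_reduced (c β : ℝ) {k s : ℝ} (hk : 0 < k) (hs : 0 < s) :
    HasDerivAt (reduced (limitPoint c k β)) (-slope c k s / s ^ 2) s := by
  have hks := mul_pos hk hs
  have a1 := (Real.hasDerivAt_arctan (k * s)).comp s ((hasDerivAt_id s).const_mul k)
  have i1 := ((hasDerivAt_id s).const_mul k).add ((hasDerivAt_const s (1:ℝ)).div
    ((hasDerivAt_id s).const_mul k) hks.ne')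
  have i2 := (hasDerivAt_id s).add ((hasDerivAt_const s (1:ℝ)).div (hasDerivAt_id s) hs.ne')
  have h1 := ((Real.hasDerivAt_arctan s).const_sub Real.pi).mul i2
  have h2 := (((a1.mul i1).sub_const 1).const_mul c).div_const k
  have h3 := ((h1.const_add 1).add h2).add_const β
  have h4 := h3.congr_of_eventuallyEq (f₁ := reduced (limitPoint c k β)) (by
    filter_upwards [lt_mem_nhds hs] with x hx
    rw [reduced_limitPoint β hk hx]
    simp)
  refine h4.congr_deriv ?_
  simp only [slope, Function.comp_apply, id, Pi.add_apply, Pi.div_apply]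
  field_simp
  ring

lemma analyticAt_reduced_limitPoint (c β : ℝ) {k s : ℝ} (hk : 0 < k) (hs : 0 < s) :
    AnalyticAt ℝ (reduced (limitPoint c k β)) s :=
  analyticAt_slice (p := (limitPoint c k β, s)) (analyticAt_reduced
    (by simpa [limitPoint] using mem_meanDomain_zero hs) hk)

/-- This inequality is the monotonicity of `arctan x * (x + 1 / x)`. -/
lemma arctan_mul_lt {k : ℝ} (hk : 0 < k) : Real.arctan k * (1 / k ^ 2 - 1) < 1 / k := by
  have h1 : 0 < Real.arctan k := Real.arctan_pos.2 hk
  have h2 : Real.arctan k ≤ k := by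
    by_cases h : k < Real.pi / 2
    · have := Real.le_tan hk.le h
      have := Real.arctan_strictMono.monotone this
      rwa [Real.arctan_tan (by linarith) h] at this
    · linarith [Real.arctan_lt_pi_div_two k]
  have h3 : Real.arctan k * (1 / k ^ 2) ≤ 1 / k := by
    rw [mul_one_div, div_le_div_iff₀ (by positivity) hk]
    nlinarith
  linarith

lemma one_le_slope_one {c k : ℝ} (hc : c ≤ 0) (hk : 0 < k) : 1 ≤ slope c k 1 := by
  have := arctan_mul_lt hk
  simp only [slope, mul_one]
  nlinarith

/-! ### Orders of the zeros -/

lemma analyticAt_arctan (x : ℝ) : AnalyticAt ℝ Real.arctan x :=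
  (Real.contDiff_arctan (n := ⊤)).contDiffAt.analyticAt

lemma analyticAt_curv (c k s : ℝ) : AnalyticAt ℝ (curv c k) s := by
  have h1 : ∀ x : ℝ, (1 + x ^ 2) ≠ 0 := fun x => by positivity
  have h : AnalyticAt ℝ tee s := by
    exact (analyticAt_arctan _).add (by fun_prop (disch := exact h1 _))
  have h' : AnalyticAt ℝ tee (k * s) := by
    exact (analyticAt_arctan _).add (by fun_prop (disch := exact h1 _))
  have h2 : AnalyticAt ℝ (fun s => tee (k * s)) s :=
    AnalyticAt.fun_comp (f := fun s => k * s) (g := tee) h' (by fun_prop)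
  unfold curv
  exact (analyticAt_const.sub h).add (analyticAt_const.mul h2)

lemma analyticAt_slope (c k s : ℝ) : AnalyticAt ℝ (slope c k) s := by
  have h1 := analyticAt_arctan s
  have h2 : AnalyticAt ℝ (fun s => Real.arctan (k * s)) s :=
    AnalyticAt.fun_comp (f := fun s => k * s) (g := Real.arctan) (analyticAt_arctan _) (by fun_prop)
  unfold slope
  exact (analyticAt_id.add ((analyticAt_const.sub h1).mul (by fun_prop))).add
    (analyticAt_const.mul ((h2.mul (by fun_prop)).sub (by fun_prop)))

lemma analyticOrderAt_eq_add_one {f g h : ℝ → ℝ} {x : ℝ} (hf : AnalyticAt ℝ f x) (hg : AnalyticAt ℝ g x)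
    (hh : AnalyticAt ℝ h x) (hh0 : h x ≠ 0) (h0 : f x = 0)
    (hd : ∀ᶠ y in 𝓝 x, HasDerivAt f (h y * g y) y) :
    analyticOrderAt f x = analyticOrderAt g x + 1 := by
  have h1 := hf.analyticOrderAt_deriv_add_one
  rw [show (fun y => f y - f x) = f by ext; simp [h0]] at h1
  rw [← h1]
  congr 1
  have h2 : deriv f =ᶠ[𝓝 x] h * g := hd.mono fun y hy => hy.deriv
  rw [analyticOrderAt_congr h2, analyticOrderAt_mul hh hg, hh.analyticOrderAt_eq_zero.2 hh0, zero_add]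

section Order

variable {c k β s : ℝ} (hk : 0 < k) (hs : 0 < s)
include hk hs

lemma analyticOrderAt_reduced (h0 : reduced (limitPoint c k β) s = 0) :
    analyticOrderAt (reduced (limitPoint c k β)) s = analyticOrderAt (slope c k) s + 1 := by
  refine analyticOrderAt_eq_add_one (h := fun s => -1 / s ^ 2) (analyticAt_reduced_limitPoint c β hk hs)
    (analyticAt_slope c k s) (by fun_prop (disch := positivity))
    (div_ne_zero (by norm_num) (by positivity)) h0 ?_
  filter_upwards [lt_mem_nhds hs] with x hx
  refine (hasDerivAt_reduced c β hk hx).congr_deriv ?_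
  ring

lemma order_one (h0 : reduced (limitPoint c k β) s = 0) (h1 : slope c k s ≠ 0) :
    analyticOrderAt (reduced (limitPoint c k β)) s = 1 := by
  rw [analyticOrderAt_reduced hk hs h0, (analyticAt_slope c k s).analyticOrderAt_eq_zero.2 h1, zero_add]

lemma analyticOrderAt_slope (h0 : slope c k s = 0) :
    analyticOrderAt (slope c k) s = analyticOrderAt (curv c k) s + 1 :=
  analyticOrderAt_eq_add_one (h := fun s => -2 * s) (analyticAt_slope c k s) (analyticAt_curv c k s)
    (by fun_prop) (mul_ne_zero (by norm_num) hs.ne') h0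
    (Eventually.of_forall fun x => hasDerivAt_slope c hk x)

lemma order_two (h0 : reduced (limitPoint c k β) s = 0) (h1 : slope c k s = 0) (h2 : curv c k s ≠ 0) :
    analyticOrderAt (reduced (limitPoint c k β)) s = 2 := by
  rw [analyticOrderAt_reduced hk hs h0, analyticOrderAt_slope hk hs h1,
    (analyticAt_curv c k s).analyticOrderAt_eq_zero.2 h2]
  rfl

/-- For `c ≤ 0` the function `curv` has a nonvanishing derivative, so no zero has a higher order. -/
lemma order_three (hc : c ≤ 0) (h0 : reduced (limitPoint c k β) s = 0) (h1 : slope c k s = 0)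
    (h2 : curv c k s = 0) : analyticOrderAt (reduced (limitPoint c k β)) s = 3 := by
  rw [analyticOrderAt_reduced hk hs h0, analyticOrderAt_slope hk hs h1,
    (analyticAt_curv c k s).analyticOrderAt_eq_one_of_zero_deriv_ne_zero h2 ?_]
  · rfl
  · rw [(hasDerivAt_curv c k s).deriv]
    have h1 : 0 < 2 / (1 + s ^ 2) ^ 2 := by positivity
    have h2 : 0 < 2 / (1 + (k * s) ^ 2) ^ 2 * k := by positivity
    nlinarith

end Order

/-! ### Realization of the zero patterns -/

section Shape

variable {c k : ℝ} (β : ℝ) (hk : 0 < k)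
include hk

lemma antiOn_of_slope_pos {D : Set ℝ} (hD : Convex ℝ D) (h0 : ∀ s ∈ D, 0 < s)
    (h : ∀ s ∈ interior D, 0 < slope c k s) : StrictAntiOn (reduced (limitPoint c k β)) D := by
  refine strictAntiOn_of_deriv_neg hD (fun s hs =>
    (hasDerivAt_reduced c β hk (h0 s hs)).continuousAt.continuousWithinAt) fun s hs => ?_
  have h1 := h0 s (interior_subset hs)
  rw [(hasDerivAt_reduced c β hk h1).deriv]
  exact div_neg_of_neg_of_pos (neg_neg_of_pos (h s hs)) (by positivity)

lemma monoOn_of_slope_neg {D : Set ℝ} (hD : Convex ℝ D) (h0 : ∀ s ∈ D, 0 < s)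
    (h : ∀ s ∈ interior D, slope c k s < 0) : StrictMonoOn (reduced (limitPoint c k β)) D := by
  refine strictMonoOn_of_deriv_pos hD (fun s hs =>
    (hasDerivAt_reduced c β hk (h0 s hs)).continuousAt.continuousWithinAt) fun s hs => ?_
  have h1 := h0 s (interior_subset hs)
  rw [(hasDerivAt_reduced c β hk h1).deriv]
  exact div_pos (neg_pos.2 (h s hs)) (by positivity)

lemma continuousOn_reduced {a b : ℝ} (ha : 0 < a) :
    ContinuousOn (reduced (limitPoint c k β)) (Set.Icc a b) := fun _ hs =>
  (hasDerivAt_reduced c β hk (ha.trans_le hs.1)).continuousAt.continuousWithinAt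

/-- The reduced displacement is positive near `0`, since the damping in the left zone is `1`. -/
lemma exists_zero_left {σ : ℝ} (hσ : 0 < σ) (h : reduced (limitPoint c k β) σ < 0) :
    ∃ a, 0 < a ∧ a < σ ∧ reduced (limitPoint c k β) a = 0 := by
  obtain ⟨s₀, hs₀, hev⟩ := exists_reduced_sign_zero (q₀ := limitPoint c k β) rfl hk
    (by simp [limitPoint])
  have h1 : ∀ s, 0 < s → s ≤ s₀ → 0 < reduced (limitPoint c k β) s := fun s hs hle => by
    simpa [limitPoint] using hev.self_of_nhds s (by simpa [limitPoint] using mem_meanDomain_zero hs) hle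
  have hm : 0 < min s₀ σ := lt_min hs₀ hσ
  obtain ⟨a, ha, ha0⟩ := intermediate_value_Icc' (min_le_right s₀ σ)
    (continuousOn_reduced (c := c) β hk hm) ⟨h.le, (h1 _ hm (min_le_left _ _)).le⟩
  refine ⟨a, hm.trans_le ha.1, lt_of_le_of_ne ha.2 ?_, ha0⟩
  rintro rfl
  exact h.ne ha0

lemma exists_sign_right (hc : 1 + c ≠ 0) (σ : ℝ) :
    ∃ s > σ, 0 < (1 + c) * reduced (limitPoint c k β) s := by
  obtain ⟨s₁, -, hev⟩ := exists_reduced_sign_atTop (q₀ := limitPoint c k β) rfl hk hc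
  exact ⟨max s₁ (σ + 1), (lt_add_one σ).trans_le (le_max_right _ _),
    hev.self_of_nhds _ (le_max_left _ _)⟩

/-- Far out the reduced displacement has the sign of the total damping `1 + c`. -/
lemma exists_zero_right (hc : 1 + c ≠ 0) {σ : ℝ} (hσ : 0 < σ)
    (h : (1 + c) * reduced (limitPoint c k β) σ < 0) :
    ∃ b, σ < b ∧ reduced (limitPoint c k β) b = 0 := by
  obtain ⟨s, hs, hpos⟩ := exists_sign_right β hk hc σ
  have hcont := (continuousOn_reduced (c := c) β hk (b := s) hσ).const_mul (1 + c)
  obtain ⟨b, hb, hb0⟩ := intermediate_value_Icc hs.le hcont ⟨h.le, hpos.le⟩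
  have hb0' := (mul_eq_zero.1 hb0).resolve_left hc
  refine ⟨b, lt_of_le_of_ne hb.1 ?_, hb0'⟩
  rintro rfl
  simp [hb0'] at h

lemma reduced_add {s : ℝ} (hs : 0 < s) :
    reduced (limitPoint c k β) s = reduced (limitPoint c k 0) s + β := by
  rw [reduced_limitPoint β hk hs, reduced_limitPoint 0 hk hs]; ring

end Shape

lemma isZeroPattern_one {c k β a : ℝ} {m : ℕ} (hk : 0 < k) (hc : 1 + c ≠ 0) (ha : 0 < a)
    (h1 : analyticOrderAt (reduced (limitPoint c k β)) a = m)
    (hz : ∀ s, 0 < s → reduced (limitPoint c k β) s = 0 → s = a) :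
    IsZeroPattern (limitPoint c k β) [m] (fun _ => a) :=
  ⟨rfl, hk, by simp [limitPoint], hc, Subsingleton.strictMono (α := Fin 1) _, fun _ => ha, fun i => by
    rw [h1, show i = (0 : Fin 1) from Subsingleton.elim (α := Fin 1) _ _]; rfl,
    fun s hs h0 => ⟨(0 : Fin 1), hz s hs h0⟩⟩

lemma isZeroPattern_two {c k β a b : ℝ} {m n : ℕ} (hk : 0 < k) (hc : 1 + c ≠ 0) (ha : 0 < a) (hab : a < b)
    (h1 : analyticOrderAt (reduced (limitPoint c k β)) a = m)
    (h2 : analyticOrderAt (reduced (limitPoint c k β)) b = n)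
    (hz : ∀ s, 0 < s → reduced (limitPoint c k β) s = 0 → s = a ∨ s = b) :
    IsZeroPattern (limitPoint c k β) [m, n] (![a, b] : Fin 2 → ℝ) := by
  refine ⟨rfl, hk, by simp [limitPoint], hc, ?_, ?_, ?_, ?_⟩
  · change StrictMono (![a, b] : Fin 2 → ℝ)
    rw [Fin.strictMono_iff_lt_succ]
    intro i; fin_cases i; simpa
  · change ∀ i : Fin 2, 0 < (![a, b] : Fin 2 → ℝ) i
    intro i; fin_cases i
    · exact ha
    · exact ha.trans hab
  · change ∀ i : Fin 2, analyticOrderAt _ ((![a, b] : Fin 2 → ℝ) i) = (([m, n] : List ℕ).get i : ℕ∞)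
    intro i; fin_cases i
    · exact h1
    · exact h2
  · intro s hs h0
    rcases hz s hs h0 with h | h
    · exact ⟨(0 : Fin 2), h⟩
    · exact ⟨(1 : Fin 2), h⟩

lemma isZeroPattern_three {c k β a₁ a₂ a₃ : ℝ} {m₁ m₂ m₃ : ℕ} (hk : 0 < k) (hc : 1 + c ≠ 0) (ha : 0 < a₁)
    (h12 : a₁ < a₂) (h23 : a₂ < a₃)
    (h1 : analyticOrderAt (reduced (limitPoint c k β)) a₁ = m₁)
    (h2 : analyticOrderAt (reduced (limitPoint c k β)) a₂ = m₂)
    (h3 : analyticOrderAt (reduced (limitPoint c k β)) a₃ = m₃)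
    (hz : ∀ s, 0 < s → reduced (limitPoint c k β) s = 0 → s = a₁ ∨ s = a₂ ∨ s = a₃) :
    IsZeroPattern (limitPoint c k β) [m₁, m₂, m₃] (![a₁, a₂, a₃] : Fin 3 → ℝ) := by
  refine ⟨rfl, hk, by simp [limitPoint], hc, ?_, ?_, ?_, ?_⟩
  · change StrictMono (![a₁, a₂, a₃] : Fin 3 → ℝ)
    rw [Fin.strictMono_iff_lt_succ]
    intro i; fin_cases i
    · exact h12
    · exact h23
  · change ∀ i : Fin 3, 0 < (![a₁, a₂, a₃] : Fin 3 → ℝ) i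
    intro i; fin_cases i
    · exact ha
    · exact ha.trans h12
    · exact (ha.trans h12).trans h23
  · change ∀ i : Fin 3, analyticOrderAt _ ((![a₁, a₂, a₃] : Fin 3 → ℝ) i) =
      (([m₁, m₂, m₃] : List ℕ).get i : ℕ∞)
    intro i; fin_cases i
    · exact h1
    · exact h2
    · exact h3
  · intro s hs h0
    rcases hz s hs h0 with h | h | h
    · exact ⟨(0 : Fin 3), h⟩
    · exact ⟨(1 : Fin 3), h⟩
    · exact ⟨(2 : Fin 3), h⟩

/-! #### One damped zone -/

/-- Without damping in the right zone the slope changes its sign exactly once. -/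
lemma exists_slope_zero_of_center {k : ℝ} (hk : 0 < k) :
    ∃ σ > 0, slope 0 k σ = 0 ∧ curv 0 k σ ≠ 0 ∧ (∀ s, 0 < s → s < σ → 0 < slope 0 k s) ∧
      ∀ s, σ < s → slope 0 k s < 0 := by
  have hcurv : ∀ s, 0 < curv 0 k s := fun s => by
    have := tee_lt s
    have := Real.pi_pos
    rw [curv]; linarith
  have hanti : StrictAntiOn (slope 0 k) (Set.Ici 0) := by
    refine strictAntiOn_of_deriv_neg (convex_Ici 0) (continuous_slope 0 hk).continuousOn fun s hs => ?_
    rw [interior_Ici] at hs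
    have hs' : 0 < s := hs
    rw [(hasDerivAt_slope 0 hk s).deriv]
    have := mul_pos hs' (hcurv s)
    nlinarith
  have h1 := one_le_slope_one (c := 0) le_rfl hk
  have h3 : slope 0 k 3 < 0 := by
    have := Real.arctan_lt_pi_div_two 3
    have := Real.pi_gt_three
    simp only [slope]
    nlinarith
  obtain ⟨σ, hσ, h0⟩ := intermediate_value_Icc' (show (1:ℝ) ≤ 3 by norm_num)
    (continuous_slope 0 hk).continuousOn ⟨h3.le, by linarith⟩
  have hσ0 : 0 < σ := by linarith [hσ.1]
  refine ⟨σ, hσ0, h0, (hcurv σ).ne', fun s hs hlt => ?_, fun s hlt => ?_⟩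
  · have := hanti hs.le hσ0.le hlt; rwa [h0] at this
  · have := hanti hσ0.le (hσ0.trans hlt).le hlt; rwa [h0] at this

/-- The reduced displacement has a single minimum; the offset puts it at height zero. -/
lemma exists_pattern_double {k : ℝ} (hk : 0 < k) :
    ∃ c β t, IsZeroPattern (limitPoint c k β) [2] t := by
  obtain ⟨σ, hσ, h0, h1, h2, h3⟩ := exists_slope_zero_of_center hk
  set β := -reduced (limitPoint 0 k 0) σ with hβ
  have hz : reduced (limitPoint 0 k β) σ = 0 := by rw [reduced_add β hk hσ, hβ, add_neg_cancel]
  have hA := antiOn_of_slope_pos (c := 0) β hk (convex_Ioc 0 σ) (fun s hs => hs.1)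
    (fun s hs => by rw [interior_Ioc] at hs; exact h2 s hs.1 hs.2)
  have hM := monoOn_of_slope_neg (c := 0) β hk (convex_Ici σ) (fun s hs => hσ.trans_le hs)
    (fun s hs => by rw [interior_Ici] at hs; exact h3 s hs)
  refine ⟨0, β, _, isZeroPattern_one hk (by norm_num) hσ (order_two hk hσ hz h0 h1) fun s hs hs0 => ?_⟩
  rcases le_total s σ with hle | hle
  · exact hA.injOn ⟨hs, hle⟩ ⟨hσ, le_rfl⟩ (hs0.trans hz.symm)
  · exact hM.injOn hle (Set.self_mem_Ici) (hs0.trans hz.symm)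

/-- The reduced displacement has a single minimum; the offset puts it below zero. -/
lemma exists_pattern_two_simple {k : ℝ} (hk : 0 < k) :
    ∃ c β t, IsZeroPattern (limitPoint c k β) [1, 1] t := by
  obtain ⟨σ, hσ, h0, h1, h2, h3⟩ := exists_slope_zero_of_center hk
  set β := -reduced (limitPoint 0 k 0) σ - 1 with hβ
  have hz : reduced (limitPoint 0 k β) σ < 0 := by rw [reduced_add β hk hσ, hβ]; linarith
  have hA := antiOn_of_slope_pos (c := 0) β hk (convex_Ioc 0 σ) (fun s hs => hs.1)
    (fun s hs => by rw [interior_Ioc] at hs; exact h2 s hs.1 hs.2)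
  have hM := monoOn_of_slope_neg (c := 0) β hk (convex_Ici σ) (fun s hs => hσ.trans_le hs)
    (fun s hs => by rw [interior_Ici] at hs; exact h3 s hs)
  obtain ⟨a, ha, haσ, ha0⟩ := exists_zero_left β hk hσ hz
  obtain ⟨b, hb, hb0⟩ := exists_zero_right (c := 0) β hk (by norm_num) hσ (by linarith)
  refine ⟨0, β, _, isZeroPattern_two hk (by norm_num) ha (haσ.trans hb)
    (order_one hk ha ha0 (h2 a ha haσ).ne') (order_one hk (hσ.trans hb) hb0 (h3 b hb).ne) fun s hs hs0 => ?_⟩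
  rcases le_total s σ with hle | hle
  · exact Or.inl (hA.injOn ⟨hs, hle⟩ ⟨ha, haσ.le⟩ (hs0.trans ha0.symm))
  · exact Or.inr (hM.injOn hle (le_of_lt hb) (hs0.trans hb0.symm))

/-! #### Dampings of opposite sign -/

/-- The damping in the right zone for which the slope has its minimum at `p`. -/
noncomputable def critDamping (k p : ℝ) : ℝ := -((Real.pi - tee p) / tee (k * p))

section Critical

variable {k p : ℝ} (hk : 0 < k) (hp : 0 < p)
include hk hp

/-- With the critical damping the total damping `1 + c` is negative. -/
lemma critDamping_lt : critDamping k p < -1 := by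
  have h1 := tee_pos (mul_pos hk hp)
  have h2 := tee_lt p
  have h3 := tee_lt (k * p)
  rw [critDamping, neg_lt_neg_iff, one_lt_div h1]
  linarith

lemma curv_critDamping : curv (critDamping k p) k p = 0 := by
  have h1 := (tee_pos (mul_pos hk hp)).ne'
  rw [curv, critDamping]
  field_simp
  ring

/-- The slope decreases up to `p` and increases from there on. -/
lemma slope_critDamping_mono : StrictAntiOn (slope (critDamping k p) k) (Set.Icc 0 p) ∧
    StrictMonoOn (slope (critDamping k p) k) (Set.Ici p) := by
  have hc : critDamping k p ≤ 0 := by linarith [critDamping_lt hk hp]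
  have h0 := curv_critDamping hk hp
  constructor
  · refine strictAntiOn_of_deriv_neg (convex_Icc 0 p) (continuous_slope _ hk).continuousOn fun s hs => ?_
    rw [interior_Icc] at hs
    have := curv_strictAnti hc hk hs.2
    rw [h0] at this
    rw [(hasDerivAt_slope _ hk s).deriv]
    have := mul_pos hs.1 this
    linarith
  · refine strictMonoOn_of_deriv_pos (convex_Ici p) (continuous_slope _ hk).continuousOn fun s hs => ?_
    rw [interior_Ici] at hs
    have := curv_strictAnti hc hk hs
    rw [h0] at this
    rw [(hasDerivAt_slope _ hk s).deriv]
    have := mul_pos_of_neg_of_neg (neg_neg_of_pos (hp.trans hs)) this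
    linarith

lemma slope_critDamping_lt {s : ℝ} (hs : 0 < s) (hne : s ≠ p) :
    slope (critDamping k p) k p < slope (critDamping k p) k s := by
  have h := slope_critDamping_mono hk hp
  rcases hne.lt_or_gt with hlt | hlt
  · exact h.1 ⟨hs.le, hlt.le⟩ ⟨hp.le, le_rfl⟩ hlt
  · exact h.2 Set.self_mem_Ici (le_of_lt hlt) hlt

/-- The minimum of the slope. -/
lemma slope_critDamping_self : slope (critDamping k p) k p = 2 * (p / (1 + p ^ 2)) -
    critDamping k p * (k * p / (1 + (k * p) ^ 2)) * (1 + 1 / k ^ 2) +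
    critDamping k p * Real.arctan (k * p) * (1 / k ^ 2 - 1) := by
  have h0 := curv_critDamping hk hp
  set c := critDamping k p
  rw [curv, tee, tee] at h0
  have h1 : Real.pi - Real.arctan p = p / (1 + p ^ 2) -
    c * (Real.arctan (k * p) + k * p / (1 + (k * p) ^ 2)) := by linarith
  rw [slope, h1]
  field_simp
  ring

lemma continuousAt_slope_critDamping : ContinuousAt (fun p => slope (critDamping k p) k p) p := by
  have ht : Continuous tee := continuous_iff_continuousAt.2 fun x => (hasDerivAt_tee x).continuousAt
  have h1 : ContinuousAt (critDamping k) p := by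
    unfold critDamping
    have h2 : ContinuousAt (fun p => tee (k * p)) p :=
      (ht.comp (continuous_const.mul continuous_id)).continuousAt
    exact ((continuousAt_const.sub ht.continuousAt).div h2 (tee_pos (mul_pos hk hp)).ne').neg
  unfold slope
  exact (by fun_prop : ContinuousAt (fun p => p + (Real.pi - Real.arctan p) * (1 - p ^ 2)) p).add
    (h1.mul (by fun_prop))

end Critical

/-- For `k < 1` the minimum of the slope is negative when it is attained far out. It is positive when
attained at `1`, so in between it vanishes, and there a triple zero occurs. -/
lemma tendsto_slope_critDamping {k : ℝ} (hk : 0 < k) :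
    Tendsto (fun p => slope (critDamping k p) k p) atTop (𝓝 (-(Real.pi / 2) * (1 / k ^ 2 - 1))) := by
  have hkp : Tendsto (fun p => k * p) atTop atTop := tendsto_id.const_mul_atTop hk
  have hc : Tendsto (critDamping k) atTop (𝓝 (-1)) := by
    have := ((tendsto_tee.const_sub Real.pi).div (tendsto_tee.comp hkp) (by positivity)).neg
    rw [show (Real.pi - Real.pi / 2) / (Real.pi / 2) = 1 by field_simp; norm_num] at this
    exact this
  have hat : Tendsto Real.arctan atTop (𝓝 (Real.pi / 2)) :=
    Real.tendsto_arctan_atTop.mono_right nhdsWithin_le_nhds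
  have h := ((tendsto_div_one_add_sq.const_mul 2).sub ((hc.mul (tendsto_div_one_add_sq.comp hkp)).mul_const
    (1 + 1 / k ^ 2))).add ((hc.mul (hat.comp hkp)).mul_const (1 / k ^ 2 - 1))
  simp only [mul_zero, zero_mul, sub_zero, zero_add, neg_mul, one_mul] at h
  rw [neg_mul]
  refine h.congr' ?_
  filter_upwards [eventually_gt_atTop 0] with p hp
  rw [slope_critDamping_self hk hp]
  simp only [Function.comp_apply]

/-- If the minimum of the slope is positive, the reduced displacement is strictly decreasing. -/
lemma exists_pattern_simple {k : ℝ} (hk : 0 < k) :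
    ∃ c β t, IsZeroPattern (limitPoint c k β) [1] t := by
  have hc := critDamping_lt hk one_pos
  have h1 := one_le_slope_one (c := critDamping k 1) (by linarith) hk
  have hpos : ∀ s, 0 < s → 0 < slope (critDamping k 1) k s := fun s hs => by
    rcases eq_or_ne s 1 with rfl | hne
    · linarith
    · linarith [slope_critDamping_lt hk one_pos hs hne]
  set c := critDamping k 1
  set β := -reduced (limitPoint c k 0) 1 with hβ
  have hz : reduced (limitPoint c k β) 1 = 0 := by rw [reduced_add β hk one_pos, hβ, add_neg_cancel]
  have hA := antiOn_of_slope_pos (c := c) β hk (convex_Ioi 0) (fun s hs => hs)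
    (fun s hs => by rw [interior_Ioi] at hs; exact hpos s hs)
  refine ⟨c, β, _, isZeroPattern_one hk (by linarith) one_pos (order_one hk one_pos hz (hpos 1 one_pos).ne')
    fun s hs hs0 => hA.injOn hs (Set.mem_Ioi.2 one_pos) (hs0.trans hz.symm)⟩

lemma exists_slope_critDamping_neg {k : ℝ} (hk : 0 < k) (hk1 : k < 1) :
    ∃ p > 1, slope (critDamping k p) k p < 0 := by
  have hlim : -(Real.pi / 2) * (1 / k ^ 2 - 1) < 0 := by
    have h1 : 1 < 1 / k ^ 2 := by
      rw [lt_div_iff₀ (by positivity)]; nlinarith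
    have := Real.pi_pos
    nlinarith
  obtain ⟨p, h1, h2⟩ := (((tendsto_slope_critDamping hk).eventually (gt_mem_nhds hlim)).and
    (eventually_gt_atTop 1)).exists
  exact ⟨p, h2, h1⟩

/-- If the minimum of the slope is zero, the reduced displacement is strictly decreasing with one
horizontal tangent, of order three. -/
lemma exists_pattern_triple {k : ℝ} (hk : 0 < k) (hk1 : k < 1) :
    ∃ c β t, IsZeroPattern (limitPoint c k β) [3] t := by
  obtain ⟨p₁, hp₁, hneg⟩ := exists_slope_critDamping_neg hk hk1
  have h1 := one_le_slope_one (c := critDamping k 1) (by linarith [critDamping_lt hk one_pos]) hk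
  obtain ⟨p, hp, hp0⟩ := intermediate_value_Icc' hp₁.le (f := fun p => slope (critDamping k p) k p)
    (fun x hx => (continuousAt_slope_critDamping hk (one_pos.trans_le hx.1)).continuousWithinAt)
    ⟨hneg.le, by linarith⟩
  have hpp : 0 < p := one_pos.trans_le hp.1
  have hc := critDamping_lt hk hpp
  have hcurv := curv_critDamping hk hpp
  have hp0' : slope (critDamping k p) k p = 0 := hp0
  have hpos : ∀ s, 0 < s → s ≠ p → 0 < slope (critDamping k p) k s := fun s hs hne => by
    linarith [slope_critDamping_lt hk hpp hs hne]
  set c := critDamping k p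
  set β := -reduced (limitPoint c k 0) p with hβ
  have hz : reduced (limitPoint c k β) p = 0 := by rw [reduced_add β hk hpp, hβ, add_neg_cancel]
  have hA := antiOn_of_slope_pos (c := c) β hk (convex_Ioc 0 p) (fun s hs => hs.1)
    (fun s hs => by rw [interior_Ioc] at hs; exact hpos s hs.1 hs.2.ne)
  have hB := antiOn_of_slope_pos (c := c) β hk (convex_Ici p) (fun s hs => hpp.trans_le hs)
    (fun s hs => by rw [interior_Ici] at hs; exact hpos s (hpp.trans hs) (ne_of_gt hs))
  refine ⟨c, β, _, isZeroPattern_one hk (by linarith) hpp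
    (order_three hk hpp (by linarith) hz hp0' hcurv) fun s hs hs0 => ?_⟩
  rcases le_total s p with hle | hle
  · exact hA.injOn ⟨hs, hle⟩ ⟨hpp, le_rfl⟩ (hs0.trans hz.symm)
  · exact hB.injOn hle (Set.self_mem_Ici) (hs0.trans hz.symm)

/-- For `k < 1` the slope may change its sign twice. -/
lemma exists_two_slope_zeros {k : ℝ} (hk : 0 < k) (hk1 : k < 1) :
    ∃ c < -1, ∃ σ₁ σ₂, 0 < σ₁ ∧ σ₁ < σ₂ ∧ slope c k σ₁ = 0 ∧ slope c k σ₂ = 0 ∧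
      curv c k σ₁ ≠ 0 ∧ curv c k σ₂ ≠ 0 ∧ (∀ s, 0 < s → s < σ₁ → 0 < slope c k s) ∧
      (∀ s, σ₁ < s → s < σ₂ → slope c k s < 0) ∧ ∀ s, σ₂ < s → 0 < slope c k s := by
  obtain ⟨p, hp, hneg⟩ := exists_slope_critDamping_neg hk hk1
  have hpp : 0 < p := one_pos.trans hp
  have hc := critDamping_lt hk hpp
  have hcurv := curv_critDamping hk hpp
  obtain ⟨hanti, hmono⟩ := slope_critDamping_mono hk hpp
  set c := critDamping k p
  have h1 := one_le_slope_one (c := c) (by linarith) hk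
  have hcv := curv_strictAnti (c := c) (by linarith) hk
  have hcont := continuous_slope c hk
  obtain ⟨σ₁, hσ₁, h10⟩ := intermediate_value_Icc' hp.le hcont.continuousOn
    ⟨hneg.le, (by linarith : (0:ℝ) ≤ slope c k 1)⟩
  have hσ₁p : σ₁ < p := lt_of_le_of_ne hσ₁.2 (by rintro rfl; exact hneg.ne h10)
  have hσ₁0 : 0 < σ₁ := one_pos.trans_le hσ₁.1
  -- otherwise the reduced displacement could not tend to `-∞`
  obtain ⟨s₂, hs₂, hpos₂⟩ : ∃ s > p, 0 < slope c k s := by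
    by_contra hn
    push Not at hn
    set β := -reduced (limitPoint c k 0) p with hβ
    have hz : reduced (limitPoint c k β) p = 0 := by rw [reduced_add β hk hpp, hβ, add_neg_cancel]
    have hm : MonotoneOn (reduced (limitPoint c k β)) (Set.Ici p) := by
      refine monotoneOn_of_deriv_nonneg (convex_Ici p) (fun s hs =>
        (hasDerivAt_reduced c β hk (hpp.trans_le hs)).continuousAt.continuousWithinAt) (fun s hs => ?_)
        fun s hs => ?_
      · rw [interior_Ici] at hs
        exact (hasDerivAt_reduced c β hk (hpp.trans hs)).differentiableAt.differentiableWithinAt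
      · rw [interior_Ici] at hs
        rw [(hasDerivAt_reduced c β hk (hpp.trans hs)).deriv]
        exact div_nonneg (neg_nonneg.2 (hn s hs)) (sq_nonneg s)
    obtain ⟨s, hs, hsp⟩ := exists_sign_right (c := c) β hk (by linarith) p
    have := hm Set.self_mem_Ici (le_of_lt hs) (le_of_lt hs)
    rw [hz] at this
    nlinarith
  obtain ⟨σ₂, hσ₂, h20⟩ := intermediate_value_Icc hs₂.le hcont.continuousOn ⟨hneg.le, hpos₂.le⟩
  have hσ₂p : p < σ₂ := lt_of_le_of_ne hσ₂.1 (by rintro rfl; exact hneg.ne h20)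
  refine ⟨c, hc, σ₁, σ₂, hσ₁0, hσ₁p.trans hσ₂p, h10, h20, ?_, ?_, fun s hs hlt => ?_, fun s hs hlt => ?_,
    fun s hs => ?_⟩
  · have := hcv hσ₁p; rw [hcurv] at this; exact this.ne'
  · have := hcv hσ₂p; rw [hcurv] at this; exact this.ne
  · rw [← h10]; exact hanti ⟨hs.le, (hlt.trans hσ₁p).le⟩ ⟨hσ₁0.le, hσ₁p.le⟩ hlt
  · rcases le_total s p with hle | hle
    · rw [← h10]; exact hanti ⟨hσ₁0.le, hσ₁p.le⟩ ⟨(hσ₁0.trans hs).le, hle⟩ hs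
    · rw [← h20]; exact hmono hle hσ₂p.le hlt
  · rw [← h20]; exact hmono hσ₂p.le (hσ₂p.trans hs).le hs

/-- The reduced displacement decreases, increases and decreases; the choice of its value at the two
critical points gives the three patterns of total multiplicity three with several zeros. -/
lemma exists_pattern_of_two_slope_zeros {k : ℝ} (hk : 0 < k) (hk1 : k < 1) :
    (∃ c β t, IsZeroPattern (limitPoint c k β) [1, 1, 1] t) ∧
    (∃ c β t, IsZeroPattern (limitPoint c k β) [2, 1] t) ∧
    (∃ c β t, IsZeroPattern (limitPoint c k β) [1, 2] t) := by
  obtain ⟨c, hc, σ₁, σ₂, h0, h12, z1, z2, v1, v2, p1, p2, p3⟩ := exists_two_slope_zeros hk hk1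
  have hσ₂ := h0.trans h12
  have hc' : 1 + c ≠ 0 := by linarith
  have hA := fun β => antiOn_of_slope_pos (c := c) β hk (convex_Ioc 0 σ₁) (fun s hs => hs.1)
    (fun s hs => by rw [interior_Ioc] at hs; exact p1 s hs.1 hs.2)
  have hM := fun β => monoOn_of_slope_neg (c := c) β hk (convex_Icc σ₁ σ₂) (fun s hs => h0.trans_le hs.1)
    (fun s hs => by rw [interior_Icc] at hs; exact p2 s hs.1 hs.2)
  have hB := fun β => antiOn_of_slope_pos (c := c) β hk (convex_Ici σ₂) (fun s hs => hσ₂.trans_le hs)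
    (fun s hs => by rw [interior_Ici] at hs; exact p3 s hs)
  have hinc : ∀ β, reduced (limitPoint c k β) σ₁ < reduced (limitPoint c k β) σ₂ := fun β =>
    hM β ⟨le_rfl, h12.le⟩ ⟨h12.le, le_rfl⟩ h12
  have hcases : ∀ s, 0 < s → s ∈ Set.Ioc 0 σ₁ ∨ s ∈ Set.Icc σ₁ σ₂ ∨ s ∈ Set.Ici σ₂ := by
    intro s hs
    rcases le_total s σ₁ with h | h
    · exact Or.inl ⟨hs, h⟩
    · rcases le_total s σ₂ with h' | h'
      · exact Or.inr (Or.inl ⟨h, h'⟩)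
      · exact Or.inr (Or.inr h')
  refine ⟨?_, ?_, ?_⟩
  · set β := -(reduced (limitPoint c k 0) σ₁ + reduced (limitPoint c k 0) σ₂) / 2 with hβ
    have e1 : reduced (limitPoint c k β) σ₁ < 0 := by
      rw [reduced_add β hk h0, hβ]; linarith [hinc 0]
    have e2 : 0 < reduced (limitPoint c k β) σ₂ := by
      rw [reduced_add β hk hσ₂, hβ]; linarith [hinc 0]
    obtain ⟨a₁, ha₁, ha₁σ, ha₁0⟩ := exists_zero_left β hk h0 e1
    obtain ⟨a₂, ha₂, ha₂0⟩ := intermediate_value_Icc h12.le (continuousOn_reduced (c := c) β hk h0) ⟨e1.le, e2.le⟩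
    obtain ⟨a₃, ha₃, ha₃0⟩ := exists_zero_right (c := c) β hk hc' hσ₂ (by nlinarith)
    have l2 : σ₁ < a₂ := lt_of_le_of_ne ha₂.1 (by rintro rfl; exact e1.ne ha₂0)
    have r2 : a₂ < σ₂ := lt_of_le_of_ne ha₂.2 (by rintro rfl; exact e2.ne' ha₂0)
    refine ⟨c, β, _, isZeroPattern_three hk hc' ha₁ (ha₁σ.trans l2) (r2.trans ha₃)
      (order_one hk ha₁ ha₁0 (p1 _ ha₁ ha₁σ).ne') (order_one hk (h0.trans l2) ha₂0 (p2 _ l2 r2).ne)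
      (order_one hk (hσ₂.trans ha₃) ha₃0 (p3 _ ha₃).ne') fun s hs hs0 => ?_⟩
    rcases hcases s hs with h | h | h
    · exact Or.inl ((hA β).injOn h ⟨ha₁, ha₁σ.le⟩ (hs0.trans ha₁0.symm))
    · exact Or.inr (Or.inl ((hM β).injOn h ha₂ (hs0.trans ha₂0.symm)))
    · exact Or.inr (Or.inr ((hB β).injOn h (le_of_lt ha₃) (hs0.trans ha₃0.symm)))
  · set β := -reduced (limitPoint c k 0) σ₁ with hβ
    have e1 : reduced (limitPoint c k β) σ₁ = 0 := by rw [reduced_add β hk h0, hβ, add_neg_cancel]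
    have e2 : 0 < reduced (limitPoint c k β) σ₂ := by rw [← e1]; exact hinc β
    obtain ⟨a₃, ha₃, ha₃0⟩ := exists_zero_right (c := c) β hk hc' hσ₂ (by nlinarith)
    refine ⟨c, β, _, isZeroPattern_two hk hc' h0 (h12.trans ha₃) (order_two hk h0 e1 z1 v1)
      (order_one hk (hσ₂.trans ha₃) ha₃0 (p3 _ ha₃).ne') fun s hs hs0 => ?_⟩
    rcases hcases s hs with h | h | h
    · exact Or.inl ((hA β).injOn h ⟨h0, le_rfl⟩ (hs0.trans e1.symm))
    · exact Or.inl ((hM β).injOn h ⟨le_rfl, h12.le⟩ (hs0.trans e1.symm))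
    · exact Or.inr ((hB β).injOn h (le_of_lt ha₃) (hs0.trans ha₃0.symm))
  · set β := -reduced (limitPoint c k 0) σ₂ with hβ
    have e2 : reduced (limitPoint c k β) σ₂ = 0 := by rw [reduced_add β hk hσ₂, hβ, add_neg_cancel]
    have e1 : reduced (limitPoint c k β) σ₁ < 0 := by rw [← e2]; exact hinc β
    obtain ⟨a₁, ha₁, ha₁σ, ha₁0⟩ := exists_zero_left β hk h0 e1
    refine ⟨c, β, _, isZeroPattern_two hk hc' ha₁ (ha₁σ.trans h12)
      (order_one hk ha₁ ha₁0 (p1 _ ha₁ ha₁σ).ne') (order_two hk hσ₂ e2 z2 v2) fun s hs hs0 => ?_⟩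
    rcases hcases s hs with h | h | h
    · exact Or.inl ((hA β).injOn h ⟨ha₁, ha₁σ.le⟩ (hs0.trans ha₁0.symm))
    · exact Or.inr ((hM β).injOn h ⟨h12.le, le_rfl⟩ (hs0.trans e2.symm))
    · exact Or.inr ((hB β).injOn h Set.self_mem_Ici (hs0.trans e2.symm))

lemma eq_of_sum_le_three {m : List ℕ} (h0 : m ≠ []) (h1 : ∀ i ∈ m, 1 ≤ i) (hs : m.sum ≤ 3) :
    m = [1] ∨ m = [2] ∨ m = [1, 1] ∨ m = [3] ∨ m = [1, 1, 1] ∨ m = [2, 1] ∨ m = [1, 2] := by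
  match m, h0, h1, hs with
  | [a], _, h1, hs =>
    have := h1 a (by simp)
    simp at hs
    interval_cases a <;> simp
  | [a, b], _, h1, hs =>
    have := h1 a (by simp)
    have := h1 b (by simp)
    simp at hs
    have : a ≤ 2 := by omega
    interval_cases a <;> have : b ≤ 2 := by omega
    · interval_cases b <;> simp
    · interval_cases b <;> simp at hs ⊢
  | [a, b, c], _, h1, hs =>
    have := h1 a (by simp)
    have := h1 b (by simp)
    have := h1 c (by simp)
    simp at hs
    obtain rfl : a = 1 := by omega
    obtain rfl : b = 1 := by omega
    obtain rfl : c = 1 := by omega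
    simp
  | a :: b :: c :: d :: l, _, h1, hs =>
    have := h1 a (by simp)
    have := h1 b (by simp)
    have := h1 c (by simp)
    have := h1 d (by simp)
    simp at hs
    omega

/-- All the multiplicities in question are realized in the limit. -/
lemma exists_isZeroPattern {k : ℝ} (hk : 0 < k) {m : List ℕ} (h0 : m ≠ []) (h1 : ∀ i ∈ m, 1 ≤ i)
    (hs : m.sum ≤ 2 ∨ (m.sum = 3 ∧ k < 1)) :
    ∃ c β t, IsZeroPattern (limitPoint c k β) m t := by
  rcases eq_of_sum_le_three h0 h1 (by omega) with rfl | rfl | rfl | rfl | rfl | rfl | rfl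
  · exact exists_pattern_simple hk
  · exact exists_pattern_double hk
  · exact exists_pattern_two_simple hk
  all_goals
    have hk1 : k < 1 := by simp at hs; exact hs
  · exact exists_pattern_triple hk hk1
  · exact (exists_pattern_of_two_slope_zeros hk hk1).1
  · exact (exists_pattern_of_two_slope_zeros hk hk1).2.1
  · exact (exists_pattern_of_two_slope_zeros hk hk1).2.2

/-! ### Families with an exact multiple zero -/

/-- A zero of order two or three of `N` persists, with its order, along a suitable curve of the two
unfolding parameters `r` and `β`: the zero of the highest vanishing derivative is followed with the
implicit function theorem, `β` is used to make the value vanish there, and `r` the derivative. -/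
lemma exists_multiple_zero {G : ℝ × ℝ × ℝ → ℝ → ℝ} {N a : ℝ → ℝ} {μ t : ℝ}
    (hG : AnalyticAt ℝ (fun p : (ℝ × ℝ × ℝ) × ℝ => G p.1 p.2) (0, t))
    (h0 : ∀ r β s, G (0, r, β) s = N s + r * a s + β * μ) (hμ : μ ≠ 0) (ha : AnalyticAt ℝ a t)
    (ha' : deriv a t ≠ 0) {n : ℕ} (hn : n = 1 ∨ n = 2) (hN : analyticOrderAt N t = (n + 1 : ℕ)) :
    ∃ r β τ : ℝ → ℝ, AnalyticAt ℝ r 0 ∧ AnalyticAt ℝ β 0 ∧ ContinuousAt τ 0 ∧ r 0 = 0 ∧ β 0 = 0 ∧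
      τ 0 = t ∧ ∀ j < n + 1, ∀ᶠ ε in 𝓝 (0 : ℝ), iteratedDeriv j (G (ε, r ε, β ε)) (τ ε) = 0 := by
  have hG0 : G 0 = N := funext fun s => by
    have := h0 0 0 s
    simp only [zero_mul, add_zero] at this
    exact this
  have hNA : AnalyticAt ℝ N t := by rw [← hG0]; exact analyticAt_slice (p := (0, t)) hG
  obtain ⟨hv, hv'⟩ := (analyticOrderAt_eq_nat_iff_iteratedDeriv_eq_zero hNA).1 hN
  have hN0 : N t = 0 := by simpa using hv 0 (by omega)
  have hN1 : deriv N t = 0 := by simpa using hv 1 (by omega)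
  have hD := fun j => analyticAt_iteratedDeriv_slice hG j
  -- the zero of the highest vanishing derivative
  have hd : HasDerivAt (fun s => iteratedDeriv n (G 0) s) (iteratedDeriv (n + 1) N t) t := by
    rw [hG0, iteratedDeriv_succ]
    have := analyticAt_slice (F := fun x => iteratedDeriv n (G x)) (p := (0, t)) (hD n)
    simp only [hG0] at this
    exact this.differentiableAt.hasDerivAt
  obtain ⟨σ, s1, s2, s3⟩ := exists_analyticAt_implicit (hD n)
    (show iteratedDeriv n (G 0) t = 0 by rw [hG0]; exact hv n (by omega)) hd hv'
  -- the value
  have hA2 : AnalyticAt ℝ (fun p : (ℝ × ℝ) × ℝ => G (p.1.1, p.1.2, p.2) (σ (p.1.1, p.1.2, p.2))) (0, 0) := by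
    have e1 : AnalyticAt ℝ (fun p : (ℝ × ℝ) × ℝ => σ (p.1.1, p.1.2, p.2)) (0, 0) :=
      AnalyticAt.fun_comp (f := fun p : (ℝ × ℝ) × ℝ => (p.1.1, p.1.2, p.2)) (g := σ) s1 (by fun_prop)
    have e2 : AnalyticAt ℝ (fun p : (ℝ × ℝ) × ℝ => ((p.1.1, p.1.2, p.2), σ (p.1.1, p.1.2, p.2))) (0, 0) :=
      AnalyticAt.prod (by fun_prop) e1
    refine AnalyticAt.fun_comp (g := fun p : (ℝ × ℝ × ℝ) × ℝ => G p.1 p.2) ?_ e2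
    have : σ (0, 0, 0) = t := s2
    simp only [Prod.fst_zero, Prod.snd_zero, this]
    exact hG
  have hσd : ∀ {f : ℝ → ℝ × ℝ × ℝ}, AnalyticAt ℝ f 0 → f 0 = 0 →
      AnalyticAt ℝ (fun x => σ (f x)) 0 := fun {f} hf hf0 =>
    AnalyticAt.fun_comp (f := f) (g := σ) (by rw [hf0]; exact s1) hf
  have hd2 : HasDerivAt (fun β => G (0, 0, β) (σ (0, 0, β))) μ 0 := by
    have e1 := (hσd (f := fun β => (0, 0, β)) (by fun_prop) rfl).differentiableAt.hasDerivAt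
    have e2 : HasDerivAt N (deriv N t) (σ (0, 0, 0)) := by
      rw [show σ (0, 0, 0) = t from s2]; exact hNA.differentiableAt.hasDerivAt
    have e3 := (e2.comp (0 : ℝ) e1).add ((hasDerivAt_id (0 : ℝ)).mul_const μ)
    rw [hN1, zero_mul, zero_add, one_mul] at e3
    refine e3.congr_of_eventuallyEq (Eventually.of_forall fun β => ?_)
    simp [h0]
  obtain ⟨β, b1, b2, b3⟩ := exists_analyticAt_implicit hA2
    (by have : σ (0, 0, 0) = t := s2
        simp [this, h0, hN0]) hd2 hμ
  -- the curve of zeros of the value, for a given function `r`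
  have hcont : ∀ {r : ℝ → ℝ}, AnalyticAt ℝ r 0 → r 0 = 0 →
      AnalyticAt ℝ (fun ε => β (ε, r ε)) 0 ∧ β (0, r 0) = 0 ∧
      AnalyticAt ℝ (fun ε => σ (ε, r ε, β (ε, r ε))) 0 ∧ σ (0, r 0, β (0, r 0)) = t ∧
      (∀ᶠ ε in 𝓝 (0 : ℝ), G (ε, r ε, β (ε, r ε)) (σ (ε, r ε, β (ε, r ε))) = 0) ∧
      (∀ᶠ ε in 𝓝 (0 : ℝ), iteratedDeriv n (G (ε, r ε, β (ε, r ε))) (σ (ε, r ε, β (ε, r ε))) = 0) := by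
    intro r hr hr0
    have i1 : AnalyticAt ℝ (fun ε => (ε, r ε)) 0 := AnalyticAt.prod analyticAt_id hr
    have i2 : AnalyticAt ℝ (fun ε => β (ε, r ε)) 0 :=
      AnalyticAt.fun_comp (g := β) (by simp only [hr0]; exact b1) i1
    have i3 : β (0, r 0) = 0 := by rw [hr0]; exact b2
    have i4 : AnalyticAt ℝ (fun ε => (ε, r ε, β (ε, r ε))) 0 := AnalyticAt.prod analyticAt_id (hr.prod i2)
    have i5 : ((0 : ℝ), r 0, β (0, r 0)) = 0 := by rw [i3, hr0]; rfl
    refine ⟨i2, i3, hσd i4 i5, by rw [i5, s2], ?_, ?_⟩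
    · have : Tendsto (fun ε => (ε, r ε)) (𝓝 0) (𝓝 0) := by
        have := i1.continuousAt.tendsto
        simp only [hr0] at this
        exact this
      exact this.eventually b3
    · have : Tendsto (fun ε => (ε, r ε, β (ε, r ε))) (𝓝 0) (𝓝 0) := by
        have := i4.continuousAt.tendsto
        rw [i5] at this
        exact this
      exact this.eventually s3
  rcases hn with rfl | rfl
  · obtain ⟨c1, c2, c3, c4, c5, c6⟩ := hcont (r := fun _ => 0) analyticAt_const rfl
    refine ⟨fun _ => 0, fun ε => β (ε, 0), fun ε => σ (ε, 0, β (ε, 0)), analyticAt_const, c1,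
      c3.continuousAt, rfl, c2, c4, fun j hj => ?_⟩
    interval_cases j
    · simpa using c5
    · exact c6
  · -- the derivative
    have hA3 : AnalyticAt ℝ (fun p : ℝ × ℝ => iteratedDeriv 1 (G (p.1, p.2, β p)) (σ (p.1, p.2, β p))) (0, 0) := by
      have e0 : AnalyticAt ℝ (fun p : ℝ × ℝ => (p.1, p.2, β p)) (0, 0) :=
        AnalyticAt.prod analyticAt_fst (analyticAt_snd.prod b1)
      have e00 : ((0 : ℝ), (0 : ℝ), β (0, 0)) = 0 := by rw [show β (0, 0) = 0 from b2]; rfl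
      have e1 : AnalyticAt ℝ (fun p : ℝ × ℝ => σ (p.1, p.2, β p)) (0, 0) :=
        AnalyticAt.fun_comp (g := σ) (by simp only [e00]; exact s1) e0
      refine AnalyticAt.fun_comp (g := fun p : (ℝ × ℝ × ℝ) × ℝ => iteratedDeriv 1 (G p.1) p.2)
        ?_ (e0.prod e1)
      simp only [e00, s2]
      exact hD 1
    have hd3 : HasDerivAt (fun r => iteratedDeriv 1 (G (0, r, β (0, r))) (σ (0, r, β (0, r)))) (deriv a t) 0 := by
      have e0 : AnalyticAt ℝ (fun r : ℝ => ((0 : ℝ), r)) 0 := AnalyticAt.prod analyticAt_const analyticAt_id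
      have e1 : AnalyticAt ℝ (fun r => β (0, r)) 0 := AnalyticAt.fun_comp (g := β) b1 e0
      have e2 : AnalyticAt ℝ (fun r : ℝ => ((0 : ℝ), r, β (0, r))) 0 :=
        AnalyticAt.prod analyticAt_const (analyticAt_id.prod e1)
      have e00 : ((0 : ℝ), (0 : ℝ), β (0, 0)) = 0 := by rw [show β (0, 0) = 0 from b2]; rfl
      have e3 := hσd e2 e00
      have e4 : σ (0, 0, β (0, 0)) = t := by rw [e00, s2]
      have hN2 : deriv (deriv N) t = 0 := by
        have := hv 2 (by omega)
        rwa [iteratedDeriv_succ, iteratedDeriv_one] at this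
      have f1 : HasDerivAt (deriv N) (deriv (deriv N) t) (σ (0, 0, β (0, 0))) := by
        rw [e4]; exact hNA.deriv.differentiableAt.hasDerivAt
      have f2 : HasDerivAt (deriv a) (deriv (deriv a) t) (σ (0, 0, β (0, 0))) := by
        rw [e4]; exact ha.deriv.differentiableAt.hasDerivAt
      have f3 := (f1.comp (0 : ℝ) e3.differentiableAt.hasDerivAt).add
        ((hasDerivAt_id (0 : ℝ)).mul (f2.comp (0 : ℝ) e3.differentiableAt.hasDerivAt))
      have f4 := f3.congr_of_eventuallyEq
        (f₁ := fun r => iteratedDeriv 1 (G (0, r, β (0, r))) (σ (0, r, β (0, r)))) (by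
          have hev := (hNA.eventually_analyticAt.and ha.eventually_analyticAt)
          have ht : Tendsto (fun r => σ (0, r, β (0, r))) (𝓝 0) (𝓝 t) := by
            have := e3.continuousAt.tendsto
            rwa [e4] at this
          filter_upwards [ht.eventually hev] with r ⟨g1, g2⟩
          rw [iteratedDeriv_one]
          have : G (0, r, β (0, r)) = fun s => N s + r * a s + β (0, r) * μ := funext fun s => h0 _ _ _
          rw [this]
          have := ((g1.differentiableAt.hasDerivAt.add (g2.differentiableAt.hasDerivAt.const_mul r)).add_const
            (β (0, r) * μ)).deriv
          simpa using this)
      refine f4.congr_deriv ?_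
      simp [hN2, e4]
    obtain ⟨r, r1, r2, r3⟩ := exists_analyticAt_implicit hA3
      (by have e00 : ((0 : ℝ), (0 : ℝ), β (0, 0)) = 0 := by rw [show β (0, 0) = 0 from b2]; rfl
          simp only [e00, s2, hG0, iteratedDeriv_one, hN1]) hd3 ha'
    obtain ⟨c1, c2, c3, c4, c5, c6⟩ := hcont r1 r2
    refine ⟨r, fun ε => β (ε, r ε), fun ε => σ (ε, r ε, β (ε, r ε)), r1, c1, c3.continuousAt, r2, c2, c4,
      fun j hj => ?_⟩
    interval_cases j
    · simpa using c5
    · exact r3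
    · exact c6

/-! ### Unfolding of a perturbation -/

/-- The linear perturbation, unfolded by the trace in the right zone and by the horizontal component
of the constant term there. -/
noncomputable def unfolding (Z₀ Z₁ : PWL) (x : ℝ × ℝ × ℝ) : PWL where
  rightMat := Z₀.rightMat + x.1 • Z₁.rightMat + !![0, 0; 0, x.1 * x.2.1]
  rightVec := Z₀.rightVec + x.1 • Z₁.rightVec + ![x.1 * x.2.2, 0]
  leftMat := Z₀.leftMat + x.1 • Z₁.leftMat
  leftVec := Z₀.leftVec + x.1 • Z₁.leftVec

/-- The normalized parameters of the unfolding, extended to `ε = 0`. -/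
noncomputable def unfoldingParams (Z₀ Z₁ : PWL) (x : ℝ × ℝ × ℝ) : Params :=
  (x.1, Z₁.trL / 2 / freq (unfolding Z₀ Z₁ x).leftMat, (Z₁.trR + x.2.1) / 2 / freq (unfolding Z₀ Z₁ x).rightMat,
    (unfolding Z₀ Z₁ x).kappa,
    (Z₁.rightVec 0 + x.2.2 - (unfolding Z₀ Z₁ x).rho * Z₁.leftVec 0) /
      ((unfolding Z₀ Z₁ x).rho * (unfolding Z₀ Z₁ x).hL))

lemma analyticAt_freq {E : Type*} [NormedAddCommGroup E] [NormedSpace ℝ E]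
    {M : E → Matrix (Fin 2) (Fin 2) ℝ} {x : E}
    (h : ∀ i j, AnalyticAt ℝ (fun x => M x i j) x) (hx : IsRotating (M x)) :
    AnalyticAt ℝ (fun x => stiffness (M x)) x ∧ AnalyticAt ℝ (fun x => freq (M x)) x := by
  have h1 : AnalyticAt ℝ (fun x => damping (M x)) x :=
    ((h 0 0).add (h 1 1)).div analyticAt_const two_ne_zero
  have h2 : AnalyticAt ℝ (fun x => stiffness (M x)) x :=
    ((h 0 0).mul (h 1 1)).sub ((h 0 1).mul (h 1 0))
  refine ⟨h2, ?_⟩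
  have h3 : AnalyticAt ℝ Real.sqrt (stiffness (M x) - damping (M x) ^ 2) :=
    (Real.contDiffAt_sqrt (n := ⊤) (sub_pos.2 hx.2).ne').analyticAt
  exact AnalyticAt.fun_comp (g := Real.sqrt) h3 (h2.sub (h1.pow 2))

lemma analyticAt_reach {E : Type*} [NormedAddCommGroup E] [NormedSpace ℝ E]
    {M : E → Matrix (Fin 2) (Fin 2) ℝ} {v : E → Fin 2 → ℝ} {x : E}
    (h : ∀ i j, AnalyticAt ℝ (fun x => M x i j) x) (hv : ∀ i, AnalyticAt ℝ (fun x => v x i) x)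
    (hx : IsRotating (M x)) : AnalyticAt ℝ (fun x => reach (M x) (v x)) x :=
  ((((h 1 1).mul (hv 0)).sub ((h 0 1).mul (hv 1))).div (analyticAt_freq h hx).1 hx.stiffness_pos.ne').mul
    (analyticAt_freq h hx).2

section Unfolding

variable {a b c d e ξ : ℝ} {Z₀ Z₁ : PWL}

lemma analyticAt_unfolding (x : ℝ × ℝ × ℝ) :
    (∀ i j, AnalyticAt ℝ (fun x => (unfolding Z₀ Z₁ x).leftMat i j) x) ∧
    (∀ i, AnalyticAt ℝ (fun x => (unfolding Z₀ Z₁ x).leftVec i) x) ∧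
    (∀ i j, AnalyticAt ℝ (fun x => (unfolding Z₀ Z₁ x).rightMat i j) x) ∧
    (∀ i, AnalyticAt ℝ (fun x => (unfolding Z₀ Z₁ x).rightVec i) x) := by
  refine ⟨fun i j => ?_, fun i => ?_, fun i j => ?_, fun i => ?_⟩
  · simp only [unfolding, Matrix.add_apply, Matrix.smul_apply, smul_eq_mul]; fun_prop
  · simp only [unfolding, Pi.add_apply, Pi.smul_apply, smul_eq_mul]; fun_prop
  · simp only [unfolding, Matrix.add_apply, Matrix.smul_apply, smul_eq_mul]
    fin_cases i <;> fin_cases j <;> simp <;> fun_prop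
  · simp only [unfolding, Pi.add_apply, Pi.smul_apply, smul_eq_mul]
    fin_cases i <;> simp <;> fun_prop

lemma unfolding_rightVec_zero (x : ℝ × ℝ × ℝ) : (unfolding Z₀ Z₁ x).rightVec 0 =
    Z₀.rightVec 0 + x.1 * Z₁.rightVec 0 + x.1 * x.2.2 := rfl

lemma unfolding_rightVec_one (x : ℝ × ℝ × ℝ) : (unfolding Z₀ Z₁ x).rightVec 1 =
    Z₀.rightVec 1 + x.1 * Z₁.rightVec 1 + 0 := rfl

lemma unfolding_leftVec (x : ℝ × ℝ × ℝ) (i : Fin 2) : (unfolding Z₀ Z₁ x).leftVec i =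
    Z₀.leftVec i + x.1 * Z₁.leftVec i := rfl

lemma unfolding_zero (y : ℝ × ℝ) : unfolding Z₀ Z₁ (0, y) = Z₀ := by
  have h1 : (Matrix.of ![0, 0] : Matrix (Fin 2) (Fin 2) ℝ) = 0 := by
    ext i j; fin_cases i <;> rfl
  have h2 : (![0, 0] : Fin 2 → ℝ) = 0 := by ext i; fin_cases i <;> rfl
  simp [unfolding, h1, h2]

lemma analyticAt_unfoldingParams (h0 : Z₀.IsGood) :
    AnalyticAt ℝ (unfoldingParams Z₀ Z₁) 0 := by
  have hx : unfolding Z₀ Z₁ 0 = Z₀ := unfolding_zero 0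
  obtain ⟨hl, hlv, hr, hrv⟩ := analyticAt_unfolding (Z₀ := Z₀) (Z₁ := Z₁) 0
  have rl : IsRotating (unfolding Z₀ Z₁ 0).leftMat := by rw [hx]; exact h0.rotL
  have rr : IsRotating (unfolding Z₀ Z₁ 0).rightMat := by rw [hx]; exact h0.rotR
  have fL := (analyticAt_freq hl rl).2
  have fR := (analyticAt_freq hr rr).2
  have aL : AnalyticAt ℝ (fun x => (unfolding Z₀ Z₁ x).hL) 0 := analyticAt_reach hl hlv rl
  have aR : AnalyticAt ℝ (fun x => (unfolding Z₀ Z₁ x).hR) 0 := analyticAt_reach hr hrv rr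
  have ar : AnalyticAt ℝ (fun x => (unfolding Z₀ Z₁ x).rho) 0 := (hr 0 1).div (hl 0 1) rl.1.ne
  have hρ : (unfolding Z₀ Z₁ 0).rho * (unfolding Z₀ Z₁ 0).hL ≠ 0 := by
    rw [hx]; exact (mul_pos h0.rho_pos h0.hL_pos).ne'
  have hR : (unfolding Z₀ Z₁ 0).hR ≠ 0 := by rw [hx]; exact h0.hR_pos.ne'
  refine AnalyticAt.prod analyticAt_fst (AnalyticAt.prod ?_ (AnalyticAt.prod ?_ (AnalyticAt.prod ?_ ?_)))
  · exact analyticAt_const.div fL rl.freq_pos.ne'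
  · exact AnalyticAt.div (by fun_prop) fR rr.freq_pos.ne'
  · exact (ar.mul aL).div aR hR
  · exact AnalyticAt.div (AnalyticAt.sub (by fun_prop) (ar.mul analyticAt_const)) (ar.mul aL) hρ

/-- For `ε ≠ 0` the parameters of the unfolding are the normalized parameters of the field. -/
lemma params_unfolding {x : ℝ × ℝ × ℝ} (hx : x.1 ≠ 0) :
    (unfolding (canonical a b c d e) Z₁ x).params x.1 = unfoldingParams (canonical a b c d e) Z₁ x := by
  have h1 : damping (unfolding (canonical a b c d e) Z₁ x).leftMat = x.1 * (Z₁.trL / 2) := by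
    simp [damping, unfolding, canonical, trL]; ring
  have h2 : damping (unfolding (canonical a b c d e) Z₁ x).rightMat = x.1 * ((Z₁.trR + x.2.1) / 2) := by
    simp [damping, unfolding, canonical, trR]; ring
  have h3 : (unfolding (canonical a b c d e) Z₁ x).beta = x.1 * (Z₁.rightVec 0 + x.2.2 -
      (unfolding (canonical a b c d e) Z₁ x).rho * Z₁.leftVec 0) := by
    have h4 : (unfolding (canonical a b c d e) Z₁ x).rightVec 0 = x.1 * (Z₁.rightVec 0 + x.2.2) := by
      rw [unfolding_rightVec_zero]; simp [canonical]; ring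
    have h5 : (unfolding (canonical a b c d e) Z₁ x).leftVec 0 = x.1 * Z₁.leftVec 0 := by
      rw [unfolding_leftVec]; simp [canonical]
    rw [beta, h4, h5]; ring
  simp only [params, unfoldingParams, gL, gR, ratio, h1, h2, offset, h3]
  refine Prod.ext rfl (Prod.ext ?_ (Prod.ext ?_ (Prod.ext rfl ?_)))
  all_goals
    simp only
    rw [div_right_comm, mul_div_cancel_left₀ _ hx]

/-- The unfolding parameters act independently on the damping of the right zone and on the offset. -/
lemma unfoldingParams_zero (hb : b < 0) (hd : 0 < d) (he : 0 < e) (hξ : 0 < ξ)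
    (habc : a ^ 2 + b * c = -ξ ^ 2) (r β : ℝ) :
    unfoldingParams (canonical a b c d e) Z₁ (0, r, β) =
      (0, Z₁.trL / 2, (Z₁.trR + r) / (2 * ξ), e * ξ / d,
        (b * Z₁.leftVec 0 + Z₁.rightVec 0 + β) / (-b * e)) := by
  obtain ⟨l1, l2, l3, l4⟩ := @canonical_left a b c d e
  obtain ⟨r1, r2, r3, r4⟩ := canonical_right (d := d) (e := e) hξ habc
  have hb' := hb.ne
  have hrho : (canonical a b c d e).rho = -b := by simp [rho, canonical, div_neg]
  simp only [unfoldingParams, unfolding_zero, l3, r3, kappa, l4, r4, hrho]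
  refine Prod.ext rfl (Prod.ext ?_ (Prod.ext ?_ (Prod.ext ?_ ?_)))
  · simp
  · simp only; field_simp
  · simp only; field_simp
  · simp only; ring

/-- Along a curve of the unfolding parameters that starts at the origin the unfolding is a
perturbation with the given first-order term. -/
lemma isPerturbation_unfolding {r β : ℝ → ℝ} (hr : AnalyticAt ℝ r 0) (hβ : AnalyticAt ℝ β 0) (hr0 : r 0 = 0)
    (hβ0 : β 0 = 0) :
    IsPerturbation Z₀ Z₁ ⟨!![0, 0; 0, deriv r 0], ![deriv β 0, 0], 0, 0⟩
      (fun ε => unfolding Z₀ Z₁ (ε, r ε, β ε)) := by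
  have key : ∀ {f : ℝ → ℝ}, AnalyticAt ℝ f 0 → f 0 = 0 →
      (fun ε => ε * f ε - ε ^ 2 * deriv f 0) =O[𝓝[≥] 0] fun ε : ℝ => ε ^ 3 := by
    intro f hf hf0
    obtain ⟨p, hp⟩ := hf
    have hg : AnalyticAt ℝ (dslope f 0) 0 := ⟨_, hp.has_fpower_series_dslope_fslope⟩
    have h1 := hg.differentiableAt.hasDerivAt.isBigO_sub
    have h2 : (fun ε => ε * f ε - ε ^ 2 * deriv f 0) =O[𝓝 0] fun ε : ℝ => ε ^ 2 * (ε - 0) := by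
      refine ((isBigO_refl (fun ε : ℝ => ε ^ 2) _).mul h1).congr_left fun ε => ?_
      have h3 := sub_smul_dslope f 0 ε
      simp only [sub_zero, hf0, smul_eq_mul] at h3
      rw [dslope_same, ← h3]
      ring
    refine (h2.mono nhdsWithin_le_nhds).congr_right fun ε => by ring
  have hz : ∀ {f : ℝ → ℝ}, (∀ ε, f ε = 0) → f =O[𝓝[≥] 0] fun ε : ℝ => ε ^ 3 := fun {f} hf => by
    rw [show f = fun _ => 0 from funext hf]; exact isBigO_zero _ _
  refine ⟨fun i j => ?_, fun i => ?_, fun i j => hz fun ε => ?_, fun i => hz fun ε => ?_⟩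
  · fin_cases i <;> fin_cases j
    · exact hz fun ε => by simp [unfolding]
    · exact hz fun ε => by simp [unfolding]
    · exact hz fun ε => by simp [unfolding]
    · refine (key hr hr0).congr_left fun ε => ?_
      simp [unfolding]
  · fin_cases i
    · refine (key hβ hβ0).congr_left fun ε => ?_
      simp only [Fin.zero_eta, unfolding_rightVec_zero, Matrix.cons_val_zero]
      ring
    · refine hz fun ε => ?_
      simp [unfolding_rightVec_one]
  · simp [unfolding]
  · simp [unfolding_leftVec]

end Unfolding

/-- The gain in the right zone depends on its damping ratio in a nondegenerate way. -/
lemma deriv_psi_zero_ne {s : ℝ} (hs : 0 < s) : deriv (psi 0) s ≠ 0 := by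
  have h1 := ((Real.hasDerivAt_arctan s).mul ((hasDerivAt_id s).add
    ((hasDerivAt_const s (1:ℝ)).div (hasDerivAt_id s) hs.ne'))).sub_const 1
  have h2 := h1.congr_of_eventuallyEq (f₁ := psi 0) (by
    filter_upwards [lt_mem_nhds hs] with x hx
    rw [psi_zero hx]
    simp)
  rw [h2.deriv]
  have h3 := arctan_mul_lt hs
  have h4 : 1 / (1 + s ^ 2) * (s + 1 / s) + Real.arctan s * (1 + (0 * s - 1 * 1) / s ^ 2) =
      1 / s - Real.arctan s * (1 / s ^ 2 - 1) := by field_simp; ring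
  simp only [id, Pi.add_apply, Pi.div_apply]
  rw [h4]
  linarith

/-- A pattern with one multiple zero is realized by a family along a curve in the unfolding: the
multiple zero is kept exactly, and the simple ones persist. -/
lemma exists_family {a b c d e ξ : ℝ} (hb : b < 0) (hd : 0 < d) (he : 0 < e) (hξ : 0 < ξ)
    (habc : a ^ 2 + b * c = -ξ ^ 2) {Z₁ : PWL} {m : List ℕ} {t : Fin m.length → ℝ}
    (h : IsZeroPattern (limitParams b d e ξ Z₁) m t) {i₀ : Fin m.length} {n : ℕ} (hn : n = 1 ∨ n = 2)
    (hi₀ : m.get i₀ = n + 1) (hi : ∀ i, i ≠ i₀ → m.get i = 1) :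
    ∃ (Z₂ : PWL) (Z : ℝ → PWL), IsPerturbation (canonical a b c d e) Z₁ Z₂ Z ∧
      ∀ᶠ ε in 𝓝[>] (0 : ℝ), (Z ε).HasConfiguration m := by
  have hgood := isGood_canonical (c := c) hb hd he hξ habc
  set q := unfoldingParams (canonical a b c d e) Z₁ with hqdef
  have hk : 0 < e * ξ / d := div_pos (mul_pos he hξ) hd
  have hbe : -b * e ≠ 0 := (mul_pos (neg_pos.2 hb) he).ne'
  have hq0 : q 0 = limitParams b d e ξ Z₁ := by
    have := unfoldingParams_zero (Z₁ := Z₁) hb hd he hξ habc 0 0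
    rw [add_zero, add_zero] at this
    exact this
  have ht := h.pos i₀
  have hG : AnalyticAt ℝ (fun p : (ℝ × ℝ × ℝ) × ℝ => reduced (q p.1) p.2) (0, t i₀) := by
    refine AnalyticAt.fun_comp (f := fun p : (ℝ × ℝ × ℝ) × ℝ => (q p.1, p.2))
      (g := fun p : Params × ℝ => reduced p.1 p.2) ?_
      (AnalyticAt.prod (AnalyticAt.fun_comp (g := q) (analyticAt_unfoldingParams hgood) analyticAt_fst)
        analyticAt_snd)
    simp only [hq0]
    exact h.analyticAt ht
  have hN : ∀ r β s, reduced (q (0, r, β)) s = reduced (limitParams b d e ξ Z₁) s +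
      r * (psi 0 (e * ξ / d * s) / (2 * ξ * (e * ξ / d))) + β * (1 / (-b * e)) := by
    intro r β s
    rw [hqdef, unfoldingParams_zero hb hd he hξ habc]
    simp only [reduced, rest, limitParams, zero_mul]
    have := hb.ne
    field_simp
    ring
  have hks := mul_pos hk ht
  have hpsi : AnalyticAt ℝ (psi 0) (e * ξ / d * t i₀) :=
    analyticAt_slice (F := psi) (p := (0, e * ξ / d * t i₀)) (analyticAt_psi hks)
  have ha : AnalyticAt ℝ (fun s => psi 0 (e * ξ / d * s) / (2 * ξ * (e * ξ / d))) (t i₀) :=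
    (AnalyticAt.fun_comp (f := fun s => e * ξ / d * s) (g := psi 0) hpsi (by fun_prop)).div analyticAt_const
      (by positivity)
  have ha' : deriv (fun s => psi 0 (e * ξ / d * s) / (2 * ξ * (e * ξ / d))) (t i₀) ≠ 0 := by
    have h1 := (hpsi.differentiableAt.hasDerivAt.comp (t i₀)
      ((hasDerivAt_id (t i₀)).const_mul (e * ξ / d))).div_const (2 * ξ * (e * ξ / d))
    have h2 : deriv (fun s => psi 0 (e * ξ / d * s) / (2 * ξ * (e * ξ / d))) (t i₀) = _ := h1.deriv
    rw [h2]
    exact div_ne_zero (mul_ne_zero (deriv_psi_zero_ne hks) (by simpa using hk.ne')) (by positivity)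
  obtain ⟨r, β, τ, hr, hβ, hτ, hr0, hβ0, hτ0, hz⟩ := exists_multiple_zero
    (G := fun x => reduced (q x)) hG hN (one_div_ne_zero hbe) ha ha' hn
    (by rw [← hi₀]; exact h.order i₀)
  have hpert := isPerturbation_unfolding (Z₀ := canonical a b c d e) (Z₁ := Z₁) hr hβ hr0 hβ0
  refine ⟨_, _, hpert, ?_⟩
  have hlim := hpert.tendsto_params hb hd he hξ habc
  have hsimple : ∀ i, ∃ σ : Params → ℝ, ContinuousAt σ (limitParams b d e ξ Z₁) ∧
      σ (limitParams b d e ξ Z₁) = t i ∧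
      (i ≠ i₀ → ∀ᶠ q in 𝓝 (limitParams b d e ξ Z₁), reduced q (σ q) = 0) := by
    intro i
    by_cases hii : i = i₀
    · exact ⟨fun _ => t i, continuousAt_const, rfl, fun h => absurd hii h⟩
    · obtain ⟨σ, s1, s2, s3⟩ := h.exists_simple (hi i hii)
      exact ⟨σ, s1, s2, fun _ => s3⟩
  choose σ s1 s2 s3 using hsimple
  refine h.eventually_hasConfiguration (fun i him => ?_) (hpert.eventually_isGood hgood) hlim
    (τ := fun ε i => if i = i₀ then τ ε else σ i ((unfolding (canonical a b c d e) Z₁ (ε, r ε, β ε)).params ε))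
    (fun i => ?_) fun i j hj => ?_
  · obtain ⟨x, rfl⟩ := List.get_of_mem him
    by_cases hii : x = i₀
    · rw [hii, hi₀]; omega
    · exact (hi x hii).ge
  · by_cases hii : i = i₀
    · simp only [hii, if_true]
      have := hτ.tendsto
      rw [hτ0] at this
      exact this.mono_left nhdsWithin_le_nhds
    · simp only [hii, if_false]
      have := (s1 i).tendsto.comp hlim
      rwa [s2 i] at this
  · by_cases hii : i = i₀
    · simp only [hii, if_true]
      have h1 := (hz j (by rwa [hii, hi₀] at hj)).filter_mono (nhdsWithin_le_nhds (s := Set.Ioi (0:ℝ)))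
      filter_upwards [h1, self_mem_nhdsWithin] with ε h2 hε
      have := params_unfolding (a := a) (b := b) (c := c) (d := d) (e := e) (Z₁ := Z₁) (x := (ε, r ε, β ε))
        (ne_of_gt hε)
      simp only at this
      rw [this]
      exact h2
    · simp only [hii, if_false]
      rw [hi i hii, Nat.lt_one_iff] at hj
      subst hj
      simpa using hlim.eventually (s3 i hii)

/-! ### The parameters of the first-order term -/

section First

variable {b d e ξ : ℝ}

/-- `K0`, `K1` and `K2` determine the limit of the normalized parameters. -/
lemma limitParams_eq (hb : b < 0) (hd : 0 < d) (he : 0 < e) (hξ : 0 < ξ) {c β : ℝ} {Z₁ : PWL}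
    (h0 : K0 b d e ξ Z₁ = 2 * d * (ξ ^ 2 * (2 * (-b * e * β) - b * e * 2) + b * d * (2 * ξ * c)) / (e * ξ))
    (h1 : K1 b e ξ Z₁ = b * e * ξ ^ 2 * 2) (h2 : K2 b d e ξ Z₁ = -(b * d ^ 2 * (2 * ξ * c) / (e * ξ))) :
    limitParams b d e ξ Z₁ = limitPoint c (e * ξ / d) β := by
  have hb' := hb.ne
  have e1 : Z₁.trL = 2 := mul_left_cancel₀ (by positivity) h1
  have e2 : Z₁.trR = 2 * ξ * c := by
    rw [K2, neg_inj, div_left_inj' (by positivity)] at h2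
    exact mul_left_cancel₀ (by positivity) h2
  have e3 : b * Z₁.leftVec 0 + Z₁.rightVec 0 = -b * e * β := by
    rw [K0, e1, e2, div_left_inj' (by positivity)] at h0
    have h3 := mul_left_cancel₀ (by positivity) h0
    have h4 : ξ ^ 2 * (b * Z₁.leftVec 0 + Z₁.rightVec 0) = ξ ^ 2 * (-b * e * β) := by linarith
    exact mul_left_cancel₀ (by positivity) h4
  rw [limitParams, limitPoint, e1, e2, e3]
  refine Prod.ext rfl (Prod.ext ?_ (Prod.ext ?_ (Prod.ext rfl ?_))) <;> simp only <;> field_simp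

end First

/-- At most one multiplicity exceeds one, since the total is at most three. -/
lemma exists_multiple_index {m : List ℕ} (h0 : m ≠ []) (h1 : ∀ i ∈ m, 1 ≤ i) (hs : m.sum ≤ 3)
    (hne : ¬ ∀ i ∈ m, i = 1) : ∃ (i₀ : Fin m.length) (n : ℕ), (n = 1 ∨ n = 2) ∧ m.get i₀ = n + 1 ∧
      ∀ i, i ≠ i₀ → m.get i = 1 := by
  rcases eq_of_sum_le_three h0 h1 hs with rfl | rfl | rfl | rfl | rfl | rfl | rfl
  · simp at hne
  · exact ⟨(0 : Fin 1), 1, by decide, by decide, by decide⟩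
  · simp at hne
  · exact ⟨(0 : Fin 1), 2, by decide, by decide, by decide⟩
  · simp at hne
  · exact ⟨(0 : Fin 2), 1, by decide, by decide, by decide⟩
  · exact ⟨(1 : Fin 2), 1, by decide, by decide, by decide⟩

/-- Realization of the configurations of limit cycles. -/
lemma exists_configuration {a b c d e ξ : ℝ} (hb : b < 0) (hd : 0 < d) (he : 0 < e) (hξ : 0 < ξ)
    (habc : a ^ 2 + b * c = -ξ ^ 2) (m : List ℕ) (hm : m ≠ []) (hm1 : ∀ i ∈ m, 1 ≤ i)
    (hs : m.sum ≤ 2 ∨ (m.sum = 3 ∧ ξ * e < d)) :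
    ∃ k₀ k₁ k₂ : ℝ,
      (∃ Z₁ : PWL, K0 b d e ξ Z₁ = k₀ ∧ K1 b e ξ Z₁ = k₁ ∧ K2 b d e ξ Z₁ = k₂) ∧
      ∀ Z₁ : PWL, K0 b d e ξ Z₁ = k₀ → K1 b e ξ Z₁ = k₁ → K2 b d e ξ Z₁ = k₂ →
        (∃ (Z₂ : PWL) (Z : ℝ → PWL), IsPerturbation (canonical a b c d e) Z₁ Z₂ Z ∧
          ∀ᶠ ε in 𝓝[>] (0 : ℝ), (Z ε).HasConfiguration m) ∧
        ((∀ i ∈ m, i = 1) → ∀ (Z₂ : PWL) (Z : ℝ → PWL),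
          IsPerturbation (canonical a b c d e) Z₁ Z₂ Z →
          ∀ᶠ ε in 𝓝[>] (0 : ℝ), (Z ε).HasConfiguration m) := by
  have hk : 0 < e * ξ / d := div_pos (mul_pos he hξ) hd
  have hgood := isGood_canonical (c := c) hb hd he hξ habc
  obtain ⟨γ, β, t, hpat⟩ := exists_isZeroPattern hk hm hm1 (hs.imp_right fun h =>
    ⟨h.1, by rw [div_lt_one hd]; linarith [h.2]⟩)
  refine ⟨2 * d * (ξ ^ 2 * (2 * (-b * e * β) - b * e * 2) + b * d * (2 * ξ * γ)) / (e * ξ),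
    b * e * ξ ^ 2 * 2, -(b * d ^ 2 * (2 * ξ * γ) / (e * ξ)),
    ⟨⟨!![2 * ξ * γ, 0; 0, 0], ![-b * e * β, 0], !![2, 0; 0, 0], 0⟩, ?_, ?_, ?_⟩, fun Z₁ h0 h1 h2 => ?_⟩
  · simp [K0, trL, trR]; ring
  · simp [K1, trL]
  · simp [K2, trR]
  · have hlim := limitParams_eq hb hd he hξ h0 h1 h2
    rw [← hlim] at hpat
    have hsimple : (∀ i ∈ m, i = 1) → ∀ (Z₂ : PWL) (Z : ℝ → PWL),
        IsPerturbation (canonical a b c d e) Z₁ Z₂ Z →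
        ∀ᶠ ε in 𝓝[>] (0 : ℝ), (Z ε).HasConfiguration m := fun h Z₂ Z hZ =>
      hpat.eventually_hasConfiguration_of_simple h (hZ.eventually_isGood hgood)
        (hZ.tendsto_params hb hd he hξ habc)
    refine ⟨?_, hsimple⟩
    by_cases hone : ∀ i ∈ m, i = 1
    · have hpert := isPerturbation_unfolding (Z₀ := canonical a b c d e) (Z₁ := Z₁)
        (r := fun _ => 0) (β := fun _ => 0) analyticAt_const analyticAt_const rfl rfl
      exact ⟨_, _, hpert, hsimple hone _ _ hpert⟩
    · obtain ⟨i₀, n, hn, hi₀, hi⟩ := exists_multiple_index hm hm1 (by omega) hone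
      exact exists_family hb hd he hξ habc hpat hn hi₀ hi

end PWL

theorem mainTheorem1 (a b c d e ξ : ℝ) (hb : b < 0) (hc : 0 < c) (hd : 0 < d) (he : 0 < e)
    (hξ : 0 < ξ) (habc : a ^ 2 + b * c = -ξ ^ 2) :
    -- (a)
    (∀ m : List ℕ, m ≠ [] → (∀ i ∈ m, 1 ≤ i) → (m.sum ≤ 2 ∨ (m.sum = 3 ∧ ξ * e < d)) →
      ∃ k₀ k₁ k₂ : ℝ,
        (∃ Z₁ : PWL, PWL.K0 b d e ξ Z₁ = k₀ ∧ PWL.K1 b e ξ Z₁ = k₁ ∧ PWL.K2 b d e ξ Z₁ = k₂) ∧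
        ∀ Z₁ : PWL, PWL.K0 b d e ξ Z₁ = k₀ → PWL.K1 b e ξ Z₁ = k₁ → PWL.K2 b d e ξ Z₁ = k₂ →
          (∃ (Z₂ : PWL) (Z : ℝ → PWL), PWL.IsPerturbation (PWL.canonical a b c d e) Z₁ Z₂ Z ∧
            ∀ᶠ ε in 𝓝[>] (0 : ℝ), (Z ε).HasConfiguration m) ∧
          ((∀ i ∈ m, i = 1) → ∀ (Z₂ : PWL) (Z : ℝ → PWL),
            PWL.IsPerturbation (PWL.canonical a b c d e) Z₁ Z₂ Z →
            ∀ᶠ ε in 𝓝[>] (0 : ℝ), (Z ε).HasConfiguration m)) ∧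
    ∀ (Z₁ Z₂ : PWL) (Z : ℝ → PWL), PWL.IsPerturbation (PWL.canonical a b c d e) Z₁ Z₂ Z →
      -- (b)
      (∀ᶠ ε in 𝓝[>] (0 : ℝ), (Z ε).InfinityPeriodic ∧
        ∀ Γ, (Z ε).IsHighest Γ → (Z ε).IsHyperbolic Γ →
          ((Z ε).IsStable Γ ∧ (Z ε).InfinityUnstable) ∨
          ((Z ε).IsUnstable Γ ∧ (Z ε).InfinityStable)) ∧
      (ξ * Z₁.trL + Z₁.trR < 0 → ∀ᶠ ε in 𝓝[>] (0 : ℝ), (Z ε).InfinityUnstable ∧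
        ∀ Γ, (Z ε).IsHighest Γ → (Z ε).IsHyperbolic Γ → (Z ε).IsStable Γ) ∧
      (0 < ξ * Z₁.trL + Z₁.trR → ∀ᶠ ε in 𝓝[>] (0 : ℝ), (Z ε).InfinityStable ∧
        ∀ Γ, (Z ε).IsHighest Γ → (Z ε).IsHyperbolic Γ → (Z ε).IsUnstable Γ) ∧
      -- (c)
      (0 < Z₁.trL → ∀ᶠ ε in 𝓝[>] (0 : ℝ),
        ∀ Γ, (Z ε).IsLowest Γ → (Z ε).IsHyperbolic Γ → (Z ε).IsStable Γ) ∧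
      (Z₁.trL < 0 → ∀ᶠ ε in 𝓝[>] (0 : ℝ),
        ∀ Γ, (Z ε).IsLowest Γ → (Z ε).IsHyperbolic Γ → (Z ε).IsUnstable Γ) ∧
      (Z₁.trL = 0 → 0 < b * Z₁.leftVec 0 + Z₁.rightVec 0 →
        (∃ r₀ > 0, ∀ r ∈ Set.Ioo 0 r₀, ∀ᶠ ε in 𝓝[>] (0 : ℝ),
          ∀ Γ, (Z ε).IsLowestAbove r Γ → (Z ε).IsHyperbolic Γ → (Z ε).IsStable Γ) ∧
        ((∀ᶠ ε in 𝓝[>] (0 : ℝ), (Z ε).trL = 0) → ∀ᶠ ε in 𝓝[>] (0 : ℝ),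
          ∀ Γ, (Z ε).IsLowest Γ → (Z ε).IsHyperbolic Γ → (Z ε).IsStable Γ)) ∧
      (Z₁.trL = 0 → b * Z₁.leftVec 0 + Z₁.rightVec 0 < 0 →
        (∃ r₀ > 0, ∀ r ∈ Set.Ioo 0 r₀, ∀ᶠ ε in 𝓝[>] (0 : ℝ),
          ∀ Γ, (Z ε).IsLowestAbove r Γ → (Z ε).IsHyperbolic Γ → (Z ε).IsUnstable Γ) ∧
        ((∀ᶠ ε in 𝓝[>] (0 : ℝ), (Z ε).trL = 0) → ∀ᶠ ε in 𝓝[>] (0 : ℝ),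
          ∀ Γ, (Z ε).IsLowest Γ → (Z ε).IsHyperbolic Γ → (Z ε).IsUnstable Γ)) := by
  refine ⟨fun m h0 h1 hs => PWL.exists_configuration hb hd he hξ habc m h0 h1 hs, fun Z₁ Z₂ Z hZ => ?_⟩
  have hgood := hZ.eventually_isGood (PWL.isGood_canonical hb hd he hξ habc)
  have hsum := fun h => hZ.eventually_disp_atTop hb hd he hξ habc h
  have hlow := fun h => hZ.eventually_lowest hb hd he hξ habc h
  have habove := fun h h' => hZ.eventually_lowestAbove hb hd he hξ habc h h'
  refine ⟨?_, fun h => ?_, fun h => ?_, fun h => ?_, fun h => ?_, fun h h' => ?_, fun h h' => ?_⟩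
  · filter_upwards [hgood] with ε hε
    refine ⟨hε.infinityPeriodic, fun Γ hΓ hyp => ?_⟩
    rcases hε.highest hΓ hyp with ⟨h1, h2⟩ | ⟨h1, h2⟩
    · exact Or.inl ⟨h1, hε.infinityUnstable_of_disp h2⟩
    · exact Or.inr ⟨h1, hε.infinityStable_of_disp h2⟩
  · filter_upwards [hgood, hsum h.ne] with ε hε hdisp
    have hneg : ∀ᶠ s in atTop, (Z ε).disp s < 0 :=
      hdisp.mono fun s hs => (neg_iff_neg_of_mul_pos hs).1 h
    refine ⟨hε.infinityUnstable_of_disp hneg, fun Γ hΓ hyp => ?_⟩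
    rcases hε.highest hΓ hyp with ⟨h1, -⟩ | ⟨-, h2⟩
    · exact h1
    · obtain ⟨s, hs, hs'⟩ := (hneg.and h2).exists
      exact absurd hs hs'.not_gt
  · filter_upwards [hgood, hsum h.ne'] with ε hε hdisp
    have hpos : ∀ᶠ s in atTop, 0 < (Z ε).disp s :=
      hdisp.mono fun s hs => (pos_iff_pos_of_mul_pos hs).1 h
    refine ⟨hε.infinityStable_of_disp hpos, fun Γ hΓ hyp => ?_⟩
    rcases hε.highest hΓ hyp with ⟨-, h2⟩ | ⟨h1, -⟩
    · obtain ⟨s, hs, hs'⟩ := (hpos.and h2).exists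
      exact absurd hs hs'.not_gt
    · exact h1
  · filter_upwards [hlow h.ne'] with ε hε Γ hΓ hyp using (hε Γ hΓ hyp).1 h
  · filter_upwards [hlow h.ne] with ε hε Γ hΓ hyp using (hε Γ hΓ hyp).2 h
  · obtain ⟨⟨r₀, hr₀, h1⟩, h2⟩ := habove h h'.ne'
    exact ⟨⟨r₀, hr₀, fun r hr => (h1 r hr).mono fun ε hε Γ hΓ hyp => (hε Γ hΓ hyp).1 h'⟩,
      fun htr => (h2 htr).mono fun ε hε Γ hΓ hyp => (hε Γ hΓ hyp).1 h'⟩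
  · obtain ⟨⟨r₀, hr₀, h1⟩, h2⟩ := habove h h'.ne
    exact ⟨⟨r₀, hr₀, fun r hr => (h1 r hr).mono fun ε hε Γ hΓ hyp => (hε Γ hΓ hyp).2 h'⟩,
      fun htr => (h2 htr).mono fun ε hε Γ hΓ hyp => (hε Γ hΓ hyp).2 h'⟩
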